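/- Theorem (fault tolerant DFS tree). There are two fixed algorithms (programs of the word RAM with words of $w\ge c\log_2 n$ bits, for a constant $c$; arithmetic operations, comparisons and reads and writes of a word cost one step each), a preprocessing algorithm and a query algorithm, and an absolute constant $C$ such that the following holds. Let $G=(V,E)$ be an undirected simple graph, not necessarily connected, with $n=|V|\ge 2$ vertices and $m=|E|$ edges. Given the list of the edges of $G$, the preprocessing algorithm halts and builds a data structure consisting of at most $C\,m\log n$ words. For every set $U$ of $k$ failed vertices or edges of $G$, where $1\le k\le n$, the query algorithm, given $n$, this data structure and a list of the elements of $U$, reports in at most $C\,nk\log^4 n$ steps a DFS tree of $G+U$, the graph obtained from $G$ by deleting the failed vertices (with their incident edges) and the failed edges. Here, since $G+U$ may be disconnected, a dummy vertex $r$ joined to all vertices of $G+U$ is added, and a DFS tree of $G+U$ means a spanning tree, rooted at $r$, of this augmented graph such that every edge of the augmented graph joins two vertices one of which is an ancestor of the other in the tree (equivalently, every non-tree edge is a back edge). The tree is reported as an array containing the parent of each vertex of $G+U$. -/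

import Mathlib

/-! ## A word RAM with step count

Words are natural numbers below `2 ^ w`, where `w` is the word length.  A machine has registers and
arrays of words.  A program is a finite piece of code, so it names only finitely many registers and
arrays, and it is the same program for all inputs and all word lengths.  Each read of a constant,
register or array cell, each arithmetic operation or comparison, each write and each test costs one
step. -/

namespace WordRAM

/-- The binary operations on words. -/
inductive Op where
  | add | sub | mul | div | mod | lt | eq

/-- The value of an operation on words of length `w`: sums and products are reduced modulo `2 ^ w`,
differences are cut off at `0`, comparisons return `1` for true and `0` for false. -/
def Op.eval (w : ℕ) : Op → ℕ → ℕ → ℕ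
  | .add, a, b => (a + b) % 2 ^ w
  | .sub, a, b => a - b
  | .mul, a, b => a * b % 2 ^ w
  | .div, a, b => a / b
  | .mod, a, b => a % b
  | .lt, a, b => (if a < b then 1 else 0) % 2 ^ w
  | .eq, a, b => (if a = b then 1 else 0) % 2 ^ w

/-- The contents of the registers and of the arrays: `mem a i` is cell `i` of array `a`. -/
structure State where
  reg : ℕ → ℕ
  mem : ℕ → ℕ → ℕ

/-- Expressions; `load a e` reads the cell of array `a` whose index is the value of `e`. -/
inductive Expr where
  | const (c : ℕ)
  | reg (x : ℕ)
  | load (a : ℕ) (e : Expr)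
  | op (o : Op) (e₁ e₂ : Expr)

/-- The value of an expression. -/
def Expr.eval (w : ℕ) (s : State) : Expr → ℕ
  | .const c => c % 2 ^ w
  | .reg x => s.reg x
  | .load a e => s.mem a (e.eval w s)
  | .op o e₁ e₂ => o.eval w (e₁.eval w s) (e₂.eval w s)

/-- The number of steps needed to evaluate an expression. -/
def Expr.cost : Expr → ℕ
  | .const _ => 1
  | .reg _ => 1
  | .load _ e => e.cost + 1
  | .op _ e₁ e₂ => e₁.cost + e₂.cost + 1

/-- Programs: do nothing, `x := e`, `a[i] := e`, sequencing, conditional (on a nonzero value) and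
while-loop (as long as the value is nonzero). -/
inductive Program where
  | skip
  | assign (x : ℕ) (e : Expr)
  | store (a : ℕ) (i e : Expr)
  | seq (p q : Program)
  | cond (e : Expr) (p q : Program)
  | loop (e : Expr) (p : Program)

/-- The state after writing `v` into register `x`. -/
def State.setReg (s : State) (x v : ℕ) : State :=
  { s with reg := Function.update s.reg x v }

/-- The state after writing `v` into cell `i` of array `a`. -/
def State.setMem (s : State) (a i v : ℕ) : State :=
  { s with mem := Function.update s.mem a (Function.update (s.mem a) i v) }

/-- `Exec w p s t s'`: on words of length `w`, the program `p` started in state `s` halts after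
exactly `t` steps, in state `s'`. -/
inductive Exec (w : ℕ) : Program → State → ℕ → State → Prop where
  | skip (s : State) : Exec w .skip s 1 s
  | assign (s : State) (x : ℕ) (e : Expr) :
      Exec w (.assign x e) s (e.cost + 1) (s.setReg x (e.eval w s))
  | store (s : State) (a : ℕ) (i e : Expr) :
      Exec w (.store a i e) s (i.cost + e.cost + 1) (s.setMem a (i.eval w s) (e.eval w s))
  | seq {p q : Program} {s s' s'' : State} {t t' : ℕ} :
      Exec w p s t s' → Exec w q s' t' s'' → Exec w (.seq p q) s (t + t') s''
  | cond_true {e : Expr} {p q : Program} {s s' : State} {t : ℕ} :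
      e.eval w s ≠ 0 → Exec w p s t s' → Exec w (.cond e p q) s (e.cost + 1 + t) s'
  | cond_false {e : Expr} {p q : Program} {s s' : State} {t : ℕ} :
      e.eval w s = 0 → Exec w q s t s' → Exec w (.cond e p q) s (e.cost + 1 + t) s'
  | loop_done {e : Expr} {p : Program} {s : State} :
      e.eval w s = 0 → Exec w (.loop e p) s (e.cost + 1) s
  | loop_step {e : Expr} {p : Program} {s s' s'' : State} {t t' : ℕ} :
      e.eval w s ≠ 0 → Exec w p s t s' → Exec w (.loop e p) s' t' s'' →
      Exec w (.loop e p) s (e.cost + 1 + t + t') s''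

/-- The state with the listed words in registers `0, 1, …`, the listed arrays as arrays `0, 1, …`,
and `0` everywhere else. -/
def State.init (regs : List ℕ) (arrays : List (List ℕ)) : State where
  reg x := regs.getD x 0
  mem a i := (arrays.getD a []).getD i 0

/-- The first `len` words of array `a`. -/
def State.prefixOf (s : State) (a len : ℕ) : List ℕ :=
  (List.range len).map (s.mem a)

end WordRAM

/-! ## Graphs, failures and DFS trees -/

/-- `l` lists every element of the set `S` of unordered pairs exactly once, each of them as an ordered
pair in one of its two orientations. -/
def ListsEdges {V : Type*} (l : List (V × V)) (S : Set (Sym2 V)) : Prop :=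
  (l.map fun p => s(p.1, p.2)).Nodup ∧ ∀ e, e ∈ l.map (fun p => s(p.1, p.2)) ↔ e ∈ S

/-- The words `u₁, v₁, u₂, v₂, …` of a list of pairs of vertices. -/
def pairWords {n : ℕ} (l : List (Fin n × Fin n)) : List ℕ :=
  l.flatMap fun p => [(p.1 : ℕ), (p.2 : ℕ)]

/-- The graph that is left when the vertices in `F` and the edges in `E` have failed. -/
def afterFailures {V : Type*} (G : SimpleGraph V) (F : Set V) (E : Set (Sym2 V)) :
    SimpleGraph ↥(Fᶜ) :=
  (G.deleteEdges E).induce Fᶜ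

/-- The graph `H` with a dummy vertex `none` that is joined to all vertices of `H`. -/
def withDummyRoot {V : Type*} (H : SimpleGraph V) : SimpleGraph (Option V) where
  Adj
    | none, none => False
    | none, some _ => True
    | some _, none => True
    | some u, some v => H.Adj u v
  symm := by
    constructor
    rintro (_ | u) (_ | v) h
    · exact h
    · trivial
    · trivial
    · exact H.adj_symm h
  loopless := by
    constructor
    rintro (_ | u) h
    · exact h
    · exact H.irrefl h

/-- In the rooted tree with parent map `par`, `u` is an ancestor of `v` (not necessarily proper). -/
def IsAncestor {V : Type*} (par : V → V) (u v : V) : Prop :=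
  ∃ i : ℕ, par^[i] v = u

/-- `par` is the parent map of a spanning tree of `H` rooted at `r` (with `par r = r`). -/
def IsRootedSpanningTree {V : Type*} (H : SimpleGraph V) (r : V) (par : V → V) : Prop :=
  par r = r ∧ (∀ v, v ≠ r → H.Adj v (par v)) ∧ ∀ v, IsAncestor par r v

/-- `par` is the parent map of a DFS tree of `H` rooted at `r`: a rooted spanning tree such that every
edge of `H` joins a vertex with one of its ancestors. -/
def IsDFSTree {V : Type*} (H : SimpleGraph V) (r : V) (par : V → V) : Prop :=
  IsRootedSpanningTree H r par ∧ ∀ u v, H.Adj u v → IsAncestor par u v ∨ IsAncestor par v u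

/-- The label of a vertex in the output: a surviving vertex keeps its label in `{0, …, n - 1}`, and
the dummy root has label `n`. -/
def outLabel {n : ℕ} {S : Set (Fin n)} : Option ↥S → ℕ
  | none => n
  | some v => (v : Fin n)

/-- The array `out` holds, for each surviving vertex, its parent in a DFS tree, rooted at the dummy
vertex, of the graph after the failures. -/
def ReportsDFSTree {n : ℕ} (G : SimpleGraph (Fin n)) (F : Set (Fin n)) (E : Set (Sym2 (Fin n)))
    (out : ℕ → ℕ) : Prop :=
  ∃ par : Option ↥(Fᶜ) → Option ↥(Fᶜ),
    IsDFSTree (withDummyRoot (afterFailures G F E)) none par ∧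
      ∀ v : ↥(Fᶜ), out ((v : Fin n) : ℕ) = outLabel (par (some v))

/-- Preprocessing: given `n` and the number of edges in registers `0, 1` and the list of edges in
array `0`, the program `pre` halts and leaves the data structure `D` (a sequence of words) in array
`0` and its length in register `0`. -/
def Builds (w : ℕ) (pre : WordRAM.Program) (n : ℕ) (edges : List (Fin n × Fin n)) (D : List ℕ) :
    Prop :=
  ∃ (t : ℕ) (s : WordRAM.State),
    WordRAM.Exec w pre (WordRAM.State.init [n, edges.length] [pairWords edges]) t s ∧
      D = s.prefixOf 0 (s.reg 0)

/-- The start state of a query: `n` and the numbers of failed vertices and failed edges in registers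
`0, 1, 2`; the data structure, the failed vertices and the failed edges in arrays `0, 1, 2`.  The
query leaves its output in array `3`. -/
def queryStart {n : ℕ} (D : List ℕ) (vs : List (Fin n)) (es : List (Fin n × Fin n)) :
    WordRAM.State :=
  WordRAM.State.init [n, vs.length, es.length] [D, vs.map fun v => (v : ℕ), pairWords es]

/-! The data structure is a depth-first forest of `G`. The vertices that have neighbours are
numbered `1, …, N` in preorder; stored are the parent of each vertex, the end of its interval of
descendants, and its neighbours sorted by number. Every edge joins an ancestor with a descendant
(`IsIndex.desc_of_adj`), and a binary search finds the first or last neighbour of a vertex in an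
interval of numbers (`IndexFits.runs_find`). Isolated vertices get no number, so `N ≤ 2m` and `O(m)`
words suffice.

For a query, call the failed vertices and the ends of failed edges special; there are at most `2k`
of them. Let `A` be the set of their ancestors in the forest. A vertex of `A` without a child in `A`
is special, so `A`, listed in preorder, falls into `O(k)` runs, each of them a path of the forest,
where a special vertex is always a run by itself (`Enumerated.snoc`, `IndexFits.setup`). The rest of
the forest consists of subtrees that no failure touches. If `att u` is the nearest ancestor of `u`
in `A`, then the neighbours of `u` with numbers up to `att u` lie in `A` (`Setup.mem_path`), so the
neighbours in a part of a run form an interval of the sorted list.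

The query is a depth-first search of the surviving graph from the dummy root `0` that visits whole
paths at once. On entering a run it goes to the farther end of what is left of it, so that at most
half remains. Then every unvisited vertex with a neighbour on the path is put on the list of just
one such neighbour, the one nearest to the end of the path. One is enough, because the search
backtracks from that end and meets this neighbour before the others (`Setup.runs_listPath`). On
entering an untouched subtree the search climbs to the root of its unvisited part. Of the subtrees
that then hang from the path, at most one has more than half of the size. The vertices of the light
ones are put on lists as before. The heavy one is not scanned; a vertex of the path looks for a
neighbour in its interval only when it has nothing else left. At that time the heavy subtree is
either completely unvisited or completely visited (`SearchInv.unvisited_desc`,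
`SearchInv.all_of_heavy`), so one binary search decides. The other possible neighbours are smaller
vertices in `A`; for them each visited vertex inspects each run (`Setup.runs_pieceStep`). The field
`cover` of `SearchInv` says that these three sources miss no unvisited neighbour of an unfinished
vertex; `DFSState.push` and `DFSState.pop` show that such a search yields a DFS tree.

A vertex is listed `O(log n)` times because of light subtrees, a run is halved `O(log n)` times at a
cost of `n` searches, and there are `n` times `O(k)` inspections of runs. So there are `O(n k log
n)` basic operations, counted by `potential`, of `O(log n)` steps each.

Memory of the query: array `4` maps vertices to numbers, `5` marks special and `6` visited vertices,
`7` the cells of failed edges; `8` to `12` hold `A`, `att`, `aord`, `aidx`, `run`; `13` and `14` the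
ends of what is left of each run; `15` and `16` the lists; `17` the parents; `18` how many runs a
vertex has inspected; `20` the first vertex of the path on which a vertex was visited, or `0` for
paths in runs, and `19` the heavy root stored at that vertex. Registers `3`, `4`, `6`, `7` hold `N`,
the number of runs, the current vertex and the vertex to be visited. -/

namespace WordRAM

/-! ### Symbolic execution -/

/-- Started in `s`, the program `p` halts after some number `t` of steps in a state `s'` with
`Q t s'`. -/
def Runs (w : ℕ) (p : Program) (s : State) (Q : ℕ → State → Prop) : Prop :=
  ∃ t s', Exec w p s t s' ∧ Q t s'

theorem Runs.mono {w : ℕ} {p : Program} {s : State} {Q Q' : ℕ → State → Prop}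
    (h : Runs w p s Q) (hQ : ∀ t s', Q t s' → Q' t s') : Runs w p s Q' := by
  obtain ⟨t, s', he, hq⟩ := h
  exact ⟨t, s', he, hQ t s' hq⟩

/-- Hide the postcondition during symbolic execution. -/
theorem Runs.hide {w : ℕ} {p : Program} {s : State} {Q : ℕ → State → Prop}
    (h : ∀ Q' : ℕ → State → Prop, (∀ t s', Q t s' → Q' t s') → Runs w p s Q') : Runs w p s Q :=
  h Q fun _ _ => id

/-- This equivalence and the following ones are weakest-precondition rules: rewriting with them
executes straight-line code inside the goal and adds up the exact step count. -/
theorem runs_skip {w : ℕ} {s : State} {Q : ℕ → State → Prop} :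
    Runs w .skip s Q ↔ Q 1 s := by
  constructor
  · rintro ⟨t, s', he, hq⟩
    cases he
    exact hq
  · exact fun h => ⟨_, _, .skip s, h⟩

theorem runs_assign {w x : ℕ} {e : Expr} {s : State} {Q : ℕ → State → Prop} :
    Runs w (.assign x e) s Q ↔ Q (e.cost + 1) (s.setReg x (e.eval w s)) := by
  constructor
  · rintro ⟨t, s', he, hq⟩
    cases he
    exact hq
  · exact fun h => ⟨_, _, .assign s x e, h⟩

theorem runs_store {w a : ℕ} {i e : Expr} {s : State} {Q : ℕ → State → Prop} :
    Runs w (.store a i e) s Q ↔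
      Q (i.cost + e.cost + 1) (s.setMem a (i.eval w s) (e.eval w s)) := by
  constructor
  · rintro ⟨t, s', he, hq⟩
    cases he
    exact hq
  · exact fun h => ⟨_, _, .store s a i e, h⟩

theorem runs_seq {w : ℕ} {p q : Program} {s : State} {Q : ℕ → State → Prop} :
    Runs w (.seq p q) s Q ↔ Runs w p s fun t s' => Runs w q s' fun t' s'' => Q (t + t') s'' := by
  constructor
  · rintro ⟨t, s', he, hq⟩
    cases he with
    | seq h1 h2 => exact ⟨_, _, h1, _, _, h2, hq⟩
  · rintro ⟨t, s', h1, t', s'', h2, hq⟩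
    exact ⟨_, _, .seq h1 h2, hq⟩

theorem runs_cond {w : ℕ} {e : Expr} {p q : Program} {s : State} {Q : ℕ → State → Prop} :
    Runs w (.cond e p q) s Q ↔
      (e.eval w s ≠ 0 → Runs w p s fun t s' => Q (e.cost + 1 + t) s') ∧
      (e.eval w s = 0 → Runs w q s fun t s' => Q (e.cost + 1 + t) s') := by
  constructor
  · rintro ⟨t, s', he, hq⟩
    cases he with
    | cond_true h1 h2 => exact ⟨fun _ => ⟨_, _, h2, hq⟩, fun h => absurd h h1⟩
    | cond_false h1 h2 => exact ⟨fun h => absurd h1 h, fun _ => ⟨_, _, h2, hq⟩⟩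
  · rintro ⟨h1, h2⟩
    by_cases h : e.eval w s = 0
    · obtain ⟨t, s', he, hq⟩ := h2 h
      exact ⟨_, _, .cond_false h he, hq⟩
    · obtain ⟨t, s', he, hq⟩ := h1 h
      exact ⟨_, _, .cond_true h he, hq⟩

/-! ### Frames -/

/-- Whether a program writes into register `x`. -/
def Program.writesReg (x : ℕ) : Program → Bool
  | .skip => false
  | .assign y _ => y == x
  | .store _ _ _ => false
  | .seq p q => p.writesReg x || q.writesReg x
  | .cond _ p q => p.writesReg x || q.writesReg x
  | .loop _ p => p.writesReg x

/-- Whether a program writes into array `a`. -/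
def Program.writesMem (a : ℕ) : Program → Bool
  | .skip => false
  | .assign _ _ => false
  | .store b _ _ => b == a
  | .seq p q => p.writesMem a || q.writesMem a
  | .cond _ p q => p.writesMem a || q.writesMem a
  | .loop _ p => p.writesMem a

/-- `s'` agrees with `s` on all registers and arrays that `p` does not write. -/
structure Frame (p : Program) (s s' : State) : Prop where
  reg : ∀ x, p.writesReg x = false → s'.reg x = s.reg x
  mem : ∀ a, p.writesMem a = false → s'.mem a = s.mem a

theorem Frame.refl (p : Program) (s : State) : Frame p s s := ⟨fun _ _ => rfl, fun _ _ => rfl⟩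

theorem Frame.trans {p : Program} {s s' s'' : State} (h : Frame p s s') (h' : Frame p s' s'') :
    Frame p s s'' :=
  ⟨fun x hx => (h'.reg x hx).trans (h.reg x hx), fun a ha => (h'.mem a ha).trans (h.mem a ha)⟩

/-- The written registers and arrays are computed from the program text by a Boolean recursion, so
for a concrete program each unchanged register or array is obtained with `rfl`. -/
theorem Exec.frame {w : ℕ} {p : Program} {s s' : State} {t : ℕ} (h : Exec w p s t s') :
    Frame p s s' := by
  induction h with
  | skip s => exact Frame.refl _ _
  | assign s x e =>
    refine ⟨fun y hy => ?_, fun _ _ => rfl⟩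
    simp only [Program.writesReg, beq_eq_false_iff_ne, ne_eq] at hy
    exact Function.update_of_ne (Ne.symm hy) _ _
  | store s a i e =>
    refine ⟨fun _ _ => rfl, fun b hb => ?_⟩
    simp only [Program.writesMem, beq_eq_false_iff_ne, ne_eq] at hb
    exact Function.update_of_ne (Ne.symm hb) _ _
  | seq _ _ ih1 ih2 =>
    constructor <;> intro x hx
    · simp only [Program.writesReg, Bool.or_eq_false_iff] at hx
      exact (ih2.reg x hx.2).trans (ih1.reg x hx.1)
    · simp only [Program.writesMem, Bool.or_eq_false_iff] at hx
      exact (ih2.mem x hx.2).trans (ih1.mem x hx.1)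
  | cond_true _ _ ih =>
    constructor <;> intro x hx
    · simp only [Program.writesReg, Bool.or_eq_false_iff] at hx
      exact ih.reg x hx.1
    · simp only [Program.writesMem, Bool.or_eq_false_iff] at hx
      exact ih.mem x hx.1
  | cond_false _ _ ih =>
    constructor <;> intro x hx
    · simp only [Program.writesReg, Bool.or_eq_false_iff] at hx
      exact ih.reg x hx.2
    · simp only [Program.writesMem, Bool.or_eq_false_iff] at hx
      exact ih.mem x hx.2
  | loop_done => exact Frame.refl _ _
  | loop_step _ _ _ ih1 ih2 =>
    exact ⟨fun x hx => (ih2.reg x hx).trans (ih1.reg x hx),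
      fun x hx => (ih2.mem x hx).trans (ih1.mem x hx)⟩

theorem Runs.frame {w : ℕ} {p : Program} {s : State} {Q : ℕ → State → Prop} (h : Runs w p s Q) :
    Runs w p s fun t s' => Q t s' ∧ Frame p s s' := by
  obtain ⟨t, s', he, hq⟩ := h
  exact ⟨t, s', he, hq, he.frame⟩

/-- Use a specification of `p` together with its frame. -/
theorem Runs.use {w : ℕ} {p : Program} {s : State} {Q Q' : ℕ → State → Prop}
    (h : Runs w p s Q) (hQ : ∀ t s', Q t s' → Frame p s s' → Q' t s') : Runs w p s Q' :=
  h.frame.mono fun t s' h => hQ t s' h.1 h.2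

/-! ### Loops -/

/-- The rule for loops: `I b s` says that the invariant holds in `s` and that the remaining
iterations take at most `b` steps. -/
theorem Runs.loop {w : ℕ} {e : Expr} {p : Program} {s₀ : State} (I : ℕ → State → Prop) {b₀ : ℕ}
    (h₀ : I b₀ s₀)
    (step : ∀ b s, I b s → Frame p s₀ s → e.eval w s ≠ 0 →
      Runs w p s fun t s' => ∃ b', I b' s' ∧ e.cost + 1 + t + b' ≤ b) :
    Runs w (.loop e p) s₀ fun t s' =>
      Frame p s₀ s' ∧ e.eval w s' = 0 ∧ ∃ b, I b s' ∧ t + b ≤ b₀ + (e.cost + 1) := by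
  suffices H : ∀ b s, I b s → Frame p s₀ s → Runs w (.loop e p) s fun t s' =>
      Frame p s₀ s' ∧ e.eval w s' = 0 ∧ ∃ b', I b' s' ∧ t + b' ≤ b + (e.cost + 1) from
    H b₀ s₀ h₀ (Frame.refl _ _)
  intro b
  -- The budget is itself the termination measure: every iteration pays at least for the test, which
  -- costs a positive number of steps.
  induction b using Nat.strong_induction_on with
  | _ b ih =>
    intro s hI hf
    by_cases he : e.eval w s = 0
    · exact ⟨_, _, .loop_done he, hf, he, b, hI, by omega⟩
    · obtain ⟨t, s', h1, b', hI', hb⟩ := step b s hI hf he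
      obtain ⟨t', s'', h2, hf2, he2, b'', hI2, hb2⟩ :=
        ih b' (by omega) s' hI' (hf.trans h1.frame)
      exact ⟨_, _, .loop_step he h1 h2, hf2, he2, b'', hI2, by omega⟩

/-- The rule for loops without a bound on the running time. -/
theorem Runs.loop_measure {w : ℕ} {e : Expr} {p : Program} {s₀ : State} (I : ℕ → State → Prop)
    {b₀ : ℕ} (h₀ : I b₀ s₀)
    (step : ∀ b s, I b s → Frame p s₀ s → e.eval w s ≠ 0 →
      Runs w p s fun _ s' => ∃ b', I b' s' ∧ b' < b) :
    Runs w (.loop e p) s₀ fun _ s' => Frame p s₀ s' ∧ e.eval w s' = 0 ∧ ∃ b, I b s' := by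
  suffices H : ∀ b s, I b s → Frame p s₀ s → Runs w (.loop e p) s fun _ s' =>
      Frame p s₀ s' ∧ e.eval w s' = 0 ∧ ∃ b, I b s' from
    H b₀ s₀ h₀ (Frame.refl _ _)
  intro b
  induction b using Nat.strong_induction_on with
  | _ b ih =>
    intro s hI hf
    by_cases he : e.eval w s = 0
    · exact ⟨_, _, .loop_done he, hf, he, b, hI⟩
    · obtain ⟨t, s', h1, b', hI', hb⟩ := step b s hI hf he
      obtain ⟨t', s'', h2, hf2, he2, hI2⟩ := ih b' hb s' hI' (hf.trans h1.frame)
      exact ⟨_, _, .loop_step he h1 h2, hf2, he2, hI2⟩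

/-! ### Reading off the state -/

theorem setReg_reg (s : State) (x v y : ℕ) :
    (s.setReg x v).reg y = if y = x then v else s.reg y := by
  simp [State.setReg, Function.update_apply]

theorem setReg_mem (s : State) (x v : ℕ) : (s.setReg x v).mem = s.mem := rfl

theorem setMem_reg (s : State) (a i v : ℕ) : (s.setMem a i v).reg = s.reg := rfl

theorem setMem_mem (s : State) (a i v b : ℕ) :
    (s.setMem a i v).mem b = if b = a then Function.update (s.mem a) i v else s.mem b := by
  simp [State.setMem, Function.update_apply]

end WordRAM

open WordRAM

infixl:65 " +ᵉ " => Expr.op Op.add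
infixl:65 " -ᵉ " => Expr.op Op.sub
infixl:70 " *ᵉ " => Expr.op Op.mul
infixl:70 " /ᵉ " => Expr.op Op.div
infixl:70 " %ᵉ " => Expr.op Op.mod
infix:50 " <ᵉ " => Expr.op Op.lt
infixr:40 " ;; " => Program.seq

namespace WordRAM

theorem eval_const {w c : ℕ} {s : State} (h : c < 2 ^ w) : (Expr.const c).eval w s = c :=
  Nat.mod_eq_of_lt h

theorem eval_reg {w x : ℕ} {s : State} : (Expr.reg x).eval w s = s.reg x := rfl

theorem eval_load {w a : ℕ} {e : Expr} {s : State} :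
    (Expr.load a e).eval w s = s.mem a (e.eval w s) := rfl

theorem eval_add {w : ℕ} {e f : Expr} {s : State} (h : e.eval w s + f.eval w s < 2 ^ w) :
    (e +ᵉ f).eval w s = e.eval w s + f.eval w s := Nat.mod_eq_of_lt h

theorem eval_sub {w : ℕ} {e f : Expr} {s : State} :
    (e -ᵉ f).eval w s = e.eval w s - f.eval w s := rfl

theorem eval_div {w : ℕ} {e f : Expr} {s : State} :
    (e /ᵉ f).eval w s = e.eval w s / f.eval w s := rfl

theorem eval_mod {w : ℕ} {e f : Expr} {s : State} :
    (e %ᵉ f).eval w s = e.eval w s % f.eval w s := rfl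

theorem eval_lt {w : ℕ} {e f : Expr} {s : State} (h : 1 < 2 ^ w) :
    (e <ᵉ f).eval w s = if e.eval w s < f.eval w s then 1 else 0 := by
  refine Nat.mod_eq_of_lt ?_
  split_ifs <;> omega

/-- `for x := x to h - 1 do p`, where `x` and `h` are registers. -/
def forUp (x h : ℕ) (p : Program) : Program :=
  .loop (.reg x <ᵉ .reg h) (p ;; .assign x (.reg x +ᵉ .const 1))

theorem ite_ne_zero {p : Prop} [Decidable p] : ((if p then 1 else 0 : ℕ) ≠ 0) ↔ p := by
  split_ifs <;> simp_all

theorem ite_eq_zero {p : Prop} [Decidable p] : ((if p then 1 else 0 : ℕ) = 0) ↔ ¬p := by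
  split_ifs <;> simp_all

/-- The rule for `forUp`, where an iteration takes at most `B` steps. -/
theorem Runs.forUp {w x h : ℕ} {p : Program} {s₀ : State} (I : ℕ → State → Prop) (B : ℕ)
    (hw : s₀.reg h < 2 ^ w) (hw' : 1 < 2 ^ w) (hx : p.writesReg x = false)
    (hh : p.writesReg h = false) (hxh : x ≠ h)
    (hle : s₀.reg x ≤ s₀.reg h) (h₀ : I (s₀.reg x) s₀)
    (step : ∀ i s, s₀.reg x ≤ i → i < s₀.reg h → I i s → s.reg x = i →
      Frame (p ;; .assign x (.reg x +ᵉ .const 1)) s₀ s →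
      Runs w p s fun t s' => t ≤ B ∧ I (i + 1) (s'.setReg x (i + 1))) :
    Runs w (WordRAM.forUp x h p) s₀ fun t s' =>
      t ≤ (s₀.reg h - s₀.reg x) * (B + 8) + 4 ∧ I (s₀.reg h) s' ∧ s'.reg x = s₀.reg h := by
  have hhw : (p ;; .assign x (.reg x +ᵉ .const 1)).writesReg h = false := by
    simp [Program.writesReg, hh, hxh]
  -- Besides the body an iteration costs `8` steps: four for the test and four for the increment.
  -- The final `4` is the last, failing test.
  refine (Runs.loop (fun b s => ∃ i, s.reg x = i ∧ s₀.reg x ≤ i ∧ i ≤ s₀.reg h ∧ I i s ∧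
    b = (s₀.reg h - i) * (B + 8)) ⟨_, rfl, le_rfl, hle, h₀, rfl⟩ ?_).mono ?_
  · rintro b s ⟨i, hi, hi1, hi2, hI, rfl⟩ hf he
    have hb := hf.reg h hhw
    rw [eval_lt hw', ite_ne_zero, eval_reg, eval_reg, hi, hb] at he
    rw [runs_seq]
    refine (step i s hi1 he hI hi hf).use ?_
    intro t s' ⟨ht, hI'⟩ hf'
    rw [runs_assign, eval_add, eval_const hw', eval_reg, hf'.reg x hx, hi]
    · refine ⟨_, ⟨i + 1, by simp [setReg_reg], by omega, by omega, hI', rfl⟩, ?_⟩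
      have : s₀.reg h - i = (s₀.reg h - (i + 1)) + 1 := by omega
      rw [this, Nat.add_mul]
      simp only [Expr.cost]
      omega
    · rw [eval_const hw', eval_reg, hf'.reg x hx, hi]
      omega
  · rintro t s' ⟨hf, he, b, ⟨i, hi, hi1, hi2, hI, rfl⟩, hb⟩
    rw [eval_lt hw', ite_eq_zero, eval_reg, eval_reg, hi, hf.reg h hhw] at he
    obtain rfl : i = s₀.reg h := by omega
    simp only [Expr.cost] at hb
    exact ⟨by omega, hI, hi⟩

/-- The rule for `forUp` without a bound on the running time. -/
theorem Runs.forUp_total {w x h : ℕ} {p : Program} {s₀ : State} (I : ℕ → State → Prop)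
    (hw : s₀.reg h < 2 ^ w) (hw' : 1 < 2 ^ w) (hx : p.writesReg x = false)
    (hh : p.writesReg h = false) (hxh : x ≠ h)
    (hle : s₀.reg x ≤ s₀.reg h) (h₀ : I (s₀.reg x) s₀)
    (step : ∀ i s, s₀.reg x ≤ i → i < s₀.reg h → I i s → s.reg x = i →
      Frame (p ;; .assign x (.reg x +ᵉ .const 1)) s₀ s →
      Runs w p s fun _ s' => I (i + 1) (s'.setReg x (i + 1))) :
    Runs w (WordRAM.forUp x h p) s₀ fun _ s' => I (s₀.reg h) s' ∧ s'.reg x = s₀.reg h := by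
  have hhw : (p ;; .assign x (.reg x +ᵉ .const 1)).writesReg h = false := by
    simp [Program.writesReg, hh, hxh]
  refine (Runs.loop_measure (fun b s => ∃ i, s.reg x = i ∧ s₀.reg x ≤ i ∧ i ≤ s₀.reg h ∧ I i s ∧
    b = s₀.reg h - i) ⟨_, rfl, le_rfl, hle, h₀, rfl⟩ ?_).mono ?_
  · rintro b s ⟨i, hi, hi1, hi2, hI, rfl⟩ hf he
    have hb := hf.reg h hhw
    rw [eval_lt hw', ite_ne_zero, eval_reg, eval_reg, hi, hb] at he
    rw [runs_seq]
    refine (step i s hi1 he hI hi hf).use ?_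
    intro t s' hI' hf'
    rw [runs_assign, eval_add, eval_const hw', eval_reg, hf'.reg x hx, hi]
    · exact ⟨_, ⟨i + 1, by simp [setReg_reg], by omega, by omega, hI', rfl⟩, by omega⟩
    · rw [eval_const hw', eval_reg, hf'.reg x hx, hi]
      omega
  · rintro t s' ⟨hf, he, b, ⟨i, hi, hi1, hi2, hI, rfl⟩⟩
    rw [eval_lt hw', ite_eq_zero, eval_reg, eval_reg, hi, hf.reg h hhw] at he
    obtain rfl : i = s₀.reg h := by omega
    exact ⟨hI, hi⟩

end WordRAM

/-! ### Depth-first numberings -/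

/-- In the forest with parent map `p` on `1, …, N` (numbered in preorder, `0` meaning no parent),
`v` is an ancestor of `u`. -/
def Desc (N : ℕ) (p : ℕ → ℕ) (v u : ℕ) : Prop :=
  v ≤ u ∧ u ≤ N ∧ ∀ b, v < b → b ≤ u → v ≤ p b

namespace Desc

variable {N : ℕ} {p : ℕ → ℕ} {a b u v : ℕ}

theorem refl (h : v ≤ N) : Desc N p v v := ⟨le_rfl, h, fun _ h1 h2 => by omega⟩

theorem trans (h : Desc N p a b) (h' : Desc N p b u) : Desc N p a u := by
  refine ⟨h.1.trans h'.1, h'.2.1, fun x h1 h2 => ?_⟩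
  by_cases hx : x ≤ b
  · exact h.2.2 x h1 hx
  · exact h.1.trans (h'.2.2 x (by omega) h2)

/-- Descendants of a vertex occupy an interval in preorder. This is what turns questions about
subtrees into range queries. -/
theorem mid (h : Desc N p a u) (h1 : a ≤ b) (h2 : b ≤ u) : Desc N p a b :=
  ⟨h1, h2.trans h.2.1, fun x hx hx' => h.2.2 x hx (hx'.trans h2)⟩

theorem parent (h : Desc N p a u) (hau : a < u) (hp : p u < u) : Desc N p a (p u) :=
  h.mid (h.2.2 u hau le_rfl) hp.le

end Desc

/-- The words `D` hold a depth-first numbering of the graph `R` on the vertices `1, …, N`: the parent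
`D (4 v + 1)` of `v` in the depth-first forest, the end `D (4 v + 2)` of the interval of descendants
of `v`, and the place `D (4 v + 3)` from which on the neighbours of `v` are listed in ascending order. -/
structure IsIndex (N : ℕ) (R : ℕ → ℕ → Prop) (D : ℕ → ℕ) : Prop where
  symm : ∀ {a b}, R a b → R b a
  irrefl : ∀ {a}, ¬R a a
  pos : ∀ {a b}, R a b → 1 ≤ a
  le : ∀ {a b}, R a b → a ≤ N
  par_lt : ∀ {b}, 1 ≤ b → b ≤ N → D (4 * b + 1) < b
  par_adj : ∀ {b}, 1 ≤ b → b ≤ N → D (4 * b + 1) ≠ 0 → R b (D (4 * b + 1))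
  desc_adj : ∀ {a c}, R a c → a < c → ∀ b, a < b → b ≤ c → a ≤ D (4 * b + 1)
  fin_iff : ∀ {v u}, 1 ≤ v → v ≤ N → v ≤ u →
    (u < D (4 * v + 2) ↔ u ≤ N ∧ ∀ b, v < b → b ≤ u → v ≤ D (4 * b + 1))
  off_le : ∀ {u}, 1 ≤ u → u ≤ N → D (4 * u + 3) ≤ D (4 * u + 7)
  adj_lt : ∀ {u i j}, 1 ≤ u → u ≤ N → D (4 * u + 3) ≤ i → i < j → j < D (4 * u + 7) → D i < D j
  adj_iff : ∀ {u x}, 1 ≤ u → u ≤ N →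
    ((∃ j, D (4 * u + 3) ≤ j ∧ j < D (4 * u + 7) ∧ D j = x) ↔ R u x)

namespace IsIndex

variable {N : ℕ} {R : ℕ → ℕ → Prop} {D : ℕ → ℕ}

/-- A depth-first forest has no cross edges: the end with the smaller number is an ancestor of the
other. -/
theorem desc_of_adj (h : IsIndex N R D) {a c : ℕ} (hR : R a c) (hac : a < c) :
    Desc N (fun b => D (4 * b + 1)) a c :=
  ⟨hac.le, h.le (h.symm hR), h.desc_adj hR hac⟩

theorem desc_iff (h : IsIndex N R D) {v u : ℕ} (hv : 1 ≤ v) (hvN : v ≤ N) :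
    Desc N (fun b => D (4 * b + 1)) v u ↔ v ≤ u ∧ u < D (4 * v + 2) := by
  constructor
  · exact fun hd => ⟨hd.1, (h.fin_iff hv hvN hd.1).2 hd.2⟩
  · exact fun hd => ⟨hd.1, (h.fin_iff hv hvN hd.1).1 hd.2⟩

theorem lt_fin (h : IsIndex N R D) {v : ℕ} (hv : 1 ≤ v) (hvN : v ≤ N) : v < D (4 * v + 2) :=
  ((h.desc_iff hv hvN).1 (Desc.refl hvN)).2

theorem fin_le (h : IsIndex N R D) {v : ℕ} (hv : 1 ≤ v) (hvN : v ≤ N) : D (4 * v + 2) ≤ N + 1 := by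
  by_contra hc
  have := ((h.fin_iff (u := N + 1) hv hvN (by omega)).1 (by omega)).1
  omega

theorem desc_par (h : IsIndex N R D) {b : ℕ} (hb : 1 ≤ b) (hbN : b ≤ N)
    (h0 : D (4 * b + 1) ≠ 0) : Desc N (fun b => D (4 * b + 1)) (D (4 * b + 1)) b :=
  h.desc_of_adj (h.symm (h.par_adj hb hbN h0)) (h.par_lt hb hbN)

/-- A property of a vertex that passes to children passes to descendants. -/
theorem desc_induction (h : IsIndex N R D) {P : ℕ → Prop} {v : ℕ} (hv : 1 ≤ v)
    (hP : P v) (step : ∀ u, v < u → Desc N (fun b => D (4 * b + 1)) v u →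
      P (D (4 * u + 1)) → P u) :
    ∀ u, Desc N (fun b => D (4 * b + 1)) v u → P u := by
  intro u
  induction u using Nat.strong_induction_on with
  | _ u ih =>
    intro hu
    rcases Nat.eq_or_lt_of_le hu.1 with rfl | hlt
    · exact hP
    · have hlt' := h.par_lt (b := u) (by omega) hu.2.1
      exact step u hlt hu (ih _ hlt' (hu.parent hlt hlt'))

end IsIndex

/-! ### Depth-first search -/

namespace IsAncestor

variable {V : Type*} {par : V → V} {u v x : V}

theorem refl (v : V) : IsAncestor par v v := ⟨0, rfl⟩

theorem parent (h : IsAncestor par u (par v)) : IsAncestor par u v := by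
  obtain ⟨i, rfl⟩ := h
  exact ⟨i + 1, rfl⟩

theorem eq_or_parent (h : IsAncestor par u v) : u = v ∨ IsAncestor par u (par v) := by
  obtain ⟨i, rfl⟩ := h
  cases i with
  | zero => exact Or.inl rfl
  | succ i => exact Or.inr ⟨i, rfl⟩

end IsAncestor

/-- A depth-first search of the graph `H` from the root `0` has visited the vertices in `V`, with
parent map `par`, and stands at `cur`; the vertices that are not yet finished are the ancestors of
`cur`. -/
structure DFSState (H : ℕ → ℕ → Prop) (V : ℕ → Prop) (par : ℕ → ℕ) (cur : ℕ) : Prop where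
  root : V 0
  par_root : par 0 = 0
  cur_mem : V cur
  tree : ∀ v, V v → v ≠ 0 → H v (par v) ∧ V (par v)
  anc : ∀ v, V v → IsAncestor par 0 v
  comp : ∀ u v, V u → V v → H u v → IsAncestor par u v ∨ IsAncestor par v u
  finished : ∀ v, V v → ¬IsAncestor par v cur → ∀ u, H v u → V u

namespace DFSState

variable {H : ℕ → ℕ → Prop} {V : ℕ → Prop} {par : ℕ → ℕ} {cur : ℕ}

theorem par_mem (h : DFSState H V par cur) {v : ℕ} (hv : V v) : V (par v) := by
  by_cases h0 : v = 0
  · rw [h0, h.par_root]; exact h.root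
  · exact (h.tree v hv h0).2

theorem mem_of_anc (h : DFSState H V par cur) {u v : ℕ} (hv : V v) (ha : IsAncestor par u v) :
    V u := by
  obtain ⟨i, rfl⟩ := ha
  induction i with
  | zero => exact hv
  | succ i ih =>
    rw [Function.iterate_succ_apply']
    exact h.par_mem ih

/-- The visited set is closed under taking parents, so the chain above a visited vertex never meets
the unvisited vertex `y` whose parent is changed. -/
theorem iterate_update (h : DFSState H V par cur) {y x : ℕ} (hy : ¬V y) (i : ℕ) {v : ℕ}
    (hv : V v) : (Function.update par y x)^[i] v = par^[i] v := by
  induction i generalizing v with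
  | zero => rfl
  | succ i ih =>
    have hne : v ≠ y := fun e => hy (e ▸ hv)
    rw [Function.iterate_succ_apply, Function.iterate_succ_apply, Function.update_of_ne hne]
    exact ih (h.par_mem hv)

theorem anc_update (h : DFSState H V par cur) {y x : ℕ} (hy : ¬V y) {u v : ℕ} (hv : V v) :
    IsAncestor (Function.update par y x) u v ↔ IsAncestor par u v := by
  simp only [IsAncestor, h.iterate_update hy _ hv]

theorem anc_update_new (h : DFSState H V par cur) {y : ℕ} (hy : ¬V y) {u : ℕ} :
    IsAncestor (Function.update par y cur) u y ↔ u = y ∨ IsAncestor par u cur := by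
  have hpy : Function.update par y cur y = cur := Function.update_self ..
  constructor
  · intro ha
    refine ha.eq_or_parent.imp_right fun ha' => ?_
    rw [hpy] at ha'
    exact (h.anc_update hy h.cur_mem).1 ha'
  · rintro (rfl | ha)
    · exact IsAncestor.refl _
    · refine IsAncestor.parent ?_
      rw [hpy]
      exact (h.anc_update hy h.cur_mem).2 ha

/-- Visiting an unvisited neighbour of the current vertex. -/
theorem push (hs : ∀ a b, H a b → H b a) (hi : ∀ a, ¬H a a) (h : DFSState H V par cur) {y : ℕ}
    (hy : ¬V y) (hH : H y cur) :
    DFSState H (fun v => V v ∨ v = y) (Function.update par y cur) y := by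
  have hy0 : y ≠ 0 := fun e => hy (e ▸ h.root)
  -- A visited neighbour of `y` that is not an ancestor of `cur` would be finished, and then `y`
  -- would be visited already. Hence all edges from `y` to visited vertices are back edges.
  have hanc_y : ∀ v, V v → H y v → IsAncestor par v cur := by
    intro v hv hvy
    by_contra hc
    exact hy (h.finished v hv hc y (hs _ _ hvy))
  refine ⟨Or.inl h.root, ?_, Or.inr rfl, ?_, ?_, ?_, ?_⟩
  · rw [Function.update_of_ne (Ne.symm hy0), h.par_root]
  · rintro v (hv | rfl) hv0
    · rw [Function.update_of_ne (fun e : v = y => hy (e ▸ hv))]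
      exact ⟨(h.tree v hv hv0).1, Or.inl (h.tree v hv hv0).2⟩
    · rw [Function.update_self]
      exact ⟨hH, Or.inl h.cur_mem⟩
  · rintro v (hv | rfl)
    · exact (h.anc_update hy hv).2 (h.anc v hv)
    · exact (h.anc_update_new hy).2 (Or.inr (h.anc cur h.cur_mem))
  · rintro u v (hu | rfl) (hv | rfl) huv
    · rw [h.anc_update hy hu, h.anc_update hy hv]
      exact h.comp u v hu hv huv
    · exact Or.inl ((h.anc_update_new hy).2 (Or.inr (hanc_y u hu (hs _ _ huv))))
    · exact Or.inr ((h.anc_update_new hy).2 (Or.inr (hanc_y v hv huv)))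
    · exact absurd huv (hi _)
  · rintro v (hv | rfl) hnv u hvu
    · exact Or.inl (h.finished v hv (fun ha => hnv ((h.anc_update_new hy).2 (Or.inr ha))) u hvu)
    · exact absurd (IsAncestor.refl _) hnv

/-- Leaving the current vertex when all of its neighbours are visited. -/
theorem pop (h : DFSState H V par cur) (hc : ∀ u, H cur u → V u) :
    DFSState H V par (par cur) := by
  refine ⟨h.root, h.par_root, h.par_mem h.cur_mem, h.tree, h.anc, h.comp, ?_⟩
  intro v hv hnv u hvu
  by_cases ha : IsAncestor par v cur
  · rcases ha.eq_or_parent with rfl | ha'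
    · exact hc u hvu
    · exact absurd ha' hnv
  · exact h.finished v hv ha u hvu

theorem congr {V' : ℕ → Prop} (h : DFSState H V par cur) (hV : ∀ v, V' v ↔ V v) :
    DFSState H V' par cur := by
  obtain rfl : V' = V := funext fun v => propext (hV v)
  exact h

end DFSState

/-- The search has gone on from the state `V, par, cur` at depth `d` along the path
`q 0, …, q (l - 1)`. -/
structure PathPush (H : ℕ → ℕ → Prop) (V : ℕ → Prop) (par : ℕ → ℕ) (cur d : ℕ) (q : ℕ → ℕ)
    (l : ℕ) (V' : ℕ → Prop) (par' : ℕ → ℕ) (cur' : ℕ) : Prop where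
  dfs : DFSState H V' par' cur'
  mem : ∀ v, V' v ↔ V v ∨ ∃ j < l, v = q j
  anc_old : ∀ u v, V v → (IsAncestor par' u v ↔ IsAncestor par u v)
  anc_path : ∀ i j, i ≤ j → j < l → IsAncestor par' (q i) (q j)
  anc_cur : ∀ u, IsAncestor par' u cur' ↔ IsAncestor par u cur ∨ ∃ j < l, u = q j
  cur_eq : cur' = if l = 0 then cur else q (l - 1)
  depth : par'^[d + l] cur' = 0

namespace PathPush

variable {H : ℕ → ℕ → Prop} {V V' : ℕ → Prop} {par par' : ℕ → ℕ} {cur cur' d l : ℕ} {q : ℕ → ℕ}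

theorem nil (h : DFSState H V par cur) (hd : par^[d] cur = 0) :
    PathPush H V par cur d q 0 V par cur :=
  ⟨h, by simp, by simp, by omega, by simp, by simp, hd⟩

theorem snoc (hs : ∀ a b, H a b → H b a) (hi : ∀ a, ¬H a a)
    (h : PathPush H V par cur d q l V' par' cur') (hq : ¬V' (q l)) (hH : H (q l) cur')
    {V'' : ℕ → Prop} (hV : ∀ v, V'' v ↔ V' v ∨ v = q l) :
    PathPush H V par cur d q (l + 1) V'' (Function.update par' (q l) cur') (q l) := by
  obtain rfl : V'' = fun v => V' v ∨ v = q l := funext fun v => propext (hV v)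
  have hlast : ∀ P : ℕ → Prop, (∃ j < l + 1, P j) ↔ (∃ j < l, P j) ∨ P l := by
    intro P
    constructor
    · rintro ⟨j, hj, hP⟩
      rcases Nat.lt_succ_iff_lt_or_eq.1 hj with hj | rfl
      · exact Or.inl ⟨j, hj, hP⟩
      · exact Or.inr hP
    · rintro (⟨j, hj, hP⟩ | hP)
      · exact ⟨j, by omega, hP⟩
      · exact ⟨l, by omega, hP⟩
  have hold : ∀ v, V v → V' v := fun v hv => (h.mem v).2 (Or.inl hv)
  have hpath : ∀ j < l, V' (q j) := fun j hj => (h.mem _).2 (Or.inr ⟨j, hj, rfl⟩)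
  refine ⟨h.dfs.push hs hi hq hH, ?_, ?_, ?_, ?_, by simp, ?_⟩
  · intro v
    rw [hlast, h.mem, or_assoc]
  · intro u v hv
    rw [h.dfs.anc_update hq (hold v hv), h.anc_old u v hv]
  · intro i j hij hj
    rcases Nat.lt_succ_iff_lt_or_eq.1 hj with hj | rfl
    · exact (h.dfs.anc_update hq (hpath j hj)).2 (h.anc_path i j hij hj)
    · refine (h.dfs.anc_update_new hq).2 ?_
      rcases Nat.eq_or_lt_of_le hij with rfl | hij
      · exact Or.inl rfl
      · exact Or.inr ((h.anc_cur _).2 (Or.inr ⟨i, hij, rfl⟩))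
  · intro u
    rw [h.dfs.anc_update_new hq, h.anc_cur, hlast, or_comm, or_assoc]
  · rw [← Nat.add_assoc, Function.iterate_succ_apply, Function.update_self,
      h.dfs.iterate_update hq _ h.dfs.cur_mem]
    exact h.depth

end PathPush

/-! ### Evaluation modulo `2 ^ w` -/

namespace WordRAM

@[simp] theorem eval_const_mod {w c : ℕ} {s : State} : (Expr.const c).eval w s = c % 2 ^ w := rfl

@[simp] theorem eval_add_mod {w : ℕ} {e f : Expr} {s : State} :
    (e +ᵉ f).eval w s = (e.eval w s + f.eval w s) % 2 ^ w := rfl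

@[simp] theorem eval_mul_mod {w : ℕ} {e f : Expr} {s : State} :
    (e *ᵉ f).eval w s = (e.eval w s * f.eval w s) % 2 ^ w := rfl

@[simp] theorem eval_lt_mod {w : ℕ} {e f : Expr} {s : State} :
    (e <ᵉ f).eval w s = (if e.eval w s < f.eval w s then 1 else 0) % 2 ^ w := rfl

@[simp] theorem bit_mod {w : ℕ} {p : Prop} [Decidable p] (h : 1 < 2 ^ w) :
    (if p then 1 else 0) % 2 ^ w = if p then 1 else 0 := by
  refine Nat.mod_eq_of_lt ?_
  split_ifs <;> omega

attribute [simp] runs_skip runs_assign runs_store runs_seq runs_cond setReg_reg setReg_mem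
  setMem_reg setMem_mem eval_reg eval_load eval_sub eval_div eval_mod Expr.cost
  Program.writesReg Program.writesMem

end WordRAM

open WordRAM Expr Program

/-! ### Binary search in the lists of neighbours -/

/-- Binary search in the list of neighbours of the vertex in register `10` for the first one that is at
least register `15`; its place is left in register `16`. -/
def search : Program :=
  assign 16 (load 0 (const 4 *ᵉ reg 10 +ᵉ const 3)) ;;
  assign 17 (load 0 (const 4 *ᵉ reg 10 +ᵉ const 7)) ;;
  loop (reg 16 <ᵉ reg 17)
    (assign 18 ((reg 16 +ᵉ reg 17) /ᵉ const 2) ;;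
     cond (load 0 (reg 18) <ᵉ reg 15) (assign 16 (reg 18 +ᵉ const 1)) (assign 17 (reg 18)))

/-- Cells to the left of the window hold values below `a`, cells to the right hold values from `a`
on. A window shorter than `2 ^ g` leaves at most `g` rounds, since each round halves it. The bound
on `2 * r` keeps the sum of the two ends within a word. -/
theorem runs_search {w : ℕ} {s : State} {u l r a L : ℕ}
    (hw : 1024 ≤ 2 ^ w) (hu : s.reg 10 = u) (huw : 4 * u + 7 < 2 ^ w) (ha : s.reg 15 = a)
    (hl : s.mem 0 (4 * u + 3) = l) (hr : s.mem 0 (4 * u + 7) = r) (hlr : l ≤ r)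
    (hrw : 2 * r < 2 ^ w) (hL : r - l < 2 ^ L)
    (hmono : ∀ i j, l ≤ i → i < j → j < r → s.mem 0 i < s.mem 0 j) :
    Runs w search s fun t s' => t ≤ 30 * L + 30 ∧ l ≤ s'.reg 16 ∧ s'.reg 16 ≤ r ∧
      ∀ j, l ≤ j → j < r → (s.mem 0 j < a ↔ j < s'.reg 16) := by
  simp (disch := omega) [search, Nat.mod_eq_of_lt, hu, hl, hr]
  refine (Runs.loop (fun b s' => ∃ x y g, s'.reg 16 = x ∧ s'.reg 17 = y ∧ l ≤ x ∧ x ≤ y ∧ y ≤ r ∧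
    (∀ j, l ≤ j → j < x → s.mem 0 j < a) ∧ (∀ j, y ≤ j → j < r → a ≤ s.mem 0 j) ∧
    y - x < 2 ^ g ∧ b = 30 * g) (b₀ := 30 * L) ?_ ?_).mono ?_
  · refine ⟨l, r, L, by simp, by simp, le_rfl, hlr, le_rfl, fun j _ _ => by omega,
      fun j _ _ => by omega, hL, rfl⟩
  · rintro b s₁ ⟨x, y, g, hx, hy, hlx, hxy, hyr, h1, h2, hg, rfl⟩ hf he
    have hm := hf.mem 0 rfl
    have h15 := hf.reg 15 rfl
    simp [ha] at hm h15
    simp (disch := omega) [hx, hy] at he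
    have hmr : (x + y) / 2 < r := by omega
    obtain ⟨g, rfl⟩ : ∃ g', g = g' + 1 := Nat.exists_eq_succ_of_ne_zero (by
      rintro rfl
      omega)
    rw [pow_succ] at hg
    refine Runs.hide fun Q hQ => ?_
    simp (disch := omega) [Nat.mod_eq_of_lt, hx, hy, hm, h15]
    constructor
    · intro hlt
      refine hQ _ _ ⟨_, ⟨(x + y) / 2 + 1, y, g, by simp, by simp [hy], by omega, by omega, hyr, ?_, h2, by omega, rfl⟩,
        by simp; omega⟩
      intro j hj hj'
      rcases Nat.lt_succ_iff_lt_or_eq.1 hj' with hj' | rfl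
      · exact (hmono _ _ hj hj' hmr).trans hlt
      · exact hlt
    · intro hge
      refine hQ _ _ ⟨_, ⟨x, (x + y) / 2, g, by simp [hx], by simp, hlx, by omega, by omega, h1, ?_, by omega, rfl⟩,
        by simp; omega⟩
      intro j hj hj'
      rcases Nat.eq_or_lt_of_le hj with rfl | hj
      · exact hge
      · exact hge.trans (hmono _ _ (by omega) hj hj').le
  · rintro t s' ⟨hf, he, b, ⟨x, y, g, hx, hy, hlx, hxy, hyr, h1, h2, hg, rfl⟩, hb⟩
    simp (disch := omega) [hx, hy] at he
    simp at hb
    obtain rfl : x = y := by omega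
    rw [hx]
    refine ⟨by omega, hlx, hyr, fun j hj hj' => ⟨fun h => ?_, fun h => h1 j hj h⟩⟩
    by_contra hc
    have := h2 j (by omega) hj'
    omega

/-- A depth-first numbering whose entries can be handled with words of `w` bits; the number of
vertices has at most `L` bits. -/
structure IndexFits (w N L : ℕ) (R : ℕ → ℕ → Prop) (D : ℕ → ℕ) : Prop extends IsIndex N R D where
  word : 1024 ≤ 2 ^ w
  off_word : ∀ {u}, 1 ≤ u → u ≤ N → 2 * D (4 * u + 7) < 2 ^ w
  size_word : 8 * N + 8 < 2 ^ w
  log : N < 2 ^ L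

/-- The list is strictly ascending with values in `1, …, N`, so its `k`-th entry, counted from `0`,
is at least `k + 1`. Hence a search takes at most `L` rounds when `N < 2 ^ L`. -/
theorem IsIndex.degree_le {N : ℕ} {R : ℕ → ℕ → Prop} {D : ℕ → ℕ} (h : IsIndex N R D) {u : ℕ}
    (hu : 1 ≤ u) (huN : u ≤ N) : D (4 * u + 7) - D (4 * u + 3) ≤ N := by
  have H : ∀ k, D (4 * u + 3) + k < D (4 * u + 7) → k + 1 ≤ D (D (4 * u + 3) + k) := by
    intro k
    induction k with
    | zero =>
      intro hk
      exact h.pos (h.symm ((h.adj_iff hu huN).1 ⟨_, le_rfl, hk, rfl⟩))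
    | succ k ih =>
      intro hk
      have := ih (by omega)
      have := h.adj_lt hu huN (i := D (4 * u + 3) + k) (j := D (4 * u + 3) + (k + 1)) (by omega)
        (by omega) hk
      omega
  by_contra hc
  have h1 := H N (by omega)
  have h2 := h.le (h.symm ((h.adj_iff hu huN).1 ⟨D (4 * u + 3) + N, by omega, by omega, rfl⟩))
  omega

theorem IndexFits.runs_search {w N L : ℕ} {R : ℕ → ℕ → Prop} {D : ℕ → ℕ}
    (h : IndexFits w N L R D) {s : State} {u : ℕ} (hD : s.mem 0 = D) (hu : s.reg 10 = u)
    (hu1 : 1 ≤ u) (huN : u ≤ N) :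
    Runs w search s fun t s' => t ≤ 30 * L + 30 ∧ D (4 * u + 3) ≤ s'.reg 16 ∧
      s'.reg 16 ≤ D (4 * u + 7) ∧
      ∀ j, D (4 * u + 3) ≤ j → j < D (4 * u + 7) → (D j < s.reg 15 ↔ j < s'.reg 16) := by
  subst hD
  have hw := h.size_word
  have hd := h.degree_le hu1 huN
  have hL := h.log
  exact _root_.runs_search h.word hu (by omega) rfl rfl rfl (h.off_le hu1 huN) (h.off_word hu1 huN)
    (by omega) fun i j h1 h2 h3 => h.adj_lt hu1 huN h1 h2 h3

/-- Look for a neighbour of the vertex in register `10` between registers `11` and `12`, the first one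
if register `13` is not zero and the last one otherwise.  It is left in register `14`, which is zero
if there is no neighbour or if the edge found has failed. -/
def find : Program :=
  assign 15 (reg 11) ;; search ;; assign 19 (reg 16) ;; assign 15 (reg 12 +ᵉ const 1) ;; search ;;
  assign 14 (const 0) ;;
  cond (reg 19 <ᵉ reg 16)
    (cond (reg 13) (assign 18 (reg 19)) (assign 18 (reg 16 -ᵉ const 1)) ;;
     cond (load 7 (reg 18)) skip (assign 14 (load 0 (reg 18))))
    skip

/-- Searching for `lo` and for `hi + 1` gives places `j₁` and `j₂`, and the neighbours in the range
are the cells from `j₁` up to `j₂`, exclusive. Failed edges need not be skipped: by `hclean` a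
neighbour across a failed edge is the only neighbour in the range, so a marked cell at an end means
that no surviving neighbour is there. -/
theorem IndexFits.runs_find {w N L : ℕ} {R Fl : ℕ → ℕ → Prop} {D : ℕ → ℕ}
    (h : IndexFits w N L R D) {s : State} {u lo hi up : ℕ} (hD : s.mem 0 = D) (hu : s.reg 10 = u)
    (hlo : s.reg 11 = lo) (hhi : s.reg 12 = hi) (hup : s.reg 13 = up) (hhw : hi + 1 < 2 ^ w)
    (hu1 : 1 ≤ u) (huN : u ≤ N)
    (hbad : ∀ j, D (4 * u + 3) ≤ j → j < D (4 * u + 7) → (s.mem 7 j ≠ 0 ↔ Fl u (D j)))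
    (hclean : ∀ x x', lo ≤ x → x ≤ hi → lo ≤ x' → x' ≤ hi → R u x → R u x' → Fl u x → x' = x) :
    Runs w find s fun t s' => t ≤ 60 * L + 100 ∧
      (s'.reg 14 ≠ 0 → R u (s'.reg 14) ∧ ¬Fl u (s'.reg 14) ∧ lo ≤ s'.reg 14 ∧ s'.reg 14 ≤ hi ∧
        ∀ x, R u x → lo ≤ x → x ≤ hi → if up ≠ 0 then s'.reg 14 ≤ x else x ≤ s'.reg 14) ∧
      (s'.reg 14 = 0 → ∀ x, R u x → ¬Fl u x → lo ≤ x → x ≤ hi → False) := by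
  have hw := h.word
  rw [find, runs_seq, runs_assign, runs_seq]
  refine (h.runs_search (by simpa using hD) (by simpa using hu) hu1 huN).use ?_
  intro t₁ s₁ ⟨ht₁, hl₁, hr₁, hj₁⟩ hf₁
  have e0 := hf₁.mem 0 rfl
  have e7 := hf₁.mem 7 rfl
  have e10 := hf₁.reg 10 rfl
  have e12 := hf₁.reg 12 rfl
  have e13 := hf₁.reg 13 rfl
  simp [hlo, hu, hhi, hup, hD] at e0 e7 e10 e12 e13 hj₁
  rw [runs_seq, runs_assign, runs_seq, runs_assign, runs_seq]
  refine (h.runs_search (by simpa using e0) (by simpa using e10) hu1 huN).use ?_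
  intro t₂ s₂ ⟨ht₂, hl₂, hr₂, hj₂⟩ hf₂
  have e0' := hf₂.mem 0 rfl
  have e7' := hf₂.mem 7 rfl
  have e13' := hf₂.reg 13 rfl
  have e19' := hf₂.reg 19 rfl
  simp (disch := omega) [Nat.mod_eq_of_lt, e0, e7, e12, e13] at e0' e7' e13' e19' hj₂
  obtain ⟨j₁, hj1⟩ : ∃ j, s₁.reg 16 = j := ⟨_, rfl⟩
  obtain ⟨j₂, hj2⟩ : ∃ j, s₂.reg 16 = j := ⟨_, rfl⟩
  rw [hj1] at e19' hj₁ hl₁ hr₁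
  rw [hj2] at hj₂ hl₂ hr₂
  have hmem : ∀ j, D (4 * u + 3) ≤ j → j < D (4 * u + 7) →
      (lo ≤ D j ∧ D j ≤ hi ↔ j₁ ≤ j ∧ j < j₂) := by
    intro j hj hj'
    have h1 := hj₁ j hj hj'
    have h2 := hj₂ j hj hj'
    omega
  have hnb : ∀ x, R u x → lo ≤ x → x ≤ hi → ∃ j, D (4 * u + 3) ≤ j ∧ j < D (4 * u + 7) ∧
      D j = x ∧ j₁ ≤ j ∧ j < j₂ := by
    intro x hx h1 h2
    obtain ⟨j, hj, hj', rfl⟩ := (h.adj_iff hu1 huN).2 hx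
    exact ⟨j, hj, hj', rfl, ((hmem j hj hj').1 ⟨h1, h2⟩).1, ((hmem j hj hj').1 ⟨h1, h2⟩).2⟩
  have hmono : ∀ i j, D (4 * u + 3) ≤ i → i ≤ j → j < D (4 * u + 7) → D i ≤ D j := by
    intro i j hi hij hj
    rcases Nat.eq_or_lt_of_le hij with rfl | hij
    · exact le_rfl
    · exact (h.adj_lt hu1 huN hi hij hj).le
  have key : ∀ j, j₁ ≤ j → j < j₂ → (∀ i, j₁ ≤ i → i < j₂ → if up ≠ 0 then j ≤ i else i ≤ j) →
      (s.mem 7 j = 0 → D j ≠ 0 ∧ R u (D j) ∧ ¬Fl u (D j) ∧ lo ≤ D j ∧ D j ≤ hi ∧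
        ∀ x, R u x → lo ≤ x → x ≤ hi → if up ≠ 0 then D j ≤ x else x ≤ D j) ∧
      (s.mem 7 j ≠ 0 → ∀ x, R u x → ¬Fl u x → lo ≤ x → x ≤ hi → False) := by
    intro j h1 h2 h3
    have hR : R u (D j) := (h.adj_iff hu1 huN).1 ⟨j, by omega, by omega, rfl⟩
    have hint := (hmem j (by omega) (by omega)).2 ⟨h1, h2⟩
    have hb := hbad j (by omega) (by omega)
    refine ⟨fun h0 => ⟨?_, hR, ?_, hint.1, hint.2, ?_⟩, fun h0 x hx hFl hx1 hx2 => ?_⟩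
    · have := h.pos (h.symm hR)
      omega
    · exact fun hF => hb.2 hF h0
    · intro x hx hx1 hx2
      obtain ⟨i, hi1, hi2, rfl, hi3, hi4⟩ := hnb x hx hx1 hx2
      have := h3 i hi3 hi4
      split_ifs at this ⊢
      · exact hmono _ _ (by omega) this hi2
      · exact hmono _ _ hi1 this (by omega)
    · have hF := hb.1 h0
      exact hFl (hclean _ _ hint.1 hint.2 hx1 hx2 hR hx hF ▸ hF)
  refine Runs.hide fun Q hQ => ?_
  simp (disch := omega) [Nat.mod_eq_of_lt, e0', e7', e13', e19', hj2]
  refine ⟨fun hlt => ⟨fun hup0 => ⟨fun hb => ?_, fun hb => ?_⟩,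
    fun hup0 => ⟨fun hb => ?_, fun hb => ?_⟩⟩, fun hge => ?_⟩
  · have := key j₁ le_rfl hlt fun i h1 h2 => by rw [if_pos hup0]; exact h1
    exact hQ _ _ ⟨by simp only [Expr.cost]; omega, by simp, by simpa using this.2 hb⟩
  · have := key j₁ le_rfl hlt fun i h1 h2 => by rw [if_pos hup0]; exact h1
    exact hQ _ _ ⟨by simp only [Expr.cost]; omega, fun _ => by simpa using (this.1 hb).2,
      fun h0 => absurd (by simpa using h0) (this.1 hb).1⟩
  · have := key (j₂ - 1) (by omega) (by omega) fun i h1 h2 => by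
      rw [if_neg (not_not.2 hup0)]; omega
    exact hQ _ _ ⟨by simp only [Expr.cost]; omega, by simp, by simpa using this.2 hb⟩
  · have := key (j₂ - 1) (by omega) (by omega) fun i h1 h2 => by
      rw [if_neg (not_not.2 hup0)]; omega
    exact hQ _ _ ⟨by simp only [Expr.cost]; omega, fun _ => by simpa using (this.1 hb).2,
      fun h0 => absurd (by simpa using h0) (this.1 hb).1⟩
  · refine hQ _ _ ⟨by simp only [Expr.cost]; omega, by simp, fun _ x hx hFl hx1 hx2 => ?_⟩
    obtain ⟨j, h1, h2, h3, h4, h5⟩ := hnb x hx hx1 hx2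
    omega

/-! ### Lists of vertices still to be visited -/

/-- `v` is on the list of `z`, where the list of `z` has `cnt z` entries and its entry `i` is stored in
cell `i * (N + 1) + z`. -/
def Listed (N : ℕ) (cnt ent : ℕ → ℕ) (z v : ℕ) : Prop :=
  ∃ i < cnt z, ent (i * (N + 1) + z) = v

theorem cell_injective {N i j y z : ℕ} (hy : y ≤ N) (hz : z ≤ N)
    (h : i * (N + 1) + y = j * (N + 1) + z) : i = j ∧ y = z := by
  have h3 : y = z := by
    have := congrArg (· % (N + 1)) h
    simpa [Nat.mul_add_mod_self_right, Nat.mod_eq_of_lt (Nat.lt_succ_of_le hy),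
      Nat.mod_eq_of_lt (Nat.lt_succ_of_le hz)] using this
  subst h3
  exact ⟨Nat.eq_of_mul_eq_mul_right (Nat.succ_pos N) (Nat.add_right_cancel h), rfl⟩

theorem listed_push {N r u : ℕ} {cnt ent : ℕ → ℕ} (hr : r ≤ N) {z v : ℕ} (hz : z ≤ N) :
    Listed N (Function.update cnt r (cnt r + 1))
      (Function.update ent (cnt r * (N + 1) + r) u) z v ↔
      Listed N cnt ent z v ∨ (z = r ∧ v = u) := by
  constructor
  · rintro ⟨i, hi, rfl⟩
    by_cases hzr : z = r
    · subst hzr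
      rw [Function.update_self] at hi
      by_cases hic : i = cnt z
      · subst hic
        exact Or.inr ⟨rfl, Function.update_self ..⟩
      · refine Or.inl ⟨i, by omega, ?_⟩
        rw [Function.update_of_ne fun e => hic (cell_injective hz hz e).1]
    · rw [Function.update_of_ne hzr] at hi
      refine Or.inl ⟨i, hi, ?_⟩
      rw [Function.update_of_ne fun e => hzr (cell_injective hz hr e).2]
  · rintro (⟨i, hi, rfl⟩ | ⟨rfl, rfl⟩)
    · by_cases hzr : z = r
      · subst hzr
        refine ⟨i, by rw [Function.update_self]; omega, ?_⟩
        rw [Function.update_of_ne fun e => hi.ne (cell_injective hz hz e).1]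
      · refine ⟨i, by rwa [Function.update_of_ne hzr], ?_⟩
        rw [Function.update_of_ne fun e => hzr (cell_injective hz hr e).2]
    · exact ⟨cnt z, by rw [Function.update_self]; omega, Function.update_self ..⟩

theorem sum_update_range {n r : ℕ} {f : ℕ → ℕ} (hr : r < n) (x : ℕ) :
    ∑ z ∈ Finset.range n, Function.update f r x z + f r = ∑ z ∈ Finset.range n, f z + x := by
  have hm : r ∈ Finset.range n := Finset.mem_range.2 hr
  rw [Finset.sum_update_of_mem hm, ← Finset.sum_sdiff (Finset.singleton_subset_iff.2 hm),
    Finset.sum_singleton]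
  omega

theorem sum_update {N r : ℕ} {f : ℕ → ℕ} (hr : r ≤ N) (x : ℕ) :
    ∑ z ∈ Finset.range (N + 1), Function.update f r x z + f r =
      ∑ z ∈ Finset.range (N + 1), f z + x :=
  sum_update_range (Nat.lt_succ_of_le hr) x

theorem le_sum {N r : ℕ} (f : ℕ → ℕ) (hr : r ≤ N) : f r ≤ ∑ z ∈ Finset.range (N + 1), f z :=
  Finset.single_le_sum (f := f) (fun _ _ => Nat.zero_le _) (Finset.mem_range.2 (by omega))

/-- Every unvisited vertex `u` from register `20` up to register `21` (exclusive) is put on the list of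
its neighbour between `lo` and `min hi (max (att u) fl)` that is closest to the end of the path just
visited, where `lo`, `hi`, `fl` are the registers `11`, `22`, `23`. -/
def batch : Program :=
  forUp 20 21 (cond (load 6 (reg 20)) skip
    (assign 10 (reg 20) ;;
     assign 24 (load 9 (reg 20) +ᵉ (reg 23 -ᵉ load 9 (reg 20))) ;;
     assign 12 (reg 22 -ᵉ (reg 22 -ᵉ reg 24)) ;;
     find ;;
     cond (reg 14)
      (store 16 (load 15 (reg 14) *ᵉ (reg 3 +ᵉ const 1) +ᵉ reg 14) (reg 20) ;;
       store 15 (reg 14) (load 15 (reg 14) +ᵉ const 1)) skip))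

/-- Each unvisited vertex gets at most one entry, at its first or last neighbour in the range, which
is what the growth bound and the final comparison of `z` with `x` express. The cap serves two
purposes: with `fl = 0` it confines the range to numbers up to `att v`, with `fl = hi` it has no
effect. The bound `T` on the number of entries makes the addresses of the list cells fit into words.
-/
theorem IndexFits.runs_batch {w N L : ℕ} {R Fl : ℕ → ℕ → Prop} {D : ℕ → ℕ}
    (h : IndexFits w N L R D) {s : State} {a b lo hi fl up T : ℕ} {att : ℕ → ℕ}
    (hD : s.mem 0 = D) (hN : s.reg 3 = N)
    (ha : s.reg 20 = a) (hb : s.reg 21 = b) (hlo : s.reg 11 = lo) (hup : s.reg 13 = up)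
    (hhi : s.reg 22 = hi) (hfl : s.reg 23 = fl) (hatt : s.mem 9 = att)
    (ha1 : 1 ≤ a) (hab : a ≤ b) (hbN : b ≤ N + 1) (hhiN : hi ≤ N) (hflN : fl ≤ N)
    (hattN : ∀ u, 1 ≤ u → u ≤ N → att u ≤ N)
    (hT : ∑ z ∈ Finset.range (N + 1), s.mem 15 z + (b - a) ≤ T) (hTw : T * (N + 1) + N < 2 ^ w)
    (hbad : ∀ u j, 1 ≤ u → u ≤ N → D (4 * u + 3) ≤ j → j < D (4 * u + 7) →
      (s.mem 7 j ≠ 0 ↔ Fl u (D j)))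
    (hclean : ∀ u x x', a ≤ u → u < b → s.mem 6 u = 0 → lo ≤ x → x ≤ min hi (max (att u) fl) →
      lo ≤ x' → x' ≤ min hi (max (att u) fl) → R u x → R u x' → Fl u x → x' = x) :
    Runs w batch s fun t s' => t ≤ (b - a) * (60 * L + 200) + 4 ∧ s'.reg 20 = b ∧
      ∑ z ∈ Finset.range (N + 1), s'.mem 15 z ≤
        ∑ z ∈ Finset.range (N + 1), s.mem 15 z + (b - a) ∧
      (∀ z v, z ≤ N → Listed N (s.mem 15) (s.mem 16) z v →
        Listed N (s'.mem 15) (s'.mem 16) z v) ∧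
      (∀ z v, z ≤ N → Listed N (s'.mem 15) (s'.mem 16) z v → Listed N (s.mem 15) (s.mem 16) z v ∨
        (a ≤ v ∧ v < b ∧ s.mem 6 v = 0 ∧ R v z ∧ ¬Fl v z ∧ lo ≤ z ∧
          z ≤ min hi (max (att v) fl))) ∧
      (∀ v x, a ≤ v → v < b → s.mem 6 v = 0 → R v x → ¬Fl v x → lo ≤ x →
        x ≤ min hi (max (att v) fl) → ∃ z, Listed N (s'.mem 15) (s'.mem 16) z v ∧
          R v z ∧ ¬Fl v z ∧ lo ≤ z ∧ z ≤ min hi (max (att v) fl) ∧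
          if up ≠ 0 then z ≤ x else x ≤ z) := by
  have hw := h.word
  have hsw := h.size_word
  refine (Runs.forUp (fun i s' =>
      ∑ z ∈ Finset.range (N + 1), s'.mem 15 z ≤
        ∑ z ∈ Finset.range (N + 1), s.mem 15 z + (i - a) ∧
      (∀ z v, z ≤ N → Listed N (s.mem 15) (s.mem 16) z v →
        Listed N (s'.mem 15) (s'.mem 16) z v) ∧
      (∀ z v, z ≤ N → Listed N (s'.mem 15) (s'.mem 16) z v → Listed N (s.mem 15) (s.mem 16) z v ∨
        (a ≤ v ∧ v < i ∧ s.mem 6 v = 0 ∧ R v z ∧ ¬Fl v z ∧ lo ≤ z ∧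
          z ≤ min hi (max (att v) fl))) ∧
      (∀ v x, a ≤ v → v < i → s.mem 6 v = 0 → R v x → ¬Fl v x → lo ≤ x →
        x ≤ min hi (max (att v) fl) → ∃ z, Listed N (s'.mem 15) (s'.mem 16) z v ∧
          R v z ∧ ¬Fl v z ∧ lo ≤ z ∧ z ≤ min hi (max (att v) fl) ∧
          if up ≠ 0 then z ≤ x else x ≤ z)) (60 * L + 192)
      (by omega) (by omega) rfl rfl (by omega) (by omega)
      ⟨by omega, fun _ _ _ => id, fun _ _ _ => Or.inl, fun v x h1 h2 => by omega⟩ ?_).mono ?_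
  · intro i s₁ hi1 hi2 ⟨hS, hmono, hsound, hcompl⟩ hri hf
    rw [ha] at hi1
    rw [hb] at hi2
    have e0 := hf.mem 0 rfl
    have e6 := hf.mem 6 rfl
    have e7 := hf.mem 7 rfl
    have e9 := hf.mem 9 rfl
    have r3 := hf.reg 3 rfl
    have r11 := hf.reg 11 rfl
    have r13 := hf.reg 13 rfl
    have r22 := hf.reg 22 rfl
    have r23 := hf.reg 23 rfl
    rw [hD] at e0
    rw [hatt] at e9
    rw [hN] at r3
    rw [hlo] at r11
    rw [hup] at r13
    rw [hhi] at r22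
    rw [hfl] at r23
    have hatti := hattN i (by omega) (by omega)
    rw [runs_cond]
    simp only [eval_load, eval_reg, e6, hri]
    refine ⟨fun hv => ?_, fun hv => ?_⟩
    · refine Runs.hide fun Q hQ => ?_
      simp only [runs_skip]
      refine hQ _ _ ⟨by simp only [Expr.cost]; omega, ?_⟩
      simp only [setReg_mem]
      refine ⟨by omega, hmono, fun z v hz hl => (hsound z v hz hl).imp_right fun hh =>
        ⟨hh.1, by omega, hh.2.2⟩, fun v x hv1 hv2 hv3 => ?_⟩
      refine hcompl v x hv1 ?_ hv3
      rcases Nat.lt_succ_iff_lt_or_eq.1 hv2 with hlt | rfl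
      · exact hlt
      · exact absurd hv3 hv
    · simp (disch := omega) only [runs_seq, runs_assign, eval_reg, eval_load, eval_add_mod,
        eval_sub, setReg_reg, setReg_mem, Nat.mod_eq_of_lt, e9, hri, r22, r23, Nat.reduceEqDiff,
        reduceIte]
      -- With subtraction cut off at `0`, `x + (y - x)` is the maximum and `x - (x - y)` the minimum
      -- of `x` and `y`.
      have hcap : hi - (hi - (att i + (fl - att i))) = min hi (max (att i) fl) := by omega
      rw [hcap]
      refine (h.runs_find (Fl := Fl) (u := i) (lo := lo) (hi := min hi (max (att i) fl)) (up := up)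
        (by simpa using e0) (by simp) (by simpa using r11) (by simp) (by simpa using r13)
        (by omega) (by omega) (by omega) ?_ ?_).use ?_
      · intro j hj1 hj2
        simpa [e7] using hbad i j (by omega) (by omega) hj1 hj2
      · exact fun x x' h1 h2 h3 h4 => hclean i x x' hi1 hi2 hv h1 h2 h3 h4
      · intro t₂ s₂ ⟨ht₂, hres, hnone⟩ hf₂
        have f3 := hf₂.reg 3 rfl
        have f20 := hf₂.reg 20 rfl
        have g15 := hf₂.mem 15 rfl
        have g16 := hf₂.mem 16 rfl
        simp at f3 f20 g15 g16
        rw [r3] at f3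
        rw [hri] at f20
        obtain ⟨r, hr⟩ : ∃ r, s₂.reg 14 = r := ⟨_, rfl⟩
        rw [hr] at hres hnone
        refine Runs.hide fun Q hQ => ?_
        by_cases hr0 : r = 0
        · simp [hr, hr0]
          refine hQ _ _ ⟨by simp only [Expr.cost]; omega, ?_⟩
          simp only [g15, g16]
          refine ⟨by omega, hmono, fun z v hz hl => (hsound z v hz hl).imp_right fun hh =>
            ⟨hh.1, by omega, hh.2.2⟩, fun v x hv1 hv2 hv3 h4 h5 h6 h7 => ?_⟩
          rcases Nat.lt_succ_iff_lt_or_eq.1 hv2 with hlt | rfl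
          · exact hcompl v x hv1 hlt hv3 h4 h5 h6 h7
          · exact (hnone hr0 x h4 h5 h6 h7).elim
        · obtain ⟨hR, hFl, hr1, hr2, hopt⟩ := hres hr0
          have hrN : r ≤ N := by omega
          have hc := le_sum (s₁.mem 15) hrN
          have hcT : s₁.mem 15 r < T := by omega
          have hcT' : s₁.mem 15 r * (N + 1) ≤ T * (N + 1) := Nat.mul_le_mul_right _ hcT.le
          have hcN : s₁.mem 15 r ≤ s₁.mem 15 r * (N + 1) := Nat.le_mul_of_pos_right _ (by omega)
          have hTN : T ≤ T * (N + 1) := Nat.le_mul_of_pos_right _ (by omega)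
          simp (disch := omega) [Nat.mod_eq_of_lt, hr, hr0, g15, f3, f20]
          refine hQ _ _ ⟨by simp only [Expr.cost]; omega, ?_⟩
          simp only [setMem_mem, reduceIte, Nat.reduceEqDiff, g15, g16]
          refine ⟨?_, ?_, ?_, ?_⟩
          · have := sum_update (f := s₁.mem 15) hrN (s₁.mem 15 r + 1)
            omega
          · exact fun z v hz hl => (listed_push hrN hz).2 (Or.inl (hmono z v hz hl))
          · intro z v hz hl
            rcases (listed_push hrN hz).1 hl with hl | ⟨rfl, rfl⟩
            · exact (hsound z v hz hl).imp_right fun hh => ⟨hh.1, by omega, hh.2.2⟩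
            · exact Or.inr ⟨hi1, by omega, hv, hR, hFl, hr1, hr2⟩
          · intro v x hv1 hv2 hv3 h4 h5 h6 h7
            rcases Nat.lt_succ_iff_lt_or_eq.1 hv2 with hlt | rfl
            · obtain ⟨z, hz, hz'⟩ := hcompl v x hv1 hlt hv3 h4 h5 h6 h7
              exact ⟨z, (listed_push hrN (h.le (h.symm hz'.1))).2 (Or.inl hz), hz'⟩
            · exact ⟨r, (listed_push hrN hrN).2 (Or.inr ⟨rfl, rfl⟩), hR, hFl, hr1, hr2,
                hopt x h4 h6 h7⟩
  · intro t s' ⟨ht, hI, hr⟩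
    rw [ha, hb] at ht
    rw [hb] at hI hr
    exact ⟨by simpa using ht, hr, hI⟩

/-! ### Tables and invariant of the search -/

/-- The tables that the query algorithm computes before its search: the set `A` of the ancestors of
the endpoints of failed edges and of the failed (`dead`) vertices, for each vertex its nearest ancestor
`att` in `A`, the ascending enumeration `aord 1, …, aord M` of `A` with inverse `aidx`, and the partition
of `A` into ascending paths by the labels `run i < K`. -/
structure Setup (w N L K M : ℕ) (R Fl : ℕ → ℕ → Prop) (dead : ℕ → Prop)
    (D A att aord aidx run : ℕ → ℕ) : Prop extends IndexFits w N L R D where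
  K_le : K ≤ N
  M_le : M ≤ N
  A_par : ∀ {b}, 1 ≤ b → b ≤ N → A b ≠ 0 → D (4 * b + 1) ≠ 0 → A (D (4 * b + 1)) ≠ 0
  att_le : ∀ {z}, 1 ≤ z → z ≤ N → att z ≤ z
  att_desc : ∀ {z}, 1 ≤ z → z ≤ N → att z ≠ 0 →
    A (att z) ≠ 0 ∧ Desc N (fun b => D (4 * b + 1)) (att z) z
  att_max : ∀ {z v}, 1 ≤ v → A v ≠ 0 → Desc N (fun b => D (4 * b + 1)) v z → v ≤ att z
  aidx_mem : ∀ {v}, 1 ≤ v → v ≤ N → A v ≠ 0 → 1 ≤ aidx v ∧ aidx v ≤ M ∧ aord (aidx v) = v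
  aord_mem : ∀ {i}, 1 ≤ i → i ≤ M → 1 ≤ aord i ∧ aord i ≤ N ∧ A (aord i) ≠ 0 ∧ aidx (aord i) = i
  aord_lt : ∀ {i j}, 1 ≤ i → i < j → j ≤ M → aord i < aord j
  run_lt : ∀ {i}, 1 ≤ i → i ≤ M → run i < K
  run_mono : ∀ {i j}, 1 ≤ i → i ≤ j → j ≤ M → run i ≤ run j
  run_par : ∀ {i}, 1 ≤ i → i + 1 ≤ M → run i = run (i + 1) → D (4 * aord (i + 1) + 1) = aord i
  failed_symm : ∀ {a b}, Fl a b → Fl b a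
  failed_run : ∀ {i j x}, 1 ≤ i → i ≤ M → 1 ≤ j → j ≤ M → Fl (aord i) x → run i = run j → i = j
  failed_mem : ∀ {a b}, Fl a b → 1 ≤ a ∧ a ≤ N ∧ A a ≠ 0
  dead_pos : ∀ {a}, dead a → 1 ≤ a
  dead_mem : ∀ {a}, dead a → a ≤ N → A a ≠ 0

/-- The graph that is searched: the dummy root `0` and what is left of the graph `R`. -/
def LiveAdj (N : ℕ) (R Fl : ℕ → ℕ → Prop) (dead : ℕ → Prop) (a b : ℕ) : Prop :=
  a ≤ N ∧ b ≤ N ∧ a ≠ b ∧ ¬dead a ∧ ¬dead b ∧ (a = 0 ∨ b = 0 ∨ R a b ∧ ¬Fl a b)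

/-- The vertices visited by the search, according to the marks `vis`. -/
def Visited (N : ℕ) (dead : ℕ → Prop) (vis : ℕ → ℕ) (v : ℕ) : Prop :=
  v ≤ N ∧ vis v ≠ 0 ∧ ¬dead v

/-- The number of unvisited vertices. -/
def numUnvisited (N : ℕ) (vis : ℕ → ℕ) : ℕ :=
  ∑ z ∈ Finset.range (N + 1), if vis z = 0 then 1 else 0

namespace Setup

variable {w N L K M : ℕ} {R Fl : ℕ → ℕ → Prop} {dead : ℕ → Prop} {D A att aord aidx run : ℕ → ℕ}

theorem liveAdj_symm (S : Setup w N L K M R Fl dead D A att aord aidx run) (a b : ℕ)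
    (h : LiveAdj N R Fl dead a b) : LiveAdj N R Fl dead b a := by
  obtain ⟨h1, h2, h3, h4, h5, h6⟩ := h
  refine ⟨h2, h1, h3.symm, h5, h4, ?_⟩
  rcases h6 with h6 | h6 | h6
  · exact Or.inr (Or.inl h6)
  · exact Or.inl h6
  · exact Or.inr (Or.inr ⟨S.symm h6.1, fun h => h6.2 (S.failed_symm h)⟩)

/-- As `A` is closed under parents, the complement of `A` is closed under children, and hence under
descendants. -/
theorem A_of_desc (S : Setup w N L K M R Fl dead D A att aord aidx run) {a c : ℕ} (ha : 1 ≤ a)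
    (hc : A c ≠ 0) (h : Desc N (fun b => D (4 * b + 1)) a c) : A a ≠ 0 := by
  by_contra h0
  refine S.desc_induction (P := fun u => A u = 0) ha h0 ?_ c h |> hc
  intro u hau hd hp
  by_contra hu
  have h1 : a ≤ D (4 * u + 1) := hd.2.2 u hau le_rfl
  exact S.A_par (by omega) hd.2.1 hu (by omega) hp

theorem aord_le (S : Setup w N L K M R Fl dead D A att aord aidx run) {i j : ℕ} (hi : 1 ≤ i)
    (hij : i ≤ j) (hj : j ≤ M) : aord i ≤ aord j := by
  rcases Nat.eq_or_lt_of_le hij with rfl | hij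
  · exact le_rfl
  · exact (S.aord_lt hi hij hj).le

theorem aidx_le_of_le (S : Setup w N L K M R Fl dead D A att aord aidx run) {x i : ℕ} (hx : 1 ≤ x)
    (hxN : x ≤ N) (hA : A x ≠ 0) (hi : 1 ≤ i) (h : x ≤ aord i) : aidx x ≤ i := by
  have hm := S.aidx_mem hx hxN hA
  by_contra hc
  have := S.aord_lt hi (not_le.1 hc) hm.2.1
  omega

theorem le_aidx_of_le (S : Setup w N L K M R Fl dead D A att aord aidx run) {x i : ℕ} (hx : 1 ≤ x)
    (hxN : x ≤ N) (hA : A x ≠ 0) (hi : i ≤ M) (h : aord i ≤ x) : i ≤ aidx x := by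
  have hm := S.aidx_mem hx hxN hA
  by_contra hc
  have := S.aord_lt hm.1 (not_le.1 hc) hi
  omega

theorem run_between (S : Setup w N L K M R Fl dead D A att aord aidx run) {i j k : ℕ} (hi : 1 ≤ i)
    (hij : i ≤ j) (hjk : j ≤ k) (hk : k ≤ M) (h : run i = run k) : run j = run i := by
  have h1 := S.run_mono hi hij (hjk.trans hk)
  have h2 := S.run_mono (hi.trans hij) hjk hk
  omega

end Setup

/-- The state `s` holds the tables of the setup. -/
structure Tables (N K : ℕ) (Fl : ℕ → ℕ → Prop) (D A att aord aidx run : ℕ → ℕ) (s : State) :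
    Prop where
  mem0 : s.mem 0 = D
  mem8 : s.mem 8 = A
  mem9 : s.mem 9 = att
  mem10 : s.mem 10 = aord
  mem11 : s.mem 11 = aidx
  mem12 : s.mem 12 = run
  reg3 : s.reg 3 = N
  reg4 : s.reg 4 = K
  bad : ∀ u j, 1 ≤ u → u ≤ N → D (4 * u + 3) ≤ j → j < D (4 * u + 7) →
    (s.mem 7 j ≠ 0 ↔ Fl u (D j))

theorem Tables.frame {N K : ℕ} {Fl : ℕ → ℕ → Prop} {D A att aord aidx run : ℕ → ℕ} {s s' : State}
    {p : Program} (h : Tables N K Fl D A att aord aidx run s) (hf : Frame p s s')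
    (hp : (p.writesMem 0 || p.writesMem 7 || p.writesMem 8 || p.writesMem 9 || p.writesMem 10 ||
      p.writesMem 11 || p.writesMem 12 || p.writesReg 3 || p.writesReg 4) = false) :
    Tables N K Fl D A att aord aidx run s' := by
  simp only [Bool.or_eq_false_iff] at hp
  obtain ⟨⟨⟨⟨⟨⟨⟨⟨h0, h7⟩, h8⟩, h9⟩, h10⟩, h11⟩, h12⟩, h3⟩, h4⟩ := hp
  exact ⟨(hf.mem 0 h0).trans h.mem0, (hf.mem 8 h8).trans h.mem8, (hf.mem 9 h9).trans h.mem9,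
    (hf.mem 10 h10).trans h.mem10, (hf.mem 11 h11).trans h.mem11, (hf.mem 12 h12).trans h.mem12,
    (hf.reg 3 h3).trans h.reg3, (hf.reg 4 h4).trans h.reg4, by rw [hf.mem 7 h7]; exact h.bad⟩

/-- The invariant of the search.  All neighbours of `cur` except `y` that are unvisited will be found;
`d` is the depth of `cur`, and `2 ^ f u`, `2 ^ g i` exceed the size of the unvisited subtree that holds
`u` and the length of what is unvisited of run `i`. -/
structure SearchInv (N K M : ℕ) (R Fl : ℕ → ℕ → Prop) (dead : ℕ → Prop)
    (D A aord aidx run : ℕ → ℕ) (y d : ℕ) (f g : ℕ → ℕ) (s : State) : Prop where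
  dfs : DFSState (LiveAdj N R Fl dead) (Visited N dead (s.mem 6)) (s.mem 17) (s.reg 6)
  depth : (s.mem 17)^[d] (s.reg 6) = 0
  dead_vis : ∀ v, v ≤ N → dead v → s.mem 6 v ≠ 0
  piece : ∀ i, 1 ≤ i → i ≤ M →
    (s.mem 6 (aord i) = 0 ↔ s.mem 13 (run i) ≤ i ∧ i ≤ s.mem 14 (run i))
  piece_run : ∀ ρ, ρ < K → s.mem 13 ρ ≤ s.mem 14 ρ →
    1 ≤ s.mem 13 ρ ∧ s.mem 14 ρ ≤ M ∧ run (s.mem 13 ρ) = ρ ∧ run (s.mem 14 ρ) = ρ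
  piece_len : ∀ ρ, ρ < K → s.mem 14 ρ + 1 - s.mem 13 ρ < 2 ^ g ρ
  tree_up : ∀ u, 1 ≤ u → u ≤ N → A u = 0 → s.mem 6 u ≠ 0 →
    D (4 * u + 1) = 0 ∨ A (D (4 * u + 1)) ≠ 0 ∨ s.mem 6 (D (4 * u + 1)) ≠ 0
  tree_size : ∀ a u, 1 ≤ a → Desc N (fun b => D (4 * b + 1)) a u → A a = 0 → s.mem 6 a = 0 →
    D (4 * a + 2) - a < 2 ^ f u
  heavy_zero : s.mem 19 0 = 0
  group : ∀ v, v ≤ N → s.mem 6 v ≠ 0 → s.mem 20 v ≤ N ∧ s.mem 6 (s.mem 20 v) ≠ 0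
  heavy : ∀ v, Visited N dead (s.mem 6) v → s.mem 19 (s.mem 20 v) ≠ 0 → 1 ≤ v ∧ A v = 0 ∧
    s.mem 19 (s.mem 20 v) ≤ N ∧ A (s.mem 19 (s.mem 20 v)) = 0 ∧
    ∀ u, Desc N (fun b => D (4 * b + 1)) (s.mem 19 (s.mem 20 v)) u → s.mem 6 u ≠ 0 →
      ¬IsAncestor (s.mem 17) u v
  listed : ∀ z v, z ≤ N → Listed N (s.mem 15) (s.mem 16) z v → LiveAdj N R Fl dead z v
  pieces_root : K ≤ s.mem 18 0
  pieces_zero : ∀ z, z ≤ N → s.mem 6 z = 0 → s.mem 18 z = 0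
  cover : ∀ z v, IsAncestor (s.mem 17) z (s.reg 6) → LiveAdj N R Fl dead z v → s.mem 6 v = 0 →
    v ≠ y →
    (∃ z', IsAncestor (s.mem 17) z' (s.reg 6) ∧ IsAncestor (s.mem 17) z z' ∧
      Listed N (s.mem 15) (s.mem 16) z' v) ∨
    (v < z ∧ A v ≠ 0 ∧ s.mem 18 z ≤ run (aidx v)) ∨
    (s.mem 19 (s.mem 20 z) ≠ 0 ∧
      Desc N (fun b => D (4 * b + 1)) (s.mem 19 (s.mem 20 z)) v)

/-- A bound for the number of basic operations that remain to be done. -/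
def potential (N K d : ℕ) (f g : ℕ → ℕ) (s : State) : ℕ :=
  ∑ z ∈ Finset.range (N + 1), s.mem 15 z + ∑ z ∈ Finset.range (N + 1), (K - s.mem 18 z) +
    2 * numUnvisited N (s.mem 6) + d + (2 * N + 2) * ∑ i ∈ Finset.range K, g i +
    2 * ∑ u ∈ Finset.range (N + 1), f u

/-! ### Extending the search path -/

/-- The vertex in register `30` becomes the current vertex. -/
def pushVertex : Program :=
  store 6 (reg 30) (const 1) ;; store 17 (reg 30) (reg 6) ;; store 20 (reg 30) (reg 29) ;;
  assign 6 (reg 30)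

/-- From the state `s₀`, the search has gone on along the path `q 0, …, q (l - 1)` and has stored `γ`
in array `20` for its vertices. -/
structure Walked (N : ℕ) (H : ℕ → ℕ → Prop) (dead : ℕ → Prop) (s₀ : State) (d γ : ℕ) (q : ℕ → ℕ)
    (l : ℕ) (s : State) : Prop where
  path : PathPush H (Visited N dead (s₀.mem 6)) (s₀.mem 17) (s₀.reg 6) d q l
    (Visited N dead (s.mem 6)) (s.mem 17) (s.reg 6)
  vis : ∀ v, s.mem 6 v = 0 ↔ s₀.mem 6 v = 0 ∧ ∀ j < l, v ≠ q j
  group_new : ∀ j < l, s.mem 20 (q j) = γ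
  group_old : ∀ v, (∀ j < l, v ≠ q j) → s.mem 20 v = s₀.mem 20 v
  card : numUnvisited N (s.mem 6) + l = numUnvisited N (s₀.mem 6)

theorem numUnvisited_update {N v : ℕ} {vis : ℕ → ℕ} (hv : v ≤ N) (h : vis v = 0) :
    numUnvisited N (Function.update vis v 1) + 1 = numUnvisited N vis := by
  have := sum_update (f := fun z => if vis z = 0 then 1 else 0) hv 0
  simp only [h, if_true, Nat.add_zero] at this
  rw [numUnvisited, numUnvisited, ← this]
  congr 1
  refine Finset.sum_congr rfl fun z _ => ?_
  by_cases hz : z = v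
  · subst hz; simp
  · simp [Function.update_of_ne hz]

theorem Walked.zero {N : ℕ} {H : ℕ → ℕ → Prop} {dead : ℕ → Prop} {s₀ s : State} {d γ : ℕ}
    {q : ℕ → ℕ} (h : DFSState H (Visited N dead (s₀.mem 6)) (s₀.mem 17) (s₀.reg 6))
    (hd : (s₀.mem 17)^[d] (s₀.reg 6) = 0) (h6 : s.mem 6 = s₀.mem 6) (h17 : s.mem 17 = s₀.mem 17)
    (h20 : s.mem 20 = s₀.mem 20) (hr : s.reg 6 = s₀.reg 6) : Walked N H dead s₀ d γ q 0 s := by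
  constructor
  · rw [h6, h17, hr]
    exact PathPush.nil h hd
  · simp [h6]
  · intro j hj
    omega
  · simp [h20]
  · rw [h6]; rfl

theorem Walked.runs_push {w N : ℕ} {H : ℕ → ℕ → Prop} {dead : ℕ → Prop} {s₀ s : State} {d γ l : ℕ}
    {q : ℕ → ℕ} (h : Walked N H dead s₀ d γ q l s) (hw : 1024 ≤ 2 ^ w)
    (hs : ∀ a b, H a b → H b a) (hi : ∀ a, ¬H a a) (hHN : ∀ a b, H a b → a ≤ N)
    (hdead : ∀ a b, H a b → ¬dead a)
    (h30 : s.reg 30 = q l) (h29 : s.reg 29 = γ) (hq : s.mem 6 (q l) = 0) (hH : H (q l) (s.reg 6)) :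
    Runs w pushVertex s fun t s' => t ≤ 20 ∧ Walked N H dead s₀ d γ q (l + 1) s' ∧
      s'.reg 6 = q l := by
  have hqN := hHN _ _ hH
  have hqd := hdead _ _ hH
  have hv : ∀ v, (∀ j < l + 1, v ≠ q j) ↔ (∀ j < l, v ≠ q j) ∧ v ≠ q l := by
    intro v
    constructor
    · exact fun h => ⟨fun j hj => h j (by omega), h l (by omega)⟩
    · rintro ⟨h1, h2⟩ j hj
      rcases Nat.lt_succ_iff_lt_or_eq.1 hj with hj | rfl
      · exact h1 j hj
      · exact h2
  refine Runs.hide fun Q hQ => ?_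
  simp (disch := omega) [pushVertex, h30, h29, Nat.mod_eq_of_lt]
  refine hQ _ _ ⟨by omega, ⟨?_, ?_, ?_, ?_, ?_⟩, by simp⟩
  · simp only [setReg_mem, setMem_mem, setReg_reg, reduceIte, Nat.reduceEqDiff]
    refine h.path.snoc hs hi (fun hV => hV.2.1 hq) hH fun v => ?_
    by_cases hvq : v = q l
    · subst hvq
      simp [Visited, hqN, hqd]
    · simp [Visited, hvq]
  · intro v
    simp only [setReg_mem, setMem_mem, reduceIte, Nat.reduceEqDiff]
    rw [hv, ← and_assoc, ← h.vis]
    by_cases hvq : v = q l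
    · subst hvq
      simp
    · simp [hvq]
  · intro j hj
    simp only [setReg_mem, setMem_mem, reduceIte, Nat.reduceEqDiff]
    by_cases hjq : q j = q l
    · rw [hjq, Function.update_self]
    · rw [Function.update_of_ne hjq]
      refine h.group_new j (lt_of_le_of_ne (by omega) fun e => hjq (e ▸ rfl))
  · intro v hv'
    simp only [setReg_mem, setMem_mem, reduceIte, Nat.reduceEqDiff]
    rw [hv] at hv'
    rw [Function.update_of_ne hv'.2]
    exact h.group_old v hv'.1
  · simp only [setReg_mem, setMem_mem, reduceIte, Nat.reduceEqDiff]
    have := numUnvisited_update hqN hq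
    have := h.card
    omega

theorem LiveAdj.irrefl {N : ℕ} {R Fl : ℕ → ℕ → Prop} {dead : ℕ → Prop} (a : ℕ) :
    ¬LiveAdj N R Fl dead a a := fun h => h.2.2.1 rfl

theorem Walked.congr {N : ℕ} {H : ℕ → ℕ → Prop} {dead : ℕ → Prop} {s₀ s s' : State} {d γ l : ℕ}
    {q : ℕ → ℕ} (h : Walked N H dead s₀ d γ q l s) (h6 : s'.mem 6 = s.mem 6)
    (h17 : s'.mem 17 = s.mem 17) (h20 : s'.mem 20 = s.mem 20) (hr : s'.reg 6 = s.reg 6) :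
    Walked N H dead s₀ d γ q l s' := by
  obtain ⟨h1, h2, h3, h4, h5⟩ := h
  constructor
  · rw [h6, h17, hr]; exact h1
  · rw [h6]; exact h2
  · rw [h20]; exact h3
  · rw [h20]; exact h4
  · rw [h6]; exact h5

theorem Walked.vis_of_vis {N : ℕ} {H : ℕ → ℕ → Prop} {dead : ℕ → Prop} {s₀ s : State} {d γ l : ℕ}
    {q : ℕ → ℕ} (h : Walked N H dead s₀ d γ q l s) {v : ℕ} (hv : s₀.mem 6 v ≠ 0) :
    s.mem 6 v ≠ 0 := fun h0 => hv ((h.vis v).1 h0).1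

theorem Walked.vis_new {N : ℕ} {H : ℕ → ℕ → Prop} {dead : ℕ → Prop} {s₀ s : State} {d γ l : ℕ}
    {q : ℕ → ℕ} (h : Walked N H dead s₀ d γ q l s) {j : ℕ} (hj : j < l) :
    s.mem 6 (q j) ≠ 0 := fun h0 => ((h.vis _).1 h0).2 j hj rfl

/-- The invariant holds again after the search has gone on along a path and the lists have been
extended. -/
theorem SearchInv.extend {N K M : ℕ} {R Fl : ℕ → ℕ → Prop} {dead : ℕ → Prop}
    {D A aord aidx run : ℕ → ℕ} {y d γ l : ℕ} {f g f' g' q : ℕ → ℕ} {s₀ s : State}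
    (h : SearchInv N K M R Fl dead D A aord aidx run y d f g s₀)
    (hW : Walked N (LiveAdj N R Fl dead) dead s₀ d γ q l s)
    (hl : 1 ≤ l) (hq0 : q 0 = y) (hq : ∀ j < l, s₀.mem 6 (q j) = 0) (hqN : ∀ j < l, q j ≤ N)
    (hγ : γ ≤ N ∧ s.mem 6 γ ≠ 0)
    (piece : ∀ i, 1 ≤ i → i ≤ M →
      (s.mem 6 (aord i) = 0 ↔ s.mem 13 (run i) ≤ i ∧ i ≤ s.mem 14 (run i)))
    (piece_run : ∀ ρ, ρ < K → s.mem 13 ρ ≤ s.mem 14 ρ →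
      1 ≤ s.mem 13 ρ ∧ s.mem 14 ρ ≤ M ∧ run (s.mem 13 ρ) = ρ ∧ run (s.mem 14 ρ) = ρ)
    (piece_len : ∀ ρ, ρ < K → s.mem 14 ρ + 1 - s.mem 13 ρ < 2 ^ g' ρ)
    (tree_up : ∀ u, 1 ≤ u → u ≤ N → A u = 0 → s.mem 6 u ≠ 0 →
      D (4 * u + 1) = 0 ∨ A (D (4 * u + 1)) ≠ 0 ∨ s.mem 6 (D (4 * u + 1)) ≠ 0)
    (tree_size : ∀ a u, 1 ≤ a → Desc N (fun b => D (4 * b + 1)) a u → A a = 0 → s.mem 6 a = 0 →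
      D (4 * a + 2) - a < 2 ^ f' u)
    (hheavy : ∀ x, x ≠ y → s.mem 19 x = s₀.mem 19 x)
    (heavy_new : ∀ j < l, s.mem 19 γ ≠ 0 → A (q j) = 0 ∧ s.mem 19 γ ≤ N ∧ A (s.mem 19 γ) = 0 ∧
      ∀ u, Desc N (fun b => D (4 * b + 1)) (s.mem 19 γ) u → s.mem 6 u = 0)
    (hlisted : ∀ z v, z ≤ N → Listed N (s.mem 15) (s.mem 16) z v →
      Listed N (s₀.mem 15) (s₀.mem 16) z v ∨ LiveAdj N R Fl dead z v)
    (hmono : ∀ z v, z ≤ N → Listed N (s₀.mem 15) (s₀.mem 16) z v →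
      Listed N (s.mem 15) (s.mem 16) z v)
    (h18 : s.mem 18 = s₀.mem 18)
    (cover_new : ∀ j < l, ∀ v, LiveAdj N R Fl dead (q j) v → s.mem 6 v = 0 →
      (∃ i, j ≤ i ∧ i < l ∧ Listed N (s.mem 15) (s.mem 16) (q i) v) ∨ (v < q j ∧ A v ≠ 0) ∨
      (s.mem 19 γ ≠ 0 ∧ Desc N (fun b => D (4 * b + 1)) (s.mem 19 γ) v)) :
    SearchInv N K M R Fl dead D A aord aidx run 0 (d + l) f' g' s := by
  have hy : s₀.mem 6 y = 0 := hq0 ▸ hq 0 hl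
  have hroot : s₀.mem 6 0 ≠ 0 := h.dfs.root.2.1
  have hy0 : (0 : ℕ) ≠ y := fun e => hroot (e ▸ hy)
  have hold : ∀ v, s.mem 6 v ≠ 0 → s₀.mem 6 v ≠ 0 ∨ ∃ j < l, v = q j := by
    intro v hv
    by_contra hc
    rw [not_or, not_not] at hc
    exact hv ((hW.vis v).2 ⟨hc.1, fun j hj e => hc.2 ⟨j, hj, e⟩⟩)
  have hne : ∀ v, s₀.mem 6 v ≠ 0 → ∀ j < l, v ≠ q j := fun v hv j hj e => hv (e ▸ hq j hj)
  -- The cell of array `19` to which an old vertex refers belongs to a vertex visited earlier, hence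
  -- not to `y`. So a new heavy root stored at `y` does not disturb the old vertices.
  have hgr : ∀ v, v ≤ N → s₀.mem 6 v ≠ 0 → s.mem 20 v = s₀.mem 20 v ∧
      s.mem 19 (s.mem 20 v) = s₀.mem 19 (s₀.mem 20 v) := by
    intro v hvN hv
    have h1 := hW.group_old v (hne v hv)
    refine ⟨h1, ?_⟩
    rw [h1, hheavy]
    exact fun e => (h.group v hvN hv).2 (e ▸ hy)
  have hqdead : ∀ j < l, Visited N dead (s.mem 6) (q j) := fun j hj =>
    (hW.path.mem _).2 (Or.inr ⟨j, hj, rfl⟩)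
  refine ⟨hW.path.dfs, hW.path.depth, fun v hv hd => hW.vis_of_vis (h.dead_vis v hv hd), piece,
    piece_run, piece_len, tree_up, tree_size, ?_, ?_, ?_, ?_, ?_, ?_, ?_⟩
  · rw [hheavy 0 hy0]
    exact h.heavy_zero
  · intro v hvN hv
    rcases hold v hv with hv | ⟨j, hj, rfl⟩
    · rw [(hgr v hvN hv).1]
      exact ⟨(h.group v hvN hv).1, hW.vis_of_vis (h.group v hvN hv).2⟩
    · rw [hW.group_new j hj]
      exact hγ
  · intro v ⟨hvN, hv, hdv⟩
    rcases hold v hv with hv | ⟨j, hj, rfl⟩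
    · have hVv : Visited N dead (s₀.mem 6) v := ⟨hvN, hv, hdv⟩
      rw [(hgr v hvN hv).2]
      intro hne0
      obtain ⟨h1, h2, h3, h4, h5⟩ := h.heavy v hVv hne0
      -- An ancestor of an old vertex is old. So vertices of a heavy subtree that are visited now do
      -- not become ancestors of the vertices that refer to this subtree.
      refine ⟨h1, h2, h3, h4, fun u hu hvu ha => ?_⟩
      rw [hW.path.anc_old u v hVv] at ha
      exact h5 u hu (h.dfs.mem_of_anc hVv ha).2.1 ha
    · rw [hW.group_new j hj]
      intro hne0
      obtain ⟨h2, h3, h4, h5⟩ := heavy_new j hj hne0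
      refine ⟨?_, h2, h3, h4, fun u hu hvu => absurd (h5 u hu) hvu⟩
      by_contra hc
      have hq0' : q j = 0 := by omega
      have hqj := hq j hj
      rw [hq0'] at hqj
      exact hroot hqj
  · intro z v hz hlz
    exact (hlisted z v hz hlz).elim (h.listed z v hz) id
  · rw [h18]; exact h.pieces_root
  · intro z hz hz0
    rw [h18]
    exact h.pieces_zero z hz ((hW.vis z).1 hz0).1
  · intro z v hz hzv hv _
    rcases (hW.path.anc_cur z).1 hz with hz' | ⟨j, hj, rfl⟩
    · have hVz := h.dfs.mem_of_anc h.dfs.cur_mem hz'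
      -- The path starts at `y`, so the exception made for `y` in the old invariant can be dropped.
      have hvy : v ≠ y := fun e => hW.vis_new hl (by rw [hq0, ← e]; exact hv)
      rw [(hgr z hVz.1 hVz.2.1).2, h18]
      refine (h.cover z v hz' hzv ((hW.vis v).1 hv).1 hvy).imp_left ?_
      rintro ⟨z', h1, h2, h3⟩
      have hVz' := h.dfs.mem_of_anc h.dfs.cur_mem h1
      exact ⟨z', (hW.path.anc_cur z').2 (Or.inl h1), (hW.path.anc_old z z' hVz').2 h2,
        hmono z' v hVz'.1 h3⟩
    · rw [hW.group_new j hj, h18, h.pieces_zero _ (hqN j hj) (hq j hj)]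
      rcases cover_new j hj v hzv hv with ⟨i, hji, hi, hlst⟩ | hc | hc
      · exact Or.inl ⟨q i, (hW.path.anc_cur _).2 (Or.inr ⟨i, hi, rfl⟩), hW.path.anc_path j i hji hi,
          hlst⟩
      · exact Or.inr (Or.inl ⟨hc.1, hc.2, Nat.zero_le _⟩)
      · exact Or.inr (Or.inr hc)

theorem Walked.runs_forUp {w N : ℕ} {H : ℕ → ℕ → Prop} {dead : ℕ → Prop} {s₀ s : State} {d γ l : ℕ}
    {q : ℕ → ℕ} {e : Expr} (h : Walked N H dead s₀ d γ q 0 s) (hw : 1024 ≤ 2 ^ w)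
    (hs : ∀ a b, H a b → H b a) (hi : ∀ a, ¬H a a) (hHN : ∀ a b, H a b → a ≤ N)
    (hdead : ∀ a b, H a b → ¬dead a) (h28 : s.reg 28 = 0) (h31 : s.reg 31 = l)
    (h29 : s.reg 29 = γ) (hlw : l < 2 ^ w)
    (he : ∀ t s', t < l → s'.reg 28 = t →
      Frame ((assign 30 e ;; pushVertex) ;; assign 28 (reg 28 +ᵉ const 1)) s s' →
      e.eval w s' = q t)
    (hq : ∀ t < l, s.mem 6 (q t) = 0) (hne : ∀ i j, i < j → j < l → q j ≠ q i)
    (hH0 : H (q 0) (s.reg 6)) (hH : ∀ t, t + 1 < l → H (q (t + 1)) (q t)) :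
    Runs w (forUp 28 31 (assign 30 e ;; pushVertex)) s fun t s' =>
      t ≤ l * (e.cost + 30) + 4 ∧ Walked N H dead s₀ d γ q l s' := by
  refine (Runs.forUp (fun t s' => Walked N H dead s₀ d γ q t s' ∧
    (∀ v, s'.mem 6 v = 0 ↔ s.mem 6 v = 0 ∧ ∀ j < t, v ≠ q j) ∧
    s'.reg 6 = if t = 0 then s.reg 6 else q (t - 1)) (e.cost + 21) (by omega) (by omega) rfl rfl
    (by omega) (by omega) ?_ ?_).mono ?_
  · rw [h28]
    exact ⟨h, by simp, by simp⟩
  · intro t s₁ _ ht ⟨hW, hvis, hr⟩ h28' hf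
    rw [h31] at ht
    rw [runs_seq, runs_assign, he t s₁ ht h28' hf]
    have r29 := hf.reg 29 rfl
    have hunv : s₁.mem 6 (q t) = 0 := (hvis _).2 ⟨hq t ht, fun j hj => hne j t hj ht⟩
    have hadj : H (q t) (s₁.reg 6) := by
      rw [hr]
      by_cases h0 : t = 0
      · subst h0
        simpa using hH0
      · rw [if_neg h0]
        obtain ⟨t, rfl⟩ := Nat.exists_eq_succ_of_ne_zero h0
        exact hH t ht
    refine ((hW.congr (s' := s₁.setReg 30 (q t)) rfl rfl rfl (by simp)).runs_push hw hs hi hHN hdead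
      (by simp) (by simp [r29, h29]) hunv (by simpa using hadj)).mono ?_
    intro t' s₂ ⟨ht', hW', hr'⟩
    refine ⟨by omega, hW'.congr rfl rfl rfl (by simp), ?_, by simp [hr']⟩
    intro v
    rw [setReg_mem, hW'.vis v]
    have h0 := hW.vis v
    have h1 := hvis v
    constructor
    · rintro ⟨h2, h3⟩
      exact ⟨(h1.1 (h0.2 ⟨h2, fun j hj => h3 j (by omega)⟩)).1, h3⟩
    · rintro ⟨h2, h3⟩
      exact ⟨(h0.1 (h1.2 ⟨h2, fun j hj => h3 j (by omega)⟩)).1, h3⟩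
  · intro t s' ⟨ht, hI, _⟩
    rw [h28, h31] at ht
    rw [h31] at hI
    refine ⟨?_, hI.1⟩
    have : (l - 0) * (e.cost + 21 + 8) ≤ l * (e.cost + 30) :=
      Nat.mul_le_mul (by omega) (by omega)
    omega

/-- A neighbour `x ≤ att u` of `u` is an ancestor of `u`, and as it does not come after `att u`,
also an ancestor of `att u`; so it lies in `A`. Between `aord a` and `aord b` there may be many
numbers outside of `A`, but the cap `att u` removes those among the neighbours of `u`. -/
theorem Setup.mem_path {w N L K M : ℕ} {R Fl : ℕ → ℕ → Prop} {dead : ℕ → Prop}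
    {D A att aord aidx run : ℕ → ℕ} (S : Setup w N L K M R Fl dead D A att aord aidx run)
    {u x a b : ℕ} (hb1 : 1 ≤ b) (haM : a ≤ M) (hR : R u x)
    (h1 : aord a ≤ x) (h2 : x ≤ aord b) (h3 : x ≤ att u) :
    x < u ∧ A x ≠ 0 ∧ a ≤ aidx x ∧ aidx x ≤ b ∧ aord (aidx x) = x := by
  have hu1 := S.pos hR
  have huN := S.le hR
  have hx1 := S.pos (S.symm hR)
  have hxN := S.le (S.symm hR)
  have hau := S.att_le hu1 huN
  have hxu : x < u := by
    refine lt_of_le_of_ne (h3.trans hau) ?_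
    rintro rfl
    exact S.irrefl hR
  have hd := S.desc_of_adj (S.symm hR) hxu
  have hA : A x ≠ 0 := S.A_of_desc hx1 (S.att_desc hu1 huN (by omega)).1 (hd.mid h3 hau)
  exact ⟨hxu, hA, S.le_aidx_of_le hx1 hxN hA haM h1, S.aidx_le_of_le hx1 hxN hA hb1 h2,
    (S.aidx_mem hx1 hxN hA).2.2⟩

/-! ### Visiting a part of a run -/

/-- After a part of a run has been visited: extend the lists. -/
def listPath : Program :=
  assign 20 (const 1) ;; assign 21 (reg 3 +ᵉ const 1) ;; assign 23 (const 0) ;; batch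

/-- This treats both directions of travel. `haq` says that going towards the end of the path means
smaller numbers if `up ≠ 0` and larger ones otherwise, so the entry made by `batch` sits at the last
neighbour on the path. Since at most half of the piece is left (`hhalf`), the exponent `g ρ` drops
by one and releases `2 * N + 2` units of potential. -/
theorem Setup.runs_listPath {w N L K M : ℕ} {R Fl : ℕ → ℕ → Prop} {dead : ℕ → Prop}
    {D A att aord aidx run : ℕ → ℕ} (S : Setup w N L K M R Fl dead D A att aord aidx run)
    {s₀ s : State} {y d l a b ρ up T : ℕ} {f g q : ℕ → ℕ}
    (hT : Tables N K Fl D A att aord aidx run s)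
    (h : SearchInv N K M R Fl dead D A aord aidx run y d f g s₀)
    (hW : Walked N (LiveAdj N R Fl dead) dead s₀ d 0 q l s)
    (hq0 : q 0 = y) (hq : ∀ j < l, s₀.mem 6 (q j) = 0)
    (hpot : potential N K d f g s₀ ≤ T) (hTw : T * (N + 1) + N < 2 ^ w)
    (h15 : s.mem 15 = s₀.mem 15) (h16 : s.mem 16 = s₀.mem 16) (h18 : s.mem 18 = s₀.mem 18)
    (h19 : s.mem 19 = s₀.mem 19)
    (h11 : s.reg 11 = aord a) (h22 : s.reg 22 = aord b) (h13 : s.reg 13 = up)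
    (ha : 1 ≤ a) (hab : a ≤ b) (hb : b ≤ M) (hρ : ∀ k, a ≤ k → k ≤ b → run k = ρ) (hρK : ρ < K)
    (hl : l = b - a + 1) (hqa : ∀ j < l, ∃ k, a ≤ k ∧ k ≤ b ∧ q j = aord k)
    (hqb : ∀ k, a ≤ k → k ≤ b → ∃ j < l, q j = aord k)
    (haq : ∀ j k, j < l → a ≤ k → k ≤ b →
      (if up ≠ 0 then aord k ≤ q j else q j ≤ aord k) → ∃ i, j ≤ i ∧ i < l ∧ q i = aord k)
    (hlo : ∀ i, i ≠ ρ → s.mem 13 i = s₀.mem 13 i) (hhi : ∀ i, i ≠ ρ → s.mem 14 i = s₀.mem 14 i)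
    (hrest : ∀ k, s.mem 13 ρ ≤ k ∧ k ≤ s.mem 14 ρ ↔
      (s₀.mem 13 ρ ≤ k ∧ k ≤ s₀.mem 14 ρ) ∧ ¬(a ≤ k ∧ k ≤ b))
    (hhalf : 2 * (s.mem 14 ρ + 1 - s.mem 13 ρ) ≤ s₀.mem 14 ρ - s₀.mem 13 ρ)
    (hpiece : s₀.mem 13 ρ ≤ s₀.mem 14 ρ) :
    Runs w listPath s fun t s' => ∃ d' f' g',
      SearchInv N K M R Fl dead D A aord aidx run 0 d' f' g' s' ∧
      t ≤ N * (60 * L + 200) + 20 ∧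
      potential N K d' f' g' s' + (N + 2 + l) ≤ potential N K d f g s₀ := by
  have hw := S.word
  have hsw := S.size_word
  have hroot : s₀.mem 6 0 ≠ 0 := h.dfs.root.2.1
  have hma := S.aord_mem ha (hab.trans hb)
  have hmb := S.aord_mem (ha.trans hab) hb
  -- The piece is not empty, so `g ρ ≥ 1`, and the weight `2 * N + 2` in the potential leaves room
  -- for `N` further entries below `T`.
  have hsum0 : ∑ z ∈ Finset.range (N + 1), s₀.mem 15 z + N ≤ T := by
    have h1 : 2 * N + 2 ≤ (2 * N + 2) * ∑ i ∈ Finset.range K, g i := by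
      refine Nat.le_mul_of_pos_right _ ?_
      refine lt_of_lt_of_le ?_ (Finset.single_le_sum (f := g) (fun _ _ => Nat.zero_le _)
        (Finset.mem_range.2 hρK))
      have := h.piece_len ρ hρK
      by_contra hc
      have hg0 : g ρ = 0 := by omega
      rw [hg0] at this
      omega
    unfold potential at hpot
    omega
  have hpath : ∀ u x, R u x → aord a ≤ x → x ≤ min (aord b) (max (att u) 0) →
      x < u ∧ A x ≠ 0 ∧ a ≤ aidx x ∧ aidx x ≤ b ∧ aord (aidx x) = x := by
    intro u x hR h1 h2
    exact S.mem_path (by omega) (by omega) hR h1 (by omega) (by omega)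
  have hqpos : ∀ j < l, 1 ≤ q j ∧ q j ≤ N ∧ A (q j) ≠ 0 := by
    intro j hj
    obtain ⟨k, hk1, hk2, hk⟩ := hqa j hj
    have := S.aord_mem (i := k) (by omega) (by omega)
    exact hk ▸ ⟨this.1, this.2.1, this.2.2.1⟩
  have hqvis : ∀ j < l, Visited N dead (s.mem 6) (q j) := fun j hj =>
    (hW.path.mem _).2 (Or.inr ⟨j, hj, rfl⟩)
  have hfound : ∀ u x, R u x → aord a ≤ x → x ≤ min (aord b) (max (att u) 0) →
      ∃ j < l, q j = x := by
    intro u x hR h1 h2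
    obtain ⟨_, _, h3, h4, h5⟩ := hpath u x hR h1 h2
    obtain ⟨j, hj, hj'⟩ := hqb _ h3 h4
    exact ⟨j, hj, hj'.trans h5⟩
  simp (disch := omega) only [listPath, runs_seq, runs_assign, eval_add_mod, eval_const_mod,
    eval_reg, Nat.mod_eq_of_lt, setReg_reg, Nat.reduceEqDiff, reduceIte, hT.reg3]
  refine (S.runs_batch (Fl := Fl) (a := 1) (b := N + 1) (lo := aord a) (hi := aord b) (fl := 0)
    (up := up) (T := T) (att := att) (by simpa using hT.mem0) (by simpa using hT.reg3) (by simp)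
    (by simp) (by simpa using h11) (by simpa using h13) (by simpa using h22) (by simp)
    (by simpa using hT.mem9) le_rfl (by omega) le_rfl hmb.2.1 (Nat.zero_le _)
    (fun u h1 h2 => (S.att_le h1 h2).trans h2) ?_ hTw ?_ ?_).use ?_
  · simp only [setReg_mem, h15]
    omega
  · simpa using hT.bad
  · intro u x x' _ _ _ h1 h2 h3 h4 hR hR' hF
    obtain ⟨_, _, hx1, hx2, hx⟩ := hpath u x hR h1 h2
    obtain ⟨_, _, hx1', hx2', hx'⟩ := hpath u x' hR' h3 h4
    have hF' : Fl (aord (aidx x)) u := by rw [hx]; exact S.failed_symm hF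
    have := S.failed_run (by omega) (by omega) (j := aidx x') (by omega) (by omega) hF'
      (by rw [hρ _ hx1 hx2, hρ _ hx1' hx2'])
    rw [← hx, ← hx', this]
  · intro t s' ⟨ht, _, hsum, hmono, hsound, hcompl⟩ hf
    have e6 := hf.mem 6 rfl
    have e13 := hf.mem 13 rfl
    have e14 := hf.mem 14 rfl
    have e17 := hf.mem 17 rfl
    have e18 := hf.mem 18 rfl
    have e19 := hf.mem 19 rfl
    have e20 := hf.mem 20 rfl
    have r6 := hf.reg 6 rfl
    simp only [setReg_mem, h15, h16] at e6 e13 e14 e17 e18 e19 e20 hsum hmono hsound hcompl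
    simp at r6
    have hW' := hW.congr e6 e17 e20 r6
    have hg : 1 ≤ g ρ := by
      have := h.piece_len ρ hρK
      by_contra hc
      have hg0 : g ρ = 0 := by omega
      rw [hg0] at this
      omega
    refine ⟨d + l, f, Function.update g ρ (g ρ - 1), ?_, ?_, ?_⟩
    · refine h.extend (l := l) hW' (by omega) hq0 hq (fun j hj => (hqpos j hj).2.1)
        ⟨Nat.zero_le _, hW'.vis_of_vis hroot⟩ ?_ ?_ ?_ ?_ ?_ ?_ ?_ ?_ ?_ ?_ ?_
      · intro i hi hiM
        rw [hW'.vis, h.piece i hi hiM, e13, e14]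
        by_cases hir : run i = ρ
        · rw [hir, hrest]
          refine and_congr_right fun _ => ?_
          constructor
          · rintro h1 ⟨h2, h3⟩
            obtain ⟨j, hj, hj'⟩ := hqb i h2 h3
            exact h1 j hj hj'.symm
          · intro h1 j hj hj'
            obtain ⟨k, hk1, hk2, hk⟩ := hqa j hj
            have hm := S.aord_mem hi hiM
            have hm' := S.aord_mem (i := k) (by omega) (by omega)
            have : i = k := by
              rw [← hm.2.2.2, ← hm'.2.2.2, ← hk, hj']
            omega
        · rw [hlo _ hir, hhi _ hir]
          refine and_iff_left fun j hj hj' => hir ?_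
          obtain ⟨k, hk1, hk2, hk⟩ := hqa j hj
          have hm := S.aord_mem hi hiM
          have hm' := S.aord_mem (i := k) (by omega) (by omega)
          have : i = k := by
            rw [← hm.2.2.2, ← hm'.2.2.2, ← hk, hj']
          rw [this, hρ k hk1 hk2]
      · intro i hi hle
        rw [e13, e14] at hle ⊢
        by_cases hir : i = ρ
        · subst hir
          obtain ⟨h1, h2, h3, h4⟩ := h.piece_run i hi hpiece
          have h5 := ((hrest _).1 ⟨le_rfl, hle⟩).1
          have h6 := ((hrest _).1 ⟨hle, le_rfl⟩).1
          have hr := h3.trans h4.symm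
          exact ⟨by omega, by omega,
            (S.run_between h1 h5.1 h5.2 h2 hr).trans h3, (S.run_between h1 h6.1 h6.2 h2 hr).trans h3⟩
        · rw [hlo _ hir, hhi _ hir] at hle ⊢
          exact h.piece_run i hi hle
      · intro i hi
        rw [e13, e14]
        by_cases hir : i = ρ
        · subst hir
          rw [Function.update_self]
          have := h.piece_len i hi
          obtain ⟨m, hm⟩ := Nat.exists_eq_add_of_le hg
          rw [hm] at this ⊢
          rw [Nat.add_comm 1 m, pow_succ] at this
          simp only [Nat.add_sub_cancel_left]
          omega
        · rw [hlo _ hir, hhi _ hir, Function.update_of_ne hir]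
          exact h.piece_len i hi
      · intro u hu1 huN hA hv
        rcases Classical.em (s₀.mem 6 u = 0) with hv0 | hv0
        · exfalso
          refine hv ((hW'.vis u).2 ⟨hv0, fun j hj e => ?_⟩)
          exact (hqpos j hj).2.2 (e ▸ hA)
        · exact (h.tree_up u hu1 huN hA hv0).imp_right (Or.imp_right hW'.vis_of_vis)
      · exact fun c u h1 h2 h3 h4 => h.tree_size c u h1 h2 h3 ((hW'.vis c).1 h4).1
      · intro x _
        rw [e19, h19]
      · intro j hj h0
        rw [e19, h19] at h0
        exact absurd h.heavy_zero h0
      · intro z v hz hl'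
        refine (hsound z v hz hl').imp_right ?_
        rintro ⟨hv1, hvN, hv0, hR, hFl, hz1, hz2⟩
        obtain ⟨j, hj, rfl⟩ := hfound v z hR hz1 hz2
        have hvd : ¬dead v := fun hd => by
          have h1 := h.dead_vis v (by omega) hd
          exact hW.vis_of_vis h1 hv0
        exact ⟨hz, by omega, fun e => S.irrefl (e ▸ hR), (hqvis j hj).2.2, hvd,
          Or.inr (Or.inr ⟨S.symm hR, fun hF => hFl (S.failed_symm hF)⟩)⟩
      · exact hmono
      · rw [e18, h18]
      · intro j hj v hzv hv
        rw [e6] at hv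
        have hv0 : v ≠ 0 := fun e => hW.vis_of_vis hroot (e ▸ hv)
        have hqj := hqpos j hj
        obtain ⟨hR, hFl⟩ : R (q j) v ∧ ¬Fl (q j) v := by
          rcases hzv.2.2.2.2.2 with h1 | h1 | h1
          · omega
          · exact absurd h1 hv0
          · exact h1
        have hvN := hzv.2.1
        rcases lt_trichotomy v (q j) with hlt | heq | hgt
        -- A smaller neighbour is an ancestor of a vertex of `A`, so it lies in `A`. It is left to
        -- the inspection of the runs.
        · refine Or.inr (Or.inl ⟨hlt, ?_⟩)
          exact S.A_of_desc (by omega) hqj.2.2 (S.desc_of_adj (S.symm hR) hlt)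
        · exact absurd heq.symm hzv.2.2.1
        · left
          obtain ⟨k, hk1, hk2, hk⟩ := hqa j hj
          -- A larger neighbour `v` is a descendant of `q j`, which lies in `A`. Hence `q j ≤ att
          -- v`, and the cap does not exclude `q j`.
          have hatt := S.att_max hqj.1 hqj.2.2 (S.desc_of_adj hR hgt)
          have h1 := S.aord_le ha hk1 (by omega)
          have h2 := S.aord_le (by omega) hk2 hb
          obtain ⟨z, hz, hRz, _, hz1, hz2, hz3⟩ := hcompl v (q j) (by omega) (by omega) hv
            (S.symm hR) (fun hF => hFl (S.failed_symm hF)) (by omega) (by omega)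
          obtain ⟨_, _, h3, h4, h5⟩ := hpath v z hRz hz1 hz2
          obtain ⟨i, hji, hi, hiq⟩ := haq j (aidx z) hj h3 h4 (by rw [h5]; exact hz3)
          exact ⟨i, hji, hi, by rw [hiq, h5]; exact hz⟩
    · simp only [Expr.cost]
      have : (N + 1 - 1) * (60 * L + 200) = N * (60 * L + 200) := by rw [Nat.add_sub_cancel]
      omega
    -- The lists gain at most `N` entries, the depth grows by `l`, twice the number of unvisited
    -- vertices falls by `2 * l`, and the run gives back `2 * N + 2`: a net loss of at least `N + 2
    -- + l`.
    · have h1 := sum_update_range (f := g) hρK (g ρ - 1)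
      have h2 : ∑ i ∈ Finset.range K, Function.update g ρ (g ρ - 1) i + 1 =
          ∑ i ∈ Finset.range K, g i := by omega
      have h3 := hW'.card
      unfold potential
      rw [← h2, Nat.mul_add (2 * N + 2), e18, h18]
      omega

/-- Consecutive vertices of a run are joined by an edge of the forest. That edge cannot have failed,
because an end of a failed edge is alone in its run. -/
theorem Setup.run_adj {w N L K M : ℕ} {R Fl : ℕ → ℕ → Prop} {dead : ℕ → Prop}
    {D A att aord aidx run : ℕ → ℕ} (S : Setup w N L K M R Fl dead D A att aord aidx run) {k : ℕ}
    (hk : 1 ≤ k) (hkM : k + 1 ≤ M) (hr : run k = run (k + 1)) (hd : ¬dead (aord k))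
    (hd' : ¬dead (aord (k + 1))) : LiveAdj N R Fl dead (aord (k + 1)) (aord k) := by
  have hm := S.aord_mem hk (by omega)
  have hm' := S.aord_mem (i := k + 1) (by omega) hkM
  have hp := S.run_par hk hkM hr
  have hR := S.par_adj hm'.1 hm'.2.1 (by omega)
  rw [hp] at hR
  refine ⟨hm'.2.1, hm.2.1, fun e => S.irrefl (e ▸ hR), hd', hd, Or.inr (Or.inr ⟨hR, fun hF => ?_⟩)⟩
  have := S.failed_run (i := k + 1) (j := k) (by omega) hkM hk (by omega) hF hr.symm
  omega

/-- Visit a vertex of a run: go on to the end of what is left of the run that is farther away. -/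
def visitPath : Program :=
  assign 24 (load 11 (reg 7)) ;; assign 25 (load 12 (reg 24)) ;; assign 26 (load 13 (reg 25)) ;;
  assign 27 (load 14 (reg 25)) ;; assign 29 (const 0) ;; assign 28 (const 0) ;;
  cond (reg 27 -ᵉ reg 24 <ᵉ reg 24 -ᵉ reg 26)
    (store 13 (reg 25) (reg 24 +ᵉ const 1) ;; assign 11 (load 10 (reg 26)) ;; assign 22 (reg 7) ;;
     assign 13 (const 1) ;; assign 31 (reg 24 -ᵉ reg 26 +ᵉ const 1) ;;
     forUp 28 31 (assign 30 (load 10 (reg 24 -ᵉ reg 28)) ;; pushVertex) ;; listPath)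
    (store 14 (reg 25) (reg 24 -ᵉ const 1) ;; assign 11 (reg 7) ;; assign 22 (load 10 (reg 27)) ;;
     assign 13 (const 0) ;; assign 31 (reg 27 -ᵉ reg 24 +ᵉ const 1) ;;
     forUp 28 31 (assign 30 (load 10 (reg 24 +ᵉ reg 28)) ;; pushVertex) ;; listPath)

-- What is left of a run is an interval of indices `a, …, b` that contains the index `i` of `y`.
-- Going from `i` to the farther of `a` and `b` leaves an interval on the other side, of length at
-- most half of `b - a`.
set_option maxHeartbeats 1000000 in
theorem Setup.runs_visitPath {w N L K M : ℕ} {R Fl : ℕ → ℕ → Prop} {dead : ℕ → Prop}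
    {D A att aord aidx run : ℕ → ℕ} (S : Setup w N L K M R Fl dead D A att aord aidx run)
    {s : State} {y d T : ℕ} {f g : ℕ → ℕ} (hT : Tables N K Fl D A att aord aidx run s)
    (h : SearchInv N K M R Fl dead D A aord aidx run y d f g s) (hy : s.reg 7 = y)
    (hy1 : 1 ≤ y) (hyN : y ≤ N) (hv : s.mem 6 y = 0) (hA : A y ≠ 0)
    (hadj : LiveAdj N R Fl dead y (s.reg 6))
    (hpot : potential N K d f g s ≤ T) (hTw : T * (N + 1) + N < 2 ^ w) :
    Runs w visitPath s fun t s' => ∃ d' f' g' l,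
      SearchInv N K M R Fl dead D A aord aidx run 0 d' f' g' s' ∧
      t ≤ l * 40 + N * (60 * L + 200) + 100 ∧
      potential N K d' f' g' s' + (N + 2 + l) ≤ potential N K d f g s := by
  have hw := S.word
  have hsw := S.size_word
  have hMN := S.M_le
  obtain ⟨hi1, hiM, hiy⟩ := S.aidx_mem hy1 hyN hA
  obtain ⟨i, hi⟩ : ∃ i, aidx y = i := ⟨_, rfl⟩
  rw [hi] at hi1 hiM hiy
  obtain ⟨ρ, hρ⟩ : ∃ ρ, run i = ρ := ⟨_, rfl⟩
  obtain ⟨a, ha⟩ : ∃ a, s.mem 13 ρ = a := ⟨_, rfl⟩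
  obtain ⟨b, hb⟩ : ∃ b, s.mem 14 ρ = b := ⟨_, rfl⟩
  have hρK : ρ < K := hρ ▸ S.run_lt hi1 hiM
  have hpi := h.piece i hi1 hiM
  rw [hiy, hρ, ha, hb] at hpi
  obtain ⟨hai, hib⟩ := hpi.1 hv
  obtain ⟨ha1, hbM, hra, hrb⟩ := h.piece_run ρ hρK (by omega)
  rw [ha] at ha1 hra
  rw [hb] at hbM hrb
  have hrun : ∀ k, a ≤ k → k ≤ b → run k = ρ := fun k h1 h2 =>
    (S.run_between ha1 h1 h2 hbM (hra.trans hrb.symm)).trans hra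
  have hunv : ∀ k, a ≤ k → k ≤ b → s.mem 6 (aord k) = 0 := by
    intro k h1 h2
    rw [h.piece k (by omega) (by omega), hrun k h1 h2, ha, hb]
    exact ⟨h1, h2⟩
  have hndead : ∀ k, a ≤ k → k ≤ b → ¬dead (aord k) := fun k h1 h2 hd =>
    h.dead_vis _ (S.aord_mem (by omega) (by omega)).2.1 hd (hunv k h1 h2)
  have hinj : ∀ j k, a ≤ j → j ≤ b → a ≤ k → k ≤ b → aord j = aord k → j = k := by
    intro j k h1 h2 h3 h4 e
    rw [← (S.aord_mem (i := j) (by omega) (by omega)).2.2.2, e,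
      (S.aord_mem (i := k) (by omega) (by omega)).2.2.2]
  have hadj' : ∀ k, a ≤ k → k + 1 ≤ b → LiveAdj N R Fl dead (aord (k + 1)) (aord k) :=
    fun k h1 h2 => S.run_adj (by omega) (by omega)
      ((hrun k h1 (by omega)).trans (hrun (k + 1) (by omega) h2).symm)
      (hndead k h1 (by omega)) (hndead (k + 1) (by omega) h2)
  have e10 := hT.mem10
  have e11 := hT.mem11
  have e12 := hT.mem12
  refine Runs.hide fun Q hQ => ?_
  simp (disch := omega) only [visitPath, runs_seq, runs_assign, eval_const_mod, eval_load,
    eval_reg, Nat.mod_eq_of_lt, setReg_reg, setReg_mem, Nat.reduceEqDiff, reduceIte, hy, e11, e12,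
    hi, hρ, ha, hb, runs_cond, eval_lt_mod, bit_mod, eval_sub, ite_ne_zero, ite_eq_zero,
    runs_store, eval_add_mod, e10, setMem_mem, setMem_reg]
  refine ⟨fun hlt => ?_, fun hge => ?_⟩
  · generalize hs₁ : ((((State.setMem _ 13 ρ (i + 1)).setReg 11 _).setReg 22 _).setReg 13 1).setReg 31
      _ = s₁
    have hW0 : Walked N (LiveAdj N R Fl dead) dead s d 0 (fun t => aord (i - t)) 0 s₁ := by
      refine Walked.zero h.dfs h.depth ?_ ?_ ?_ ?_ <;> subst hs₁ <;> simp
    have g15 : s₁.mem 15 = s.mem 15 := by subst hs₁; simp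
    have g16 : s₁.mem 16 = s.mem 16 := by subst hs₁; simp
    have g18 : s₁.mem 18 = s.mem 18 := by subst hs₁; simp
    have g19 : s₁.mem 19 = s.mem 19 := by subst hs₁; simp
    have g14 : s₁.mem 14 = s.mem 14 := by subst hs₁; simp
    have g13 : s₁.mem 13 = Function.update (s.mem 13) ρ (i + 1) := by subst hs₁; simp
    have g10 : s₁.mem 10 = aord := by subst hs₁; simp [e10]
    have g24 : s₁.reg 24 = i := by subst hs₁; simp
    have hT₁ : Tables N K Fl D A att aord aidx run s₁ := by
      subst hs₁
      refine ⟨?_, ?_, ?_, ?_, ?_, ?_, ?_, ?_, ?_⟩ <;>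
        simp [hT.mem0, hT.mem8, hT.mem9, hT.mem10, hT.mem11, hT.mem12, hT.reg3, hT.reg4]
      exact hT.bad
    refine (hW0.runs_forUp (w := w) (l := i - a + 1) hw S.liveAdj_symm LiveAdj.irrefl (fun _ _ h => h.1)
      (fun _ _ h => h.2.2.2.1) (by subst hs₁; simp) (by subst hs₁; simp) (by subst hs₁; simp)
      (by omega) ?_ ?_ ?_ ?_ ?_).use ?_
    · intro t s' ht h28 hf
      simp only [eval_load, eval_sub, eval_reg, h28, hf.reg 24 rfl, hf.mem 10 rfl, g10, g24]
    · intro t ht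
      rw [show s₁.mem 6 = s.mem 6 by subst hs₁; simp]
      exact hunv _ (by omega) (by omega)
    · intro j k hjk hk e
      have := hinj _ _ (by omega) (by omega) (by omega) (by omega) e
      omega
    · subst hs₁
      simpa [hiy] using hadj
    · intro t ht
      have := hadj' (i - (t + 1)) (by omega) (by omega)
      rw [show i - (t + 1) + 1 = i - t by omega] at this
      exact S.liveAdj_symm _ _ this
    · intro t₁ s₂ ⟨ht₁, hW⟩ hf
      refine (S.runs_listPath (T := T) (a := a) (b := i) (ρ := ρ) (up := 1) (hT₁.frame hf rfl) h hW
        (by simpa using hiy) (fun j hj => hunv _ (by omega) (by omega)) hpot hTw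
        ((hf.mem 15 rfl).trans g15) ((hf.mem 16 rfl).trans g16) ((hf.mem 18 rfl).trans g18)
        ((hf.mem 19 rfl).trans g19) ?_ ?_ ?_ ha1 hai hiM
        (fun k h1 h2 => hrun k h1 (by omega)) hρK rfl
        (fun j hj => ⟨i - j, by omega, by omega, rfl⟩)
        (fun k h1 h2 => ⟨i - k, by omega, by rw [show i - (i - k) = k by omega]⟩) ?_ ?_ ?_ ?_ ?_
        (by omega)).mono ?_
      · rw [hf.reg 11 rfl]; subst hs₁; simp
      · rw [hf.reg 22 rfl]; subst hs₁; simp [hiy]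
      · rw [hf.reg 13 rfl]; subst hs₁; simp
      · intro j k hj h1 h2 hle
        rw [if_pos (by decide)] at hle
        refine ⟨i - k, ?_, by omega, by rw [show i - (i - k) = k by omega]⟩
        by_contra hc
        have := S.aord_lt (i := i - j) (j := k) (by omega) (by omega) (by omega)
        omega
      · intro x hx
        rw [hf.mem 13 rfl, g13, Function.update_of_ne hx]
      · intro x hx
        rw [hf.mem 14 rfl, g14]
      · intro k
        rw [hf.mem 13 rfl, hf.mem 14 rfl, g13, g14, Function.update_self, ha, hb]
        omega
      · rw [hf.mem 13 rfl, hf.mem 14 rfl, g13, g14, Function.update_self, ha, hb]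
        omega
      · rintro t₂ s₃ ⟨d', f', g', h1, h2, h3⟩
        refine hQ _ _ ⟨d', f', g', i - a + 1, h1, ?_, h3⟩
        simp only [Expr.cost] at ht₁ ⊢
        have : (i - a + 1) * (1 + 1 + 1 + 1 + 30) ≤ (i - a + 1) * 40 := Nat.mul_le_mul_left _ (by omega)
        omega
  · generalize hs₁ : ((((State.setMem _ 14 ρ (i - 1)).setReg 11 _).setReg 22 _).setReg 13 0).setReg 31
      _ = s₁
    have hW0 : Walked N (LiveAdj N R Fl dead) dead s d 0 (fun t => aord (i + t)) 0 s₁ := by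
      refine Walked.zero h.dfs h.depth ?_ ?_ ?_ ?_ <;> subst hs₁ <;> simp
    have g15 : s₁.mem 15 = s.mem 15 := by subst hs₁; simp
    have g16 : s₁.mem 16 = s.mem 16 := by subst hs₁; simp
    have g18 : s₁.mem 18 = s.mem 18 := by subst hs₁; simp
    have g19 : s₁.mem 19 = s.mem 19 := by subst hs₁; simp
    have g13 : s₁.mem 13 = s.mem 13 := by subst hs₁; simp
    have g14 : s₁.mem 14 = Function.update (s.mem 14) ρ (i - 1) := by subst hs₁; simp
    have g10 : s₁.mem 10 = aord := by subst hs₁; simp [e10]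
    have g24 : s₁.reg 24 = i := by subst hs₁; simp
    have hT₁ : Tables N K Fl D A att aord aidx run s₁ := by
      subst hs₁
      refine ⟨?_, ?_, ?_, ?_, ?_, ?_, ?_, ?_, ?_⟩ <;>
        simp [hT.mem0, hT.mem8, hT.mem9, hT.mem10, hT.mem11, hT.mem12, hT.reg3, hT.reg4]
      exact hT.bad
    refine (hW0.runs_forUp (w := w) (l := b - i + 1) hw S.liveAdj_symm LiveAdj.irrefl (fun _ _ h => h.1)
      (fun _ _ h => h.2.2.2.1) (by subst hs₁; simp) (by subst hs₁; simp) (by subst hs₁; simp)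
      (by omega) ?_ ?_ ?_ ?_ ?_).use ?_
    · intro t s' ht h28 hf
      simp (disch := omega) only [eval_load, eval_add_mod, eval_reg, h28, hf.reg 24 rfl,
        hf.mem 10 rfl, g10, g24, Nat.mod_eq_of_lt]
    · intro t ht
      rw [show s₁.mem 6 = s.mem 6 by subst hs₁; simp]
      exact hunv _ (by omega) (by omega)
    · intro j k hjk hk e
      have := hinj _ _ (by omega) (by omega) (by omega) (by omega) e
      omega
    · subst hs₁
      simpa [hiy] using hadj
    · intro t ht
      exact hadj' (i + t) (by omega) (by omega)
    · intro t₁ s₂ ⟨ht₁, hW⟩ hf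
      refine (S.runs_listPath (T := T) (a := i) (b := b) (ρ := ρ) (up := 0) (hT₁.frame hf rfl) h hW
        (by simpa using hiy) (fun j hj => hunv _ (by omega) (by omega)) hpot hTw
        ((hf.mem 15 rfl).trans g15) ((hf.mem 16 rfl).trans g16) ((hf.mem 18 rfl).trans g18)
        ((hf.mem 19 rfl).trans g19) ?_ ?_ ?_ hi1 hib hbM
        (fun k h1 h2 => hrun k (by omega) h2) hρK rfl
        (fun j hj => ⟨i + j, by omega, by omega, rfl⟩)
        (fun k h1 h2 => ⟨k - i, by omega, by rw [show i + (k - i) = k by omega]⟩) ?_ ?_ ?_ ?_ ?_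
        (by omega)).mono ?_
      · rw [hf.reg 11 rfl]; subst hs₁; simp [hiy]
      · rw [hf.reg 22 rfl]; subst hs₁; simp
      · rw [hf.reg 13 rfl]; subst hs₁; simp
      · intro j k hj h1 h2 hle
        rw [if_neg (by decide)] at hle
        refine ⟨k - i, ?_, by omega, by rw [show i + (k - i) = k by omega]⟩
        by_contra hc
        have := S.aord_lt (i := k) (j := i + j) (by omega) (by omega) (by omega)
        omega
      · intro x hx
        rw [hf.mem 13 rfl, g13]
      · intro x hx
        rw [hf.mem 14 rfl, g14, Function.update_of_ne hx]
      · intro k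
        rw [hf.mem 13 rfl, hf.mem 14 rfl, g13, g14, Function.update_self, ha, hb]
        omega
      · rw [hf.mem 13 rfl, hf.mem 14 rfl, g13, g14, Function.update_self, ha, hb]
        omega
      · rintro t₂ s₃ ⟨d', f', g', h1, h2, h3⟩
        refine hQ _ _ ⟨d', f', g', b - i + 1, h1, ?_, h3⟩
        simp only [Expr.cost] at ht₁ ⊢
        have : (b - i + 1) * (1 + 1 + 1 + 1 + 30) ≤ (b - i + 1) * 40 := Nat.mul_le_mul_left _ (by omega)
        omega

/-! ### Visiting an unvisited subtree -/

/-- Visit a vertex of an unvisited subtree: go up to its root. -/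
def walkUp : Program :=
  assign 29 (reg 7) ;; assign 30 (reg 7) ;; assign 28 (const 1) ;;
  loop (reg 28)
    (pushVertex ;; assign 30 (load 0 (const 4 *ᵉ reg 30 +ᵉ const 1)) ;;
     cond (load 6 (reg 30)) (assign 28 (const 0))
      (cond (load 8 (reg 30)) (assign 28 (const 0)) skip))

/-- `q 0, …, q (l - 1)` is the path from the vertex `y` to the root `z` of the unvisited subtree that
holds it. -/
structure RootPath (N : ℕ) (D A vis : ℕ → ℕ) (y l z : ℕ) (q : ℕ → ℕ) : Prop where
  pos : 1 ≤ l
  zero : q 0 = y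
  last : q (l - 1) = z
  succ : ∀ j, j + 1 < l → q (j + 1) = D (4 * q j + 1)
  mem : ∀ j < l, 1 ≤ q j ∧ q j ≤ N ∧ A (q j) = 0 ∧ vis (q j) = 0
  root : A (D (4 * z + 1)) ≠ 0 ∨ vis (D (4 * z + 1)) ≠ 0

/-- The climb uses edges of the forest between vertices outside of `A`; these survive, since failed
edges have both ends in `A`. Each round visits one more vertex, so the number of unvisited vertices
pays for the loop. -/
theorem Setup.runs_walkUp {w N L K M : ℕ} {R Fl : ℕ → ℕ → Prop} {dead : ℕ → Prop}
    {D A att aord aidx run : ℕ → ℕ} (S : Setup w N L K M R Fl dead D A att aord aidx run)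
    {s : State} {y d : ℕ} {f g : ℕ → ℕ} (hT : Tables N K Fl D A att aord aidx run s)
    (h : SearchInv N K M R Fl dead D A aord aidx run y d f g s) (hy : s.reg 7 = y)
    (hy1 : 1 ≤ y) (hyN : y ≤ N) (hv : s.mem 6 y = 0) (hA : A y = 0)
    (hadj : LiveAdj N R Fl dead y (s.reg 6)) :
    Runs w walkUp s fun t s' => ∃ l q, t ≤ l * 50 + 20 ∧
      Walked N (LiveAdj N R Fl dead) dead s d y q l s' ∧
      RootPath N D A (s.mem 6) y l (s'.reg 6) q := by
  have hw := S.word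
  have hsw := S.size_word
  have hroot : s.mem 6 0 ≠ 0 := h.dfs.root.2.1
  have hlive : ∀ u, u ≤ N → s.mem 6 u = 0 → ¬dead u := fun u hu h0 hd => h.dead_vis u hu hd h0
  let q : ℕ → ℕ := fun t => (fun b => D (4 * b + 1))^[t] y
  have hq : ∀ t, q (t + 1) = D (4 * q t + 1) := fun t => Function.iterate_succ_apply' _ _ _
  simp (disch := omega) only [walkUp, runs_seq, runs_assign, eval_const_mod, eval_reg,
    Nat.mod_eq_of_lt, setReg_reg, Nat.reduceEqDiff, reduceIte, hy]
  refine (Runs.loop (fun b s' => ∃ t, Walked N (LiveAdj N R Fl dead) dead s d y q t s' ∧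
    (∀ j < t, 1 ≤ q j ∧ q j ≤ N ∧ A (q j) = 0 ∧ s.mem 6 (q j) = 0) ∧
    (∀ j < t, q t < q j) ∧
    b = 45 * numUnvisited N (s'.mem 6) ∧
    ((s'.reg 28 = 1 ∧ s'.reg 30 = q t ∧ 1 ≤ q t ∧ q t ≤ N ∧ A (q t) = 0 ∧ s.mem 6 (q t) = 0 ∧
        LiveAdj N R Fl dead (q t) (s'.reg 6)) ∨
      (s'.reg 28 = 0 ∧ 1 ≤ t ∧ s'.reg 6 = q (t - 1) ∧ (A (q t) ≠ 0 ∨ s.mem 6 (q t) ≠ 0))))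
    (b₀ := 45 * numUnvisited N (s.mem 6)) ?_ ?_).mono ?_
  · exact ⟨0, Walked.zero h.dfs h.depth (by simp) (by simp) (by simp) (by simp), by omega, by omega,
      by simp, Or.inl ⟨by simp, by simp [q], hy1, hyN, hA, hv, by simpa [q] using hadj⟩⟩
  · rintro b s₁ ⟨t, hW, hmem, hdec, rfl, hcase⟩ hf he
    rcases hcase with ⟨h28, h30, hq1, hqN, hqA, hqv, hqadj⟩ | ⟨h28, _⟩
    swap
    · exact absurd h28 he
    have e0 := hf.mem 0 rfl
    have e8 := hf.mem 8 rfl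
    have r29 := hf.reg 29 rfl
    simp [hT.mem0, hT.mem8] at e0 e8 r29
    have hqv₁ : s₁.mem 6 (q t) = 0 :=
      (hW.vis _).2 ⟨hqv, fun j hj e => (hdec j hj).ne e⟩
    rw [runs_seq]
    refine (hW.runs_push hw S.liveAdj_symm LiveAdj.irrefl (fun _ _ h => h.1)
      (fun _ _ h => h.2.2.2.1) h30 (by simpa using r29) hqv₁ hqadj).use ?_
    intro t₁ s₂ ⟨ht₁, hW', hr6⟩ hf'
    have e0' := (hf'.mem 0 rfl).trans e0
    have e8' := (hf'.mem 8 rfl).trans e8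
    have r30 := (hf'.reg 30 rfl).trans h30
    have r28 := (hf'.reg 28 rfl).trans h28
    have hlt := S.par_lt hq1 hqN
    rw [← hq] at hlt
    have hdec' : ∀ j < t + 1, q (t + 1) < q j := by
      intro j hj
      rcases Nat.lt_succ_iff_lt_or_eq.1 hj with hj | rfl
      · exact hlt.trans (hdec j hj)
      · exact hlt
    have hmem' : ∀ j < t + 1, 1 ≤ q j ∧ q j ≤ N ∧ A (q j) = 0 ∧ s.mem 6 (q j) = 0 := by
      intro j hj
      rcases Nat.lt_succ_iff_lt_or_eq.1 hj with hj | rfl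
      · exact hmem j hj
      · exact ⟨hq1, hqN, hqA, hqv⟩
    have hvis : s₂.mem 6 (q (t + 1)) = 0 ↔ s.mem 6 (q (t + 1)) = 0 :=
      (hW'.vis _).trans (and_iff_left fun j hj => (hdec' j hj).ne)
    have hcard : numUnvisited N (s₁.mem 6) = numUnvisited N (s₂.mem 6) + 1 := by
      have := hW.card
      have := hW'.card
      omega
    refine Runs.hide fun Q hQ => ?_
    simp (disch := omega) [Nat.mod_eq_of_lt, e0', e8', r30, ← hq]
    refine ⟨fun hv1 => ?_, fun hv1 => ⟨fun hA1 => ?_, fun hA1 => ?_⟩⟩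
    · refine hQ _ _ ⟨_, ⟨t + 1, hW'.congr rfl rfl rfl (by simp), hmem', hdec', rfl,
        Or.inr ⟨by simp, by omega, by simp [hr6], Or.inr fun h0 => hv1 (hvis.2 h0)⟩⟩, ?_⟩
      simp [hcard]
      omega
    · refine hQ _ _ ⟨_, ⟨t + 1, hW'.congr rfl rfl rfl (by simp), hmem', hdec', rfl,
        Or.inr ⟨by simp, by omega, by simp [hr6], Or.inl hA1⟩⟩, ?_⟩
      simp [hcard]
      omega
    · have hv0 := hvis.1 hv1
      -- The number `0` stands for a missing parent as well as for the dummy root. The latter is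
      -- visited, so the climb stops at a root of the forest.
      have hpos : 1 ≤ q (t + 1) := by
        by_contra hc
        exact hroot (by rwa [show q (t + 1) = 0 by omega] at hv0)
      have hR := S.par_adj hq1 hqN (by rw [← hq]; omega)
      rw [← hq] at hR
      refine hQ _ _ ⟨_, ⟨t + 1, hW'.congr rfl rfl rfl (by simp), hmem', hdec', rfl,
        Or.inl ⟨by simp [r28], by simp, hpos, by omega, hA1, hv0, ?_⟩⟩, ?_⟩
      · simp only [setReg_reg, Nat.reduceEqDiff, reduceIte, hr6]
        exact ⟨by omega, hqN, by omega, hlive _ (by omega) hv0, hlive _ hqN hqv,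
          Or.inr (Or.inr ⟨S.symm hR, fun hF => (S.failed_mem hF).2.2 hA1⟩)⟩
      · simp [hcard]
        omega
  · rintro t₀ s' ⟨_, he, b, ⟨t, hW, hmem, hdec, rfl, hcase⟩, hb⟩
    rcases hcase with ⟨h28, _⟩ | ⟨_, ht, hr6, hend⟩
    · rw [eval_reg, h28] at he
      omega
    · refine ⟨t, q, ?_, hW, ht, rfl, hr6.symm, fun j _ => hq j, hmem, ?_⟩
      · have := hW.card
        simp only [Expr.cost] at hb ⊢
        omega
      · obtain ⟨t, rfl⟩ := Nat.exists_eq_succ_of_ne_zero (by omega : t ≠ 0)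
        rw [hr6]
        rw [Nat.succ_eq_add_one, hq] at hend
        simpa using hend

namespace RootPath

variable {w N L K M : ℕ} {R Fl : ℕ → ℕ → Prop} {dead : ℕ → Prop}
  {D A att aord aidx run vis : ℕ → ℕ} {y l z : ℕ} {q : ℕ → ℕ}

theorem desc (h : RootPath N D A vis y l z q) (S : IsIndex N R D) {i j : ℕ} (hij : i ≤ j)
    (hj : j < l) : Desc N (fun b => D (4 * b + 1)) (q j) (q i) := by
  induction j, hij using Nat.le_induction with
  | base => exact Desc.refl (h.mem i hj).2.1
  | succ j hij ih =>
    have h1 := h.mem j (by omega)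
    have h2 := h.mem (j + 1) hj
    rw [h.succ j hj] at h2 ⊢
    exact (S.desc_par h1.1 h1.2.1 (by omega)).trans (ih (by omega))

theorem lt (h : RootPath N D A vis y l z q) (S : IsIndex N R D) {i j : ℕ} (hij : i < j)
    (hj : j < l) : q j < q i := by
  have h1 := (h.desc S (i := i) (j := j - 1) (by omega) (by omega)).1
  have h2 := h.mem (j - 1) (by omega)
  have h3 := h.succ (j - 1) (by omega)
  rw [Nat.sub_add_cancel (by omega)] at h3
  have := S.par_lt h2.1 h2.2.1
  omega

theorem desc_root (h : RootPath N D A vis y l z q) (S : IsIndex N R D) {i : ℕ} (hi : i < l) :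
    Desc N (fun b => D (4 * b + 1)) z (q i) := by
  have := h.desc S (i := i) (j := l - 1) (by have := h.pos; omega) (by omega)
  rwa [h.last] at this

theorem mem_root (h : RootPath N D A vis y l z q) : 1 ≤ z ∧ z ≤ N ∧ A z = 0 ∧ vis z = 0 := by
  have := h.mem (l - 1) (by have := h.pos; omega)
  rwa [h.last] at this

/-- Ancestors of the path within the subtree belong to the path. -/
theorem mem_of_desc (h : RootPath N D A vis y l z q) (S : IsIndex N R D) {x j : ℕ} (hj : j < l)
    (hzx : z ≤ x) (hx : Desc N (fun b => D (4 * b + 1)) x (q j)) : ∃ i < l, x = q i := by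
  induction hk : l - j using Nat.strong_induction_on generalizing j with
  | _ k ih =>
    rcases Nat.eq_or_lt_of_le hx.1 with heq | hlt
    · exact ⟨j, hj, heq⟩
    · have hm := h.mem j hj
      by_cases hjl : j + 1 < l
      · refine ih (l - (j + 1)) (by omega) hjl ?_ rfl
        rw [h.succ j hjl]
        exact hx.parent hlt (S.par_lt hm.1 hm.2.1)
      · have : q j = z := by rw [← h.last]; congr 1; omega
        omega

end RootPath

theorem IsIndex.fin_le_fin {N : ℕ} {R : ℕ → ℕ → Prop} {D : ℕ → ℕ} (S : IsIndex N R D) {a b : ℕ}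
    (ha : 1 ≤ a) (h : Desc N (fun b => D (4 * b + 1)) a b) : D (4 * b + 2) ≤ D (4 * a + 2) := by
  have hb := S.lt_fin (v := b) (ha.trans h.1) h.2.1
  have h1 := (S.desc_iff (v := b) (u := D (4 * b + 2) - 1) (ha.trans h.1) h.2.1).2
    ⟨by omega, by omega⟩
  have h2 := (S.desc_iff ha (h.1.trans h.2.1)).1 (h.trans h1)
  omega

/-- Below an unvisited vertex outside of `A`, all vertices are unvisited and outside of `A`. -/
theorem SearchInv.unvisited_desc {w N L K M : ℕ} {R Fl : ℕ → ℕ → Prop} {dead : ℕ → Prop}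
    {D A att aord aidx run : ℕ → ℕ} {y d : ℕ} {f g : ℕ → ℕ} {s : State}
    (S : Setup w N L K M R Fl dead D A att aord aidx run)
    (h : SearchInv N K M R Fl dead D A aord aidx run y d f g s) {a u : ℕ} (ha : 1 ≤ a)
    (hA : A a = 0) (hv : s.mem 6 a = 0) (hd : Desc N (fun b => D (4 * b + 1)) a u) :
    s.mem 6 u = 0 ∧ A u = 0 := by
  have hAu : ∀ u, Desc N (fun b => D (4 * b + 1)) a u → A u = 0 := by
    intro u hu
    by_contra hc
    exact S.A_of_desc ha hc hu hA
  refine ⟨?_, hAu u hd⟩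
  refine S.desc_induction (P := fun u => s.mem 6 u = 0) ha hv ?_ u hd
  intro u hau hu hp
  by_contra hc
  have h1 : a ≤ D (4 * u + 1) := hu.2.2 u hau le_rfl
  rcases h.tree_up u (by omega) hu.2.1 (hAu u hu) hc with h2 | h2 | h2
  · omega
  · exact h2 (hAu _ (hu.parent hau (S.par_lt (by omega) hu.2.1)))
  · exact h2 hp

/-- After the path from a vertex up to the root of its unvisited subtree has been visited: extend the
lists by the vertices of the subtrees that hang from the path, except for a subtree that holds more
than half of the vertices, whose root is stored in array `19`. -/
def listSubtrees : Program :=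
  store 19 (reg 7) (const 0) ;; assign 11 (reg 6) ;; assign 13 (const 1) ;; assign 20 (reg 6) ;;
  assign 27 (load 0 (const 4 *ᵉ reg 6 +ᵉ const 2)) ;;
  loop (reg 20 <ᵉ reg 27)
    (cond (load 6 (reg 20)) (assign 20 (reg 20 +ᵉ const 1))
      (assign 21 (load 0 (const 4 *ᵉ reg 20 +ᵉ const 2)) ;;
       cond (reg 27 -ᵉ reg 6 <ᵉ const 2 *ᵉ (reg 21 -ᵉ reg 20))
        (store 19 (reg 7) (reg 20) ;; assign 20 (reg 21))
        (assign 22 (reg 20 -ᵉ const 1) ;; assign 23 (reg 20 -ᵉ const 1) ;; batch)))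

/-- The invariant of `listSubtrees`: the subtree with root `z` has been dealt with up to `u`, and `c` is
the root of the large subtree, if it has been found. -/
structure SubtreeInv (N : ℕ) (R Fl : ℕ → ℕ → Prop) (dead : ℕ → Prop) (D A : ℕ → ℕ) (y l z : ℕ)
    (f q : ℕ → ℕ) (s₀ s₁ : State) (u c : ℕ) (f₁ : ℕ → ℕ) (s : State) : Prop where
  ge : z ≤ u
  le : u ≤ D (4 * z + 2)
  reg20 : s.reg 20 = u
  mem19 : s.mem 19 = Function.update (s₀.mem 19) y c
  closed : ∀ a, z ≤ a → a < u → s₁.mem 6 a = 0 → D (4 * a + 2) ≤ u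
  large : c ≠ 0 → z ≤ c ∧ c < u ∧ s₁.mem 6 c = 0 ∧ D (4 * z + 2) - z < 2 * (D (4 * c + 2) - c)
  count : ∑ x ∈ Finset.range (N + 1), s.mem 15 x + ∑ x ∈ Finset.range (N + 1), f₁ x ≤
    ∑ x ∈ Finset.range (N + 1), s₀.mem 15 x + ∑ x ∈ Finset.range (N + 1), f x
  le_f : ∀ v, f₁ v ≤ f v
  eq_f : ∀ v, u ≤ v → f₁ v = f v
  size : ∀ a v, 1 ≤ a → Desc N (fun b => D (4 * b + 1)) a v → A a = 0 → s₁.mem 6 a = 0 →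
    D (4 * a + 2) - a < 2 ^ f₁ v
  mono : ∀ x v, x ≤ N → Listed N (s₀.mem 15) (s₀.mem 16) x v →
    Listed N (s.mem 15) (s.mem 16) x v
  sound : ∀ x v, x ≤ N → Listed N (s.mem 15) (s.mem 16) x v →
    Listed N (s₀.mem 15) (s₀.mem 16) x v ∨ LiveAdj N R Fl dead x v
  cover : ∀ v, z ≤ v → v < u → s₁.mem 6 v = 0 →
    (c ≠ 0 ∧ Desc N (fun b => D (4 * b + 1)) c v) ∨
    ∀ j < l, LiveAdj N R Fl dead (q j) v → q j < v →
      ∃ i, j ≤ i ∧ i < l ∧ Listed N (s.mem 15) (s.mem 16) (q i) v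

theorem sum_sub_one_Ico {N a b : ℕ} {f : ℕ → ℕ} (hb : b ≤ N + 1)
    (hf : ∀ v, a ≤ v → v < b → 1 ≤ f v) :
    ∑ x ∈ Finset.range (N + 1), (if a ≤ x ∧ x < b then f x - 1 else f x) + (b - a) =
      ∑ x ∈ Finset.range (N + 1), f x := by
  have h1 : ∑ x ∈ Finset.range (N + 1), (if a ≤ x ∧ x < b then 1 else 0) = b - a := by
    rw [← Finset.card_filter, ← Nat.card_Ico]
    congr 1
    ext x
    simp only [Finset.mem_filter, Finset.mem_range, Finset.mem_Ico]
    omega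
  rw [← h1, ← Finset.sum_add_distrib]
  refine Finset.sum_congr rfl fun x _ => ?_
  split_ifs with h
  · have := hf x h.1 h.2
    omega
  · rfl

/-- The number of visited vertices from `u` up to `b`. -/
def numVisited (vis : ℕ → ℕ) (u b : ℕ) : ℕ := ((Finset.Ico u b).filter fun v => vis v ≠ 0).card

theorem numVisited_mono {vis : ℕ → ℕ} {u u' b : ℕ} (h : u ≤ u') :
    numVisited vis u' b ≤ numVisited vis u b :=
  Finset.card_le_card (Finset.filter_subset_filter _ (Finset.Ico_subset_Ico_left h))

theorem numVisited_succ {vis : ℕ → ℕ} {u b : ℕ} (h : u < b) (hv : vis u ≠ 0) :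
    numVisited vis u b = numVisited vis (u + 1) b + 1 := by
  rw [numVisited, numVisited, ← Finset.insert_Ico_add_one_left_eq_Ico h, Finset.filter_insert, if_pos hv,
    Finset.card_insert_of_notMem (by simp)]

section

variable {w N L K M : ℕ} {R Fl : ℕ → ℕ → Prop} {dead : ℕ → Prop} {D A att aord aidx run : ℕ → ℕ}
  {s₀ s₁ : State} {y d l z : ℕ} {f g q : ℕ → ℕ}

/-- What is known when the path up to the root `z` has been visited. -/
structure SubtreeCtx (S : Setup w N L K M R Fl dead D A att aord aidx run) (s₀ s₁ : State)
    (y d l z : ℕ) (f g q : ℕ → ℕ) : Prop where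
  inv : SearchInv N K M R Fl dead D A aord aidx run y d f g s₀
  walked : Walked N (LiveAdj N R Fl dead) dead s₀ d y q l s₁
  path : RootPath N D A (s₀.mem 6) y l z q

namespace SubtreeCtx

variable {S : Setup w N L K M R Fl dead D A att aord aidx run}

/-- An unvisited vertex outside of `A` above `z` would make the parent of `z` unvisited and outside
of `A` too, and the climb would not have ended at `z`. -/
theorem above (C : SubtreeCtx S s₀ s₁ y d l z f g q) {a : ℕ} (ha : 1 ≤ a) (haz : a < z)
    (hd : Desc N (fun b => D (4 * b + 1)) a z) (hA : A a = 0) : s₀.mem 6 a ≠ 0 := by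
  intro hv
  have hz := C.path.mem_root
  have h1 := hd.parent haz (S.par_lt hz.1 hz.2.1)
  have h2 := C.inv.unvisited_desc S ha hA hv h1
  exact C.path.root.elim (fun h => h h2.2) (fun h => h h2.1)

theorem mem_subtree (C : SubtreeCtx S s₀ s₁ y d l z f g q) {v : ℕ}
    (hd : Desc N (fun b => D (4 * b + 1)) z v) : s₀.mem 6 v = 0 ∧ A v = 0 := by
  have hz := C.path.mem_root
  exact C.inv.unvisited_desc S hz.1 hz.2.2.1 hz.2.2.2 hd

theorem mem_path (C : SubtreeCtx S s₀ s₁ y d l z f g q) {v : ℕ}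
    (hd : Desc N (fun b => D (4 * b + 1)) z v) (hv : s₁.mem 6 v ≠ 0) : ∃ i < l, v = q i := by
  by_contra hc
  refine hv ((C.walked.vis v).2 ⟨(C.mem_subtree hd).1, fun j hj e => hc ⟨j, hj, e⟩⟩)

/-- The descendants of an unvisited vertex of the subtree are unvisited. -/
theorem unvisited (C : SubtreeCtx S s₀ s₁ y d l z f g q) {u v : ℕ}
    (hd : Desc N (fun b => D (4 * b + 1)) z u) (hu : s₁.mem 6 u = 0)
    (huv : Desc N (fun b => D (4 * b + 1)) u v) : s₁.mem 6 v = 0 := by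
  by_contra hv
  obtain ⟨i, hi, rfl⟩ := C.mem_path (hd.trans huv) hv
  obtain ⟨j, hj, rfl⟩ := C.path.mem_of_desc S.toIsIndex hi hd.1 huv
  exact C.walked.vis_new hj hu

theorem visited_root (C : SubtreeCtx S s₀ s₁ y d l z f g q) : s₁.mem 6 z ≠ 0 := by
  rw [← C.path.last]
  exact C.walked.vis_new (by have := C.path.pos; omega)

/-- In a hanging subtree, the neighbours outside of the subtree but within the tree lie on the path. -/
theorem neighbor_mem (C : SubtreeCtx S s₀ s₁ y d l z f g q) {u v x : ℕ}
    (hzu : Desc N (fun b => D (4 * b + 1)) z u)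
    (hclosed : ∀ a, z ≤ a → a < u → s₁.mem 6 a = 0 → D (4 * a + 2) ≤ u)
    (huv : Desc N (fun b => D (4 * b + 1)) u v) (hR : R v x) (hzx : z ≤ x) (hxu : x < u) :
    ∃ i < l, x = q i := by
  have hz := C.path.mem_root
  have hu1 : 1 ≤ u := by omega
  have hxv := S.desc_of_adj (S.symm hR) (lt_of_lt_of_le hxu huv.1)
  have hxu' := hxv.mid hxu.le huv.1
  have hplt := S.par_lt hu1 hzu.2.1
  have hxp := hxu'.parent hxu hplt
  have hpz : z ≤ D (4 * u + 1) := hzx.trans hxp.1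
  have hpu := S.desc_par hu1 hzu.2.1 (by omega)
  -- Had the parent of `u` been unvisited, the scan would have jumped over its whole subtree, and
  -- with it over `u`. So `u` hangs directly from the path.
  have hpv : s₁.mem 6 (D (4 * u + 1)) ≠ 0 := by
    intro h0
    have h1 := hclosed _ hpz hplt h0
    have h2 := ((S.desc_iff (by omega) hxp.2.1).1 hpu).2
    omega
  obtain ⟨i, hi, hpi⟩ := C.mem_path (hzu.mid hpz hplt.le) hpv
  refine C.path.mem_of_desc S.toIsIndex hi hzx ?_
  rw [← hpi]
  exact hxp

/-- The subtree with root `u` becomes the large one. -/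
theorem step_large (C : SubtreeCtx S s₀ s₁ y d l z f g q) {u c : ℕ} {f₁ : ℕ → ℕ} {s s' : State}
    (h : SubtreeInv N R Fl dead D A y l z f q s₀ s₁ u c f₁ s) (hu : u < D (4 * z + 2))
    (hv : s₁.mem 6 u = 0) (hsize : D (4 * z + 2) - z < 2 * (D (4 * u + 2) - u))
    (h20 : s'.reg 20 = D (4 * u + 2)) (h19 : s'.mem 19 = Function.update (s.mem 19) y u)
    (h15 : s'.mem 15 = s.mem 15) (h16 : s'.mem 16 = s.mem 16) :
    c = 0 ∧ SubtreeInv N R Fl dead D A y l z f q s₀ s₁ (D (4 * u + 2)) u f₁ s' := by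
  have hz := C.path.mem_root
  have hge := h.ge
  have hzu := (S.desc_iff hz.1 hz.2.1).2 ⟨h.ge, hu⟩
  have hlt := S.lt_fin (v := u) (by omega) hzu.2.1
  have hff := S.fin_le_fin hz.1 hzu
  -- Two disjoint subtrees cannot both hold more than half of the vertices below `z`.
  have hc : c = 0 := by
    by_contra hc
    obtain ⟨h1, h2, h3, h4⟩ := h.large hc
    have := h.closed c h1 h2 h3
    omega
  refine ⟨hc, by omega, hff, h20, ?_, ?_, fun _ => ⟨h.ge, hlt, hv, hsize⟩, ?_, h.le_f,
    fun v hv => h.eq_f v (by omega), h.size, ?_, ?_, ?_⟩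
  · rw [h19, h.mem19, Function.update_idem]
  · intro a ha hau ha0
    by_cases hau' : a < u
    · exact (h.closed a ha hau' ha0).trans hlt.le
    · exact S.fin_le_fin (by omega) ((S.desc_iff (by omega) hzu.2.1).2 ⟨by omega, hau⟩)
  · rw [h15]; exact h.count
  · rw [h15, h16]; exact h.mono
  · rw [h15, h16]; exact h.sound
  · intro v hzv hvu hv0
    rw [h15, h16]
    by_cases hvu' : v < u
    · refine Or.inr ((h.cover v hzv hvu' hv0).resolve_left fun hh => hh.1 hc)
    · exact Or.inl ⟨by omega, (S.desc_iff (by omega) hzu.2.1).2 ⟨by omega, hvu⟩⟩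

end SubtreeCtx

end

section

variable {w N L K M : ℕ} {R Fl : ℕ → ℕ → Prop} {dead : ℕ → Prop} {D A att aord aidx run : ℕ → ℕ}
  {s₀ s₁ : State} {y d l z : ℕ} {f g q : ℕ → ℕ}

namespace SubtreeCtx

variable {S : Setup w N L K M R Fl dead D A att aord aidx run}

theorem step_skip {u c : ℕ} {f₁ : ℕ → ℕ} {s s' : State}
    (h : SubtreeInv N R Fl dead D A y l z f q s₀ s₁ u c f₁ s) (hu : u < D (4 * z + 2))
    (hv : s₁.mem 6 u ≠ 0) (h20 : s'.reg 20 = u + 1) (hm : s'.mem = s.mem) :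
    SubtreeInv N R Fl dead D A y l z f q s₀ s₁ (u + 1) c f₁ s' := by
  refine ⟨by have := h.ge; omega, hu, h20, by rw [hm]; exact h.mem19, ?_, ?_, by rw [hm]; exact h.count,
    h.le_f, fun v hv => h.eq_f v (by omega), h.size, by rw [hm]; exact h.mono,
    by rw [hm]; exact h.sound, ?_⟩
  · intro a ha hau ha0
    rcases Nat.lt_succ_iff_lt_or_eq.1 hau with hau | rfl
    · exact (h.closed a ha hau ha0).trans (Nat.le_succ u)
    · exact absurd ha0 hv
  · intro hc
    obtain ⟨h1, h2, h3, h4⟩ := h.large hc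
    exact ⟨h1, by omega, h3, h4⟩
  · intro v hzv hvu hv0
    rw [hm]
    rcases Nat.lt_succ_iff_lt_or_eq.1 hvu with hvu | rfl
    · exact h.cover v hzv hvu hv0
    · exact absurd hv0 hv

/-- `2 ^ f₁ v` exceeds the size of the whole subtree at `z`, and the subtree at `u` has at most half
of that size. So one unit of `f₁ v` can be spent. -/
theorem pos_f (C : SubtreeCtx S s₀ s₁ y d l z f g q) {u c : ℕ} {f₁ : ℕ → ℕ} {s : State}
    (h : SubtreeInv N R Fl dead D A y l z f q s₀ s₁ u c f₁ s) (hu : u < D (4 * z + 2))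
    (hsize : 2 * (D (4 * u + 2) - u) ≤ D (4 * z + 2) - z) {v : ℕ}
    (huv : Desc N (fun b => D (4 * b + 1)) u v) :
    1 ≤ f₁ v ∧ D (4 * u + 2) - u < 2 ^ (f₁ v - 1) := by
  have hz := C.path.mem_root
  have hge := h.ge
  have hzu := (S.desc_iff hz.1 hz.2.1).2 ⟨h.ge, hu⟩
  have hlt := S.lt_fin (v := u) (by omega) hzu.2.1
  have h1 := C.inv.tree_size z v hz.1 (hzu.trans huv) hz.2.2.1 hz.2.2.2
  rw [← h.eq_f v huv.1] at h1
  have hpos : 1 ≤ f₁ v := by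
    by_contra hc
    rw [show f₁ v = 0 by omega] at h1
    omega
  refine ⟨hpos, ?_⟩
  obtain ⟨m, hm⟩ := Nat.exists_eq_add_of_le hpos
  rw [hm, Nat.add_comm 1 m, pow_succ] at h1
  rw [hm, Nat.add_sub_cancel_left]
  omega

/-- Each vertex of a light subtree spends one unit of its exponent, which pays for its entry and its
binary search. Its neighbours from `z` up to `u - 1` lie on the path, by `neighbor_mem`, so the new
entries really sit at vertices of the path. -/
theorem step_small (C : SubtreeCtx S s₀ s₁ y d l z f g q) {u c : ℕ} {f₁ : ℕ → ℕ} {s s' : State}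
    (h : SubtreeInv N R Fl dead D A y l z f q s₀ s₁ u c f₁ s) (hu : u < D (4 * z + 2))
    (hv : s₁.mem 6 u = 0) (hsize : 2 * (D (4 * u + 2) - u) ≤ D (4 * z + 2) - z)
    (h20 : s'.reg 20 = D (4 * u + 2)) (h19 : s'.mem 19 = s.mem 19)
    (hsum : ∑ x ∈ Finset.range (N + 1), s'.mem 15 x ≤
        ∑ x ∈ Finset.range (N + 1), s.mem 15 x + (D (4 * u + 2) - u))
    (hmono : ∀ x v, x ≤ N → Listed N (s.mem 15) (s.mem 16) x v →
        Listed N (s'.mem 15) (s'.mem 16) x v)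
    (hsound : ∀ x v, x ≤ N → Listed N (s'.mem 15) (s'.mem 16) x v →
      Listed N (s.mem 15) (s.mem 16) x v ∨ (u ≤ v ∧ v < D (4 * u + 2) ∧ s₁.mem 6 v = 0 ∧ R v x ∧
        ¬Fl v x ∧ z ≤ x ∧ x ≤ u - 1))
    (hcompl : ∀ v x, u ≤ v → v < D (4 * u + 2) → s₁.mem 6 v = 0 → R v x → ¬Fl v x → z ≤ x →
        x ≤ u - 1 → ∃ x', Listed N (s'.mem 15) (s'.mem 16) x' v ∧
          R v x' ∧ ¬Fl v x' ∧ z ≤ x' ∧ x' ≤ u - 1 ∧ x' ≤ x) :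
    ∑ x ∈ Finset.range (N + 1), (if u ≤ x ∧ x < D (4 * u + 2) then f₁ x - 1 else f₁ x) +
        (D (4 * u + 2) - u) = ∑ x ∈ Finset.range (N + 1), f₁ x ∧
      SubtreeInv N R Fl dead D A y l z f q s₀ s₁ (D (4 * u + 2)) c
        (fun x => if u ≤ x ∧ x < D (4 * u + 2) then f₁ x - 1 else f₁ x) s' := by
  have hz := C.path.mem_root
  have hge := h.ge
  have hzu := (S.desc_iff hz.1 hz.2.1).2 ⟨h.ge, hu⟩
  have hu1 : 1 ≤ u := by omega
  have huN := hzu.2.1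
  have hlt := S.lt_fin hu1 huN
  have hzu' : z < u := lt_of_le_of_ne hge fun e => C.visited_root (e ▸ hv)
  have hdu : ∀ v, u ≤ v → v < D (4 * u + 2) → Desc N (fun b => D (4 * b + 1)) u v :=
    fun v h1 h2 => (S.desc_iff hu1 huN).2 ⟨h1, h2⟩
  have hsub := sum_sub_one_Ico (f := f₁) (a := u) (S.fin_le hu1 huN)
    fun v h1 h2 => (C.pos_f h hu hsize (hdu v h1 h2)).1
  refine ⟨hsub, by omega, S.fin_le_fin hz.1 hzu, h20, by rw [h19]; exact h.mem19, ?_, ?_, ?_, ?_, ?_,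
    ?_, ?_, ?_, ?_⟩
  · intro a ha hau ha0
    by_cases hau' : a < u
    · exact (h.closed a ha hau' ha0).trans hlt.le
    · exact S.fin_le_fin hu1 (hdu a (by omega) hau)
  · intro hc
    obtain ⟨h1, h2, h3, h4⟩ := h.large hc
    exact ⟨h1, by omega, h3, h4⟩
  · have := h.count
    omega
  · intro v
    have := h.le_f v
    split_ifs <;> omega
  · intro v hv'
    rw [if_neg (by omega)]
    exact h.eq_f v (by omega)
  · intro a v ha hav hA hva
    split_ifs with hcase
    · have hdv := hdu v hcase.1 hcase.2
      -- An unvisited ancestor `a < u` outside of `A` is impossible: above `z` all such vertices are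
      -- visited, and from `z` on the scan would have passed over the subtree at `a`, which contains
      -- `u`. So inside the light subtree only roots from `u` on matter.
      have hau : u ≤ a := by
        by_contra hc
        have hauD := hav.mid (b := u) (by omega) hcase.1
        by_cases haz : a < z
        · exact C.above ha haz (hauD.mid haz.le hge) hA ((C.walked.vis a).1 hva).1
        · have h1 := h.closed a (by omega) (by omega) hva
          have h2 := ((S.desc_iff ha (by omega)).1 hav).2
          omega
      have h1 := S.fin_le_fin hu1 (hdv.mid hau hav.1)
      have h2 := (C.pos_f h hu hsize hdv).2
      omega
    · exact h.size a v ha hav hA hva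
  · exact fun x v hx hl => hmono x v hx (h.mono x v hx hl)
  · intro x v hx hl
    rcases hsound x v hx hl with hl | ⟨h1, h2, h3, h4, h5, h6, h7⟩
    · exact h.sound x v hx hl
    · obtain ⟨i, hi, rfl⟩ := C.neighbor_mem hzu h.closed (hdu v h1 h2) h4 h6 (by omega)
      have hV : Visited N dead (s₁.mem 6) (q i) := (C.walked.path.mem _).2 (Or.inr ⟨i, hi, rfl⟩)
      have hvN := S.le h4
      refine Or.inr ⟨hx, hvN, fun e => S.irrefl (e ▸ h4), hV.2.2, fun hd => ?_,
        Or.inr (Or.inr ⟨S.symm h4, fun hF => h5 (S.failed_symm hF)⟩)⟩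
      exact C.inv.dead_vis v hvN hd ((C.walked.vis v).1 h3).1
  · intro v hzv hvu hv0
    by_cases hvu' : v < u
    · refine (h.cover v hzv hvu' hv0).imp_right fun hc j hj h1 h2 => ?_
      obtain ⟨i, h3, h4, h5⟩ := hc j hj h1 h2
      exact ⟨i, h3, h4, hmono _ _ (C.path.mem i h4).2.1 h5⟩
    · right
      intro j hj hadj hjv
      have hdv := hdu v (by omega) hvu
      have hqj := C.path.mem j hj
      have hqz := (C.path.desc_root S.toIsIndex hj).1
      obtain ⟨hR, hFl⟩ : R (q j) v ∧ ¬Fl (q j) v := by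
        rcases hadj.2.2.2.2.2 with h1 | h1 | h1
        · omega
        · omega
        · exact h1
      have hju : q j < u := by
        by_contra hc
        exact C.walked.vis_new hj (C.unvisited hzu hv (hdu (q j) (by omega) (by omega)))
      obtain ⟨x, hx, hRx, _, hzx, hxu, hxj⟩ := hcompl v (q j) (by omega) hvu hv0 (S.symm hR)
        (fun hF => hFl (S.failed_symm hF)) hqz (by omega)
      obtain ⟨i, hi, rfl⟩ := C.neighbor_mem hzu h.closed hdv hRx hzx (by omega)
      -- Numbers decrease along the climb, so the smallest neighbour is the one nearest to the end
      -- of the path.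
      refine ⟨i, ?_, hi, hx⟩
      by_contra hc
      have := C.path.lt S.toIsIndex (i := i) (j := j) (by omega) hj
      omega

/-- The time is charged in three ways: `50` steps for each visited vertex that the scan skips, `50`
once for the heavy subtree, and `60 * L + 300` for each vertex of a light subtree, paid for by its
exponent. -/
theorem runs_listSubtrees (C : SubtreeCtx S s₀ s₁ y d l z f g q)
    (hT : Tables N K Fl D A att aord aidx run s₁) (hr6 : s₁.reg 6 = z) (hr7 : s₁.reg 7 = y)
    (h15 : s₁.mem 15 = s₀.mem 15) (h16 : s₁.mem 16 = s₀.mem 16) (h19 : s₁.mem 19 = s₀.mem 19)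
    {T : ℕ} (hT' : ∑ x ∈ Finset.range (N + 1), s₀.mem 15 x + ∑ x ∈ Finset.range (N + 1), f x ≤ T)
    (hTw : T * (N + 1) + N < 2 ^ w) :
    Runs w listSubtrees s₁ fun t s' => ∃ c f₁,
      SubtreeInv N R Fl dead D A y l z f q s₀ s₁ (D (4 * z + 2)) c f₁ s' ∧
      t + (60 * L + 300) * ∑ x ∈ Finset.range (N + 1), f₁ x ≤
        60 * l + 120 + (60 * L + 300) * ∑ x ∈ Finset.range (N + 1), f x := by
  have hw := S.word
  have hsw := S.size_word
  have hz := C.path.mem_root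
  have hzlt := S.lt_fin hz.1 hz.2.1
  have hzfin := S.fin_le hz.1 hz.2.1
  have hroot : s₀.mem 6 0 ≠ 0 := C.inv.dfs.root.2.1
  -- The vertices below `z` were all unvisited before the climb, so those visited now lie on the
  -- path, and there are at most `l` of them.
  have hcard : numVisited (s₁.mem 6) z (D (4 * z + 2)) ≤ l := by
    refine (Finset.card_le_card (t := (Finset.range l).image q) ?_).trans
      (Finset.card_image_le.trans (Finset.card_range l).le)
    intro v hv
    rw [Finset.mem_filter, Finset.mem_Ico] at hv
    obtain ⟨i, hi, rfl⟩ := C.mem_path ((S.desc_iff hz.1 hz.2.1).2 hv.1) hv.2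
    exact Finset.mem_image_of_mem _ (Finset.mem_range.2 hi)
  simp (disch := omega) only [listSubtrees, runs_seq, runs_assign, runs_store, eval_const_mod,
    eval_reg, eval_load, eval_add_mod, eval_mul_mod, Nat.mod_eq_of_lt, setReg_reg, setReg_mem,
    setMem_reg, setMem_mem, Nat.reduceEqDiff, reduceIte, hr6, hr7, hT.mem0]
  refine (Runs.loop (fun b s => ∃ u c f₁, SubtreeInv N R Fl dead D A y l z f q s₀ s₁ u c f₁ s ∧
    b = 50 * numVisited (s₁.mem 6) u (D (4 * z + 2)) + (if c = 0 then 50 else 0) +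
      (60 * L + 300) * ∑ x ∈ Finset.range (N + 1), f₁ x) ⟨z, 0, f, ?_, rfl⟩ ?_).mono ?_
  · refine ⟨le_rfl, hzlt.le, by simp, by simp [h19], fun a _ _ => by omega, by simp, ?_,
      fun _ => le_rfl, fun _ _ => rfl, ?_, ?_, ?_, fun v _ _ => by omega⟩
    · simp [h15]
    · intro a v ha hav hA hva
      exact C.inv.tree_size a v ha hav hA ((C.walked.vis a).1 hva).1
    · simp [h15, h16]
    · simp only [setReg_mem, setMem_mem, h15, h16, Nat.reduceEqDiff, reduceIte]
      exact fun _ _ _ => Or.inl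
  · rintro b s ⟨u, c, f₁, h, rfl⟩ hf he
    have e0 := hf.mem 0 rfl
    have e6 := hf.mem 6 rfl
    have e7 := hf.mem 7 rfl
    have e9 := hf.mem 9 rfl
    have r3 := hf.reg 3 rfl
    have r6 := hf.reg 6 rfl
    have r7 := hf.reg 7 rfl
    have r11 := hf.reg 11 rfl
    have r13 := hf.reg 13 rfl
    have r27 := hf.reg 27 rfl
    simp [hT.mem0, hT.mem9, hT.reg3, hr6, hr7] at e0 e6 e7 e9 r3 r6 r7 r11 r13 r27
    have r20 := h.reg20
    have hge := h.ge
    simp (disch := omega) only [eval_lt_mod, bit_mod, eval_reg, r20, r27, ite_ne_zero] at he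
    have hzu := (S.desc_iff hz.1 hz.2.1).2 ⟨h.ge, he⟩
    have hu1 : 1 ≤ u := by omega
    have huN := hzu.2.1
    have hult := S.lt_fin hu1 huN
    have huf := S.fin_le hu1 huN
    refine Runs.hide fun Q hQ => ?_
    simp (disch := omega) only [runs_cond, runs_seq, runs_assign, runs_store, eval_const_mod,
      eval_reg, eval_load, eval_add_mod, eval_mul_mod, eval_sub, eval_lt_mod, bit_mod,
      Nat.mod_eq_of_lt, setReg_reg, setMem_reg, Nat.reduceEqDiff, reduceIte, r6, r7,
      r20, r27, e0, e6, ite_ne_zero, ite_eq_zero]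
    refine ⟨fun hv => ?_, fun hv => ⟨fun hbig => ?_, fun hsmall => ?_⟩⟩
    · refine hQ _ _ ⟨_, ⟨u + 1, c, f₁, step_skip h he hv (by simp) rfl, rfl⟩, ?_⟩
      rw [numVisited_succ he hv]
      simp only [Expr.cost]
      omega
    · obtain ⟨rfl, h'⟩ := C.step_large h he hv hbig
        (s' := ((s.setReg 21 (D (4 * u + 2))).setMem 19 y u).setReg 20 (D (4 * u + 2)))
        (by simp) (by simp) (by simp) (by simp)
      refine hQ _ _ ⟨_, ⟨_, _, _, h', rfl⟩, ?_⟩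
      have := numVisited_mono (vis := s₁.mem 6) (b := D (4 * z + 2)) hult.le
      rw [if_pos rfl, if_neg (by omega)]
      simp only [Expr.cost]
      omega
    · have hsize : 2 * (D (4 * u + 2) - u) ≤ D (4 * z + 2) - z := by omega
      have hzu' : z < u := lt_of_le_of_ne hge fun e => C.visited_root (e ▸ hv)
      have hdu : ∀ v, u ≤ v → v < D (4 * u + 2) → Desc N (fun b => D (4 * b + 1)) u v :=
        fun v h1 h2 => (S.desc_iff hu1 huN).2 ⟨h1, h2⟩
      have hsub := sum_sub_one_Ico (f := f₁) (a := u) (S.fin_le hu1 huN)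
        fun v h1 h2 => (C.pos_f h he hsize (hdu v h1 h2)).1
      have hcnt := h.count
      have hcap : ∀ x, min (u - 1) (max x (u - 1)) = u - 1 := fun x => by omega
      refine (S.runs_batch (Fl := Fl) (a := u) (b := D (4 * u + 2)) (lo := z) (hi := u - 1)
        (fl := u - 1) (up := 1) (T := T) (att := att) (by simpa using e0) (by simpa using r3)
        (by simp [r20]) (by simp) (by simpa using r11) (by simpa using r13) (by simp) (by simp)
        (by simpa using e9) hu1 hult.le huf (by omega) (by omega)
        (fun u h1 h2 => (S.att_le h1 h2).trans h2) ?_ hTw ?_ ?_).use ?_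
      · simp only [setReg_mem]
        omega
      · simpa [e7] using hT.bad
      · intro v x x' h1 h2 _ _ _ _ _ _ _ hF
        exact absurd (C.mem_subtree (hzu.trans (hdu v h1 h2))).2 (S.failed_mem hF).2.2
      · intro t s' ⟨ht, hr20, hsum, hmono, hsound, hcompl⟩ hf'
        simp only [setReg_mem, e6, hcap] at hsum hmono hsound hcompl
        obtain ⟨hfs, h'⟩ := C.step_small h he hv hsize hr20 (hf'.mem 19 rfl) hsum hmono hsound
          (by simpa using hcompl)
        refine hQ _ _ ⟨_, ⟨_, _, _, h', rfl⟩, ?_⟩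
        have := numVisited_mono (vis := s₁.mem 6) (b := D (4 * z + 2)) hult.le
        rw [← hfs, Nat.mul_add]
        simp only [Expr.cost]
        have h1 : (60 * L + 300) * (D (4 * u + 2) - u) = (D (4 * u + 2) - u) * (60 * L + 200) +
            (D (4 * u + 2) - u) * 100 := by ring
        omega
  · rintro t s' ⟨hf, he, b, ⟨u, c, f₁, h, rfl⟩, hb⟩
    have r27 := hf.reg 27 rfl
    simp at r27
    simp (disch := omega) only [eval_lt_mod, bit_mod, eval_reg, r27, h.reg20, ite_eq_zero] at he
    obtain rfl : u = D (4 * z + 2) := le_antisymm h.le (not_lt.1 he)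
    refine ⟨c, f₁, h, ?_⟩
    simp only [Expr.cost] at hb ⊢
    rw [if_pos trivial] at hb
    omega

end SubtreeCtx

end

/-- Visit a vertex of an unvisited subtree. -/
def visitTree : Program := walkUp ;; listSubtrees

theorem Setup.runs_visitTree {w N L K M : ℕ} {R Fl : ℕ → ℕ → Prop} {dead : ℕ → Prop}
    {D A att aord aidx run : ℕ → ℕ} (S : Setup w N L K M R Fl dead D A att aord aidx run)
    {s : State} {y d T : ℕ} {f g : ℕ → ℕ} (hT : Tables N K Fl D A att aord aidx run s)
    (h : SearchInv N K M R Fl dead D A aord aidx run y d f g s) (hy : s.reg 7 = y)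
    (hy1 : 1 ≤ y) (hyN : y ≤ N) (hv : s.mem 6 y = 0) (hA : A y = 0)
    (hadj : LiveAdj N R Fl dead y (s.reg 6))
    (hpot : potential N K d f g s ≤ T) (hTw : T * (N + 1) + N < 2 ^ w) :
    Runs w visitTree s fun t s' => ∃ d' f' g' l m,
      SearchInv N K M R Fl dead D A aord aidx run 0 d' f' g' s' ∧ 1 ≤ l ∧
      t ≤ (60 * L + 300) * m + 110 * l + 140 ∧
      potential N K d' f' g' s' + (m + l) ≤ potential N K d f g s := by
  rw [visitTree, runs_seq]
  refine (S.runs_walkUp hT h hy hy1 hyN hv hA hadj).use ?_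
  rintro t₁ s₁ ⟨l, q, ht₁, hW, hP⟩ hf₁
  obtain ⟨z, hz⟩ : ∃ z, s₁.reg 6 = z := ⟨_, rfl⟩
  rw [hz] at hP
  have C : SubtreeCtx S s s₁ y d l z f g q := ⟨h, hW, hP⟩
  have hzr := hP.mem_root
  have hroot : s.mem 6 0 ≠ 0 := h.dfs.root.2.1
  have hcount : ∑ x ∈ Finset.range (N + 1), s.mem 15 x + ∑ x ∈ Finset.range (N + 1), f x ≤ T := by
    unfold potential at hpot
    omega
  refine (C.runs_listSubtrees (hT.frame hf₁ rfl) hz ((hf₁.reg 7 rfl).trans hy) (hf₁.mem 15 rfl)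
    (hf₁.mem 16 rfl) (hf₁.mem 19 rfl) hcount hTw).use ?_
  rintro t₂ s₂ ⟨c, f₁, hI, ht₂⟩ hf₂
  have e6 := hf₂.mem 6 rfl
  have e13 := (hf₂.mem 13 rfl).trans (hf₁.mem 13 rfl)
  have e14 := (hf₂.mem 14 rfl).trans (hf₁.mem 14 rfl)
  have e18 := (hf₂.mem 18 rfl).trans (hf₁.mem 18 rfl)
  have hW₂ := hW.congr e6 (hf₂.mem 17 rfl) (hf₂.mem 20 rfl) (hf₂.reg 6 rfl)
  have hc19 : s₂.mem 19 y = c := by rw [hI.mem19, Function.update_self]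
  have hsum : ∑ x ∈ Finset.range (N + 1), f₁ x ≤ ∑ x ∈ Finset.range (N + 1), f x :=
    Finset.sum_le_sum fun x _ => hI.le_f x
  obtain ⟨m, hm⟩ := Nat.exists_eq_add_of_le hsum
  refine ⟨d + l, f₁, g, l, m, ?_, hP.pos, ?_, ?_⟩
  · refine h.extend hW₂ hP.pos hP.zero (fun j hj => (hP.mem j hj).2.2.2)
      (fun j hj => (hP.mem j hj).2.1) ⟨hyN, ?_⟩ ?_ ?_ ?_ ?_ ?_ ?_ ?_ hI.sound hI.mono e18 ?_
    · rw [← hP.zero]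
      exact hW₂.vis_new hP.pos
    · intro i hi hiM
      rw [e13, e14, ← h.piece i hi hiM, hW₂.vis]
      refine and_iff_left fun j hj e => ?_
      exact (S.aord_mem hi hiM).2.2.1 (e ▸ (hP.mem j hj).2.2.1)
    · rw [e13, e14]; exact h.piece_run
    · rw [e13, e14]; exact h.piece_len
    · intro u hu1 huN hAu hvu
      by_cases hv0 : s.mem 6 u = 0
      · have hex : ∃ j < l, u = q j := by
          by_contra hc
          exact hvu ((hW₂.vis u).2 ⟨hv0, fun j hj e => hc ⟨j, hj, e⟩⟩)
        obtain ⟨j, hj, rfl⟩ := hex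
        by_cases hjl : j + 1 < l
        · rw [← hP.succ j hjl]
          exact Or.inr (Or.inr (hW₂.vis_new hjl))
        · have : q j = z := by rw [← hP.last]; congr 1; omega
          rw [this]
          exact Or.inr (hP.root.imp_right hW₂.vis_of_vis)
      · exact (h.tree_up u hu1 huN hAu hv0).imp_right (Or.imp_right hW₂.vis_of_vis)
    · rw [e6]; exact hI.size
    · intro x hx
      rw [hI.mem19, Function.update_of_ne hx]
    · intro j hj hc
      rw [hc19] at hc ⊢
      obtain ⟨h1, h2, h3, _⟩ := hI.large hc
      have hzc := (S.desc_iff hzr.1 hzr.2.1).2 ⟨h1, h2⟩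
      refine ⟨(hP.mem j hj).2.2.1, hzc.2.1, (C.mem_subtree hzc).2, fun u hu => ?_⟩
      rw [e6]
      exact C.unvisited hzc h3 hu
    · intro j hj v hqv hv0
      have hqj := hP.mem j hj
      have hv0' : v ≠ 0 := fun e => hW₂.vis_of_vis hroot (e ▸ hv0)
      have hzq := hP.desc_root S.toIsIndex hj
      obtain ⟨hR, hFl⟩ : R (q j) v ∧ ¬Fl (q j) v := by
        rcases hqv.2.2.2.2.2 with h1 | h1 | h1
        · omega
        · exact absurd h1 hv0'
        · exact h1
      rw [hc19]
      rcases lt_trichotomy v (q j) with hlt | heq | hgt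
      -- A smaller neighbour is an ancestor. Outside of `A`, the ancestors above `z` were visited
      -- before and those from `z` on belong to the path, so an unvisited one lies in `A`.
      · refine Or.inr (Or.inl ⟨hlt, fun hAv => ?_⟩)
        have hd := S.desc_of_adj (S.symm hR) hlt
        by_cases hvz : v < z
        · exact C.above (by omega) hvz (hd.mid hvz.le hzq.1) hAv ((hW₂.vis v).1 hv0).1
        · obtain ⟨i, hi, rfl⟩ := hP.mem_of_desc S.toIsIndex hj (by omega) hd
          exact hW₂.vis_new hi hv0
      · exact absurd heq.symm hqv.2.2.1
      · have hd := (S.desc_iff hzr.1 hzr.2.1).1 (hzq.trans (S.desc_of_adj hR hgt))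
        rw [e6] at hv0
        rcases hI.cover v hd.1 hd.2 hv0 with hc | hc
        · exact Or.inr (Or.inr hc)
        · exact Or.inl (hc j hj hqv hgt)
  · rw [hm, Nat.mul_add] at ht₂
    omega
  -- The `m` units that the exponents lose count twice: one half pays for the new entries, the other
  -- half for the time. The path itself contributes `-2 * l` for the visited vertices and `+l` for
  -- the depth.
  · have h1 := hW₂.card
    have h2 := hI.count
    unfold potential
    rw [e18]
    omega

/-! ### The cost of a visit -/

/-- Visit the unvisited vertex in register `7`, a neighbour of the current vertex. -/
def visit : Program := cond (load 8 (reg 7)) visitPath visitTree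

/-- A unit of potential buys `300 * (L + 1)` steps. The loss is `N + 2 + l` for a run and `m + l`
with `l ≥ 1` for a subtree, which covers the binary searches, the vertices of the path and the
constants. -/
theorem Setup.runs_visit {w N L K M : ℕ} {R Fl : ℕ → ℕ → Prop} {dead : ℕ → Prop}
    {D A att aord aidx run : ℕ → ℕ} (S : Setup w N L K M R Fl dead D A att aord aidx run)
    {s : State} {y d T : ℕ} {f g : ℕ → ℕ} (hT : Tables N K Fl D A att aord aidx run s)
    (h : SearchInv N K M R Fl dead D A aord aidx run y d f g s) (hy : s.reg 7 = y)
    (hy1 : 1 ≤ y) (hyN : y ≤ N) (hv : s.mem 6 y = 0)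
    (hadj : LiveAdj N R Fl dead y (s.reg 6))
    (hpot : potential N K d f g s ≤ T) (hTw : T * (N + 1) + N < 2 ^ w) :
    Runs w visit s fun t s' => ∃ d' f' g',
      SearchInv N K M R Fl dead D A aord aidx run 0 d' f' g' s' ∧
      t + 300 * (L + 1) * potential N K d' f' g' s' ≤ 300 * (L + 1) * potential N K d f g s ∧
      potential N K d' f' g' s' + 1 ≤ potential N K d f g s := by
  rw [visit, runs_cond]
  simp only [eval_load, eval_reg, hy, hT.mem8]
  refine ⟨fun hA => ?_, fun hA => ?_⟩
  · refine (S.runs_visitPath hT h hy hy1 hyN hv hA hadj hpot hTw).mono ?_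
    rintro t s' ⟨d', f', g', l, h1, h2, h3⟩
    refine ⟨d', f', g', h1, ?_, by omega⟩
    have h4 := Nat.mul_le_mul_left (300 * (L + 1)) h3
    have h5 : N * (60 * L + 200) ≤ 300 * (L + 1) * N := by nlinarith
    have h6 : 300 * l ≤ 300 * (L + 1) * l := by nlinarith
    have h7 : 300 * (L + 1) * (potential N K d' f' g' s' + (N + 2 + l)) =
      300 * (L + 1) * potential N K d' f' g' s' + 300 * (L + 1) * N + 600 * (L + 1) +
        300 * (L + 1) * l := by ring
    simp only [Expr.cost]
    omega
  · refine (S.runs_visitTree hT h hy hy1 hyN hv hA hadj hpot hTw).mono ?_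
    rintro t s' ⟨d', f', g', l, m, h1, hl, h2, h3⟩
    refine ⟨d', f', g', h1, ?_, by omega⟩
    have h4 := Nat.mul_le_mul_left (300 * (L + 1)) h3
    have h5 : (60 * L + 300) * m ≤ 300 * (L + 1) * m := Nat.mul_le_mul_right _ (by omega)
    have h6 : 300 * l ≤ 300 * (L + 1) * l := by nlinarith
    have h7 : 300 * (L + 1) * (potential N K d' f' g' s' + (m + l)) =
      300 * (L + 1) * potential N K d' f' g' s' + 300 * (L + 1) * m + 300 * (L + 1) * l := by ring
    simp only [Expr.cost]
    omega

/-- If `u ≠ v`, then `v` would be periodic under `par`. But the iterates of `v` reach the fixed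
point `0`, so `v = 0`, and then `u = 0` as well. -/
theorem DFSState.anc_antisymm {H : ℕ → ℕ → Prop} {V : ℕ → Prop} {par : ℕ → ℕ} {cur : ℕ}
    (h : DFSState H V par cur) {u v : ℕ} (hv : V v) (huv : IsAncestor par u v)
    (hvu : IsAncestor par v u) : u = v := by
  obtain ⟨i, rfl⟩ := huv
  obtain ⟨j, hj⟩ := hvu
  rw [← Function.iterate_add_apply] at hj
  by_cases hij : j + i = 0
  · simp [show i = 0 by omega]
  · obtain ⟨m, hm⟩ := h.anc v hv
    have h0 : ∀ k, par^[k] 0 = 0 := fun k => Function.iterate_fixed h.par_root k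
    have hk : par^[(j + i) * m] v = v := by
      rw [Function.iterate_mul]
      exact Function.iterate_fixed hj m
    obtain ⟨k, hk'⟩ : ∃ k, (j + i) * m = k + m := ⟨(j + i - 1) * m, by
      rw [Nat.sub_mul, one_mul, Nat.sub_add_cancel (Nat.le_mul_of_pos_left _ (by omega))]⟩
    rw [hk', Function.iterate_add_apply, hm, h0] at hk
    rw [← hk, h0]

/-! ### The invariant under the removal of an entry, the end of an inspection, and backtracking -/

namespace SearchInv

variable {N K M : ℕ} {R Fl : ℕ → ℕ → Prop} {dead : ℕ → Prop} {D A aord aidx run : ℕ → ℕ}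
  {y d : ℕ} {f g : ℕ → ℕ} {s : State}

theorem congr (h : SearchInv N K M R Fl dead D A aord aidx run y d f g s) {s' : State}
    (hm : s'.mem = s.mem) (hr : s'.reg 6 = s.reg 6) :
    SearchInv N K M R Fl dead D A aord aidx run y d f g s' := by
  obtain ⟨r, m⟩ := s
  obtain ⟨r', m'⟩ := s'
  simp only at hm hr
  subst hm
  constructor <;> simp only [hr]
  exacts [h.dfs, h.depth, h.dead_vis, h.piece, h.piece_run, h.piece_len, h.tree_up, h.tree_size,
    h.heavy_zero, h.group, h.heavy, h.listed, h.pieces_root, h.pieces_zero, h.cover]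

theorem weaken (h : SearchInv N K M R Fl dead D A aord aidx run y d f g s) {y' : ℕ}
    (hy : s.mem 6 y ≠ 0) : SearchInv N K M R Fl dead D A aord aidx run y' d f g s :=
  { h with cover := fun z v h1 h2 h3 _ => h.cover z v h1 h2 h3 fun e => hy (e ▸ h3) }

/-- An entry of the list of the current vertex is removed. -/
theorem popEntry (h : SearchInv N K M R Fl dead D A aord aidx run 0 d f g s) {s' : State} {c : ℕ}
    (hc : s.mem 15 (s.reg 6) = c + 1) (hr : s'.reg 6 = s.reg 6)
    (h15 : s'.mem 15 = Function.update (s.mem 15) (s.reg 6) c)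
    (hm : ∀ a, a ≠ 15 → s'.mem a = s.mem a)
    (hy : s.mem 16 (c * (N + 1) + s.reg 6) = y) :
    SearchInv N K M R Fl dead D A aord aidx run y d f g s' ∧
      LiveAdj N R Fl dead (s.reg 6) y ∧ potential N K d f g s' + 1 = potential N K d f g s := by
  have hcN : s.reg 6 ≤ N := h.dfs.cur_mem.1
  have hl : ∀ z v, Listed N (s'.mem 15) (s'.mem 16) z v → Listed N (s.mem 15) (s.mem 16) z v := by
    rintro z v ⟨i, hi, rfl⟩
    rw [h15] at hi
    refine ⟨i, ?_, by rw [hm 16 (by omega)]⟩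
    by_cases hz : z = s.reg 6
    · subst hz
      rw [Function.update_self] at hi
      omega
    · rwa [Function.update_of_ne hz] at hi
  have hl' : ∀ z v, Listed N (s.mem 15) (s.mem 16) z v → v ≠ y →
      Listed N (s'.mem 15) (s'.mem 16) z v := by
    rintro z v ⟨i, hi, rfl⟩ hv
    rw [h15, hm 16 (by omega)]
    refine ⟨i, ?_, rfl⟩
    by_cases hz : z = s.reg 6
    · subst hz
      rw [Function.update_self]
      refine lt_of_le_of_ne (by omega) fun e => hv ?_
      rw [e, hy]
    · rwa [Function.update_of_ne hz]
  have hadj := h.listed (s.reg 6) y hcN ⟨c, by omega, hy⟩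
  refine ⟨?_, ?_, ?_⟩
  · constructor <;> try simp only [hr, hm 6, hm 13, hm 14, hm 17, hm 18, hm 19, hm 20, ne_eq,
      Nat.reduceEqDiff, not_false_eq_true]
    · exact h.dfs
    · exact h.depth
    · exact h.dead_vis
    · exact h.piece
    · exact h.piece_run
    · exact h.piece_len
    · exact h.tree_up
    · exact h.tree_size
    · exact h.heavy_zero
    · exact h.group
    · exact h.heavy
    · exact fun z v hz hv => h.listed z v hz (hl z v hv)
    · exact h.pieces_root
    · exact h.pieces_zero
    · intro z v hz hv h0 hvy
      have hv0 : v ≠ 0 := by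
        rintro rfl
        exact h.dfs.root.2.1 h0
      rcases h.cover z v hz hv h0 hv0 with ⟨z', h1, h2, h3⟩ | h1 | h1
      · exact Or.inl ⟨z', h1, h2, hl' _ _ h3 hvy⟩
      · exact Or.inr (Or.inl h1)
      · exact Or.inr (Or.inr h1)
  · exact hadj
  · have := sum_update (f := s.mem 15) hcN c
    unfold potential
    rw [h15, hm 18 (by omega), hm 6 (by omega)]
    omega

/-- The current vertex has no unvisited neighbours in the run that is its turn. -/
theorem nextPiece (h : SearchInv N K M R Fl dead D A aord aidx run 0 d f g s) {s' : State} {ρ : ℕ}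
    (hρ : s.mem 18 (s.reg 6) = ρ) (hρK : ρ < K) (hr : s'.reg 6 = s.reg 6)
    (h18 : s'.mem 18 = Function.update (s.mem 18) (s.reg 6) (ρ + 1))
    (hm : ∀ a, a ≠ 18 → s'.mem a = s.mem a)
    (hno : ∀ v, LiveAdj N R Fl dead (s.reg 6) v → s.mem 6 v = 0 → v < s.reg 6 → A v ≠ 0 →
      run (aidx v) ≠ ρ) :
    SearchInv N K M R Fl dead D A aord aidx run 0 d f g s' ∧
      potential N K d f g s' + 1 = potential N K d f g s := by
  have hcN : s.reg 6 ≤ N := h.dfs.cur_mem.1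
  have hle : ∀ z, z ≠ s.reg 6 → s'.mem 18 z = s.mem 18 z := fun z hz => by
    rw [h18, Function.update_of_ne hz]
  refine ⟨?_, ?_⟩
  · constructor <;> try simp only [hr, hm 6, hm 13, hm 14, hm 15, hm 16, hm 17, hm 19, hm 20, ne_eq,
      Nat.reduceEqDiff, not_false_eq_true]
    · exact h.dfs
    · exact h.depth
    · exact h.dead_vis
    · exact h.piece
    · exact h.piece_run
    · exact h.piece_len
    · exact h.tree_up
    · exact h.tree_size
    · exact h.heavy_zero
    · exact h.group
    · exact h.heavy
    · exact h.listed
    · have := h.pieces_root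
      rw [hle]
      · exact this
      · intro e
        rw [e] at this
        omega
    · intro z hz h0
      rw [hle]
      · exact h.pieces_zero z hz h0
      · rintro rfl
        exact h.dfs.cur_mem.2.1 h0
    · intro z v hz hv h0 hvy
      rcases h.cover z v hz hv h0 hvy with h1 | ⟨h1, h2, h3⟩ | h1
      · exact Or.inl h1
      · refine Or.inr (Or.inl ⟨h1, h2, ?_⟩)
        by_cases hzc : z = s.reg 6
        · subst hzc
          rw [h18, Function.update_self]
          exact lt_of_le_of_ne (hρ ▸ h3) (hno v hv h0 h1 h2).symm
        · rwa [hle z hzc]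
      · exact Or.inr (Or.inr h1)
  · have := Finset.sum_update_of_mem (Finset.mem_range.2 (Nat.lt_succ_of_le hcN))
      (fun z => K - s.mem 18 z) (K - (ρ + 1))
    have h1 := sum_update (f := fun z => K - s.mem 18 z) hcN (K - (ρ + 1))
    have h2 : ∑ z ∈ Finset.range (N + 1),
        Function.update (fun z => K - s.mem 18 z) (s.reg 6) (K - (ρ + 1)) z =
        ∑ z ∈ Finset.range (N + 1), (K - s'.mem 18 z) := by
      refine Finset.sum_congr rfl fun z _ => ?_
      by_cases hz : z = s.reg 6
      · subst hz
        rw [h18, Function.update_self, Function.update_self]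
      · rw [Function.update_of_ne hz, hle z hz]
    unfold potential
    rw [← h2, hm 15 (by omega), hm 6 (by omega)]
    simp only [hρ] at h1
    omega

/-- All neighbours of the current vertex are visited. -/
theorem back (h : SearchInv N K M R Fl dead D A aord aidx run 0 d f g s) {s' : State}
    (h0 : s.reg 6 ≠ 0) (hm : s'.mem = s.mem) (hr : s'.reg 6 = s.mem 17 (s.reg 6))
    (hcnt : s.mem 15 (s.reg 6) = 0)
    (hall : ∀ v, LiveAdj N R Fl dead (s.reg 6) v → s.mem 6 v ≠ 0) :
    SearchInv N K M R Fl dead D A aord aidx run 0 (d - 1) f g s' ∧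
      potential N K (d - 1) f g s' + 1 = potential N K d f g s := by
  have hd : d ≠ 0 := by
    rintro rfl
    exact h0 h.depth
  obtain ⟨r, m⟩ := s
  obtain ⟨r', m'⟩ := s'
  simp only at hm hr h0 hcnt hall
  subst hm
  refine ⟨?_, ?_⟩
  · constructor <;> simp only [hr]
    · refine h.dfs.pop fun u hu => ⟨hu.2.1, hall u hu, hu.2.2.2.2.1⟩
    · rw [← Function.iterate_succ_apply, Nat.succ_eq_add_one, Nat.sub_add_cancel (by omega)]
      exact h.depth
    · exact h.dead_vis
    · exact h.piece
    · exact h.piece_run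
    · exact h.piece_len
    · exact h.tree_up
    · exact h.tree_size
    · exact h.heavy_zero
    · exact h.group
    · exact h.heavy
    · exact h.listed
    · exact h.pieces_root
    · exact h.pieces_zero
    · intro z v hz hv h0 hvy
      rcases h.cover z v hz.parent hv h0 hvy with ⟨z', h1, h2, h3⟩ | h1
      · refine Or.inl ⟨z', ?_, h2, h3⟩
        -- An entry that serves a vertex above cannot sit at the vertex that is being left, as the
        -- list there is empty. It sits at an ancestor of the new current vertex.
        rcases h1.eq_or_parent with rfl | h1
        · obtain ⟨i, hi, _⟩ := h3
          simp only [hcnt] at hi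
          omega
        · exact h1
      · exact Or.inr h1
  · simp only [potential]
    omega

/-- The current vertex has no entries and no runs left. -/
theorem cover_heavy {w L : ℕ} {att : ℕ → ℕ}
    (S : Setup w N L K M R Fl dead D A att aord aidx run)
    (h : SearchInv N K M R Fl dead D A aord aidx run 0 d f g s)
    (hcnt : s.mem 15 (s.reg 6) = 0) (hpz : K ≤ s.mem 18 (s.reg 6)) {v : ℕ}
    (hv : LiveAdj N R Fl dead (s.reg 6) v) (h0 : s.mem 6 v = 0) :
    s.mem 19 (s.mem 20 (s.reg 6)) ≠ 0 ∧
      Desc N (fun b => D (4 * b + 1)) (s.mem 19 (s.mem 20 (s.reg 6))) v := by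
  have hv0 : v ≠ 0 := by
    rintro rfl
    exact h.dfs.root.2.1 h0
  rcases h.cover _ v (IsAncestor.refl _) hv h0 hv0 with ⟨z', h1, h2, i, h3, _⟩ | ⟨_, h1, h2⟩ | h1
  · obtain rfl := h.dfs.anc_antisymm h.dfs.cur_mem h1 h2
    omega
  · have := S.aidx_mem (by omega) hv.2.1 h1
    have := S.run_lt this.1 this.2.1
    omega
  · exact h1

/-- If the heavy subtree is visited, then so are all neighbours of the current vertex. -/
theorem all_of_heavy {w L : ℕ} {att : ℕ → ℕ}
    (S : Setup w N L K M R Fl dead D A att aord aidx run)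
    (h : SearchInv N K M R Fl dead D A aord aidx run 0 d f g s)
    (hcnt : s.mem 15 (s.reg 6) = 0) (hpz : K ≤ s.mem 18 (s.reg 6))
    (hc : s.mem 6 (s.mem 19 (s.mem 20 (s.reg 6))) ≠ 0) :
    ∀ v, LiveAdj N R Fl dead (s.reg 6) v → s.mem 6 v ≠ 0 := by
  intro v hv h0
  obtain ⟨h1, h2⟩ := h.cover_heavy S hcnt hpz hv h0
  obtain ⟨h3, h4, h5, h6, h7⟩ := h.heavy _ h.dfs.cur_mem h1
  obtain ⟨c, hc'⟩ : ∃ c, s.mem 19 (s.mem 20 (s.reg 6)) = c := ⟨_, rfl⟩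
  rw [hc'] at h1 h2 h5 h6 h7 hc
  -- Being visited spreads down from the root `c` of the heavy subtree: a visited vertex of this
  -- subtree is not an ancestor of the current vertex, so it is finished, and its children are
  -- joined to it by surviving edges.
  refine S.desc_induction (P := fun u => s.mem 6 u ≠ 0) (by omega) hc ?_ v h2 h0
  intro u hcu hu hp
  have hcp : c ≤ D (4 * u + 1) := hu.2.2 u hcu le_rfl
  have hlt := S.par_lt (b := u) (by omega) hu.2.1
  have hdp := hu.parent hcu hlt
  have hAu : A u = 0 := by
    by_contra hA
    exact S.A_of_desc (by omega) hA hu h6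
  have hAp : A (D (4 * u + 1)) = 0 := by
    by_contra hA
    exact S.A_of_desc (by omega) hA hdp h6
  have hdead : ¬dead (D (4 * u + 1)) := fun hd => S.dead_mem hd hdp.2.1 hAp
  refine (h.dfs.finished _ ⟨hdp.2.1, hp, hdead⟩ (h7 _ hdp hp) u ⟨hdp.2.1, hu.2.1, by omega, hdead,
    fun hd => S.dead_mem hd hu.2.1 hAu, Or.inr (Or.inr ⟨S.symm ?_, fun hF => ?_⟩)⟩).2.1
  · exact S.par_adj (by omega) hu.2.1 (by omega)
  · exact (S.failed_mem hF).2.2 hAp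

end SearchInv

/-! ### Finding the next vertex -/

/-- Take the last entry of the list of the current vertex. -/
def popStep : Program :=
  store 15 (reg 6) (load 15 (reg 6) -ᵉ const 1) ;;
  assign 7 (load 16 (load 15 (reg 6) *ᵉ (reg 3 +ᵉ const 1) +ᵉ reg 6))

/-- Look for an unvisited neighbour of the current vertex in the run that is its turn. -/
def pieceStep : Program :=
  assign 20 (load 18 (reg 6)) ;; assign 21 (load 13 (reg 20)) ;; assign 22 (load 14 (reg 20)) ;;
  cond (reg 22 <ᵉ reg 21) skip
    (assign 10 (reg 6) ;; assign 11 (load 10 (reg 21)) ;; assign 12 (load 10 (reg 22)) ;;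
     cond (load 9 (reg 6) <ᵉ reg 12) (assign 12 (load 9 (reg 6))) skip ;; assign 13 (const 1) ;;
     find ;; assign 7 (reg 14)) ;;
  cond (reg 7) skip (store 18 (reg 6) (load 18 (reg 6) +ᵉ const 1))

/-- Look for an unvisited neighbour of the current vertex in the heavy subtree. -/
def heavyStep : Program :=
  assign 20 (load 19 (load 20 (reg 6))) ;;
  cond (load 6 (reg 20)) skip
    (assign 10 (reg 6) ;; assign 11 (reg 20) ;;
     assign 12 (load 0 (const 4 *ᵉ reg 20 +ᵉ const 2) -ᵉ const 1) ;; assign 13 (const 1) ;;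
     find ;; assign 7 (reg 14)) ;;
  cond (reg 7) skip (assign 9 (const 1))

/-- Look for an unvisited neighbour of the current vertex, to be left in register `7`; register `9` is
set when there is none. -/
def probe : Program :=
  assign 7 (const 0) ;; assign 9 (const 0) ;;
  cond (load 15 (reg 6)) popStep (cond (load 18 (reg 6) <ᵉ reg 4) pieceStep heavyStep)

/-- The vertex `y` has been found from the state `s`. -/
structure Found (N K M : ℕ) (R Fl : ℕ → ℕ → Prop) (dead : ℕ → Prop)
    (D A aord aidx run : ℕ → ℕ) (d : ℕ) (f g : ℕ → ℕ) (s : State) (y : ℕ) (s' : State) : Prop where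
  reg6 : s'.reg 6 = s.reg 6
  reg7 : s'.reg 7 = y
  reg9 : s'.reg 9 = 0
  inv : SearchInv N K M R Fl dead D A aord aidx run y d f g s'
  adj : y ≠ 0 → LiveAdj N R Fl dead (s.reg 6) y
  pot : potential N K d f g s' ≤ potential N K d f g s
  lt : potential N K d f g s' + 1 ≤ potential N K d f g s ∨ s'.mem 6 y = 0

/-- There is no unvisited neighbour. -/
structure Exhausted (N K M : ℕ) (R Fl : ℕ → ℕ → Prop) (dead : ℕ → Prop)
    (D A aord aidx run : ℕ → ℕ) (d : ℕ) (f g : ℕ → ℕ) (s s' : State) : Prop where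
  reg6 : s'.reg 6 = s.reg 6
  reg7 : s'.reg 7 = 0
  reg9 : s'.reg 9 = 1
  inv : SearchInv N K M R Fl dead D A aord aidx run 0 d f g s'
  cnt : s'.mem 15 (s'.reg 6) = 0
  all : ∀ v, LiveAdj N R Fl dead (s'.reg 6) v → s'.mem 6 v ≠ 0
  pot : potential N K d f g s' = potential N K d f g s

section

variable {w N L K M : ℕ} {R Fl : ℕ → ℕ → Prop} {dead : ℕ → Prop}
    {D A att aord aidx run : ℕ → ℕ} {s : State} {d T : ℕ} {f g : ℕ → ℕ}

theorem potential_congr {s s' : State} (h : s'.mem = s.mem) :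
    potential N K d f g s' = potential N K d f g s := by
  unfold potential
  rw [h]

theorem Setup.runs_popStep (S : Setup w N L K M R Fl dead D A att aord aidx run)
    (hT : Tables N K Fl D A att aord aidx run s)
    (h : SearchInv N K M R Fl dead D A aord aidx run 0 d f g s) (h9 : s.reg 9 = 0)
    (hpot : potential N K d f g s ≤ T) (hTw : T * (N + 1) + N < 2 ^ w)
    (hc : s.mem 15 (s.reg 6) ≠ 0) :
    Runs w popStep s fun t s' => t ≤ 30 ∧
      ∃ y, Found N K M R Fl dead D A aord aidx run d f g s y s' := by
  obtain ⟨c, hc'⟩ := Nat.exists_eq_succ_of_ne_zero hc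
  have hcN : s.reg 6 ≤ N := h.dfs.cur_mem.1
  have hsw := S.size_word
  have h3 := hT.reg3
  have hcT : c + 1 ≤ T := by
    have := le_sum (s.mem 15) hcN
    unfold potential at hpot
    omega
  have hmul : c * (N + 1) ≤ T * (N + 1) := Nat.mul_le_mul_right _ (by omega)
  refine Runs.hide fun Q hQ => ?_
  simp (disch := omega) [popStep, hc', Nat.mod_eq_of_lt, h3]
  obtain ⟨y, hy⟩ : ∃ y, s.mem 16 (c * (N + 1) + s.reg 6) = y := ⟨_, rfl⟩
  rw [hy]
  obtain ⟨h1, h2, h3⟩ := h.popEntry (s' := ((s.setMem 15 (s.reg 6) c).setReg 7 y)) hc' (by simp)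
    (by simp) (by intro a ha; simp [ha]) hy
  exact hQ _ _ ⟨by omega, y, by simp, by simp, by simpa using h9, h1, fun _ => h2, by omega,
    Or.inl (by omega)⟩

/-- What is left of a run is an interval of indices, so by `Setup.mem_path` every neighbour between
its ends, capped by `att`, is an unvisited vertex of the run. The search thus either finds a vertex
to visit or settles this run for the current vertex for good, which costs one unit of potential. -/
theorem Setup.runs_pieceStep (S : Setup w N L K M R Fl dead D A att aord aidx run)
    (hT : Tables N K Fl D A att aord aidx run s)
    (h : SearchInv N K M R Fl dead D A aord aidx run 0 d f g s) (h9 : s.reg 9 = 0)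
    (h7 : s.reg 7 = 0) (hρK : s.mem 18 (s.reg 6) < K) :
    Runs w pieceStep s fun t s' => t ≤ 60 * L + 200 ∧
      ∃ y, Found N K M R Fl dead D A aord aidx run d f g s y s' := by
  have hcN : s.reg 6 ≤ N := h.dfs.cur_mem.1
  -- The counter of the root has the value `K` from the start, so the root never inspects runs. It
  -- has no list of neighbours to search in.
  have hc1 : 1 ≤ s.reg 6 := by
    by_contra hc
    have := h.pieces_root
    rw [show s.reg 6 = 0 by omega] at hρK
    omega
  have hsw := S.size_word
  have hw := S.word
  have hKN := S.K_le
  obtain ⟨cur, hcur⟩ : ∃ c, s.reg 6 = c := ⟨_, rfl⟩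
  obtain ⟨ρ, hρ⟩ : ∃ ρ, s.mem 18 cur = ρ := ⟨_, rfl⟩
  obtain ⟨a, ha⟩ : ∃ a, s.mem 13 ρ = a := ⟨_, rfl⟩
  obtain ⟨b, hb⟩ : ∃ b, s.mem 14 ρ = b := ⟨_, rfl⟩
  have hpr := h.piece_run ρ (by rw [← hρ, ← hcur]; exact hρK)
  rw [ha, hb] at hpr
  rw [hcur] at hcN hc1 hρK
  rw [hρ] at hρK
  have e9 := hT.mem9
  have e10 := hT.mem10
  have key : ∀ s', s'.reg 6 = cur → s'.mem = s.mem → s'.reg 9 = 0 → s'.reg 7 = 0 →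
      (∀ v, LiveAdj N R Fl dead (s.reg 6) v → s.mem 6 v = 0 → v < s.reg 6 → A v ≠ 0 →
        run (aidx v) ≠ ρ) →
      Runs w (cond (reg 7) skip (store 18 (reg 6) (load 18 (reg 6) +ᵉ const 1))) s'
        fun t s'' => t ≤ 20 ∧ ∃ y, Found N K M R Fl dead D A aord aidx run d f g s y s'' := by
    intro s' h6' hm h9' h7' hno
    refine Runs.hide fun Q hQ => ?_
    simp (disch := omega) [h7', h6', hm, hρ, Nat.mod_eq_of_lt]
    obtain ⟨h1, h2⟩ := h.nextPiece (s' := s'.setMem 18 cur (ρ + 1)) (ρ := ρ) (by rw [hcur, hρ])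
      hρK (by simp [h6', hcur]) (by simp [hm, hcur]) (by intro x hx; simp [hx, hm]) hno
    exact hQ _ _ ⟨by omega, 0, by simp [h6', hcur], by simpa using h7', by simpa using h9', h1,
      by simp, by omega, Or.inl (by omega)⟩
  refine Runs.hide fun Q hQ => ?_
  rw [pieceStep, runs_seq, runs_assign, runs_seq, runs_assign, runs_seq, runs_assign, runs_seq,
    runs_cond]
  simp (disch := omega) only [eval_load, eval_reg, setReg_reg, setReg_mem, Nat.reduceEqDiff,
    reduceIte, hcur, hρ, ha, hb, eval_lt_mod, bit_mod, ite_ne_zero, ite_eq_zero, Expr.cost]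
  refine ⟨fun hba => ?_, fun hab => ?_⟩
  · rw [runs_skip]
    refine Runs.mono (key _ (by simp [hcur]) rfl (by simpa using h9) (by simpa using h7) ?_) ?_
    swap
    · intro t s' ht
      refine hQ _ _ ⟨?_, ht.2⟩
      omega
    intro v hv hv0 hvc hA hr
    have hm := S.aidx_mem (v := v) (Nat.pos_of_ne_zero fun e => h.dfs.root.2.1 (e ▸ hv0)) hv.2.1 hA
    have := (h.piece _ hm.1 hm.2.1).1 (by rw [hm.2.2]; exact hv0)
    rw [hr, ha, hb] at this
    omega
  · obtain ⟨ha1, hbM, hra, hrb⟩ := hpr (by omega)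
    simp (disch := omega) only [runs_seq, runs_assign, runs_cond, runs_skip, eval_load, eval_reg,
      setReg_reg, setReg_mem, Nat.reduceEqDiff, reduceIte, hcur, e9, e10, eval_lt_mod, bit_mod,
      ite_ne_zero, ite_eq_zero, Expr.cost, eval_const_mod, Nat.mod_eq_of_lt]
    have hrun : ∀ k, a ≤ k → k ≤ b → run k = ρ := fun k h1 h2 =>
      (S.run_between ha1 h1 h2 hbM (hra.trans hrb.symm)).trans hra
    have main : ∀ (s₁ : State) (hi t₀ : ℕ), s₁.reg 6 = cur → s₁.mem = s.mem → s₁.reg 9 = 0 →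
        s₁.reg 10 = cur → s₁.reg 11 = aord a → s₁.reg 12 = hi → s₁.reg 13 = 1 →
        hi ≤ aord b → hi ≤ att cur → (∀ v, v ≤ aord b → v ≤ att cur → v ≤ hi) → t₀ ≤ 70 →
        Runs w find s₁ fun t' s'' =>
          Runs w (cond (reg 7) skip (store 18 (reg 6) (load 18 (reg 6) +ᵉ const 1)))
            (s''.setReg 7 (s''.reg 14)) fun t'' s' => ∀ t, t ≤ t₀ + t' + t'' → Q t s' := by
      intro s₁ hi t₀ r6 hm r9 r10 r11 r12 r13 hb' hc' hmin ht₀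
      have haN := (S.aord_mem (i := b) (by omega) hbM).2.1
      refine (S.runs_find (by rw [hm, hT.mem0]) r10 r11 r12 r13 (by omega) hc1 hcN
        (by rw [hm]; exact fun j => hT.bad cur j hc1 hcN) ?_).use ?_
      · intro x x' h1 h2 h3 h4 hRx hRx' hF
        obtain ⟨-, -, h5, h6, h7⟩ := S.mem_path (by omega) (by omega) hRx h1 (h2.trans hb')
          (h2.trans hc')
        obtain ⟨-, -, h5', h6', h7'⟩ := S.mem_path (by omega) (by omega) hRx' h3 (h4.trans hb')
          (h4.trans hc')
        have := S.failed_run (i := aidx x) (j := aidx x') (x := cur) (by omega) (by omega)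
          (by omega) (by omega) (by rw [h7]; exact S.failed_symm hF)
          (by rw [hrun _ h5 h6, hrun _ h5' h6'])
        rw [← h7, ← h7', this]
      · intro t₂ s₂ ⟨ht₂, hfound, hnone⟩ hf
        have hm₂ : s₂.mem = s.mem := by
          rw [← hm]
          funext x
          exact hf.mem x rfl
        have r6' := hf.reg 6 rfl
        have r9' := hf.reg 9 rfl
        rw [r6] at r6'
        rw [r9] at r9'
        by_cases h14 : s₂.reg 14 = 0
        · refine Runs.mono (key _ (by simp [r6']) hm₂ (by simp [r9']) (by simp [h14]) ?_)
            fun t s' ht t₃ ht₃ => hQ _ _ ⟨by omega, ht.2⟩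
          intro v hv hv0 hvc hA hr
          have hv1 : 1 ≤ v := Nat.pos_of_ne_zero fun e => h.dfs.root.2.1 (e ▸ hv0)
          have hm := S.aidx_mem hv1 hv.2.1 hA
          have hp := (h.piece _ hm.1 hm.2.1).1 (by rw [hm.2.2]; exact hv0)
          rw [hr, ha, hb] at hp
          have hRF : R cur v ∧ ¬Fl cur v := by
            rw [hcur] at hv
            rcases hv.2.2.2.2.2 with h | h | h
            · omega
            · omega
            · exact h
          have h1 := S.aord_le ha1 hp.1 hm.2.1
          have h2 := S.aord_le hm.1 hp.2 hbM
          rw [hm.2.2] at h1 h2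
          rw [hcur] at hvc
          exact hnone h14 v hRF.1 hRF.2 h1
            (hmin v h2 (S.att_max hv1 hA (S.desc_of_adj (S.symm hRF.1) hvc)))
        · obtain ⟨hR, hnF, h1, h2, -⟩ := hfound h14
          obtain ⟨y, hy⟩ : ∃ y, s₂.reg 14 = y := ⟨_, rfl⟩
          rw [hy] at h14 hR hnF h1 h2
          obtain ⟨hyc, hA, h5, h6, h7⟩ := S.mem_path (by omega) (by omega) hR h1 (h2.trans hb')
            (h2.trans hc')
          have hyv : s.mem 6 y = 0 := by
            have := (h.piece (aidx y) (by omega) (by omega)).2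
            rw [hrun _ h5 h6, ha, hb, h7] at this
            exact this ⟨h5, h6⟩
          simp [hy, h14]
          intro t₃ ht₃
          refine hQ _ _ ⟨by omega, y, by simp [r6', hcur], by simp, by simp [r9'],
            (h.congr (s' := s₂.setReg 7 y) hm₂ (by simp [r6', hcur])).weaken ?_, fun _ => ?_,
            (potential_congr hm₂).le, Or.inr (by simp [hm₂, hyv])⟩
          · rw [setReg_mem, hm₂]
            exact h.dfs.root.2.1
          · rw [hcur]
            exact ⟨hcN, by omega, by omega, fun hd => (hcur ▸ h.dfs.cur_mem.2.2) hd,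
              fun hd => h.dead_vis y (by omega) hd hyv, Or.inr (Or.inr ⟨hR, hnF⟩)⟩
    refine ⟨fun hlt => ?_, fun hlt => ?_⟩
    · refine Runs.mono (main _ (att cur) 70 (by simp [hcur]) rfl (by simp [h9]) (by simp) (by simp)
        (by simp) (by simp) (by omega) le_rfl (fun v _ h => h) (by omega)) ?_
      intro t s' hr
      simp only [runs_cond, runs_skip, eval_reg, setReg_reg, reduceIte, Expr.cost] at hr
      exact ⟨fun h => hr.1 h _ (by omega), fun h => (hr.2 h).mono fun t' s'' hQ' => hQ' _ (by omega)⟩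
    · refine Runs.mono (main _ (aord b) 70 (by simp [hcur]) rfl (by simp [h9]) (by simp) (by simp)
        (by simp) (by simp) le_rfl (by omega) (fun v h _ => h) (by omega)) ?_
      intro t s' hr
      simp only [runs_cond, runs_skip, eval_reg, setReg_reg, reduceIte, Expr.cost] at hr
      exact ⟨fun h => hr.1 h _ (by omega), fun h => (hr.2 h).mono fun t' s'' hQ' => hQ' _ (by omega)⟩

/-- If the heavy root `c` is unvisited, so is its whole subtree, and any neighbour in its interval
can be visited. The current vertex lies outside of `A`, so none of its edges has failed. If `c` is
visited, `SearchInv.all_of_heavy` shows that nothing is left. -/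
theorem Setup.runs_heavyStep (S : Setup w N L K M R Fl dead D A att aord aidx run)
    (hT : Tables N K Fl D A att aord aidx run s)
    (h : SearchInv N K M R Fl dead D A aord aidx run 0 d f g s) (h9 : s.reg 9 = 0)
    (h7 : s.reg 7 = 0) (hcnt : s.mem 15 (s.reg 6) = 0) (hpz : K ≤ s.mem 18 (s.reg 6)) :
    Runs w heavyStep s fun t s' => t ≤ 60 * L + 200 ∧
      ((∃ y, Found N K M R Fl dead D A aord aidx run d f g s y s') ∨
        Exhausted N K M R Fl dead D A aord aidx run d f g s s') := by
  have hcN : s.reg 6 ≤ N := h.dfs.cur_mem.1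
  have hsw := S.size_word
  have hw := S.word
  obtain ⟨cur, hcur⟩ : ∃ c, s.reg 6 = c := ⟨_, rfl⟩
  obtain ⟨γ, hγ⟩ : ∃ x, s.mem 20 cur = x := ⟨_, rfl⟩
  obtain ⟨c, hc⟩ : ∃ x, s.mem 19 γ = x := ⟨_, rfl⟩
  have hall := h.all_of_heavy S hcnt hpz
  have hcov := fun v => h.cover_heavy S hcnt hpz (v := v)
  have hheavy := h.heavy _ h.dfs.cur_mem
  have e0 := hT.mem0
  rw [hcur] at hcN hcnt hpz
  rw [hcur, hγ, hc] at hall hheavy hcov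
  have key : ∀ s', s'.reg 6 = cur → s'.mem = s.mem → s'.reg 9 = 0 → s'.reg 7 = 0 →
      (∀ v, LiveAdj N R Fl dead cur v → s.mem 6 v ≠ 0) →
      Runs w (cond (reg 7) skip (assign 9 (const 1))) s'
        fun t s'' => t ≤ 20 ∧ Exhausted N K M R Fl dead D A aord aidx run d f g s s'' := by
    intro s' h6' hm h9' h7' hno
    refine Runs.hide fun Q hQ => ?_
    simp (disch := omega) [h7', Nat.mod_eq_of_lt]
    exact hQ _ _ ⟨by omega, by simp [h6', hcur], by simpa using h7', by simp,
      h.congr hm (by simp [h6', hcur]), by simpa [h6', hm] using hcnt,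
      by simpa [h6', hm] using hno, potential_congr hm⟩
  refine Runs.hide fun Q hQ => ?_
  rw [heavyStep, runs_seq, runs_assign, runs_seq, runs_cond]
  simp (disch := omega) only [eval_load, eval_reg, setReg_reg, setReg_mem, reduceIte,
    hcur, hγ, hc, Expr.cost]
  refine ⟨fun hcv => ?_, fun hcv => ?_⟩
  · rw [runs_skip]
    refine Runs.mono (key _ (by simp [hcur]) rfl (by simpa using h9) (by simpa using h7)
      (hall hcv)) ?_
    intro t s' ht
    refine hQ _ _ ⟨?_, Or.inr ht.2⟩
    omega
  · have hc0 : c ≠ 0 := by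
      rintro rfl
      exact h.dfs.root.2.1 hcv
    obtain ⟨hc1, hAc, hcN', hA, -⟩ := hheavy hc0
    have hfin := S.lt_fin (v := c) (by omega) hcN'
    have hfin' := S.fin_le (v := c) (by omega) hcN'
    simp (disch := omega) only [runs_seq, runs_assign, eval_load, eval_reg, eval_add_mod,
      eval_mul_mod, eval_sub, setReg_reg, setReg_mem, Nat.reduceEqDiff, reduceIte, hcur, e0,
      Expr.cost, eval_const_mod, Nat.mod_eq_of_lt]
    refine Runs.use (S.runs_find (u := cur) (lo := c) (hi := D (4 * c + 2) - 1) (up := 1)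
      (by simpa using e0) (by simp) (by simp) (by simp) (by simp) (by omega) hc1 hcN
      (by simpa using fun j => hT.bad cur j hc1 hcN) ?_) ?_
    · intro x x' _ _ _ _ _ _ hF
      exact absurd hAc (S.failed_mem hF).2.2
    · intro t₂ s₂ ⟨ht₂, hfound, hnone⟩ hf
      have hm₂ : s₂.mem = s.mem := by
        funext x
        simpa using hf.mem x rfl
      have r6' := hf.reg 6 rfl
      have r9' := hf.reg 9 rfl
      simp only [setReg_reg, Nat.reduceEqDiff, reduceIte, h9, hcur] at r6' r9'
      by_cases h14 : s₂.reg 14 = 0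
      · refine Runs.mono (key _ (by simp [r6']) hm₂ (by simp [r9']) (by simp [h14]) ?_) ?_
        · intro v hv hv0
          obtain ⟨-, hd⟩ := hcov v hv hv0
          obtain ⟨h1, h2⟩ := (S.desc_iff (by omega) hcN').1 hd
          rcases hv.2.2.2.2.2 with h | h | h
          · omega
          · omega
          · exact hnone h14 v h.1 h.2 h1 (by omega)
        · intro t s' ht
          refine hQ _ _ ⟨?_, Or.inr ht.2⟩
          omega
      · obtain ⟨hR, hnF, h1, h2, -⟩ := hfound h14
        obtain ⟨y, hy⟩ : ∃ y, s₂.reg 14 = y := ⟨_, rfl⟩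
        rw [hy] at h14 hR hnF h1 h2
        have hyv := (h.unvisited_desc S (by omega) hA hcv
          ((S.desc_iff (by omega) hcN').2 ⟨h1, by omega⟩)).1
        simp [hy, h14]
        refine hQ _ _ ⟨by omega, Or.inl ⟨y, by simp [r6', hcur], by simp, by simp [r9'],
          (h.congr (s' := s₂.setReg 7 y) hm₂ (by simp [r6', hcur])).weaken ?_, fun _ => ?_,
          (potential_congr hm₂).le, Or.inr (by simp [hm₂, hyv])⟩⟩
        · rw [setReg_mem, hm₂]
          exact h.dfs.root.2.1
        · rw [hcur]
          have hyN := S.le (S.symm hR)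
          refine ⟨hcN, hyN, ?_, fun hd => (hcur ▸ h.dfs.cur_mem.2.2) hd,
              fun hd => h.dead_vis y hyN hd hyv, Or.inr (Or.inr ⟨hR, hnF⟩)⟩
          rintro rfl
          exact S.irrefl hR

theorem Setup.runs_probe (S : Setup w N L K M R Fl dead D A att aord aidx run)
    (hT : Tables N K Fl D A att aord aidx run s)
    (h : SearchInv N K M R Fl dead D A aord aidx run 0 d f g s)
    (hpot : potential N K d f g s ≤ T) (hTw : T * (N + 1) + N < 2 ^ w) :
    Runs w probe s fun t s' => t ≤ 60 * L + 250 ∧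
      ((∃ y, Found N K M R Fl dead D A aord aidx run d f g s y s') ∨
        Exhausted N K M R Fl dead D A aord aidx run d f g s s') := by
  have hw := S.word
  obtain ⟨s₁, hs₁⟩ : ∃ s₁, (s.setReg 7 0).setReg 9 0 = s₁ := ⟨_, rfl⟩
  have hm : s₁.mem = s.mem := by subst hs₁; rfl
  have r6 : s₁.reg 6 = s.reg 6 := by subst hs₁; simp
  have r7 : s₁.reg 7 = 0 := by subst hs₁; simp
  have r9 : s₁.reg 9 = 0 := by subst hs₁; simp
  have hT₁ : Tables N K Fl D A att aord aidx run s₁ := by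
    subst hs₁
    exact ⟨hT.mem0, hT.mem8, hT.mem9, hT.mem10, hT.mem11, hT.mem12, by simpa using hT.reg3,
      by simpa using hT.reg4, hT.bad⟩
  have h₁ := h.congr hm r6
  have hp : potential N K d f g s₁ = potential N K d f g s := potential_congr hm
  have hfound : ∀ y s', Found N K M R Fl dead D A aord aidx run d f g s₁ y s' →
      Found N K M R Fl dead D A aord aidx run d f g s y s' := by
    rintro y s' ⟨h1, h2, h3, h4, h5, h6, h7⟩
    rw [hp] at h6 h7
    rw [r6] at h1 h5
    exact ⟨h1, h2, h3, h4, h5, h6, h7⟩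
  have hex : ∀ s', Exhausted N K M R Fl dead D A aord aidx run d f g s₁ s' →
      Exhausted N K M R Fl dead D A aord aidx run d f g s s' := by
    rintro s' ⟨h1, h2, h3, h4, h5, h6, h7⟩
    rw [hp] at h7
    rw [r6] at h1
    exact ⟨h1, h2, h3, h4, h5, h6, h7⟩
  rw [probe, runs_seq, runs_assign, runs_seq, runs_assign]
  simp only [eval_const_mod, Nat.zero_mod, hs₁, runs_cond, eval_load, eval_reg]
  refine ⟨fun hc => ?_, fun hc => ⟨fun hlt => ?_, fun hlt => ?_⟩⟩
  · refine (S.runs_popStep hT₁ h₁ r9 (hp ▸ hpot) hTw hc).mono ?_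
    rintro t s' ⟨ht, y, hy⟩
    refine ⟨?_, Or.inl ⟨y, hfound y s' hy⟩⟩
    simp only [Expr.cost]
    omega
  · simp (disch := omega) [hT₁.reg4] at hlt
    refine (S.runs_pieceStep hT₁ h₁ r9 r7 (by omega)).mono ?_
    rintro t s' ⟨ht, y, hy⟩
    refine ⟨?_, Or.inl ⟨y, hfound y s' hy⟩⟩
    simp only [Expr.cost]
    omega
  · simp (disch := omega) [hT₁.reg4] at hlt
    refine (S.runs_heavyStep hT₁ h₁ r9 r7 hc (by omega)).mono ?_
    rintro t s' ⟨ht, hy⟩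
    refine ⟨?_, hy.imp (fun ⟨y, hy⟩ => ⟨y, hfound y s' hy⟩) (hex s')⟩
    simp only [Expr.cost]
    omega

end

/-! ### The main loop of the search -/

/-- One step of the search. -/
def searchStep : Program :=
  probe ;; cond (load 6 (reg 7)) skip visit ;;
  cond (reg 9) (cond (reg 6) (assign 6 (load 17 (reg 6))) (assign 8 (const 0))) skip

/-- The search. -/
def searchLoop : Program := loop (reg 8) searchStep

-- Each round lowers the potential or switches off register `8`, whose value is added to the
-- potential to pay for the last round. A round that finds a vertex already visited has used up an
-- entry or an inspection, so it lowers the potential too.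
set_option maxHeartbeats 1000000 in
theorem Setup.runs_searchLoop {w N L K M T : ℕ} {R Fl : ℕ → ℕ → Prop} {dead : ℕ → Prop}
    {D A att aord aidx run : ℕ → ℕ} (S : Setup w N L K M R Fl dead D A att aord aidx run)
    {s : State} {d : ℕ} {f g : ℕ → ℕ} (hT : Tables N K Fl D A att aord aidx run s)
    (h : SearchInv N K M R Fl dead D A aord aidx run 0 d f g s) (h8 : s.reg 8 = 1)
    (hpot : potential N K d f g s ≤ T) (hTw : T * (N + 1) + N < 2 ^ w) :
    Runs w searchLoop s fun t s' => t ≤ 1000 * (L + 1) * (T + 1) + 2 ∧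
      (∀ v, v ≤ N → ¬dead v → Visited N dead (s'.mem 6) v) ∧
      DFSState (LiveAdj N R Fl dead) (Visited N dead (s'.mem 6)) (s'.mem 17) (s'.reg 6) := by
  have hw := S.word
  refine (Runs.loop (b₀ := 1000 * (L + 1) * (T + 1)) (fun b s₁ => ∃ d f g,
    SearchInv N K M R Fl dead D A aord aidx run 0 d f g s₁ ∧ potential N K d f g s₁ ≤ T ∧
    (s₁.reg 8 = 1 ∨ s₁.reg 8 = 0 ∧ ∀ v, v ≤ N → ¬dead v → s₁.mem 6 v ≠ 0) ∧
    1000 * (L + 1) * (potential N K d f g s₁ + s₁.reg 8) ≤ b) ?_ ?_).mono ?_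
  · exact ⟨d, f, g, h, hpot, Or.inl h8, Nat.mul_le_mul_left _ (by omega)⟩
  · rintro b s₁ ⟨d, f, g, hI, hp, h81, hb⟩ hf he
    rw [eval_reg] at he
    have h8 : s₁.reg 8 = 1 := by omega
    rw [h8] at hb
    have hT₁ := hT.frame hf rfl
    rw [searchStep, runs_seq]
    refine (S.runs_probe hT₁ hI hp hTw).use ?_
    rintro t₂ s₂ ⟨ht₂, hcase⟩ hf₂
    have hT₂ := hT₁.frame hf₂ rfl
    have h82 := hf₂.reg 8 rfl
    rw [h8] at h82
    rw [runs_seq, runs_cond]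
    simp only [eval_load, eval_reg]
    have hmul : ∀ p q : ℕ, p + 1 ≤ q →
        1000 * (L + 1) * p + 1000 * (L + 1) ≤ 1000 * (L + 1) * q := by
      intro p q hpq
      have := Nat.mul_le_mul_left (1000 * (L + 1)) hpq
      rw [Nat.mul_add, Nat.mul_one] at this
      exact this
    rcases hcase with ⟨y, hF⟩ | hE
    · have hno : ∀ (s₃ : State) (t₃ : ℕ) (d' : ℕ) (f' g' : ℕ → ℕ), s₃.reg 9 = 0 → s₃.reg 8 = 1 →
          SearchInv N K M R Fl dead D A aord aidx run 0 d' f' g' s₃ →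
          t₃ + 300 * (L + 1) * potential N K d' f' g' s₃ ≤
            300 * (L + 1) * potential N K d f g s₁ + 10 →
          potential N K d' f' g' s₃ + 1 ≤ potential N K d f g s₁ →
          Runs w (cond (reg 9) (cond (reg 6) (assign 6 (load 17 (reg 6))) (assign 8 (const 0))) skip)
            s₃ fun t₄ s₄ => ∃ b', (∃ d f g,
              SearchInv N K M R Fl dead D A aord aidx run 0 d f g s₄ ∧ potential N K d f g s₄ ≤ T ∧
              (s₄.reg 8 = 1 ∨ s₄.reg 8 = 0 ∧ ∀ v, v ≤ N → ¬dead v → s₄.mem 6 v ≠ 0) ∧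
              1000 * (L + 1) * (potential N K d f g s₄ + s₄.reg 8) ≤ b') ∧
              (reg 8).cost + 1 + (t₂ + (t₃ + t₄)) + b' ≤ b := by
        intro s₃ t₃ d' f' g' r9 r8 hI₃ htp hp₃
        simp [r9]
        refine ⟨1000 * (L + 1) * (potential N K d' f' g' s₃ + s₃.reg 8),
          ⟨d', f', g', hI₃, by omega, Or.inl r8, Nat.le_refl _⟩, ?_⟩
        rw [r8]
        rw [Nat.mul_add] at hb ⊢
        -- Of the `1000 * (L + 1)` steps per unit, `300 * (L + 1)` belong to the visit; the other
        -- `700 * (L + 1)` of a single unit cover the search for the next vertex and the tests of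
        -- the round.
        have := Nat.mul_le_mul_left (700 * (L + 1)) hp₃
        have e1 : 1000 * (L + 1) * potential N K d' f' g' s₃ =
          300 * (L + 1) * potential N K d' f' g' s₃ +
            700 * (L + 1) * potential N K d' f' g' s₃ := by ring
        have e2 : 1000 * (L + 1) * potential N K d f g s₁ =
          300 * (L + 1) * potential N K d f g s₁ +
            700 * (L + 1) * potential N K d f g s₁ := by ring
        rw [Nat.mul_add, Nat.mul_one] at this
        rw [Nat.mul_one] at hb
        rw [e2] at hb
        rw [e1, Nat.mul_one]
        have fin : ∀ a a' c c' e e' : ℕ, t₃ + a' ≤ a + 10 → c' + e' ≤ c → a + c + e ≤ b →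
            t₂ + 15 ≤ e' → 2 + (t₂ + (t₃ + 3)) + (a' + c' + e) ≤ b := by
          clear hmul htp this e1 e2 hb
          intro a a' c c' e e' h1 h2 h3 h4
          omega
        exact fin _ _ _ _ _ _ htp this hb (by clear hmul htp this e1 e2 hb; omega)
      refine ⟨fun hv => ?_, fun hv => ?_⟩
      · rw [runs_skip]
        rw [hF.reg7] at hv
        have hlt : potential N K d f g s₂ + 1 ≤ potential N K d f g s₁ := by
          rcases hF.lt with h | h
          · exact h
          · exact absurd h hv
        refine hno s₂ _ d f g hF.reg9 h82 (hF.inv.weaken hv) ?_ hlt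
        have := Nat.mul_le_mul_left (300 * (L + 1)) hF.pot
        simp only [Expr.cost]
        omega
      · rw [hF.reg7] at hv
        have hy0 : y ≠ 0 := by
          rintro rfl
          exact hF.inv.dfs.root.2.1 hv
        have hadj := hF.adj hy0
        refine (S.runs_visit hT₂ hF.inv hF.reg7 (by omega) hadj.2.1 hv ?_ (hF.pot.trans hp) hTw).use ?_
        · rw [hF.reg6]
          exact S.liveAdj_symm _ _ hadj
        · rintro t₃ s₃ ⟨d', f', g', hI₃, hpt, hpl⟩ hf₃
          have r9 := hf₃.reg 9 rfl
          have r8 := hf₃.reg 8 rfl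
          rw [hF.reg9] at r9
          rw [h82] at r8
          have := Nat.mul_le_mul_left (300 * (L + 1)) hF.pot
          have h6 := hF.pot
          refine hno s₃ _ d' f' g' r9 r8 hI₃ ?_ (by omega)
          simp only [Expr.cost]
          omega
    · refine ⟨fun hv => ?_, fun hv => ?_⟩
      · simp (disch := omega) only [runs_skip, runs_cond, runs_assign, eval_reg, hE.reg9,
          eval_load, eval_const_mod, Nat.zero_mod, Expr.cost]
        refine ⟨fun _ => ⟨fun h0 => ?_, fun h0 => ?_⟩, fun h => absurd h (by omega)⟩
        · obtain ⟨h1, h2⟩ := hE.inv.back (s' := s₂.setReg 6 (s₂.mem 17 (s₂.reg 6))) h0 rfl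
            (by simp) hE.cnt hE.all
          have h3 := hE.pot
          refine ⟨1000 * (L + 1) * (potential N K (d - 1) f g
            (s₂.setReg 6 (s₂.mem 17 (s₂.reg 6))) + 1),
            ⟨d - 1, f, g, h1, by omega, Or.inl (by simpa using h82), ?_⟩, ?_⟩
          · simp [h82]
          have := hmul _ _ h2.le
          rw [Nat.mul_add, Nat.mul_one] at hb ⊢
          rw [h3] at this
          have fin : ∀ a a' c : ℕ, a' + c ≤ a → a + c ≤ b → t₂ + 30 ≤ c →
              1 + 1 + (t₂ + (1 + 1 + 1 + 1 + (1 + 1 + (1 + 1 + (1 + 1 + 1))))) + (a' + c) ≤ b := by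
            clear hmul this hb
            intro a a' c h1 h2 h3
            omega
          exact fin _ _ _ this hb (by clear hmul this hb; omega)
        · have hp0 : potential N K d f g (s₂.setReg 8 0) = potential N K d f g s₁ :=
            (potential_congr rfl).trans hE.pot
          refine ⟨1000 * (L + 1) * potential N K d f g s₁,
            ⟨d, f, g, hE.inv.congr rfl (by simp), by omega, Or.inr ⟨by simp, ?_⟩, ?_⟩, ?_⟩
          -- The root is joined to every live vertex, so when it has no unvisited neighbour,
          -- everything is visited.
          · intro v hvN hvd
            by_cases hv0 : v = 0
            · subst hv0
              exact hE.inv.dfs.root.2.1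
            · refine hE.all v ?_
              rw [h0]
              exact ⟨Nat.zero_le _, hvN, Ne.symm hv0, hE.inv.dfs.root.2.2, hvd, Or.inl rfl⟩
          · rw [hp0]
            simp
          · rw [Nat.mul_add] at hb
            omega
      · rw [hE.reg7] at hv
        exact absurd hv hE.inv.dfs.root.2.1
  · rintro t s' ⟨-, he, b, ⟨d', f', g', hI, -, h8', -⟩, hb⟩
    rw [eval_reg] at he
    simp only [Expr.cost] at hb
    refine ⟨by omega, fun v hv hd => ⟨hv, ?_, hd⟩, hI.dfs⟩
    rcases h8' with h | h
    · omega
    · exact h.2 v hv hd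

/-! ### Marking the failures -/

theorem IsIndex.off_mono {N : ℕ} {R : ℕ → ℕ → Prop} {D : ℕ → ℕ} (h : IsIndex N R D) {u v : ℕ}
    (hu : 1 ≤ u) (huv : u ≤ v) (hv : v ≤ N + 1) : D (4 * u + 3) ≤ D (4 * v + 3) := by
  induction v, huv using Nat.le_induction with
  | base => exact le_rfl
  | succ v huv ih =>
    have := h.off_le (u := v) (by omega) (by omega)
    rw [show 4 * (v + 1) + 3 = 4 * v + 7 by ring]
    exact (ih (by omega)).trans this

/-- The lists of neighbours of different vertices are disjoint. -/
theorem IsIndex.off_disjoint {N : ℕ} {R : ℕ → ℕ → Prop} {D : ℕ → ℕ} (h : IsIndex N R D) {u v j : ℕ}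
    (hu : 1 ≤ u) (huN : u ≤ N) (hv : 1 ≤ v) (hvN : v ≤ N) (h1 : D (4 * u + 3) ≤ j)
    (h2 : j < D (4 * u + 7)) (h3 : D (4 * v + 3) ≤ j) (h4 : j < D (4 * v + 7)) : u = v := by
  rcases Nat.lt_trichotomy u v with hlt | rfl | hlt
  · have := h.off_mono (u := u + 1) (v := v) (by omega) hlt (by omega)
    rw [show 4 * (u + 1) + 3 = 4 * u + 7 by ring] at this
    omega
  · rfl
  · have := h.off_mono (u := v + 1) (v := u) (by omega) hlt (by omega)
    rw [show 4 * (v + 1) + 3 = 4 * v + 7 by ring] at this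
    omega

theorem update_one_ne_zero {f : ℕ → ℕ} {x i : ℕ} :
    Function.update f x 1 i ≠ 0 ↔ i = x ∨ f i ≠ 0 := by
  by_cases h : i = x
  · simp [h]
  · simp [h]

theorem card_filter_update {N x : ℕ} {f : ℕ → ℕ} :
    ((Finset.Icc 1 N).filter (fun i => Function.update f x 1 i ≠ 0)).card ≤
      ((Finset.Icc 1 N).filter (fun i => f i ≠ 0)).card + 1 := by
  refine (Finset.card_le_card (t := insert x ((Finset.Icc 1 N).filter (fun i => f i ≠ 0))) ?_).trans
    (Finset.card_insert_le _ _)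
  intro i hi
  simp only [Finset.mem_filter, Finset.mem_insert] at hi ⊢
  by_cases hix : i = x
  · exact Or.inl hix
  · rw [Function.update_of_ne hix] at hi
    exact Or.inr hi

/-- Fill the output with the dummy root. -/
def initOut : Program := assign 24 (const 0) ;; forUp 24 0 (store 3 (reg 24) (reg 0))

/-- A vertex without number is isolated, so in the augmented graph its only neighbour is the dummy
root. Label `n` as default value therefore settles all vertices that the search never sees. -/
theorem runs_initOut {w n : ℕ} {s : State} (hw : 1024 ≤ 2 ^ w) (hn : n < 2 ^ w) (h0 : s.reg 0 = n) :
    Runs w initOut s fun t s' => t ≤ 20 * n + 10 ∧ ∀ v < n, s'.mem 3 v = n := by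
  rw [initOut, runs_seq, runs_assign]
  refine (Runs.forUp (fun i s' => ∀ v < i, s'.mem 3 v = n) 10 (by simpa [h0] using hn) (by omega) rfl
    rfl (by decide) (by simp) (by simp) ?_).mono ?_
  · intro i s₁ _ hin hI hi hf
    have e0 := hf.reg 0 rfl
    simp [h0] at e0
    refine Runs.hide fun Q hQ => ?_
    simp [hi, e0]
    refine hQ _ _ ⟨by omega, fun v hv => ?_⟩
    by_cases hvi : v = i
    · simp [hvi]
    · simp [hvi, hI v (by omega)]
  · rintro t s' ⟨ht, hI, -⟩
    simp [h0] at ht hI ⊢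
    exact ⟨by omega, hI⟩

/-- Number the vertices of the data structure. -/
def initNum : Program :=
  assign 3 (load 0 (const 0)) ;; assign 24 (const 1) ;; assign 25 (reg 3 +ᵉ const 1) ;;
  forUp 24 25 (store 4 (load 0 (const 4 *ᵉ reg 24)) (reg 24))

theorem runs_initNum {w N : ℕ} {s : State} {D : ℕ → ℕ} (hw : 1024 ≤ 2 ^ w) (hN : 8 * N + 8 < 2 ^ w)
    (hD : s.mem 0 = D) (hD0 : D 0 = N) (h4 : s.mem 4 = fun _ => 0)
    (hinj : ∀ i j, 1 ≤ i → i < j → j ≤ N → D (4 * i) ≠ D (4 * j)) :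
    Runs w initNum s fun t s' => t ≤ 30 * N + 30 ∧ s'.reg 3 = N ∧
      (∀ i, 1 ≤ i → i ≤ N → s'.mem 4 (D (4 * i)) = i) ∧
      ∀ x, s'.mem 4 x ≠ 0 → D (4 * s'.mem 4 x) = x := by
  simp (disch := omega) only [initNum, runs_seq, runs_assign, eval_load, eval_const_mod,
    hD, hD0, eval_add_mod, eval_reg, setReg_reg, reduceIte, Nat.reduceEqDiff,
    Nat.mod_eq_of_lt, Expr.cost]
  refine (Runs.forUp (fun i s' => (∀ j, 1 ≤ j → j < i → s'.mem 4 (D (4 * j)) = j) ∧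
      ∀ x, s'.mem 4 x ≠ 0 → D (4 * s'.mem 4 x) = x) 12
    (by simp; omega) (by omega) rfl rfl (by decide) (by simp) ?_ ?_).use ?_
  · refine ⟨fun j h1 h2 => ?_, by simp [h4]⟩
    simp at h2
    omega
  · intro i s₁ h1i hin ⟨hI, hI'⟩ hi hf
    simp at h1i hin
    have e0 := hf.mem 0 rfl
    simp [hD] at e0
    refine Runs.hide fun Q hQ => ?_
    simp (disch := omega) [hi, e0, Nat.mod_eq_of_lt]
    refine hQ _ _ ⟨by omega, fun j hj hji => ?_, fun x hx => ?_⟩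
    · by_cases hij : j = i
      · simp [hij]
      · simp [hinj j i hj (by omega) (by omega), hI j hj (by omega)]
    · by_cases hxi : x = D (4 * i)
      · simp [hxi]
      · simp only [setReg_mem, setMem_mem, reduceIte, Function.update_of_ne hxi] at hx ⊢
        exact hI' x hx
  · rintro t s' ⟨ht, ⟨hI, hI'⟩, -⟩ hf
    have e3 := hf.reg 3 rfl
    simp at ht hI e3 ⊢
    exact ⟨by omega, e3, fun i h1 h2 => hI i h1 (by omega), hI'⟩

/-- Mark the failed vertices. -/
def initVertices : Program :=
  assign 24 (const 0) ;;
  forUp 24 1 (assign 26 (load 4 (load 1 (reg 24))) ;; store 5 (reg 26) (const 1) ;;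
    store 6 (reg 26) (const 1))

/-- A failed vertex without number is mapped to `0`. Its marks fall on cell `0`, which belongs to
the dummy root and is left out of the count over `1, …, N`. -/
theorem runs_initVertices {w N k : ℕ} {s : State} (hw : 1024 ≤ 2 ^ w) (hk : k < 2 ^ w)
    (h1 : s.reg 1 = k) (h5 : s.mem 5 = fun _ => 0) (h6 : s.mem 6 = fun _ => 0) :
    Runs w initVertices s fun t s' => t ≤ 30 * k + 10 ∧
      (∀ i, s'.mem 6 i ≠ 0 ↔ ∃ j < k, s.mem 4 (s.mem 1 j) = i) ∧
      (∀ i, s'.mem 6 i ≤ 1) ∧ (∀ i, s'.mem 6 i ≠ 0 → s'.mem 5 i ≠ 0) ∧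
      ((Finset.Icc 1 N).filter (fun i => s'.mem 5 i ≠ 0)).card ≤ k := by
  rw [initVertices, runs_seq, runs_assign]
  refine (Runs.forUp (fun x s' => (∀ i, s'.mem 6 i ≠ 0 ↔ ∃ j < x, s.mem 4 (s.mem 1 j) = i) ∧
      (∀ i, s'.mem 6 i ≤ 1) ∧ (∀ i, s'.mem 6 i ≠ 0 → s'.mem 5 i ≠ 0) ∧
      ((Finset.Icc 1 N).filter (fun i => s'.mem 5 i ≠ 0)).card ≤ x) 20
    (by simpa [h1] using hk) (by omega) rfl rfl (by decide) (by simp) (by simp [h5, h6]) ?_).use ?_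
  · intro x s₁ _ hxk ⟨hI1, hI2, hI3, hI4⟩ hx hf
    have e4 := hf.mem 4 rfl
    have e1 := hf.mem 1 rfl
    simp at e1 e4
    refine Runs.hide fun Q hQ => ?_
    simp (disch := omega) [hx, e1, e4, Nat.mod_eq_of_lt]
    obtain ⟨p, hp⟩ : ∃ p, s.mem 4 (s.mem 1 x) = p := ⟨_, rfl⟩
    rw [hp]
    refine hQ _ _ ⟨by omega, fun i => ?_, fun i => ?_, fun i => ?_, ?_⟩
    · rw [Nat.exists_lt_succ_right, ← hI1, hp]
      by_cases hip : i = p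
      · simp [hip]
      · simp [hip, Ne.symm hip]
    · by_cases hip : i = p
      · simp [hip]
      · simpa [hip] using hI2 i
    · by_cases hip : i = p
      · simp [hip]
      · simpa [hip] using hI3 i
    · have := card_filter_update (N := N) (x := p) (f := s₁.mem 5)
      simp at this hI4 ⊢
      omega
  · rintro t s' ⟨ht, hI, -⟩ hf
    simp only [setReg_reg, h1, Nat.reduceEqDiff, reduceIte, eval_const_mod, Nat.zero_mod] at ht hI
    refine ⟨?_, hI⟩
    simp only [Expr.cost]
    omega

/-- Mark the failed edges and their endpoints. -/
def initEdges : Program :=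
  assign 24 (const 0) ;;
  forUp 24 2 (assign 10 (load 4 (load 2 (const 2 *ᵉ reg 24))) ;;
    assign 15 (load 4 (load 2 (const 2 *ᵉ reg 24 +ᵉ const 1))) ;;
    store 5 (reg 10) (const 1) ;; store 5 (reg 15) (const 1) ;;
    search ;; store 7 (reg 16) (const 1) ;;
    assign 26 (reg 10) ;; assign 10 (reg 15) ;; assign 15 (reg 26) ;;
    search ;; store 7 (reg 16) (const 1))

/-- When the value sought is known to occur, the first cell that is at least that value holds it.
This locates the cell of a failed edge. -/
theorem IsIndex.slot_eq {N : ℕ} {R : ℕ → ℕ → Prop} {D : ℕ → ℕ} (h : IsIndex N R D) {a b r : ℕ}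
    (hR : R a b) (hl : D (4 * a + 3) ≤ r) 
    (hj : ∀ j, D (4 * a + 3) ≤ j → j < D (4 * a + 7) → (D j < b ↔ j < r)) :
    r < D (4 * a + 7) ∧ D r = b := by
  have ha := h.pos hR
  have haN := h.le hR
  obtain ⟨j, h1, h2, rfl⟩ := (h.adj_iff ha haN).2 hR
  have h3 : r ≤ j := by
    by_contra hc
    have := (hj j h1 h2).2 (by omega)
    omega
  rcases Nat.eq_or_lt_of_le h3 with rfl | h3
  · exact ⟨h2, rfl⟩
  · have := (hj r hl (by omega)).1 (h.adj_lt ha haN hl h3 h2)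
    omega

/-- A slot of the list of `u` marks the edge from `u` to `x`. -/
theorem IsIndex.mark_iff {N : ℕ} {R : ℕ → ℕ → Prop} {D : ℕ → ℕ} (h : IsIndex N R D) {a b r : ℕ}
    (hR : R a b) (hl : D (4 * a + 3) ≤ r) (hr : r < D (4 * a + 7)) (hD : D r = b) {u p : ℕ}
    (hu : 1 ≤ u) (huN : u ≤ N) (h1 : D (4 * u + 3) ≤ p) (h2 : p < D (4 * u + 7)) :
    p = r ↔ u = a ∧ D p = b := by
  have ha := h.pos hR
  have haN := h.le hR
  constructor
  · rintro rfl
    exact ⟨h.off_disjoint hu huN ha haN h1 h2 hl hr, hD⟩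
  · rintro ⟨rfl, hp⟩
    rcases Nat.lt_trichotomy p r with hlt | rfl | hlt
    · have := h.adj_lt hu huN h1 hlt hr
      omega
    · rfl
    · have := h.adj_lt hu huN hl hlt h2
      omega

-- Each failed edge is marked in the lists of both of its ends, by one binary search each. It makes
-- at most two more vertices special, whence `c + 2 * k`.
set_option maxHeartbeats 1000000 in
theorem IndexFits.runs_initEdges {w N L k c : ℕ} {R : ℕ → ℕ → Prop} {D e₁ e₂ : ℕ → ℕ} {s : State}
    (h : IndexFits w N L R D) (hD : s.mem 0 = D) (hk : 4 * k + 4 < 2 ^ w) (h2 : s.reg 2 = k)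
    (he₁ : ∀ j < k, s.mem 4 (s.mem 2 (2 * j)) = e₁ j)
    (he₂ : ∀ j < k, s.mem 4 (s.mem 2 (2 * j + 1)) = e₂ j)
    (hR : ∀ j < k, R (e₁ j) (e₂ j)) (h7 : s.mem 7 = fun _ => 0)
    (hc : ((Finset.Icc 1 N).filter (fun i => s.mem 5 i ≠ 0)).card ≤ c) :
    Runs w initEdges s fun t s' => t ≤ k * (60 * L + 160) + 10 ∧
      (∀ i, s.mem 5 i ≠ 0 → s'.mem 5 i ≠ 0) ∧
      (∀ j < k, s'.mem 5 (e₁ j) ≠ 0 ∧ s'.mem 5 (e₂ j) ≠ 0) ∧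
      (∀ u p, 1 ≤ u → u ≤ N → D (4 * u + 3) ≤ p → p < D (4 * u + 7) →
        (s'.mem 7 p ≠ 0 ↔ ∃ j < k, (u = e₁ j ∧ D p = e₂ j) ∨ (u = e₂ j ∧ D p = e₁ j))) ∧
      ((Finset.Icc 1 N).filter (fun i => s'.mem 5 i ≠ 0)).card ≤ c + 2 * k := by
  have hw := h.word
  rw [initEdges, runs_seq, runs_assign]
  refine (Runs.forUp (fun x s' => (∀ i, s.mem 5 i ≠ 0 → s'.mem 5 i ≠ 0) ∧
      (∀ j < x, s'.mem 5 (e₁ j) ≠ 0 ∧ s'.mem 5 (e₂ j) ≠ 0) ∧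
      (∀ u p, 1 ≤ u → u ≤ N → D (4 * u + 3) ≤ p → p < D (4 * u + 7) →
        (s'.mem 7 p ≠ 0 ↔ ∃ j < x, (u = e₁ j ∧ D p = e₂ j) ∨ (u = e₂ j ∧ D p = e₁ j))) ∧
      ((Finset.Icc 1 N).filter (fun i => s'.mem 5 i ≠ 0)).card ≤ c + 2 * x) (60 * L + 150)
    (by simp [h2]; omega) (by omega) rfl rfl (by decide) (by simp) ?_ ?_).use ?_
  · exact ⟨fun i hi => hi, by simp, by simp [h7], hc.trans (Nat.le_add_right _ _)⟩
  · intro x s₁ _ hxk ⟨hI1, hI2, hI3, hI4⟩ hx hf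
    have e4 := hf.mem 4 rfl
    have e2 := hf.mem 2 rfl
    have e0 := hf.mem 0 rfl
    simp [hD, h2] at e2 e4 e0 hxk
    obtain ⟨a, ha⟩ : ∃ a, e₁ x = a := ⟨_, rfl⟩
    obtain ⟨b, hb⟩ : ∃ b, e₂ x = b := ⟨_, rfl⟩
    have hab := hR x hxk
    have hax := he₁ x hxk
    have hbx := he₂ x hxk
    rw [ha, hb] at hab
    rw [ha] at hax
    rw [hb] at hbx
    have hba := h.symm hab
    refine Runs.hide fun Q hQ => ?_
    simp (disch := omega) only [runs_seq, runs_assign, runs_store, eval_load, eval_const_mod,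
      eval_mul_mod, eval_reg, setReg_reg, reduceIte, Nat.reduceEqDiff, hx, Nat.mod_eq_of_lt, e2, e4,
      hax, hbx, eval_add_mod, setReg_mem, Expr.cost]
    refine (h.runs_search (u := a) (by simpa using e0) (by simp) (h.pos hab) (h.le hab)).use ?_
    intro t₂ s₂ ⟨ht₂, hl₂, _, hj₂⟩ hf₂
    have r10 := hf₂.reg 10 rfl
    have r15 := hf₂.reg 15 rfl
    have m0 := hf₂.mem 0 rfl
    have m5 := hf₂.mem 5 rfl
    have m7 := hf₂.mem 7 rfl
    simp [e0] at r10 r15 m0 m5 m7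
    simp at hj₂
    obtain ⟨r₁, hr₁⟩ : ∃ r₁, s₂.reg 16 = r₁ := ⟨_, rfl⟩
    rw [hr₁] at hl₂ hj₂
    obtain ⟨hs₁, hs₁'⟩ := h.slot_eq hab hl₂ hj₂
    simp (disch := omega) only [setMem_reg, r10, r15, hr₁]
    refine (h.runs_search (u := b) (by simpa using m0) (by simp) (h.pos hba) (h.le hba)).use ?_
    intro t₃ s₃ ⟨ht₃, hl₃, _, hj₃⟩ hf₃
    have m5' := hf₃.mem 5 rfl
    have m7' := hf₃.mem 7 rfl
    simp [m5, m7] at m5' m7'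
    simp at hj₃
    obtain ⟨r₂, hr₂⟩ : ∃ r₂, s₃.reg 16 = r₂ := ⟨_, rfl⟩
    rw [hr₂] at hl₃ hj₃
    obtain ⟨hs₂, hs₂'⟩ := h.slot_eq hba hl₃ hj₃
    simp only [hr₂]
    have k5 : ∀ s₄ : State, s₄.mem 5 = Function.update (Function.update (s₁.mem 5) a 1) b 1 →
        ∀ i, s₄.mem 5 i ≠ 0 ↔ i = b ∨ i = a ∨ s₁.mem 5 i ≠ 0 := by
      intro s₄ h₄ i
      rw [h₄, update_one_ne_zero, update_one_ne_zero]
    have k7 : ∀ s₄ : State, s₄.mem 7 = Function.update (Function.update (s₁.mem 7) r₁ 1) r₂ 1 →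
        ∀ i, s₄.mem 7 i ≠ 0 ↔ i = r₂ ∨ i = r₁ ∨ s₁.mem 7 i ≠ 0 := by
      intro s₄ h₄ i
      rw [h₄, update_one_ne_zero, update_one_ne_zero]
    obtain ⟨s₄, h₄⟩ : ∃ s₄, (s₃.setMem 7 r₂ 1).setReg 24 (x + 1) = s₄ := ⟨_, rfl⟩
    have h45 : s₄.mem 5 = Function.update (Function.update (s₁.mem 5) a 1) b 1 := by
      rw [← h₄, ← m5']
      rfl
    have h47 : s₄.mem 7 = Function.update (Function.update (s₁.mem 7) r₁ 1) r₂ 1 := by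
      rw [← h₄, ← m7']
      rfl
    replace k5 := k5 s₄ h45
    replace k7 := k7 s₄ h47
    refine hQ _ _ ⟨by omega, ?_⟩
    rw [h₄]
    clear h₄ m5' m7' hQ
    refine ⟨?_, ?_, ?_, ?_⟩
    · exact fun i hi => (k5 i).2 (Or.inr (Or.inr (hI1 i hi)))
    · intro j hj
      rcases Nat.lt_succ_iff_lt_or_eq.1 hj with hj | rfl
      · exact ⟨(k5 _).2 (Or.inr (Or.inr (hI2 j hj).1)), (k5 _).2 (Or.inr (Or.inr (hI2 j hj).2))⟩
      · exact ⟨(k5 _).2 (Or.inr (Or.inl ha)), (k5 _).2 (Or.inl hb)⟩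
    · intro u p h1 h2 h3 h4
      have k1 := h.mark_iff hab hl₂ hs₁ hs₁' h1 h2 h3 h4
      have k2 := h.mark_iff hba hl₃ hs₂ hs₂' h1 h2 h3 h4
      rw [Nat.exists_lt_succ_right, ha, hb, ← k1, ← k2, ← hI3 u p h1 h2 h3 h4, k7]
      tauto
    · have q1 := card_filter_update (N := N) (x := a) (f := s₁.mem 5)
      have q2 := card_filter_update (N := N) (x := b) (f := Function.update (s₁.mem 5) a 1)
      rw [h45]
      omega
  · rintro t s' ⟨ht, hI, -⟩ hf
    simp only [setReg_reg, h2, Nat.reduceEqDiff, reduceIte, eval_const_mod, Nat.zero_mod,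
      Nat.sub_zero] at ht hI
    refine ⟨?_, hI⟩
    have : k * (60 * L + 150 + 8) ≤ k * (60 * L + 160) := Nat.mul_le_mul_left _ (by omega)
    simp only [Expr.cost]
    omega

/-! ### The ancestors of the special vertices -/

/-- Mark all ancestors of the special vertices. -/
def closeUp : Program :=
  assign 24 (const 0) ;;
  forUp 24 3 (assign 26 (reg 3 -ᵉ reg 24) ;;
    cond (load 5 (reg 26)) (store 8 (reg 26) (const 1)) skip ;;
    cond (load 8 (reg 26)) (store 8 (load 0 (const 4 *ᵉ reg 26 +ᵉ const 1)) (const 1)) skip)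

/-- Parents have smaller numbers, so a single sweep from `N` down to `1` closes the set. The last
conclusion, that a marked vertex is special or has a marked child, is the reason why there are few
runs. -/
theorem IndexFits.runs_closeUp {w N L : ℕ} {R : ℕ → ℕ → Prop} {D spec : ℕ → ℕ} {s : State}
    (h : IndexFits w N L R D) (hD : s.mem 0 = D) (h3 : s.reg 3 = N) (h5 : s.mem 5 = spec)
    (h8 : s.mem 8 = fun _ => 0) :
    Runs w closeUp s fun t s' => t ≤ 40 * N + 10 ∧
      (∀ i, 1 ≤ i → i ≤ N → spec i ≠ 0 → s'.mem 8 i ≠ 0) ∧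
      (∀ i, 1 ≤ i → i ≤ N → s'.mem 8 i ≠ 0 → D (4 * i + 1) ≠ 0 → s'.mem 8 (D (4 * i + 1)) ≠ 0) ∧
      (∀ v, 1 ≤ v → v ≤ N → s'.mem 8 v ≠ 0 → spec v ≠ 0 ∨
        ∃ c, v < c ∧ c ≤ N ∧ s'.mem 8 c ≠ 0 ∧ D (4 * c + 1) = v) := by
  have hw := h.word
  have hsw := h.size_word
  rw [closeUp, runs_seq, runs_assign]
  refine (Runs.forUp (fun x s' => 
      (∀ i, N < i + x → i ≤ N → spec i ≠ 0 → s'.mem 8 i ≠ 0) ∧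
      (∀ i, N < i + x → i ≤ N → s'.mem 8 i ≠ 0 → s'.mem 8 (D (4 * i + 1)) ≠ 0) ∧
      (∀ v, 1 ≤ v → v ≤ N → s'.mem 8 v ≠ 0 → spec v ≠ 0 ∨
        ∃ c, v < c ∧ c ≤ N ∧ s'.mem 8 c ≠ 0 ∧ D (4 * c + 1) = v)) 30
    (by simp [h3]; omega) (by omega) rfl rfl (by decide) (by simp) ?_ ?_).use ?_
  · refine ⟨fun i h1 h2 => ?_, fun i h1 h2 => ?_, fun v _ _ hv => ?_⟩
    · simp at h1; omega
    · simp at h1; omega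
    · simp [h8] at hv
  · intro x s₁ _ hxN ⟨hI1, hI2, hI3⟩ hx hf
    have e5 := hf.mem 5 rfl
    have e0 := hf.mem 0 rfl
    have e3 := hf.reg 3 rfl
    simp [hD, h3, h5] at e5 e0 e3 hxN
    obtain ⟨i, hi⟩ : ∃ i, N - x = i := ⟨_, rfl⟩
    have hp := h.par_lt (b := i) (by omega) (by omega)
    refine Runs.hide fun Q hQ => ?_
    simp (disch := omega) [hx, e5, e3, e0, hi, Nat.mod_eq_of_lt]
    have key : ∀ (s₂ : State) (t : ℕ), t ≤ 30 → (∀ j, s₂.mem 8 j ≠ 0 ↔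
        s₁.mem 8 j ≠ 0 ∨ (spec i ≠ 0 ∨ s₁.mem 8 i ≠ 0) ∧ (j = i ∨ j = D (4 * i + 1))) → Q t s₂ := by
      intro s₂ t ht hs₂
      refine hQ _ _ ⟨ht, ?_⟩
      simp only [setReg_mem]
      refine ⟨fun j h1 h2 h4 => ?_, fun j h1 h2 h4 => ?_, fun v h1 h2 h4 => ?_⟩
      · rw [hs₂]
        by_cases hji : j = i
        · subst hji
          exact Or.inr ⟨Or.inl h4, Or.inl rfl⟩
        · exact Or.inl (hI1 j (by omega) h2 h4)
      · rw [hs₂] at h4 ⊢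
        by_cases hji : j = i
        · subst hji
          refine Or.inr ⟨?_, Or.inr rfl⟩
          tauto
        · refine Or.inl (hI2 j (by omega) h2 ?_)
          rcases h4 with h4 | ⟨-, h4 | h4⟩
          · exact h4
          · omega
          · omega
      · rw [hs₂] at h4
        rcases h4 with h4 | ⟨h4, rfl | h6⟩
        · refine (hI3 v h1 h2 h4).imp_right ?_
          rintro ⟨c, h6, h7, h8, h9⟩
          exact ⟨c, h6, h7, (hs₂ c).2 (Or.inl h8), h9⟩
        · rcases h4 with h4 | h4
          · exact Or.inl h4
          · refine (hI3 v h1 h2 h4).imp_right ?_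
            rintro ⟨c, h6, h7, h8, h9⟩
            exact ⟨c, h6, h7, (hs₂ c).2 (Or.inl h8), h9⟩
        · exact Or.inr ⟨i, by omega, by omega, (hs₂ i).2 (Or.inr ⟨h4, Or.inl rfl⟩), h6.symm⟩
    refine ⟨fun hs => ?_, fun hs => ⟨fun hA => ?_, fun hA => ?_⟩⟩
    · refine key _ _ (by omega) fun j => ?_
      simp only [setMem_mem, setReg_mem, reduceIte]
      rw [update_one_ne_zero, update_one_ne_zero]
      tauto
    · refine key _ _ (by omega) fun j => ?_
      simp only [setMem_mem, setReg_mem, reduceIte]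
      rw [update_one_ne_zero]
      by_cases hj : j = i
      · subst hj; tauto
      · tauto
    · refine key _ _ (by omega) fun j => ?_
      simp only [setReg_mem]
      tauto
  · rintro t s' ⟨ht, ⟨hI1, hI2, hI3⟩, -⟩ hf
    simp [h3] at ht hI1 hI2
    refine ⟨?_, fun i h1 h2 h4 => hI1 i (by omega) h2 h4, fun i h1 h2 h4 _ => hI2 i (by omega) h2 h4,
      hI3⟩
    simp only [Expr.cost]
    omega

/-- Compute the nearest marked ancestors. -/
def initAtt : Program :=
  assign 24 (const 1) ;; assign 25 (reg 3 +ᵉ const 1) ;;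
  forUp 24 25 (cond (load 8 (reg 24)) (store 9 (reg 24) (reg 24))
    (store 9 (reg 24) (load 9 (load 0 (const 4 *ᵉ reg 24 +ᵉ const 1)))))

/-- In an ascending sweep the value at the parent is known already. Cell `0` keeps the value `0`,
which means that there is no ancestor in `A`. -/
theorem IndexFits.runs_initAtt {w N L : ℕ} {R : ℕ → ℕ → Prop} {D A : ℕ → ℕ} {s : State}
    (h : IndexFits w N L R D) (hD : s.mem 0 = D) (h3 : s.reg 3 = N) (h8 : s.mem 8 = A)
    (h9 : s.mem 9 = fun _ => 0) :
    Runs w initAtt s fun t s' => t ≤ 40 * N + 20 ∧ s'.mem 9 0 = 0 ∧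
      ∀ i, 1 ≤ i → i ≤ N → s'.mem 9 i = if A i ≠ 0 then i else s'.mem 9 (D (4 * i + 1)) := by
  have hw := h.word
  have hsw := h.size_word
  simp (disch := omega) only [initAtt, runs_seq, runs_assign, eval_const_mod,
    eval_add_mod, eval_reg, setReg_reg, reduceIte, Nat.reduceEqDiff,
    Nat.mod_eq_of_lt, Expr.cost, h3]
  refine (Runs.forUp (fun x s' => s'.mem 9 0 = 0 ∧
      ∀ i, 1 ≤ i → i < x → s'.mem 9 i = if A i ≠ 0 then i else s'.mem 9 (D (4 * i + 1))) 20
    (by simp; omega) (by omega) rfl rfl (by decide) (by simp) ?_ ?_).use ?_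
  · refine ⟨by simp [h9], fun i h1 h2 => ?_⟩
    simp at h2
    omega
  · intro x s₁ hx1 hxN ⟨hI0, hI⟩ hx hf
    have e0 := hf.mem 0 rfl
    have e8 := hf.mem 8 rfl
    simp [hD, h8] at e0 e8 hx1 hxN
    have hp := h.par_lt (b := x) (by omega) (by omega)
    refine Runs.hide fun Q hQ => ?_
    simp (disch := omega) [hx, e8, e0, Nat.mod_eq_of_lt]
    have key : ∀ (s₂ : State) (t : ℕ), t ≤ 20 → s₂.mem 9 = Function.update (s₁.mem 9) x
        (if A x ≠ 0 then x else s₁.mem 9 (D (4 * x + 1))) → Q t s₂ := by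
      intro s₂ t ht hs₂
      refine hQ _ _ ⟨ht, ?_⟩
      simp only [setReg_mem, hs₂]
      refine ⟨?_, fun i h1 h2 => ?_⟩
      · rw [Function.update_of_ne (by omega)]
        exact hI0
      · by_cases hix : i = x
        · subst hix
          rw [Function.update_self, Function.update_of_ne (by omega)]
        · have hp' := h.par_lt (b := i) (by omega) (by omega)
          rw [Function.update_of_ne hix, Function.update_of_ne (by omega)]
          exact hI i h1 (by omega)
    refine ⟨fun hA => key _ _ (by omega) ?_, fun hA => key _ _ (by omega) ?_⟩
    · simp [hA]
    · simp [hA]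
  · rintro t s' ⟨ht, ⟨hI0, hI⟩, -⟩ hf
    simp at ht hI
    exact ⟨by omega, hI0, fun i h1 h2 => by simpa using hI i h1 (by omega)⟩

/-- Put all vertices that have not failed on the list of the root. -/
def initList : Program :=
  assign 24 (const 1) ;; assign 25 (reg 3 +ᵉ const 1) ;;
  forUp 24 25 (cond (load 6 (reg 24)) skip
    (store 16 (load 15 (const 0) *ᵉ (reg 3 +ᵉ const 1)) (reg 24) ;;
     store 15 (const 0) (load 15 (const 0) +ᵉ const 1)))

theorem runs_initList {w N : ℕ} {s : State} (hw : 1024 ≤ 2 ^ w) (hN : (N + 1) * (N + 1) < 2 ^ w)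
    (h3 : s.reg 3 = N) (h15 : s.mem 15 = fun _ => 0) :
    Runs w initList s fun t s' => t ≤ 40 * N + 20 ∧ s'.mem 15 0 ≤ N ∧
      (∀ z, z ≠ 0 → s'.mem 15 z = 0) ∧
      ∀ v, Listed N (s'.mem 15) (s'.mem 16) 0 v ↔ 1 ≤ v ∧ v ≤ N ∧ s.mem 6 v = 0 := by
  have hN' : N + 1 < 2 ^ w := lt_of_le_of_lt (Nat.le_mul_self _) hN
  simp (disch := omega) only [initList, runs_seq, runs_assign, eval_const_mod,
    eval_add_mod, eval_reg, setReg_reg, reduceIte, Nat.reduceEqDiff,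
    Nat.mod_eq_of_lt, Expr.cost, h3]
  refine (Runs.forUp (fun x s' => s'.mem 15 0 + 1 ≤ x ∧ (∀ z, z ≠ 0 → s'.mem 15 z = 0) ∧
      ∀ v, Listed N (s'.mem 15) (s'.mem 16) 0 v ↔ 1 ≤ v ∧ v < x ∧ s.mem 6 v = 0) 30
    (by simp; omega) (by omega) rfl rfl (by decide) (by simp) ?_ ?_).use ?_
  · refine ⟨by simp [h15], by simp [h15], fun v => ?_⟩
    simp only [Listed, setReg_mem, h15, setReg_reg, reduceIte, Nat.reduceEqDiff]
    constructor
    · rintro ⟨i, hi, -⟩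
      omega
    · omega
  · intro x s₁ hx1 hxN ⟨hI1, hI2, hI3⟩ hx hf
    have e6 := hf.mem 6 rfl
    have e3 := hf.reg 3 rfl
    simp [h3] at e6 e3 hx1 hxN
    obtain ⟨c, hc⟩ : ∃ c, s₁.mem 15 0 = c := ⟨_, rfl⟩
    rw [hc] at hI1
    have hmul : c * (N + 1) ≤ (N + 1) * (N + 1) := Nat.mul_le_mul_right _ (by omega)
    refine Runs.hide fun Q hQ => ?_
    simp (disch := omega) [hx, e6, e3, hc, Nat.mod_eq_of_lt]
    refine ⟨fun h6 => hQ _ _ ⟨by omega, by simp; omega, by simpa using hI2, fun v => ?_⟩,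
      fun h6 => hQ _ _ ⟨by omega, by simp; omega, fun z hz => ?_, fun v => ?_⟩⟩
    · simp only [setReg_mem]
      rw [hI3]
      constructor
      · rintro ⟨h1, h2, h4⟩
        exact ⟨h1, by omega, h4⟩
      · rintro ⟨h1, h2, h4⟩
        refine ⟨h1, lt_of_le_of_ne (by omega) ?_, h4⟩
        rintro rfl
        exact h6 h4
    · simpa [hz] using hI2 z hz
    · have := listed_push (N := N) (r := 0) (u := x) (cnt := s₁.mem 15) (ent := s₁.mem 16)
        (Nat.zero_le _) (z := 0) (v := v) (Nat.zero_le _)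
      simp only [hc, Nat.add_zero] at this
      simp only [setReg_mem, setMem_mem, Nat.reduceEqDiff, reduceIte]
      rw [this, hI3]
      constructor
      · rintro (⟨h1, h2, h4⟩ | ⟨-, rfl⟩)
        · exact ⟨h1, by omega, h4⟩
        · exact ⟨hx1, by omega, h6⟩
      · rintro ⟨h1, h2, h4⟩
        by_cases hvx : v = x
        · exact Or.inr ⟨trivial, hvx⟩
        · exact Or.inl ⟨h1, by omega, h4⟩
  · rintro t s' ⟨ht, ⟨hI1, hI2, hI3⟩, -⟩ hf
    simp at ht hI1 hI3
    exact ⟨by omega, by omega, hI2, hI3⟩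

/-! ### Partition into runs -/

/-- The elements of `A` below `i` have been enumerated and partitioned into runs. -/
structure Enumerated (spec vis A : ℕ → ℕ) (i M K : ℕ) (aord aidx run lo hi : ℕ → ℕ) : Prop where
  aidx_mem : ∀ v, 1 ≤ v → v < i → A v ≠ 0 → 1 ≤ aidx v ∧ aidx v ≤ M ∧ aord (aidx v) = v
  aord_mem : ∀ j, 1 ≤ j → j ≤ M → 1 ≤ aord j ∧ aord j < i ∧ A (aord j) ≠ 0 ∧ aidx (aord j) = j
  aord_lt : ∀ j k, 1 ≤ j → j < k → k ≤ M → aord j < aord k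
  run_lt : ∀ j, 1 ≤ j → j ≤ M → run j < K
  run_mono : ∀ j k, 1 ≤ j → j ≤ k → k ≤ M → run j ≤ run k
  run_last : 1 ≤ M → run M + 1 = K
  run_spec : ∀ j, 1 ≤ j → j + 1 ≤ M → run j = run (j + 1) →
    spec (aord j) = 0 ∧ spec (aord (j + 1)) = 0
  lo_mem : ∀ ρ, ρ < K → 1 ≤ lo ρ ∧ lo ρ ≤ M ∧ run (lo ρ) = ρ
  lo_le : ∀ j, 1 ≤ j → j ≤ M → lo (run j) ≤ j
  hi_iff : ∀ j, 1 ≤ j → j ≤ M → (vis (aord j) = 0 ↔ j ≤ hi (run j))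
  hi_mem : ∀ ρ, ρ < K → hi ρ ≤ M ∧ (lo ρ ≤ hi ρ → run (hi ρ) = ρ)
  aord_zero : aord 0 = 0
  card_lt : M < i
  runs_le : K ≤ M
  runs_card : K + (if spec (aord M) ≠ 0 then 1 else 0) ≤
    2 * ((Finset.Icc 1 (i - 1)).filter (fun v => spec v ≠ 0)).card + 1

namespace Enumerated

variable {spec vis A : ℕ → ℕ} {i M K : ℕ} {aord aidx run lo hi : ℕ → ℕ}

theorem card_succ (hi1 : 1 ≤ i) : ((Finset.Icc 1 (i + 1 - 1)).filter (fun v => spec v ≠ 0)).card =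
    ((Finset.Icc 1 (i - 1)).filter (fun v => spec v ≠ 0)).card +
      if spec i ≠ 0 then 1 else 0 := by
  obtain ⟨i, rfl⟩ := Nat.exists_eq_add_of_le' hi1
  rw [Nat.add_sub_cancel, Nat.add_sub_cancel]
  rw [← Finset.insert_Icc_right_eq_Icc_add_one (by omega), Finset.filter_insert]
  split_ifs with h
  · rw [Finset.card_insert_of_notMem (by simp)]
  · rfl

theorem skip (h : Enumerated spec vis A i M K aord aidx run lo hi) (hi1 : 1 ≤ i) (hA : A i = 0)
    (hs : spec i = 0) : Enumerated spec vis A (i + 1) M K aord aidx run lo hi :=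
  { h with
    aidx_mem := fun v h1 h2 h3 => h.aidx_mem v h1 (lt_of_le_of_ne (by omega) fun e => h3 (e ▸ hA)) h3
    aord_mem := fun j h1 h2 => by
      obtain ⟨h3, h4, h5⟩ := h.aord_mem j h1 h2
      exact ⟨h3, by omega, h5⟩
    card_lt := by have := h.card_lt; omega
    runs_card := by
      have := h.runs_card
      rw [card_succ hi1]
      simp only [hs]
      omega }

/-- A run ends before and after every special vertex. The sentinel `aord 0 = 0`, marked as special,
opens the first run. In `runs_card` the extra `1` at a special last element is the prepaid cost of
the run that opens after it, so each special vertex accounts for two runs. For a failed vertex `vis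
i = 1` makes the upper end of its one-element run smaller than the lower end, so that nothing of it
is left to visit. -/
theorem snoc (h : Enumerated spec vis A i M K aord aidx run lo hi) (hi1 : 1 ≤ i) (hA : A i ≠ 0)
    (h0 : spec 0 ≠ 0) (hv : vis i ≤ 1) (hvs : ∀ v, vis v ≠ 0 → spec v ≠ 0) {K' : ℕ} {lo' : ℕ → ℕ}
    (hnew : (spec i ≠ 0 ∨ spec (aord M) ≠ 0) ∧ K' = K + 1 ∧ lo' = Function.update lo K (M + 1) ∨
      spec i = 0 ∧ spec (aord M) = 0 ∧ K' = K ∧ lo' = lo) :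
    Enumerated spec vis A (i + 1) (M + 1) K' (Function.update aord (M + 1) i)
      (Function.update aidx i (M + 1)) (Function.update run (M + 1) (K' - 1)) lo'
      (Function.update hi (K' - 1) (M + 1 - vis i)) := by
  have hM : spec (aord M) = 0 → 1 ≤ M := by
    intro hs
    by_contra hc
    rw [show M = 0 by omega, h.aord_zero] at hs
    exact h0 hs
  have a1 : ∀ j, j ≤ M → Function.update aord (M + 1) i j = aord j := fun j hj =>
    Function.update_of_ne (by omega) _ _
  have a2 : Function.update aord (M + 1) i (M + 1) = i := Function.update_self ..
  have x1 : ∀ v, v ≠ i → Function.update aidx i (M + 1) v = aidx v := fun v hv =>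
    Function.update_of_ne hv _ _
  have x2 : Function.update aidx i (M + 1) i = M + 1 := Function.update_self ..
  have r1 : ∀ j, j ≤ M → Function.update run (M + 1) (K' - 1) j = run j := fun j hj =>
    Function.update_of_ne (by omega) _ _
  have r2 : Function.update run (M + 1) (K' - 1) (M + 1) = K' - 1 := Function.update_self ..
  have p1 : ∀ ρ, ρ ≠ K' - 1 → Function.update hi (K' - 1) (M + 1 - vis i) ρ = hi ρ := fun ρ hρ =>
    Function.update_of_ne hρ _ _
  have p2 : Function.update hi (K' - 1) (M + 1 - vis i) (K' - 1) = M + 1 - vis i :=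
    Function.update_self ..
  have l1 : ∀ ρ, ρ < K → lo' ρ = lo ρ := by
    intro ρ hρ
    rcases hnew with ⟨-, -, rfl⟩ | ⟨-, -, -, rfl⟩
    · exact Function.update_of_ne (by omega) _ _
    · rfl
  have hK : K ≤ K' ∧ K' ≤ K + 1 ∧ 1 ≤ K' := by
    rcases hnew with ⟨-, rfl, -⟩ | ⟨-, hs, rfl, -⟩
    · omega
    · have := h.run_last (hM hs)
      omega
  have l2 : K' = K + 1 → lo' K = M + 1 := by
    intro hK'
    rcases hnew with ⟨-, -, rfl⟩ | ⟨-, -, h1, -⟩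
    · exact Function.update_self ..
    · omega
  generalize Function.update aord (M + 1) i = aord' at a1 a2 ⊢
  generalize Function.update aidx i (M + 1) = aidx' at x1 x2 ⊢
  generalize Function.update run (M + 1) (K' - 1) = run' at r1 r2 ⊢
  generalize Function.update hi (K' - 1) (M + 1 - vis i) = hi' at p1 p2 ⊢
  have hMle : ∀ j, j ≤ M + 1 → j ≤ M ∨ j = M + 1 := fun j hj => by omega
  refine ⟨?_, ?_, ?_, ?_, ?_, ?_, ?_, ?_, ?_, ?_, ?_, ?_, ?_, ?_, ?_⟩
  · intro v h1 h2 h3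
    by_cases hvi : v = i
    · subst hvi
      rw [x2, a2]
      omega
    · obtain ⟨h4, h5, h6⟩ := h.aidx_mem v h1 (by omega) h3
      rw [x1 v hvi, a1 _ h5]
      exact ⟨h4, by omega, h6⟩
  · intro j h1 h2
    rcases hMle j h2 with h3 | rfl
    · obtain ⟨h4, h5, h6, h7⟩ := h.aord_mem j h1 h3
      rw [a1 j h3, x1 _ (by omega)]
      exact ⟨h4, by omega, h6, h7⟩
    · rw [a2, x2]
      exact ⟨hi1, by omega, hA, rfl⟩
  · intro j k h1 h2 h3
    rcases hMle k h3 with h4 | rfl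
    · rw [a1 j (by omega), a1 k h4]
      exact h.aord_lt j k h1 h2 h4
    · rw [a1 j (by omega), a2]
      exact (h.aord_mem j h1 (by omega)).2.1
  · intro j h1 h2
    rcases hMle j h2 with h3 | rfl
    · rw [r1 j h3]
      have := h.run_lt j h1 h3
      omega
    · omega
  · intro j k h1 h2 h3
    rcases hMle k h3 with h4 | rfl
    · rw [r1 j (by omega), r1 k h4]
      exact h.run_mono j k h1 h2 h4
    · rcases hMle j h2 with h4 | rfl
      · rw [r1 j h4, r2]
        have := h.run_lt j h1 h4
        omega
      · exact le_rfl
  · intro _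
    omega
  · intro j h1 h2 h3
    rcases hMle (j + 1) h2 with h4 | h4
    · rw [r1 j (by omega), r1 _ h4] at h3
      rw [a1 j (by omega), a1 _ h4]
      exact h.run_spec j h1 h4 h3
    · obtain rfl : j = M := by omega
      rw [r1 j le_rfl, r2] at h3
      rw [a1 j le_rfl, a2]
      have := h.run_last h1
      rcases hnew with ⟨-, h5, -⟩ | ⟨h5, h6, -⟩
      · omega
      · exact ⟨h6, h5⟩
  · intro ρ hρ
    by_cases hρK : ρ < K
    · obtain ⟨h1, h2, h3⟩ := h.lo_mem ρ hρK
      rw [l1 ρ hρK, r1 _ h2]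
      exact ⟨h1, by omega, h3⟩
    · obtain rfl : ρ = K := by omega
      rw [l2 (by omega), r2]
      omega
  · intro j h1 h2
    rcases hMle j h2 with h3 | rfl
    · rw [r1 j h3, l1 _ (h.run_lt j h1 h3)]
      exact h.lo_le j h1 h3
    · rw [r2]
      by_cases hKK : K' = K + 1
      · rw [show K' - 1 = K by omega, l2 hKK]
      · rw [l1 _ (by omega)]
        have := (h.lo_mem (K' - 1) (by omega)).2.1
        omega
  · intro j h1 h2
    rcases hMle j h2 with h3 | rfl
    · rw [r1 j h3, a1 j h3, h.hi_iff j h1 h3]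
      by_cases hr : run j = K' - 1
      · have hj := h.run_lt j h1 h3
        -- A run that is being extended contains no special vertex, hence no failed one, so raising
        -- its upper end is correct for all of its elements.
        have hv0 : vis (aord j) = 0 ∧ vis i = 0 := by
          rcases hnew with ⟨-, h5, -⟩ | ⟨h5, h6, h7, -⟩
          · omega
          · refine ⟨?_, ?_⟩
            · by_contra hc
              refine hvs _ hc ?_
              rcases Nat.eq_or_lt_of_le h3 with rfl | h3'
              · exact h6
              · have h8 := h.run_last (hM h6)
                have h9 := h.run_mono j (j + 1) h1 (by omega) h3'
                have h10 := h.run_mono (j + 1) M (by omega) h3' le_rfl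
                exact (h.run_spec j h1 h3' (by omega)).1
            · by_contra hc
              exact hvs _ hc h5
        rw [hr, p2, hv0.2, ← hr, ← h.hi_iff j h1 h3]
        simp only [hv0.1, true_iff]
        omega
      · rw [p1 _ hr]
    · rw [r2, p2, a2]
      omega
  · intro ρ hρ
    by_cases hρK : ρ = K' - 1
    · subst hρK
      rw [p2]
      refine ⟨by omega, fun hle => ?_⟩
      by_cases hvi : vis i = 0
      · rw [hvi, Nat.sub_zero, r2]
      · exfalso
        have := hvs _ hvi
        rcases hnew with ⟨-, h5, -⟩ | ⟨h5, -⟩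
        · rw [show K' - 1 = K by omega, l2 h5] at hle
          omega
        · omega
    · rw [p1 _ hρK, l1 _ (by omega)]
      obtain ⟨h1, h2⟩ := h.hi_mem ρ (by omega)
      rw [r1 _ h1]
      exact ⟨by omega, h2⟩
  · rw [a1 0 (by omega)]
    exact h.aord_zero
  · have := h.card_lt
    omega
  · have := h.runs_le
    rcases hnew with ⟨-, h5, -⟩ | ⟨-, -, h5, -⟩ <;> omega
  · have := h.runs_card
    rw [card_succ hi1, a2]
    rcases hnew with ⟨h4, h5, -⟩ | ⟨h4, h6, h5, -⟩
    · by_cases hs : spec i = 0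
      · have h6 : spec (aord M) ≠ 0 := by tauto
        simp only [hs, h6, ne_eq, not_true_eq_false, not_false_eq_true, if_true, if_false] at this ⊢
        omega
      · simp only [hs, ne_eq, not_false_eq_true, if_true] at this ⊢
        split_ifs at this <;> omega
    · simp only [h4, h6, ne_eq, not_true_eq_false, if_false] at this ⊢
      omega

end Enumerated

/-- A new run begins. -/
def newRun : Program := store 13 (reg 4) (reg 5 +ᵉ const 1) ;; assign 4 (reg 4 +ᵉ const 1)

/-- Enumerate the marked vertices and partition them into runs. -/
def enumerate : Program :=
  store 5 (const 0) (const 1) ;; assign 4 (const 0) ;; assign 5 (const 0) ;;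
  assign 24 (const 1) ;; assign 25 (reg 3 +ᵉ const 1) ;;
  forUp 24 25 (cond (load 8 (reg 24))
    (cond (load 5 (reg 24)) newRun (cond (load 5 (load 10 (reg 5))) newRun skip) ;;
     assign 5 (reg 5 +ᵉ const 1) ;; store 10 (reg 5) (reg 24) ;; store 11 (reg 24) (reg 5) ;;
     store 12 (reg 5) (reg 4 -ᵉ const 1) ;;
     store 14 (reg 4 -ᵉ const 1) (reg 5 -ᵉ load 6 (reg 24)))
    skip)

set_option maxHeartbeats 1000000 in
theorem runs_enumerate {w N : ℕ} {A vis spec : ℕ → ℕ} {s : State} (hw : 1024 ≤ 2 ^ w)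
    (hN : 8 * N + 8 < 2 ^ w) (h3 : s.reg 3 = N) (h5 : s.mem 5 = spec) (h6 : s.mem 6 = vis)
    (h8 : s.mem 8 = A) (h10 : s.mem 10 0 = 0)
    (hA : ∀ i, 1 ≤ i → i ≤ N → spec i ≠ 0 → A i ≠ 0) (hv : ∀ i, vis i ≤ 1)
    (hvs : ∀ i, vis i ≠ 0 → spec i ≠ 0) :
    Runs w enumerate s fun t s' => t ≤ 80 * N + 50 ∧ s'.mem 5 = Function.update spec 0 1 ∧
      Enumerated (Function.update spec 0 1) vis A (N + 1) (s'.reg 5) (s'.reg 4) (s'.mem 10)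
        (s'.mem 11) (s'.mem 12) (s'.mem 13) (s'.mem 14) := by
  have hA' : ∀ i, 1 ≤ i → i ≤ N → Function.update spec 0 1 i ≠ 0 → A i ≠ 0 := by
    intro i h1 h2 h
    rw [Function.update_of_ne (by omega)] at h
    exact hA i h1 h2 h
  have hvs' : ∀ i, vis i ≠ 0 → Function.update spec 0 1 i ≠ 0 := by
    intro i h
    exact update_one_ne_zero.2 (Or.inr (hvs i h))
  have hs0 : Function.update spec 0 1 0 ≠ 0 := by simp
  simp (disch := omega) only [enumerate, runs_seq, runs_assign, runs_store, eval_const_mod,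
    eval_add_mod, eval_reg, setReg_reg, setMem_reg, reduceIte, Nat.reduceEqDiff,
    Nat.mod_eq_of_lt, Expr.cost, h3]
  refine (Runs.forUp (fun x s' => Enumerated (Function.update spec 0 1) vis A x (s'.reg 5) (s'.reg 4)
      (s'.mem 10) (s'.mem 11) (s'.mem 12) (s'.mem 13) (s'.mem 14)) 60
    (by simp; omega) (by omega) rfl rfl (by decide) (by simp) ?_ ?_).use ?_
  · simp
    constructor <;> try (intros; omega)
    split_ifs <;> omega
  · intro x s₁ hx1 hxN hI hx hf
    have e5 := hf.mem 5 rfl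
    have e6 := hf.mem 6 rfl
    have e8 := hf.mem 8 rfl
    simp [h5, h6, h8] at e5 e6 e8 hx1 hxN
    have hMx := hI.card_lt
    have hKM := hI.runs_le
    obtain ⟨M, hM⟩ : ∃ M, s₁.reg 5 = M := ⟨_, rfl⟩
    obtain ⟨K, hK⟩ : ∃ K, s₁.reg 4 = K := ⟨_, rfl⟩
    rw [hM, hK] at hI hKM
    rw [hM] at hMx
    obtain ⟨σ, hσ⟩ : ∃ σ, Function.update spec 0 1 = σ := ⟨_, rfl⟩
    rw [hσ] at hI hA' hvs' hs0 e5 ⊢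
    have hnew := fun h => hI.snoc (K' := K + 1) (lo' := Function.update (s₁.mem 13) K (M + 1)) hx1
      (A := A) h hs0 (hv x) hvs'
    have hold := fun h => hI.snoc (K' := K) (lo' := s₁.mem 13) hx1 (A := A) h hs0 (hv x) hvs'
    refine Runs.hide fun Q hQ => ?_
    simp (disch := omega) [hx, e5, e6, e8, hM, hK, newRun, Nat.mod_eq_of_lt]
    refine ⟨fun hAx => ⟨fun hs => hQ _ _ ⟨by omega, ?_⟩, fun hs => ⟨fun hs' => hQ _ _ ⟨by omega, ?_⟩,
      fun hs' => hQ _ _ ⟨by omega, ?_⟩⟩⟩, fun hAx => hQ _ _ ⟨by omega, ?_⟩⟩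
    · have := hnew hAx (Or.inl ⟨Or.inl hs, rfl, rfl⟩)
      simpa [hM, hK] using this
    · have := hnew hAx (Or.inl ⟨Or.inr hs', rfl, rfl⟩)
      simpa [hM, hK] using this
    · have := hold hAx (Or.inr ⟨hs, hs', rfl, rfl⟩)
      simpa [hM, hK] using this
    · have := hI.skip hx1 hAx (by
        by_contra hc
        exact hA' x hx1 (by omega) hc hAx)
      simpa [hM, hK] using this
  · rintro t s' ⟨ht, hI, -⟩ hf
    have e5 := hf.mem 5 rfl
    simp [h5] at ht e5 hI
    exact ⟨by omega, e5, hI⟩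

/-! ### Correctness of the tables and the initial state -/

section

variable {w N L M K : ℕ} {R Fl : ℕ → ℕ → Prop} {dead : ℕ → Prop}
  {D A spec vis att aord aidx run lo hi : ℕ → ℕ}

/-- The tables are correct. -/
theorem IndexFits.setup (h : IndexFits w N L R D)
    (hA1 : ∀ i, 1 ≤ i → i ≤ N → spec i ≠ 0 → A i ≠ 0)
    (hA2 : ∀ i, 1 ≤ i → i ≤ N → A i ≠ 0 → D (4 * i + 1) ≠ 0 → A (D (4 * i + 1)) ≠ 0)
    (hA3 : ∀ v, 1 ≤ v → v ≤ N → A v ≠ 0 → spec v ≠ 0 ∨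
      ∃ c, v < c ∧ c ≤ N ∧ A c ≠ 0 ∧ D (4 * c + 1) = v)
    (hatt0 : att 0 = 0)
    (hatt : ∀ i, 1 ≤ i → i ≤ N → att i = if A i ≠ 0 then i else att (D (4 * i + 1)))
    (hE : Enumerated spec vis A (N + 1) M K aord aidx run lo hi)
    (hFs : ∀ a b, Fl a b → Fl b a) (hF : ∀ a b, Fl a b → 1 ≤ a ∧ a ≤ N ∧ spec a ≠ 0)
    (hdead : ∀ a, dead a → 1 ≤ a ∧ a ≤ N ∧ spec a ≠ 0) :
    Setup w N L K M R Fl dead D A att aord aidx run := by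
  have hMN : M ≤ N := Nat.lt_succ_iff.1 hE.card_lt
  have hatt_le : ∀ z, z ≤ N → att z ≤ z := by
    intro z
    induction z using Nat.strong_induction_on with
    | _ z ih =>
      intro hz
      rcases Nat.eq_zero_or_pos z with rfl | hz1
      · omega
      · rw [hatt z hz1 hz]
        have hp := h.par_lt hz1 hz
        split_ifs
        · exact le_rfl
        · have := ih _ hp (by omega)
          omega
  constructor
  · exact h
  · exact hE.runs_le.trans hMN
  · exact hMN
  · exact fun h1 h2 => hA2 _ h1 h2
  · exact fun _ h2 => hatt_le _ h2
  · intro z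
    induction z using Nat.strong_induction_on with
    | _ z ih =>
      intro hz1 hz h0
      rw [hatt z hz1 hz] at h0 ⊢
      have hp := h.par_lt hz1 hz
      split_ifs at h0 ⊢ with hA
      · exact ⟨hA, Desc.refl hz⟩
      · have hp0 : D (4 * z + 1) ≠ 0 := by
          intro e
          rw [e] at h0
          exact h0 hatt0
        obtain ⟨h1, h2⟩ := ih _ hp (by omega) (by omega) h0
        exact ⟨h1, h2.trans (h.desc_par hz1 hz hp0)⟩
  · intro z v hv hA hd
    induction z using Nat.strong_induction_on with
    | _ z ih =>
      have hz := hd.2.1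
      have hvz := hd.1
      rw [hatt z (by omega) hz]
      split_ifs with hAz
      · exact hvz
      · have hlt : v < z := lt_of_le_of_ne hvz (by rintro rfl; exact hAz hA)
        have hp := h.par_lt (b := z) (by omega) hz
        exact ih _ hp (hd.parent hlt hp)
  · exact fun h1 h2 h3 => hE.aidx_mem _ h1 (by omega) h3
  · intro i h1 h2
    obtain ⟨h3, h4, h5⟩ := hE.aord_mem i h1 h2
    exact ⟨h3, by omega, h5⟩
  · exact fun h1 h2 h3 => hE.aord_lt _ _ h1 h2 h3
  · exact fun h1 h2 => hE.run_lt _ h1 h2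
  · exact fun h1 h2 h3 => hE.run_mono _ _ h1 h2 h3
  · intro i h1 h2 hr
    obtain ⟨h3, h4⟩ := hE.run_spec i h1 h2 hr
    obtain ⟨ha1, haN, hAa, -⟩ := hE.aord_mem i h1 (by omega)
    obtain ⟨hb1, hbN, hAb, -⟩ := hE.aord_mem (i + 1) (by omega) h2
    have hab := hE.aord_lt i (i + 1) h1 (by omega) h2
    -- No element of `A` lies strictly between two consecutive ones of the enumeration.
    have hbet : ∀ x, 1 ≤ x → x ≤ N → A x ≠ 0 → aord i < x → aord (i + 1) ≤ x := by
      intro x hx1 hxN hAx hlt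
      obtain ⟨h5, h6, h7⟩ := hE.aidx_mem x hx1 (by omega) hAx
      by_contra hc
      rcases Nat.lt_trichotomy (aidx x) i with h8 | h8 | h8
      · have := hE.aord_lt _ _ h5 h8 (by omega)
        omega
      · rw [← h8] at hlt
        omega
      · rcases Nat.eq_or_lt_of_le (Nat.succ_le_of_lt h8) with h9 | h9
        · rw [Nat.succ_eq_add_one] at h9
          rw [h9] at hc
          omega
        · have := hE.aord_lt _ _ (by omega) h9 h6
          rw [Nat.succ_eq_add_one] at this
          omega
    -- `aord i` is not special, so it has a child `c` in `A`, and `aord (i + 1) ≤ c` lies below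
    -- `aord i`. The parent of `aord (i + 1)` belongs to `A` and is at least `aord i`, so by `hbet`
    -- it is `aord i`.
    rcases hA3 (aord i) ha1 (by omega) hAa with h5 | ⟨c, hc1, hcN, hAc, hpc⟩
    · exact absurd h3 h5
    · have hd := h.desc_par (b := c) (by omega) hcN (by omega)
      rw [hpc] at hd
      have hle : aord i ≤ D (4 * aord (i + 1) + 1) := hd.2.2 (aord (i + 1)) hab (hbet c (by omega) hcN hAc hc1)
      have hlt := h.par_lt (b := aord (i + 1)) hb1 (by omega)
      by_contra hne
      have := hbet (D (4 * aord (i + 1) + 1)) (by omega) (by omega)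
        (hA2 _ hb1 (by omega) hAb (by omega)) (by omega)
      omega
  · exact fun hab => hFs _ _ hab
  -- An end of a failed edge is special, while a run with two or more elements contains no special
  -- vertex. Runs are intervals of indices, so it is enough to compare with the neighbouring index.
  · intro i j x hi1 hiM hj1 hjM hFx hr
    have hs := (hF _ _ hFx).2.2
    rcases Nat.lt_trichotomy i j with hij | hij | hij
    · have h1 := hE.run_mono i (i + 1) hi1 (by omega) (by omega)
      have h2 := hE.run_mono (i + 1) j (by omega) hij hjM
      exact absurd (hE.run_spec i hi1 (by omega) (by omega)).1 hs
    · exact hij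
    · obtain ⟨i, rfl⟩ := Nat.exists_eq_add_of_le' hi1
      have h1 := hE.run_mono i (i + 1) (by omega) (by omega) (by omega)
      have h2 := hE.run_mono j i (by omega) (by omega) (by omega)
      exact absurd (hE.run_spec i (by omega) (by omega) (by omega)).2 hs
  · intro a b hab
    obtain ⟨h1, h2, h3⟩ := hF a b hab
    exact ⟨h1, h2, hA1 a h1 h2 h3⟩
  · exact fun ha => (hdead _ ha).1
  · intro a ha haN
    obtain ⟨h1, h2, h3⟩ := hdead a ha
    exact hA1 a h1 h2 h3

/-- The search may begin. -/
theorem Setup.searchInv (S : Setup w N L K M R Fl dead D A att aord aidx run)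
    (hE : Enumerated spec vis A (N + 1) M K aord aidx run lo hi)
    (hA1 : ∀ i, 1 ≤ i → i ≤ N → spec i ≠ 0 → A i ≠ 0)
    (hvs : ∀ i, vis i ≠ 0 → spec i ≠ 0)
    (hdead : ∀ a, dead a ↔ 1 ≤ a ∧ a ≤ N ∧ vis a ≠ 0) {s : State}
    (h6 : s.mem 6 = Function.update vis 0 1) (h13 : s.mem 13 = lo) (h14 : s.mem 14 = hi)
    (hl : ∀ v, Listed N (s.mem 15) (s.mem 16) 0 v ↔ 1 ≤ v ∧ v ≤ N ∧ vis v = 0)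
    (hc : ∀ z, z ≠ 0 → s.mem 15 z = 0)
    (h17 : s.mem 17 = fun _ => 0) (h18 : s.mem 18 = Function.update (fun _ => 0) 0 K)
    (h19 : s.mem 19 = fun _ => 0) (h20 : s.mem 20 = fun _ => 0) (hr : s.reg 6 = 0) :
    SearchInv N K M R Fl dead D A aord aidx run 0 0 (fun _ => L) (fun _ => L) s := by
  have hL := S.log
  have hv : ∀ v, v ≠ 0 → s.mem 6 v = vis v := fun v hv => by rw [h6, Function.update_of_ne hv]
  have hv0 : s.mem 6 0 ≠ 0 := by rw [h6]; simp
  have hV : ∀ v, Visited N dead (s.mem 6) v ↔ v = 0 := by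
    intro v
    constructor
    · rintro ⟨h1, h2, h3⟩
      by_contra h0
      rw [hv v h0] at h2
      exact h3 ((hdead v).2 ⟨by omega, h1, h2⟩)
    · rintro rfl
      exact ⟨Nat.zero_le _, hv0, fun h => absurd (S.dead_pos h) (by omega)⟩
  have hit : ∀ i v, (s.mem 17)^[i + 1] v = 0 := by
    intro i v
    rw [Function.iterate_succ_apply', h17]
  constructor
  · rw [hr]
    constructor
    · rw [hV]
    · rw [h17]
    · rw [hV]
    · intro v h1 h2
      rw [hV] at h1
      exact absurd h1 h2
    · exact fun v _ => ⟨1, hit 0 v⟩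
    · intro u v h1 h2 h3
      rw [hV] at h1 h2
      subst h1 h2
      exact absurd h3 (LiveAdj.irrefl _)
    · intro v h1 h2
      rw [hV] at h1
      subst h1
      exact absurd (IsAncestor.refl _) h2
  · exact hr
  · intro v hvN hd
    have := (hdead v).1 hd
    rw [hv v (by omega)]
    exact this.2.2
  · intro i h1 h2
    have := S.aord_mem h1 h2
    rw [hv _ (by omega), hE.hi_iff i h1 h2, h13, h14]
    have := hE.lo_le i h1 h2
    tauto
  · intro ρ hρ hle
    rw [h13, h14] at *
    have h1 := hE.lo_mem ρ hρ
    have h2 := hE.hi_mem ρ hρ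
    exact ⟨h1.1, h2.1, h1.2.2, h2.2 hle⟩
  · intro ρ hρ
    rw [h13, h14]
    have h1 := hE.lo_mem ρ hρ
    have h2 := hE.hi_mem ρ hρ
    have := S.M_le
    show _ < 2 ^ L
    omega
  · intro u h1 h2 h3 h4
    rw [hv u (by omega)] at h4
    exact absurd h3 (hA1 u h1 h2 (hvs u h4))
  · intro a u h1 h2 _ _
    have := S.fin_le h1 (h2.1.trans h2.2.1)
    show _ < 2 ^ L
    omega
  · rw [h19]
  · intro v _ _
    rw [h20]
    exact ⟨Nat.zero_le _, hv0⟩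
  · intro v _ h
    rw [h19] at h
    exact absurd rfl h
  · rintro z v hz ⟨i, hi, rfl⟩
    have hz0 : z = 0 := by
      by_contra h0
      rw [hc z h0] at hi
      omega
    subst hz0
    obtain ⟨h1, h2, h3⟩ := (hl _).1 ⟨i, hi, rfl⟩
    refine ⟨hz, h2, by omega, fun h => absurd (S.dead_pos h) (by omega), fun h => ?_, Or.inl rfl⟩
    exact ((hdead _).1 h).2.2 h3
  · rw [h18]
    simp
  · intro z _ h
    have h0 : z ≠ 0 := by
      rintro rfl
      exact hv0 h
    rw [h18]
    simp [h0]
  · intro z v hz hzv h1 h2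
    rw [hr] at hz ⊢
    have hz0 : z = 0 := by
      obtain ⟨i, rfl⟩ := hz
      cases i with
      | zero => rfl
      | succ i => exact hit i 0
    subst hz0
    rw [hv v h2] at h1
    exact Or.inl ⟨0, IsAncestor.refl _, IsAncestor.refl _,
      (hl v).2 ⟨by omega, hzv.2.1, h1⟩⟩

/-- Every exponent starts at `L`, as no run and no subtree has `2 ^ L` vertices. The dominant term
`2 * K * L` comes from the runs. -/
theorem potential_init {s : State} (hc0 : s.mem 15 0 ≤ N) (hc : ∀ z, z ≠ 0 → s.mem 15 z = 0) :
    potential N K 0 (fun _ => L) (fun _ => L) s ≤ (N + 1) * (3 + K + 2 * K * L + 2 * L) := by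
  have h1 : ∑ z ∈ Finset.range (N + 1), s.mem 15 z ≤ N := by
    rw [Finset.sum_eq_single 0 (fun z _ hz => hc z hz) (by simp)]
    exact hc0
  have h2 : ∑ z ∈ Finset.range (N + 1), (K - s.mem 18 z) ≤ (N + 1) * K := by
    have := Finset.sum_le_card_nsmul (Finset.range (N + 1)) (fun z => K - s.mem 18 z) K
      (fun z _ => Nat.sub_le _ _)
    simpa using this
  have h3 : numUnvisited N (s.mem 6) ≤ N + 1 := by
    unfold numUnvisited
    have := Finset.sum_le_card_nsmul (Finset.range (N + 1)) (fun z => if s.mem 6 z = 0 then 1 else 0)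
      1 (fun z _ => by split_ifs <;> omega)
    simpa using this
  unfold potential
  simp only [Finset.sum_const, Finset.card_range, smul_eq_mul]
  nlinarith

end

/-! ### Output and the whole query -/

/-- Report the tree. -/
def report : Program :=
  assign 24 (const 1) ;; assign 25 (reg 3 +ᵉ const 1) ;;
  forUp 24 25 (cond (load 17 (reg 24))
    (store 3 (load 0 (const 4 *ᵉ reg 24)) (load 0 (const 4 *ᵉ load 17 (reg 24))))
    (store 3 (load 0 (const 4 *ᵉ reg 24)) (reg 0)))

theorem runs_report {w N n : ℕ} {D par out : ℕ → ℕ} {s : State} (hw : 1024 ≤ 2 ^ w)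
    (hN : 8 * N + 8 < 2 ^ w) (hD : s.mem 0 = D) (h0 : s.reg 0 = n) (h3 : s.reg 3 = N)
    (h17 : s.mem 17 = par) (hout : s.mem 3 = out)
    (hinj : ∀ i j, 1 ≤ i → i < j → j ≤ N → D (4 * i) ≠ D (4 * j)) :
    Runs w report s fun t s' => t ≤ 40 * N + 20 ∧
      (∀ i, 1 ≤ i → i ≤ N → par i ≤ N →
        s'.mem 3 (D (4 * i)) = if par i = 0 then n else D (4 * par i)) ∧
      ∀ v, (∀ i, 1 ≤ i → i ≤ N → v ≠ D (4 * i)) → s'.mem 3 v = out v := by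
  simp (disch := omega) only [report, runs_seq, runs_assign, eval_const_mod,
    eval_add_mod, eval_reg, setReg_reg, reduceIte, Nat.reduceEqDiff,
    Nat.mod_eq_of_lt, Expr.cost, h3]
  refine (Runs.forUp (fun x s' => 
      (∀ i, 1 ≤ i → i < x → par i ≤ N →
        s'.mem 3 (D (4 * i)) = if par i = 0 then n else D (4 * par i)) ∧
      ∀ v, (∀ i, 1 ≤ i → i ≤ N → v ≠ D (4 * i)) → s'.mem 3 v = out v) 20
    (by simp; omega) (by omega) rfl rfl (by decide) (by simp) ?_ ?_).use ?_
  · refine ⟨fun i h1 h2 => ?_, fun v _ => by simp [hout]⟩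
    simp at h2
    omega
  · intro x s₁ hx1 hxN ⟨hI1, hI2⟩ hx hf
    have e0 := hf.mem 0 rfl
    have e17 := hf.mem 17 rfl
    have r0 := hf.reg 0 rfl
    simp [hD, h17, h0] at e0 e17 r0 hx1 hxN
    refine Runs.hide fun Q hQ => ?_
    simp (disch := omega) [hx, e0, e17, r0, Nat.mod_eq_of_lt]
    have key : ∀ (s₂ : State) (t y : ℕ), t ≤ 20 →
        s₂.mem 3 = Function.update (s₁.mem 3) (D (4 * x)) y →
        (par x ≤ N → y = if par x = 0 then n else D (4 * par x)) → Q t s₂ := by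
      intro s₂ t y ht hs₂ hy
      refine hQ _ _ ⟨ht, ?_⟩
      simp only [setReg_mem, hs₂]
      refine ⟨fun i h1 h2 h4 => ?_, fun v hv => ?_⟩
      · by_cases hix : i = x
        · subst hix
          rw [Function.update_self]
          exact hy h4
        · rw [Function.update_of_ne (hinj i x h1 (by omega) (by omega))]
          exact hI1 i h1 (by omega) h4
      · rw [Function.update_of_ne (hv x hx1 (by omega))]
        exact hI2 v hv
    refine ⟨fun hp => key _ _ _ (by omega) (by simp; rfl) fun hpN => ?_,
      fun hp => key _ _ _ (by omega) (by simp; rfl) fun hpN => ?_⟩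
    · rw [if_neg hp, Nat.mod_eq_of_lt (by omega)]
    · rw [if_pos hp]
  · rintro t s' ⟨ht, ⟨hI1, hI2⟩, -⟩ hf
    simp at ht hI1
    exact ⟨by omega, fun i h1 h2 => hI1 i h1 (by omega), hI2⟩

/-- The query algorithm. -/
def query : Program :=
  initOut ;; initNum ;; initVertices ;; initEdges ;; closeUp ;; initAtt ;; enumerate ;; initList ;;
  store 18 (const 0) (reg 4) ;; store 6 (const 0) (const 1) ;; assign 6 (const 0) ;;
  assign 8 (const 1) ;; searchLoop ;; report

-- There are at most `kv + 2 * ke` special vertices, hence at most `2 * (kv + 2 * ke) + 1` runs;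
-- inserting this into `potential_init` gives the time bound. Everything is stated in terms of
-- numbers; labels of vertices occur only as values `D (4 * i)`.
set_option maxHeartbeats 1000000 in
theorem IndexFits.runs_query {w N L n kv ke : ℕ} {R : ℕ → ℕ → Prop} {D e₁ e₂ : ℕ → ℕ} {s : State}
    (h : IndexFits w N L R D) (hn : n < 2 ^ w) (hNN : (N + 1) * (N + 1) < 2 ^ w)
    (hkv : kv < 2 ^ w) (hke : 4 * ke + 4 < 2 ^ w)
    (hT : ∀ K, K ≤ 2 * (kv + 2 * ke) + 1 →
      (N + 1) * (3 + K + 2 * K * L + 2 * L) * (N + 1) + N < 2 ^ w)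
    (h0 : s.reg 0 = n) (h1 : s.reg 1 = kv) (h2 : s.reg 2 = ke) (hD : s.mem 0 = D)
    (hmem : ∀ a, 3 ≤ a → s.mem a = fun _ => 0)
    (hD0 : D 0 = N) (hinj : ∀ i j, 1 ≤ i → i < j → j ≤ N → D (4 * i) ≠ D (4 * j))
    (hR : ∀ j < ke, R (e₁ j) (e₂ j)) (he₁ : ∀ j < ke, s.mem 2 (2 * j) = D (4 * e₁ j))
    (he₂ : ∀ j < ke, s.mem 2 (2 * j + 1) = D (4 * e₂ j)) :
    Runs w query s fun t s' =>
      t ≤ 1000 * (L + 1) * ((N + 1) * (3 + (2 * (kv + 2 * ke) + 1) +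
        2 * (2 * (kv + 2 * ke) + 1) * L + 2 * L) + 1) + 20 * n + 400 * N + 30 * kv +
        ke * (60 * L + 160) + 400 ∧
      ∃ dead Fl par cur,
        (∀ i, dead i ↔ 1 ≤ i ∧ i ≤ N ∧ ∃ j < kv, s.mem 1 j = D (4 * i)) ∧
        (∀ a b, Fl a b ↔ ∃ j < ke, (a = e₁ j ∧ b = e₂ j) ∨ (a = e₂ j ∧ b = e₁ j)) ∧
        DFSState (LiveAdj N R Fl dead) (fun v => v ≤ N ∧ ¬dead v) par cur ∧
        (∀ i, 1 ≤ i → i ≤ N → ¬dead i →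
          s'.mem 3 (D (4 * i)) = if par i = 0 then n else D (4 * par i)) ∧
        ∀ v < n, (∀ i, 1 ≤ i → i ≤ N → v ≠ D (4 * i)) → s'.mem 3 v = n := by
  have hw := h.word
  have hsw := h.size_word
  obtain ⟨k, hk⟩ : ∃ k, kv + 2 * ke = k := ⟨_, rfl⟩
  rw [hk] at hT ⊢
  rw [query, runs_seq]
  refine (runs_initOut hw hn h0).use ?_
  intro t₁ s₁ ⟨ht₁, hout⟩ f₁
  rw [runs_seq]
  refine (runs_initNum (D := D) hw hsw ((f₁.mem 0 rfl).trans hD) hD0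
    ((f₁.mem 4 rfl).trans (hmem 4 (by omega))) hinj).use ?_
  intro t₂ s₂ ⟨ht₂, r3, hnum, hnum'⟩ f₂
  have hmem₂ : ∀ a, 5 ≤ a → s₂.mem a = fun _ => 0 := by
    intro a ha
    have q1 : initNum.writesMem a = false := by
      simp [initNum, forUp]; omega
    have q2 : initOut.writesMem a = false := by
      simp [initOut, forUp]; omega
    rw [f₂.mem a q1, f₁.mem a q2, hmem a (by omega)]
  have m1 : s₂.mem 1 = s.mem 1 := (f₂.mem 1 rfl).trans (f₁.mem 1 rfl)
  rw [runs_seq]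
  refine (runs_initVertices (N := N) hw hkv
    ((f₂.reg 1 rfl).trans ((f₁.reg 1 rfl).trans h1)) (hmem₂ 5 le_rfl) (hmem₂ 6 (by omega))).use ?_
  intro t₃ s₃ ⟨ht₃, hvis, hvis1, hvs₃, hcard₃⟩ f₃
  have n3 : s₃.mem 4 = s₂.mem 4 := f₃.mem 4 rfl
  have m2 : s₃.mem 2 = s.mem 2 := (f₃.mem 2 rfl).trans ((f₂.mem 2 rfl).trans (f₁.mem 2 rfl))
  rw [runs_seq]
  refine (h.runs_initEdges (k := ke) (c := kv) (e₁ := e₁) (e₂ := e₂)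
    ((f₃.mem 0 rfl).trans ((f₂.mem 0 rfl).trans ((f₁.mem 0 rfl).trans hD))) hke
    ((f₃.reg 2 rfl).trans ((f₂.reg 2 rfl).trans ((f₁.reg 2 rfl).trans h2))) ?_ ?_ hR
    ((f₃.mem 7 rfl).trans (hmem₂ 7 (by omega))) hcard₃).use ?_
  · intro j hj
    rw [n3, m2, he₁ j hj, hnum _ (h.pos (hR j hj)) (h.le (hR j hj))]
  · intro j hj
    rw [n3, m2, he₂ j hj, hnum _ (h.pos (h.symm (hR j hj))) (h.le (h.symm (hR j hj)))]
  intro t₄ s₄ ⟨ht₄, hspec, hspec', hbad, hcard₄⟩ f₄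
  have D4 : s₄.mem 0 = D :=
    (f₄.mem 0 rfl).trans ((f₃.mem 0 rfl).trans ((f₂.mem 0 rfl).trans ((f₁.mem 0 rfl).trans hD)))
  have r34 : s₄.reg 3 = N := (f₄.reg 3 rfl).trans ((f₃.reg 3 rfl).trans r3)
  have hmem₄ : ∀ a, 8 ≤ a → s₄.mem a = fun _ => 0 := by
    intro a ha
    have q1 : initVertices.writesMem a = false := by
      simp [initVertices, forUp]; omega
    have q2 : initEdges.writesMem a = false := by
      simp [initEdges, forUp, search]; omega
    rw [f₄.mem a q2, f₃.mem a q1, hmem₂ a (by omega)]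
  obtain ⟨vis, hvis'⟩ : ∃ vis, s₃.mem 6 = vis := ⟨_, rfl⟩
  obtain ⟨spec, hspec''⟩ : ∃ spec, s₄.mem 5 = spec := ⟨_, rfl⟩
  have v4 : s₄.mem 6 = vis := (f₄.mem 6 rfl).trans hvis'
  rw [hvis'] at hvis hvis1 hvs₃
  rw [hspec''] at hspec hspec' hcard₄
  have hvs : ∀ i, vis i ≠ 0 → spec i ≠ 0 := fun i hi => hspec i (hvs₃ i hi)
  rw [runs_seq]
  refine (h.runs_closeUp (spec := spec) D4 r34 hspec'' (hmem₄ 8 le_rfl)).use ?_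
  intro t₅ s₅ ⟨ht₅, hA1, hA2, hA3⟩ f₅
  obtain ⟨A, hA⟩ : ∃ A, s₅.mem 8 = A := ⟨_, rfl⟩
  rw [hA] at hA1 hA2 hA3
  have D5 : s₅.mem 0 = D := (f₅.mem 0 rfl).trans D4
  have r35 : s₅.reg 3 = N := (f₅.reg 3 rfl).trans r34
  rw [runs_seq]
  refine (h.runs_initAtt D5 r35 hA ((f₅.mem 9 rfl).trans (hmem₄ 9 (by omega)))).use ?_
  intro t₆ s₆ ⟨ht₆, hatt0, hatt⟩ f₆
  have r36 : s₆.reg 3 = N := (f₆.reg 3 rfl).trans r35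
  have hmem₆ : ∀ a, 10 ≤ a → s₆.mem a = fun _ => 0 := by
    intro a ha
    have q1 : closeUp.writesMem a = false := by
      simp [closeUp, forUp]; omega
    have q2 : initAtt.writesMem a = false := by
      simp [initAtt, forUp]; omega
    rw [f₆.mem a q2, f₅.mem a q1, hmem₄ a (by omega)]
  have v6 : s₆.mem 6 = vis := (f₆.mem 6 rfl).trans ((f₅.mem 6 rfl).trans v4)
  rw [runs_seq]
  refine (runs_enumerate (A := A) (vis := vis) (spec := spec) hw hsw r36
    ((f₆.mem 5 rfl).trans ((f₅.mem 5 rfl).trans hspec'')) v6 ((f₆.mem 8 rfl).trans hA)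
    (by rw [hmem₆ 10 le_rfl]) hA1 hvis1 hvs).use ?_
  intro t₇ s₇ ⟨ht₇, _, hE⟩ f₇
  have r37 : s₇.reg 3 = N := (f₇.reg 3 rfl).trans r36
  have v7 : s₇.mem 6 = vis := (f₇.mem 6 rfl).trans v6
  have hmem₇ : ∀ a, 15 ≤ a → s₇.mem a = fun _ => 0 := by
    intro a ha
    have q1 : enumerate.writesMem a = false := by
      simp [enumerate, forUp, newRun]; omega
    rw [f₇.mem a q1, hmem₆ a (by omega)]
  rw [runs_seq]
  refine (runs_initList hw hNN r37 (hmem₇ 15 le_rfl)).use ?_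
  intro t₈ s₈ ⟨ht₈, hcnt0, hcnt, hlist⟩ f₈
  obtain ⟨K, hK⟩ : ∃ K, s₇.reg 4 = K := ⟨_, rfl⟩
  obtain ⟨M, hM⟩ : ∃ M, s₇.reg 5 = M := ⟨_, rfl⟩
  rw [hK, hM] at hE
  rw [v7] at hlist
  have r48 : s₈.reg 4 = K := (f₈.reg 4 rfl).trans hK
  have hspec0 : ∀ i, 1 ≤ i → Function.update spec 0 1 i = spec i := fun i hi =>
    Function.update_of_ne (by omega) _ _
  have hcardK : K ≤ 2 * k + 1 := by
    have h1 := hE.runs_card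
    have h2 : (Finset.Icc 1 (N + 1 - 1)).filter (fun v => Function.update spec 0 1 v ≠ 0) =
        (Finset.Icc 1 N).filter (fun v => spec v ≠ 0) := by
      refine Finset.filter_congr fun i hi => ?_
      rw [hspec0 i (Finset.mem_Icc.1 hi).1]
    rw [h2] at h1
    omega
  obtain ⟨dead, hdead⟩ : ∃ dead : ℕ → Prop, ∀ a, dead a ↔ 1 ≤ a ∧ a ≤ N ∧ vis a ≠ 0 :=
    ⟨fun a => 1 ≤ a ∧ a ≤ N ∧ vis a ≠ 0, fun _ => Iff.rfl⟩
  obtain ⟨Fl, hFl⟩ : ∃ Fl : ℕ → ℕ → Prop, ∀ a b, Fl a b ↔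
      ∃ j < ke, (a = e₁ j ∧ b = e₂ j) ∨ (a = e₂ j ∧ b = e₁ j) := ⟨fun a b => _, fun _ _ => Iff.rfl⟩
  have S : Setup w N L K M R Fl dead D A (s₆.mem 9) (s₇.mem 10) (s₇.mem 11) (s₇.mem 12) := by
    refine h.setup (spec := Function.update spec 0 1) ?_ hA2 ?_ hatt0 hatt hE ?_ ?_ ?_
    · intro i hi1 hiN hs
      rw [hspec0 i hi1] at hs
      exact hA1 i hi1 hiN hs
    · intro v hv1 hvN hv
      rw [hspec0 v hv1]
      exact hA3 v hv1 hvN hv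
    · intro a b hab
      rw [hFl] at hab ⊢
      obtain ⟨j, hj, hab⟩ := hab
      exact ⟨j, hj, by tauto⟩
    · intro a b hab
      obtain ⟨j, hj, ⟨rfl, rfl⟩ | ⟨rfl, rfl⟩⟩ := (hFl a b).1 hab
      · have h1 := h.pos (hR j hj)
        exact ⟨h1, h.le (hR j hj), by rw [hspec0 _ h1]; exact (hspec' j hj).1⟩
      · have h1 := h.pos (h.symm (hR j hj))
        exact ⟨h1, h.le (h.symm (hR j hj)), by rw [hspec0 _ h1]; exact (hspec' j hj).2⟩
    · intro a ha
      obtain ⟨h1, h2, h3⟩ := (hdead a).1 ha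
      exact ⟨h1, h2, by rw [hspec0 a h1]; exact hvs a h3⟩
  simp (disch := omega) only [runs_seq, runs_store, runs_assign, eval_const_mod, eval_reg,
    Nat.mod_eq_of_lt, r48, Expr.cost]
  obtain ⟨s₉, hs₉⟩ : ∃ s₉, ((((s₈.setMem 18 0 K).setMem 6 0 1).setReg 6 0).setReg 8 1) = s₉ :=
    ⟨_, rfl⟩
  rw [hs₉]
  have m9 : ∀ a, a ≠ 18 → a ≠ 6 → s₉.mem a = s₈.mem a := by
    intro a h1 h2
    rw [← hs₉]
    simp [h1, h2]
  have z8 : ∀ a, 17 ≤ a → s₈.mem a = fun _ => 0 := by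
    intro a ha
    have q1 : initList.writesMem a = false := by
      simp [initList, forUp]; omega
    rw [f₈.mem a q1, hmem₇ a (by omega)]
  have e13 : s₉.mem 13 = s₇.mem 13 := (m9 13 (by omega) (by omega)).trans (f₈.mem 13 rfl)
  have e14 : s₉.mem 14 = s₇.mem 14 := (m9 14 (by omega) (by omega)).trans (f₈.mem 14 rfl)
  have e15 : s₉.mem 15 = s₈.mem 15 := m9 15 (by omega) (by omega)
  have e16 : s₉.mem 16 = s₈.mem 16 := m9 16 (by omega) (by omega)
  have hI : SearchInv N K M R Fl dead D A (s₇.mem 10) (s₇.mem 11) (s₇.mem 12) 0 0 (fun _ => L)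
      (fun _ => L) s₉ := by
    refine S.searchInv hE ?_ ?_ hdead ?_ e13 e14 ?_ ?_ ?_ ?_ ?_ ?_ ?_
    · intro i hi1 hiN hs
      rw [hspec0 i hi1] at hs
      exact hA1 i hi1 hiN hs
    · intro i hi
      exact update_one_ne_zero.2 (Or.inr (hvs i hi))
    · rw [← hs₉, ← v7, ← f₈.mem 6 rfl]
      rfl
    · rw [e15, e16]
      exact hlist
    · rw [e15]
      exact hcnt
    · rw [m9 17 (by omega) (by omega), z8 17 (by omega)]
    · rw [← hs₉, ← z8 18 (by omega)]
      rfl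
    · rw [m9 19 (by omega) (by omega), z8 19 (by omega)]
    · rw [m9 20 (by omega) (by omega), z8 20 (by omega)]
    · rw [← hs₉]
      simp
  have D9 : s₉.mem 0 = D := (m9 0 (by omega) (by omega)).trans ((f₈.mem 0 rfl).trans
    ((f₇.mem 0 rfl).trans ((f₆.mem 0 rfl).trans D5)))
  have hTab : Tables N K Fl D A (s₆.mem 9) (s₇.mem 10) (s₇.mem 11) (s₇.mem 12) s₉ := by
    constructor
    · exact D9
    · exact (m9 8 (by omega) (by omega)).trans ((f₈.mem 8 rfl).trans
        ((f₇.mem 8 rfl).trans ((f₆.mem 8 rfl).trans hA)))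
    · exact (m9 9 (by omega) (by omega)).trans ((f₈.mem 9 rfl).trans (f₇.mem 9 rfl))
    · exact (m9 10 (by omega) (by omega)).trans (f₈.mem 10 rfl)
    · exact (m9 11 (by omega) (by omega)).trans (f₈.mem 11 rfl)
    · exact (m9 12 (by omega) (by omega)).trans (f₈.mem 12 rfl)
    · rw [← hs₉]
      simpa using (f₈.reg 3 rfl).trans r37
    · rw [← hs₉]
      simpa using r48
    · intro u j hu huN h3 h4
      rw [m9 7 (by omega) (by omega), f₈.mem 7 rfl, f₇.mem 7 rfl, f₆.mem 7 rfl, f₅.mem 7 rfl, hFl]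
      exact hbad u j hu huN h3 h4
  have hp := potential_init (N := N) (K := K) (L := L) (s := s₉) (by rw [e15]; exact hcnt0)
    (by rw [e15]; exact hcnt)
  refine (S.runs_searchLoop hTab hI (by rw [← hs₉]; simp) hp (hT K hcardK)).use ?_
  intro t₁₀ s₁₀ ⟨ht₁₀, hall, hdfs⟩ f₁₀
  have D10 : s₁₀.mem 0 = D := (f₁₀.mem 0 rfl).trans D9
  have r0 : s₁₀.reg 0 = n := by
    rw [f₁₀.reg 0 rfl, ← hs₉]
    simp only [setReg_reg, setMem_reg, Nat.reduceEqDiff, reduceIte]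
    rw [f₈.reg 0 rfl, f₇.reg 0 rfl, f₆.reg 0 rfl, f₅.reg 0 rfl, f₄.reg 0 rfl, f₃.reg 0 rfl,
      f₂.reg 0 rfl, f₁.reg 0 rfl, h0]
  have r3' : s₁₀.reg 3 = N := (f₁₀.reg 3 rfl).trans hTab.reg3
  have out10 : s₁₀.mem 3 = s₁.mem 3 := by
    rw [f₁₀.mem 3 rfl, m9 3 (by omega) (by omega), f₈.mem 3 rfl, f₇.mem 3 rfl, f₆.mem 3 rfl,
      f₅.mem 3 rfl, f₄.mem 3 rfl, f₃.mem 3 rfl, f₂.mem 3 rfl]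
  refine (runs_report hw hsw D10 r0 r3' rfl out10 hinj).mono ?_
  intro t₁₁ s₁₁ ⟨ht₁₁, hrep, hrep'⟩
  refine ⟨?_, dead, Fl, s₁₀.mem 17, s₁₀.reg 6, ?_, hFl, ?_, ?_, ?_⟩
  · have hle : 1000 * (L + 1) * ((N + 1) * (3 + K + 2 * K * L + 2 * L) + 1) ≤
        1000 * (L + 1) * ((N + 1) * (3 + (2 * k + 1) + 2 * (2 * k + 1) * L + 2 * L) + 1) := by
      gcongr
    clear hp hT hE hI S hTab hlist
    omega
  · intro i
    rw [hdead, hvis, m1]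
    constructor
    · rintro ⟨h3, h4, j, hj, rfl⟩
      exact ⟨h3, h4, j, hj, (hnum' _ (by omega)).symm⟩
    · rintro ⟨h3, h4, j, hj, h5⟩
      exact ⟨h3, h4, j, hj, by rw [h5, hnum i h3 h4]⟩
  · refine hdfs.congr fun v => ?_
    constructor
    · exact fun hv => hall v hv.1 hv.2
    · exact fun hv => ⟨hv.1, hv.2.2⟩
  · intro i hi1 hiN hd
    exact hrep i hi1 hiN (hdfs.par_mem (hall i hiN hd)).1
  · intro v hv hvi
    rw [hrep' v hvi, hout v hv]

/-! ### Preprocessing -/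

theorem cell_eq_iff {n u v x y : ℕ} (hv : v < n) (hy : y < n) :
    u * n + v = x * n + y ↔ u = x ∧ v = y := by
  obtain ⟨N, rfl⟩ : ∃ N, n = N + 1 := ⟨n - 1, by omega⟩
  constructor
  · exact cell_injective (by omega) (by omega)
  · rintro ⟨rfl, rfl⟩
    rfl

/-- Build the adjacency matrix. -/
def buildMatrix : Program :=
  assign 7 (const 0) ;;
  forUp 7 1 (assign 8 (load 0 (const 2 *ᵉ reg 7)) ;; assign 9 (load 0 (const 2 *ᵉ reg 7 +ᵉ const 1)) ;;
    store 1 (reg 8 *ᵉ reg 0 +ᵉ reg 9) (const 1) ;; store 1 (reg 9 *ᵉ reg 0 +ᵉ reg 8) (const 1))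

theorem runs_buildMatrix {w n m : ℕ} {e₁ e₂ : ℕ → ℕ} {s : State} (hw : 1024 ≤ 2 ^ w)
    (hn : n * n + n < 2 ^ w) (hm : 2 * m + 2 < 2 ^ w) (h0 : s.reg 0 = n) (h1 : s.reg 1 = m)
    (he₁ : ∀ j < m, s.mem 0 (2 * j) = e₁ j ∧ e₁ j < n)
    (he₂ : ∀ j < m, s.mem 0 (2 * j + 1) = e₂ j ∧ e₂ j < n) (hz : s.mem 1 = fun _ => 0) :
    Runs w buildMatrix s fun _ s' => ∀ u v, u < n → v < n →
      (s'.mem 1 (u * n + v) ≠ 0 ↔ ∃ j < m, (e₁ j = u ∧ e₂ j = v) ∨ (e₁ j = v ∧ e₂ j = u)) := by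
  rw [buildMatrix, runs_seq, runs_assign]
  refine (Runs.forUp_total (fun x s' => ∀ u v, u < n → v < n →
      (s'.mem 1 (u * n + v) ≠ 0 ↔ ∃ j < x, (e₁ j = u ∧ e₂ j = v) ∨ (e₁ j = v ∧ e₂ j = u)))
    (by simp [h1]; omega) (by omega) rfl rfl (by decide) (by simp) (by simp [hz]) ?_).mono ?_
  · intro x s₁ _ hxm hI hx hf
    have e0 := hf.mem 0 rfl
    have r0 := hf.reg 0 rfl
    simp [h0, h1] at e0 r0 hxm
    obtain ⟨ha, han⟩ := he₁ x hxm
    obtain ⟨hb, hbn⟩ := he₂ x hxm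
    have hc : ∀ u v, u < n → v < n → u * n < 2 ^ w ∧ u * n + v < 2 ^ w := by
      intro u v hu hv
      have : u * n ≤ n * n := Nat.mul_le_mul_right _ hu.le
      omega
    obtain ⟨c1, c2⟩ := hc _ _ han hbn
    obtain ⟨c3, c4⟩ := hc _ _ hbn han
    refine Runs.hide fun Q hQ => ?_
    simp (disch := omega) [hx, e0, r0, ha, hb, Nat.mod_eq_of_lt]
    refine hQ _ _ fun u v hu hv => ?_
    simp only [setReg_mem, setMem_mem, reduceIte]
    rw [update_one_ne_zero, update_one_ne_zero, hI u v hu hv, Nat.exists_lt_succ_right,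
      cell_eq_iff hv hbn, cell_eq_iff hv han]
    constructor
    · rintro (⟨h1, h2⟩ | ⟨h1, h2⟩ | h)
      · exact Or.inr (Or.inr ⟨h2.symm, h1.symm⟩)
      · exact Or.inr (Or.inl ⟨h1.symm, h2.symm⟩)
      · exact Or.inl h
    · rintro (h | ⟨h1, h2⟩ | ⟨h1, h2⟩)
      · exact Or.inr (Or.inr h)
      · exact Or.inr (Or.inl ⟨h1.symm, h2.symm⟩)
      · exact Or.inl ⟨h2.symm, h1.symm⟩
  · rintro t s' ⟨hI, -⟩
    simpa [h1] using hI

/-- Find an unnumbered vertex with a neighbour of the largest possible number. -/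
def scan : Program :=
  assign 4 (const 0) ;; assign 7 (const 0) ;; assign 6 (reg 0 *ᵉ reg 0) ;;
  forUp 7 6 (cond (load 1 (reg 7)) (cond (load 2 (reg 7 %ᵉ reg 0)) skip
    (cond (reg 4 <ᵉ load 2 (reg 7 /ᵉ reg 0) +ᵉ const 1)
      (assign 4 (load 2 (reg 7 /ᵉ reg 0) +ᵉ const 1) ;; assign 5 (reg 7 %ᵉ reg 0)) skip)) skip)

/-- Register `4` holds the largest number found plus one, so that `0` means that there is no
candidate. The value `1` means that the best neighbour is itself unnumbered: a new tree begins, with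
parent `0`. -/
theorem runs_scan {w n : ℕ} {mat num : ℕ → ℕ} {s : State} (hw : 1024 ≤ 2 ^ w)
    (hn : n * n + n < 2 ^ w) (h0 : s.reg 0 = n) (h1 : s.mem 1 = mat) (h2 : s.mem 2 = num)
    (hnum : ∀ v < n, num v ≤ n) :
    Runs w scan s fun _ s' =>
      (∀ u v, u < n → v < n → mat (u * n + v) ≠ 0 → num v = 0 → num u + 1 ≤ s'.reg 4) ∧
      (s'.reg 4 ≠ 0 → s'.reg 5 < n ∧ num (s'.reg 5) = 0 ∧
        ∃ u < n, mat (u * n + s'.reg 5) ≠ 0 ∧ num u + 1 = s'.reg 4) := by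
  have hnn : n ≤ n * n := Nat.le_mul_self n
  simp (disch := omega) only [scan, runs_seq, runs_assign, eval_const_mod,
    eval_mul_mod, eval_reg, setReg_reg, reduceIte, Nat.reduceEqDiff,
    Nat.mod_eq_of_lt, h0]
  refine (Runs.forUp_total (fun x s' =>
      (∀ p < x, mat p ≠ 0 → num (p % n) = 0 → num (p / n) + 1 ≤ s'.reg 4) ∧
      (s'.reg 4 ≠ 0 → s'.reg 5 < n ∧ num (s'.reg 5) = 0 ∧
        ∃ u < n, mat (u * n + s'.reg 5) ≠ 0 ∧ num u + 1 = s'.reg 4))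
    (by simp; omega) (by omega) rfl rfl (by decide) (by simp) (by simp) ?_).mono ?_
  · intro x s₁ _ hxm ⟨hI1, hI2⟩ hx hf
    have e1 := hf.mem 1 rfl
    have e2 := hf.mem 2 rfl
    have r0 := hf.reg 0 rfl
    simp [h0, h1, h2] at e1 e2 r0 hxm
    have hn0 : 0 < n := by
      rcases Nat.eq_zero_or_pos n with rfl | h
      · omega
      · exact h
    have hdiv : x / n < n := Nat.div_lt_of_lt_mul hxm
    have hmod : x % n < n := Nat.mod_lt _ hn0
    have hxe : x / n * n + x % n = x := by
      rw [Nat.mul_comm]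
      exact Nat.div_add_mod x n
    have hd := hnum _ hdiv
    refine Runs.hide fun Q hQ => ?_
    simp (disch := omega) [hx, e1, e2, r0, Nat.mod_eq_of_lt]
    have key : ∀ s₂ : State, s₂.reg 4 = s₁.reg 4 → s₂.reg 5 = s₁.reg 5 →
        (mat x ≠ 0 → num (x % n) = 0 → num (x / n) + 1 ≤ s₁.reg 4) → ∀ t, Q t s₂ := by
      intro s₂ h4 h5 hk t
      refine hQ _ _ ?_
      simp only [setReg_reg, Nat.reduceEqDiff, reduceIte, h4, h5]
      refine ⟨fun p hp => ?_, hI2⟩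
      rcases Nat.lt_succ_iff_lt_or_eq.1 hp with hp | rfl
      · exact hI1 p hp
      · exact hk
    refine ⟨fun hm => ⟨fun hv => key _ rfl rfl (by tauto) _, fun hv => ⟨fun hlt => hQ _ _ ?_,
      fun hlt => key _ rfl rfl (by omega) _⟩⟩, fun hm => key _ rfl rfl (by tauto) _⟩
    simp only [setReg_reg, Nat.reduceEqDiff, reduceIte]
    refine ⟨fun p hp h1 h2 => ?_, fun _ => ⟨hmod, hv, _, hdiv, by rwa [hxe], rfl⟩⟩
    rcases Nat.lt_succ_iff_lt_or_eq.1 hp with hp | rfl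
    · have := hI1 p hp h1 h2
      omega
    · exact le_rfl
  · rintro t s' ⟨⟨hI1, hI2⟩, -⟩
    refine ⟨fun u v hu hv h1 h2 => ?_, hI2⟩
    have h3 : (u * n + v) % n = v := by
      rw [Nat.mul_comm, Nat.mul_add_mod, Nat.mod_eq_of_lt hv]
    have h4 : (u * n + v) / n = u := by
      rw [Nat.mul_comm, Nat.mul_add_div (by omega), Nat.div_eq_of_lt hv, Nat.add_zero]
    have h5 : u * n + v < n * n := by
      have : (u + 1) * n ≤ n * n := Nat.mul_le_mul_right _ hu
      rw [Nat.add_mul, Nat.one_mul] at this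
      omega
    have := hI1 (u * n + v) (by simpa using h5) h1 (by rwa [h3])
    rwa [h4] at this

/-- `N` vertices have been numbered in depth-first order: `lab i` has number `i`, and its parent has
number `par i`. -/
structure Numbered (n : ℕ) (adj : ℕ → ℕ → Prop) (N : ℕ) (num lab par : ℕ → ℕ) : Prop where
  lab_mem : ∀ i, 1 ≤ i → i ≤ N → lab i < n ∧ num (lab i) = i
  num_mem : ∀ v, v < n → num v ≠ 0 → num v ≤ N ∧ lab (num v) = v
  par_lt : ∀ b, 1 ≤ b → b ≤ N → par b < b
  par_adj : ∀ b, 1 ≤ b → b ≤ N → par b ≠ 0 → adj (lab b) (lab (par b))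
  maximal : ∀ a b v, 1 ≤ a → a < b → b ≤ N → adj (lab a) v → num v = 0 ∨ b ≤ num v → a ≤ par b
  nbr : ∀ b, 1 ≤ b → b ≤ N → ∃ v, adj (lab b) v

/-- Attaching each new vertex to the neighbour with the largest number is depth-first search: while
`a` has an unnumbered neighbour, the parent of the next vertex has number at least `a`. This is the
field `maximal`. -/
theorem Numbered.snoc {n N : ℕ} {adj : ℕ → ℕ → Prop} {num lab par : ℕ → ℕ}
    (h : Numbered n adj N num lab par) (hn : ∀ u v, adj u v → u < n ∧ v < n)
    (hs : ∀ u v, adj u v → adj v u) {x u : ℕ} (hx : num x = 0) (hux : adj u x)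
    (hmax : ∀ a v, adj a v → num v = 0 → num a ≤ num u) :
    Numbered n adj (N + 1) (Function.update num x (N + 1)) (Function.update lab (N + 1) x)
      (Function.update par (N + 1) (num u)) := by
  obtain ⟨hun, hxn⟩ := hn u x hux
  have n1 : ∀ v, v ≠ x → Function.update num x (N + 1) v = num v := fun v hv =>
    Function.update_of_ne hv _ _
  have n2 : Function.update num x (N + 1) x = N + 1 := Function.update_self ..
  have l1 : ∀ i, i ≤ N → Function.update lab (N + 1) x i = lab i := fun i hi =>
    Function.update_of_ne (by omega) _ _
  have l2 : Function.update lab (N + 1) x (N + 1) = x := Function.update_self ..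
  have p1 : ∀ i, i ≤ N → Function.update par (N + 1) (num u) i = par i := fun i hi =>
    Function.update_of_ne (by omega) _ _
  have p2 : Function.update par (N + 1) (num u) (N + 1) = num u := Function.update_self ..
  generalize Function.update num x (N + 1) = num' at n1 n2 ⊢
  generalize Function.update lab (N + 1) x = lab' at l1 l2 ⊢
  generalize Function.update par (N + 1) (num u) = par' at p1 p2 ⊢
  have huN : num u ≤ N := by
    by_cases h0 : num u = 0
    · omega
    · exact (h.num_mem u hun h0).1
  have hlx : ∀ i, 1 ≤ i → i ≤ N → lab i ≠ x := by
    intro i h1 h2 e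
    have := (h.lab_mem i h1 h2).2
    rw [e] at this
    omega
  have hcase : ∀ i, i ≤ N + 1 → i ≤ N ∨ i = N + 1 := fun i hi => by omega
  refine ⟨?_, ?_, ?_, ?_, ?_, ?_⟩
  · intro i h1 h2
    rcases hcase i h2 with h3 | rfl
    · rw [l1 i h3, n1 _ (hlx i h1 h3)]
      exact h.lab_mem i h1 h3
    · rw [l2, n2]
      exact ⟨hxn, rfl⟩
  · intro v hv h0
    by_cases hvx : v = x
    · subst hvx
      rw [n2, l2]
      exact ⟨le_rfl, rfl⟩
    · rw [n1 v hvx] at h0 ⊢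
      obtain ⟨h1, h2⟩ := h.num_mem v hv h0
      rw [l1 _ h1]
      exact ⟨by omega, h2⟩
  · intro b h1 h2
    rcases hcase b h2 with h3 | rfl
    · rw [p1 b h3]
      exact h.par_lt b h1 h3
    · omega
  · intro b h1 h2 h0
    rcases hcase b h2 with h3 | rfl
    · have := h.par_lt b h1 h3
      rw [p1 b h3] at h0 ⊢
      rw [l1 b h3, l1 _ (by omega)]
      exact h.par_adj b h1 h3 h0
    · rw [p2] at h0 ⊢
      rw [l2, l1 _ huN, (h.num_mem u hun h0).2]
      exact hs _ _ hux
  · intro a b v h1 h2 h3 h4 h5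
    rw [l1 a (by omega)] at h4
    have h6 : num v = 0 ∨ b ≤ num v := by
      by_cases hvx : v = x
      · subst hvx
        exact Or.inl hx
      · rwa [n1 v hvx] at h5
    rcases hcase b h3 with h7 | rfl
    · rw [p1 b h7]
      exact h.maximal a b v h1 h2 h7 h4 h6
    · rw [p2]
      have h8 : num v = 0 := by
        by_contra h0
        have := (h.num_mem v (hn _ _ h4).2 h0).1
        omega
      have := hmax _ v h4 h8
      rwa [(h.lab_mem a h1 (by omega)).2] at this
  · intro b h1 h2
    rcases hcase b h2 with h3 | rfl
    · rw [l1 b h3]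
      exact h.nbr b h1 h3
    · rw [l2]
      exact ⟨u, hs _ _ hux⟩

/-- Number the vertices that have neighbours in depth-first order. -/
def number : Program :=
  assign 4 (const 1) ;; assign 3 (const 0) ;;
  loop (reg 4) (scan ;; cond (reg 4)
    (assign 3 (reg 3 +ᵉ const 1) ;; store 2 (reg 5) (reg 3) ;; store 3 (reg 3) (reg 5) ;;
     store 4 (reg 3) (reg 4 -ᵉ const 1)) skip)

/-- The loop stops when no unnumbered vertex has a neighbour, so that exactly the isolated vertices
remain. Preprocessing only has to halt; the measure is the number of unnumbered vertices plus one
while the flag in register `4` is set. -/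
theorem runs_number {w n : ℕ} {mat : ℕ → ℕ} {adj : ℕ → ℕ → Prop} {s : State} (hw : 1024 ≤ 2 ^ w)
    (hn : n * n + n < 2 ^ w) (h0 : s.reg 0 = n) (h1 : s.mem 1 = mat)
    (hadj : ∀ u v, adj u v ↔ u < n ∧ v < n ∧ mat (u * n + v) ≠ 0)
    (hs : ∀ u v, adj u v → adj v u) (h2 : s.mem 2 = fun _ => 0) :
    Runs w number s fun _ s' => s'.reg 3 ≤ n ∧
      Numbered n adj (s'.reg 3) (s'.mem 2) (s'.mem 3) (s'.mem 4) ∧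
      ∀ u v, adj u v → s'.mem 2 v ≠ 0 := by
  have hnn : n ≤ n * n := Nat.le_mul_self n
  simp (disch := omega) only [number, runs_seq, runs_assign, eval_const_mod,
    Nat.mod_eq_of_lt]
  refine (Runs.loop_measure (b₀ := n + 1) (fun b s' =>
      ((Finset.range n).filter (fun v => s'.mem 2 v = 0)).card + s'.reg 3 = n ∧
      Numbered n adj (s'.reg 3) (s'.mem 2) (s'.mem 3) (s'.mem 4) ∧
      b = (if s'.reg 4 = 0 then 0 else 1) +
        ((Finset.range n).filter (fun v => s'.mem 2 v = 0)).card ∧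
      (s'.reg 4 = 0 → ∀ u v, adj u v → s'.mem 2 v ≠ 0)) ?_ ?_).mono ?_
  · simp only [setReg_mem, h2, setReg_reg, Nat.reduceEqDiff, reduceIte, Finset.filter_true,
      Finset.card_range]
    refine ⟨by omega, ?_, by omega, fun h => h.elim⟩
    constructor <;> intros <;> omega
  · rintro b s₁ ⟨hc, hN, rfl, -⟩ hf he
    rw [eval_reg] at he
    have e1 := hf.mem 1 rfl
    have r0 := hf.reg 0 rfl
    simp [h0, h1] at e1 r0
    rw [runs_seq]
    refine (runs_scan (num := s₁.mem 2) hw hn r0 e1 rfl ?_).use ?_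
    · intro v hv
      by_cases hv0 : s₁.mem 2 v = 0
      · omega
      · have := (hN.num_mem v hv hv0).1
        omega
    · intro t₂ s₂ ⟨hmax, hbest⟩ hf₂
      have e2 := hf₂.mem 2 rfl
      have e3 := hf₂.mem 3 rfl
      have e4 := hf₂.mem 4 rfl
      have r3 := hf₂.reg 3 rfl
      rw [if_neg he]
      rw [runs_cond]
      refine ⟨fun h4 => ?_, fun h4 => ?_⟩
      · rw [eval_reg] at h4
        obtain ⟨hx, hx0, u, hu, hux, hbu⟩ := hbest h4
        obtain ⟨x, hx'⟩ : ∃ x, s₂.reg 5 = x := ⟨_, rfl⟩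
        obtain ⟨b, hb⟩ : ∃ b, s₂.reg 4 = b := ⟨_, rfl⟩
        rw [hx'] at hx hx0 hux
        rw [hb] at hbu hmax h4
        have hsnoc := hN.snoc (x := x) (u := u) (fun u v h => ⟨((hadj u v).1 h).1, ((hadj u v).1 h).2.1⟩)
          hs hx0 ((hadj u x).2 ⟨hu, hx, hux⟩) (by
            intro a v hav hv
            rw [hadj] at hav
            have := hmax a v hav.1 hav.2.1 hav.2.2 hv
            omega)
        have hcard : ((Finset.range n).filter
            (fun v => Function.update (s₁.mem 2) x (s₁.reg 3 + 1) v = 0)).card + 1 =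
            ((Finset.range n).filter (fun v => s₁.mem 2 v = 0)).card := by
          rw [← Finset.card_erase_add_one
            (show x ∈ (Finset.range n).filter (fun v => s₁.mem 2 v = 0) by simp [hx, hx0])]
          congr 2
          ext v
          simp only [Finset.mem_filter, Finset.mem_range, Finset.mem_erase]
          by_cases hvx : v = x
          · simp [hvx]
          · simp [hvx]
        refine Runs.hide fun Q hQ => ?_
        simp (disch := omega) [r3, hb, hx', Nat.mod_eq_of_lt]
        refine hQ _ _ ⟨(if b = 0 then 0 else 1) + ((Finset.range n).filter
            (fun v => Function.update (s₁.mem 2) x (s₁.reg 3 + 1) v = 0)).card,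
          ⟨?_, ?_, ?_, ?_⟩, ?_⟩
        · simp only [setReg_reg, setReg_mem, setMem_reg, setMem_mem, Nat.reduceEqDiff, reduceIte, e2]
          omega
        · simpa [e2, e3, e4, ← hbu] using hsnoc
        · simp [e2, hb]
        · simp [hb, h4]
        · rw [if_neg h4]
          omega
      · rw [eval_reg] at h4
        rw [runs_skip]
        refine ⟨_, ⟨by rw [e2, r3]; exact hc, by rw [e2, e3, e4, r3]; exact hN, rfl, fun _ u v huv => ?_⟩,
          ?_⟩
        · rw [hadj] at huv
          intro hv
          rw [e2] at hv
          have := hmax u v huv.1 huv.2.1 huv.2.2 hv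
          omega
        · rw [if_pos h4, e2]
          omega
  · rintro t s' ⟨-, he, b, hc, hN, -, hall⟩
    exact ⟨by omega, hN, hall he⟩

/-! ### Writing the data structure -/

/-- Row `a` of the data structure is written in cells below `q`. -/
structure Row (N : ℕ) (par lab : ℕ → ℕ) (r : ℕ → ℕ → Prop) (q : ℕ) (D : ℕ → ℕ) (a : ℕ) : Prop where
  lab_eq : D (4 * a) = lab a
  par_eq : D (4 * a + 1) = par a
  fin_iff : ∀ u, a ≤ u → (u < D (4 * a + 2) ↔ u ≤ N ∧ ∀ b, a < b → b ≤ u → a ≤ par b)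
  off_pos : 4 * N + 8 ≤ D (4 * a + 3)
  off_le : D (4 * a + 3) ≤ D (4 * a + 7)
  off_end : D (4 * a + 7) ≤ q
  adj_lt : ∀ i j, D (4 * a + 3) ≤ i → i < j → j < D (4 * a + 7) → D i < D j
  adj_iff : ∀ x, (∃ j, D (4 * a + 3) ≤ j ∧ j < D (4 * a + 7) ∧ D j = x) ↔ r a x

theorem Row.congr {N : ℕ} {par lab : ℕ → ℕ} {r : ℕ → ℕ → Prop} {q q' : ℕ} {D D' : ℕ → ℕ} {a : ℕ}
    (h : Row N par lab r q D a) (hq : q ≤ q') (h0 : D' (4 * a) = D (4 * a))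
    (h1 : D' (4 * a + 1) = D (4 * a + 1)) (h2 : D' (4 * a + 2) = D (4 * a + 2))
    (h3 : D' (4 * a + 3) = D (4 * a + 3)) (h7 : D' (4 * a + 7) = D (4 * a + 7))
    (hD : ∀ j, 4 * N + 8 ≤ j → j < q → D' j = D j) : Row N par lab r q' D' a := by
  obtain ⟨k0, k1, k2, k3, k4, k5, k6, k7⟩ := h
  refine ⟨by rw [h0, k0], by rw [h1, k1], by rw [h2]; exact k2, by rw [h3]; exact k3,
    by rw [h3, h7]; exact k4, by rw [h7]; omega, ?_, fun x => ?_⟩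
  · rw [h3, h7]
    intro i j h4 h5 h6
    rw [hD i (by omega) (by omega), hD j (by omega) (by omega)]
    exact k6 i j h4 h5 h6
  · rw [h3, h7, ← k7 x]
    constructor
    · rintro ⟨j, h4, h5, h6⟩
      rw [hD j (by omega) (by omega)] at h6
      exact ⟨j, h4, h5, h6⟩
    · rintro ⟨j, h4, h5, h6⟩
      rw [← hD j (by omega) (by omega)] at h6
      exact ⟨j, h4, h5, h6⟩

/-- Find the end of the interval of descendants of the vertex in register `7`. -/
def findEnd : Program :=
  assign 9 (reg 3 +ᵉ const 1) ;; assign 8 (const 0) ;; assign 11 (reg 3 -ᵉ reg 7) ;;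
  forUp 8 11 (cond (load 4 (reg 3 -ᵉ reg 8) <ᵉ reg 7) (assign 9 (reg 3 -ᵉ reg 8)) skip)

/-- The loop runs through the candidates `b` from `N` down to `a + 1` and remembers the last one
with `par b < a`. This is the first vertex after the subtree of `a`; the default is `N + 1`. -/
theorem runs_findEnd {w N a : ℕ} {par : ℕ → ℕ} {s : State} (hw : 1024 ≤ 2 ^ w)
    (hN : 8 * N + 8 < 2 ^ w) (h3 : s.reg 3 = N) (h4 : s.mem 4 = par) (h7 : s.reg 7 = a)
    (ha : a ≤ N) :
    Runs w findEnd s fun _ s' => ∀ u, a ≤ u →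
      (u < s'.reg 9 ↔ u ≤ N ∧ ∀ b, a < b → b ≤ u → a ≤ par b) := by
  simp (disch := omega) only [findEnd, runs_seq, runs_assign, eval_const_mod,
    eval_add_mod, eval_sub, eval_reg, setReg_reg, reduceIte, Nat.reduceEqDiff,
    Nat.mod_eq_of_lt, h3, h7]
  refine (Runs.forUp_total (fun x s' =>
      (∀ b, N < b + x → b < s'.reg 9 → b ≤ N → a ≤ par b) ∧
      (s'.reg 9 = N + 1 ∨ N < s'.reg 9 + x ∧ s'.reg 9 ≤ N ∧ par (s'.reg 9) < a))
    (by simp; omega) (by omega) rfl rfl (by decide) (by simp) (by simp; omega) ?_).mono ?_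
  · intro x s₁ _ hx1 ⟨hI1, hI2⟩ hx hf
    have e4 := hf.mem 4 rfl
    have r3 := hf.reg 3 rfl
    have r7 := hf.reg 7 rfl
    simp [h3, h4, h7] at e4 r3 r7 hx1
    refine Runs.hide fun Q hQ => ?_
    simp (disch := omega) [hx, e4, r3, r7]
    refine ⟨fun hlt => hQ _ _ ?_, fun hlt => hQ _ _ ?_⟩
    · simp only [setReg_reg, Nat.reduceEqDiff, reduceIte]
      exact ⟨fun b h1 h2 => by omega, Or.inr ⟨by omega, by omega, hlt⟩⟩
    · simp only [setReg_reg, Nat.reduceEqDiff, reduceIte]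
      refine ⟨fun b h1 h2 h5 => ?_, by omega⟩
      by_cases hb : b = N - x
      · rw [hb]
        exact hlt
      · exact hI1 b (by omega) h2 h5
  · rintro t s' ⟨⟨hI1, hI2⟩, -⟩ u hu
    simp at hI1 hI2
    constructor
    · intro hlt
      exact ⟨by omega, fun b h1 h2 => hI1 b (by omega) (by omega) (by omega)⟩
    · rintro ⟨h1, h2⟩
      rcases hI2 with hI2 | ⟨h5, h6, h8⟩
      · omega
      · by_contra hc
        have := h2 _ (by omega) (not_lt.1 hc)
        omega

/-- List the neighbours of the vertex in register `7`, from the cell in register `6` on. -/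
def listAdj : Program :=
  assign 8 (const 1) ;;
  forUp 8 10 (cond (load 1 (load 3 (reg 7) *ᵉ reg 0 +ᵉ load 3 (reg 8)))
    (store 0 (reg 6) (reg 8) ;; assign 6 (reg 6 +ᵉ const 1)) skip)

theorem runs_listAdj {w n N a q : ℕ} {mat lab D : ℕ → ℕ} {s : State} (hw : 1024 ≤ 2 ^ w)
    (hN : 8 * N + 8 < 2 ^ w) (hn : n * n + n < 2 ^ w) (h0 : s.reg 0 = n) (h10 : s.reg 10 = N + 1)
    (h7 : s.reg 7 = a) (h6 : s.reg 6 = q) (h1 : s.mem 1 = mat) (h3 : s.mem 3 = lab)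
    (hD : s.mem 0 = D) (hlab : ∀ i, 1 ≤ i → i ≤ N → lab i < n) (ha1 : 1 ≤ a) (haN : a ≤ N)
    (hq : q + N + 1 < 2 ^ w) :
    Runs w listAdj s fun _ s' => s'.reg 6 ≤ q + N ∧
      s'.reg 6 = q + ∑ b ∈ Finset.Ico 1 (N + 1), (if mat (lab a * n + lab b) = 0 then 0 else 1) ∧
      (∀ j, j < q → s'.mem 0 j = D j) ∧
      (∀ i j, q ≤ i → i < j → j < s'.reg 6 → s'.mem 0 i < s'.mem 0 j) ∧
      ∀ x, (∃ j, q ≤ j ∧ j < s'.reg 6 ∧ s'.mem 0 j = x) ↔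
        1 ≤ x ∧ x ≤ N ∧ mat (lab a * n + lab x) ≠ 0 := by
  rw [listAdj, runs_seq, runs_assign]
  refine (Runs.forUp_total (fun x s' => q ≤ s'.reg 6 ∧ s'.reg 6 + 1 ≤ q + x ∧
      s'.reg 6 = q + ∑ b ∈ Finset.Ico 1 x, (if mat (lab a * n + lab b) = 0 then 0 else 1) ∧
      (∀ j, j < q → s'.mem 0 j = D j) ∧
      (∀ i j, q ≤ i → i < j → j < s'.reg 6 → s'.mem 0 i < s'.mem 0 j) ∧
      ∀ z, (∃ j, q ≤ j ∧ j < s'.reg 6 ∧ s'.mem 0 j = z) ↔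
        1 ≤ z ∧ z < x ∧ mat (lab a * n + lab z) ≠ 0)
    (by simp [h10]; omega) (by omega) rfl rfl (by decide) ?_ ?_ ?_).mono ?_
  · simp (disch := omega) [h10, Nat.mod_eq_of_lt]
  · simp (disch := omega) only [setReg_reg, setReg_mem, eval_const_mod, Nat.mod_eq_of_lt, h6,
      Nat.reduceEqDiff, reduceIte, hD, Finset.Ico_self, Finset.sum_empty]
    exact ⟨le_rfl, le_rfl, rfl, fun _ _ => trivial, fun i j _ _ _ => by omega,
      fun z => ⟨fun ⟨j, _⟩ => by omega, fun h => by omega⟩⟩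
  · intro x s₁ hx0 hx1 ⟨hI0, hI1, hI2, hI3, hI4, hI5⟩ hx hf
    have e1 := hf.mem 1 rfl
    have e3 := hf.mem 3 rfl
    have r0 := hf.reg 0 rfl
    have r7 := hf.reg 7 rfl
    simp [h0, h1, h7, h3, h10] at e1 e3 r0 r7 hx1
    simp (disch := omega) [Nat.mod_eq_of_lt] at hx0
    have hla := hlab a ha1 haN
    have hlx := hlab x hx0 (by omega)
    have hmul : lab a * n ≤ n * n := Nat.mul_le_mul_right _ hla.le
    obtain ⟨r, hr⟩ : ∃ r, s₁.reg 6 = r := ⟨_, rfl⟩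
    rw [hr] at hI0 hI1 hI2 hI4 hI5
    have hlt : ∀ j, q ≤ j → j < r → s₁.mem 0 j < x := fun j h1 h2 =>
      ((hI5 _).1 ⟨j, h1, h2, rfl⟩).2.1
    refine Runs.hide fun Q hQ => ?_
    simp (disch := omega) [hx, e1, e3, r0, r7, hr, Nat.mod_eq_of_lt]
    refine ⟨fun hm => hQ _ _ ?_, fun hm => hQ _ _ ?_⟩
    · simp only [setReg_reg, setReg_mem, setMem_mem, Nat.reduceEqDiff, reduceIte]
      have u1 : ∀ j, j ≠ r → Function.update (s₁.mem 0) r x j = s₁.mem 0 j := fun j hj =>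
        Function.update_of_ne hj _ _
      have u2 : Function.update (s₁.mem 0) r x r = x := Function.update_self ..
      refine ⟨by omega, by omega, ?_, fun j hj => ?_, fun i j h1 h2 h5 => ?_, fun z => ?_⟩
      · rw [Finset.sum_Ico_succ_top hx0, if_neg hm, hI2]
        omega
      · rw [u1 j (by omega)]
        exact hI3 j hj
      · rw [u1 i (by omega)]
        by_cases hjr : j = r
        · subst hjr
          rw [u2]
          exact hlt i h1 h2
        · rw [u1 j hjr]
          exact hI4 i j h1 h2 (by omega)
      · constructor
        · rintro ⟨j, h1, h2, rfl⟩
          by_cases hjr : j = r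
          · subst hjr
            rw [u2]
            exact ⟨hx0, by omega, hm⟩
          · rw [u1 j hjr]
            have := (hI5 _).1 ⟨j, h1, by omega, rfl⟩
            exact ⟨this.1, by omega, this.2.2⟩
        · rintro ⟨h1, h2, h5⟩
          by_cases hzx : z = x
          · exact ⟨r, hI0, by omega, by rw [u2, hzx]⟩
          · obtain ⟨j, h8, h9, h10⟩ := (hI5 z).2 ⟨h1, by omega, h5⟩
            exact ⟨j, h8, by omega, by rw [u1 j (by omega), h10]⟩
    · simp only [setReg_reg, setReg_mem, Nat.reduceEqDiff, reduceIte, hr]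
      refine ⟨hI0, by omega, ?_, hI3, hI4, fun z => ?_⟩
      · rw [Finset.sum_Ico_succ_top hx0, if_pos hm, Nat.add_zero]
        exact hI2
      · rw [hI5]
        constructor
        · rintro ⟨h1, h2, h5⟩
          exact ⟨h1, by omega, h5⟩
        · rintro ⟨h1, h2, h5⟩
          refine ⟨h1, lt_of_le_of_ne (by omega) ?_, h5⟩
          rintro rfl
          exact h5 hm
  · rintro t s' ⟨⟨hI0, hI1, hI2, hI3, hI4, hI5⟩, -⟩
    simp [h10] at hI1 hI2 hI5
    refine ⟨by omega, hI2, hI3, hI4, fun x => ?_⟩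
    rw [hI5]

/-- Write the row of the vertex in register `7`. -/
def writeRow : Program :=
  store 0 (const 4 *ᵉ reg 7) (load 3 (reg 7)) ;;
  store 0 (const 4 *ᵉ reg 7 +ᵉ const 1) (load 4 (reg 7)) ;; findEnd ;;
  store 0 (const 4 *ᵉ reg 7 +ᵉ const 2) (reg 9) ;; listAdj ;;
  store 0 (const 4 *ᵉ reg 7 +ᵉ const 7) (reg 6)

-- Cell `4 * a + 7` is cell `4 * (a + 1) + 3`: the end of the list of `a` is the beginning of the
-- next list. This is why the lists themselves begin at cell `4 * N + 8`.
set_option maxHeartbeats 1000000 in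
theorem runs_writeRow {w n N a q : ℕ} {mat lab par D : ℕ → ℕ} {s : State} (hw : 1024 ≤ 2 ^ w)
    (hN : 8 * N + 8 < 2 ^ w) (hn : n * n + n < 2 ^ w) (h0 : s.reg 0 = n) (h10 : s.reg 10 = N + 1)
    (hr3 : s.reg 3 = N) (h4 : s.mem 4 = par)
    (h7 : s.reg 7 = a) (h6 : s.reg 6 = q) (h1 : s.mem 1 = mat) (h3 : s.mem 3 = lab)
    (hD : s.mem 0 = D) (hlab : ∀ i, 1 ≤ i → i ≤ N → lab i < n) (ha1 : 1 ≤ a) (haN : a ≤ N)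
    (hq : q + N + 1 < 2 ^ w) (hq' : 4 * N + 8 ≤ q) (hoff : D (4 * a + 3) = q) :
    Runs w writeRow s fun _ s' => s'.reg 6 ≤ q + N ∧
      s'.reg 6 = q + ∑ b ∈ Finset.Ico 1 (N + 1), (if mat (lab a * n + lab b) = 0 then 0 else 1) ∧
      (∀ j, j < q → j ≠ 4 * a → j ≠ 4 * a + 1 → j ≠ 4 * a + 2 → j ≠ 4 * a + 7 →
        s'.mem 0 j = D j) ∧
      s'.mem 0 (4 * a + 7) = s'.reg 6 ∧
      Row N par lab (fun a x => 1 ≤ x ∧ x ≤ N ∧ mat (lab a * n + lab x) ≠ 0) (s'.reg 6)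
        (s'.mem 0) a := by
  refine Runs.hide fun Q hQ => ?_
  simp (disch := omega) only [writeRow, runs_seq, runs_store, eval_const_mod, eval_mul_mod,
    eval_add_mod, eval_load, eval_reg, setMem_mem, setMem_reg, reduceIte, Nat.reduceEqDiff,
    Nat.mod_eq_of_lt, h7, h3, h4]
  refine (runs_findEnd (par := par) hw hN (by simpa using hr3) (by simpa using h4)
    (by simpa using h7) haN).use ?_
  intro t₁ s₁ hfin f₁
  obtain ⟨D₁, hD₁⟩ : ∃ D₁, s₁.mem 0 = D₁ := ⟨_, rfl⟩
  have hD₁' : D₁ = Function.update (Function.update D (4 * a) (lab a)) (4 * a + 1) (par a) := by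
    rw [← hD₁, f₁.mem 0 rfl]
    simp [hD]
  obtain ⟨e, he⟩ : ∃ e, s₁.reg 9 = e := ⟨_, rfl⟩
  have r7 : s₁.reg 7 = a := (f₁.reg 7 rfl).trans (by simpa using h7)
  rw [he] at hfin
  simp (disch := omega) only [r7, he, Nat.mod_eq_of_lt]
  refine (runs_listAdj (n := n) (N := N) (a := a) (q := q) (mat := mat) (lab := lab)
    (D := Function.update D₁ (4 * a + 2) e) hw hN hn ?_ ?_ ?_ ?_ ?_ ?_ ?_ hlab ha1 haN hq).use ?_
  · simpa using (f₁.reg 0 rfl).trans (by simpa using h0)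
  · simpa using (f₁.reg 10 rfl).trans (by simpa using h10)
  · simpa using r7
  · simpa using (f₁.reg 6 rfl).trans (by simpa using h6)
  · simpa using (f₁.mem 1 rfl).trans (by simpa using h1)
  · simpa using (f₁.mem 3 rfl).trans (by simpa using h3)
  · simp [hD₁]
  intro t₂ s₂ ⟨hqN, hsum, hold, hlt, hiff⟩ f₂
  have r7' : s₂.reg 7 = a := (f₂.reg 7 rfl).trans (by simpa using r7)
  obtain ⟨q', hq''⟩ : ∃ q', s₂.reg 6 = q' := ⟨_, rfl⟩
  rw [hq''] at hqN hsum hlt hiff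
  have hqq : q ≤ q' := by omega
  simp (disch := omega) only [r7', hq'', Nat.mod_eq_of_lt]
  have hcell : ∀ j, j < q → s₂.mem 0 j = if j = 4 * a + 2 then e else if j = 4 * a + 1 then par a
      else if j = 4 * a then lab a else D j := by
    intro j hj
    rw [hold j hj, hD₁']
    simp only [Function.update_apply]
  clear hD₁ hD₁' hold
  refine hQ _ _ ?_
  simp only [setMem_reg, setMem_mem, reduceIte, hq'']
  have v1 : ∀ j, j ≠ 4 * a + 7 → Function.update (s₂.mem 0) (4 * a + 7) q' j = s₂.mem 0 j :=
    fun j hj => Function.update_of_ne hj _ _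
  have v2 : Function.update (s₂.mem 0) (4 * a + 7) q' (4 * a + 7) = q' := Function.update_self ..
  generalize Function.update (s₂.mem 0) (4 * a + 7) q' = D' at v1 v2 ⊢
  have c0 : D' (4 * a) = lab a := by
    rw [v1 _ (by omega), hcell _ (by omega), if_neg (by omega), if_neg (by omega), if_pos rfl]
  have c1 : D' (4 * a + 1) = par a := by
    rw [v1 _ (by omega), hcell _ (by omega), if_neg (by omega), if_pos rfl]
  have c2 : D' (4 * a + 2) = e := by
    rw [v1 _ (by omega), hcell _ (by omega), if_pos rfl]
  have c3 : D' (4 * a + 3) = q := by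
    rw [v1 _ (by omega), hcell _ (by omega), if_neg (by omega), if_neg (by omega), if_neg (by omega),
      hoff]
  refine ⟨hqN, hsum, fun j hj j0 j1 j2 j7 => ?_, v2, c0, c1, by rw [c2]; exact hfin, by omega,
    by omega, by omega, ?_, fun x => ?_⟩
  · rw [v1 j j7, hcell j hj, if_neg j2, if_neg j1, if_neg j0]
  · rw [c3, v2]
    intro i j h1 h2 h5
    rw [v1 i (by omega), v1 j (by omega)]
    exact hlt i j h1 h2 h5
  · rw [c3, v2, ← hiff]
    constructor
    · rintro ⟨j, h1, h2, h5⟩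
      rw [v1 j (by omega)] at h5
      exact ⟨j, h1, h2, h5⟩
    · rintro ⟨j, h1, h2, h5⟩
      rw [← v1 j (by omega)] at h5
      exact ⟨j, h1, h2, h5⟩

/-- Write the data structure. -/
def writeIndex : Program :=
  store 0 (const 0) (reg 3) ;; assign 10 (reg 3 +ᵉ const 1) ;;
  assign 6 (const 4 *ᵉ reg 3 +ᵉ const 8) ;; store 0 (const 7) (reg 6) ;;
  assign 7 (const 1) ;; forUp 7 10 writeRow ;;
  cond (reg 3) (assign 0 (reg 6)) (assign 0 (const 0))

-- For a graph without edges the structure must have length `0`. Then the default value `0` of an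
-- absent cell gives the right value `N = 0` at cell `0`.
set_option maxHeartbeats 1000000 in
theorem runs_writeIndex {w n N : ℕ} {mat lab par : ℕ → ℕ} {s : State} (hw : 1024 ≤ 2 ^ w)
    (hN : 8 * N + 8 < 2 ^ w) (hn : n * n + n < 2 ^ w) (hq : 4 * N + 9 + (N + 2) * N < 2 ^ w)
    (h0 : s.reg 0 = n)
    (hr3 : s.reg 3 = N) (h4 : s.mem 4 = par) (h1 : s.mem 1 = mat) (h3 : s.mem 3 = lab)
    (hlab : ∀ i, 1 ≤ i → i ≤ N → lab i < n) :
    Runs w writeIndex s fun _ s' => s'.mem 0 0 = N ∧ ∃ q,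
      s'.reg 0 = (if N = 0 then 0 else q) ∧ 4 * N + 8 ≤ q ∧
      q = 4 * N + 8 + ∑ a ∈ Finset.Ico 1 (N + 1), ∑ b ∈ Finset.Ico 1 (N + 1),
        (if mat (lab a * n + lab b) = 0 then 0 else 1) ∧
      ∀ a, 1 ≤ a → a ≤ N → Row N par lab
        (fun a x => 1 ≤ x ∧ x ≤ N ∧ mat (lab a * n + lab x) ≠ 0) q (s'.mem 0) a := by
  refine Runs.hide fun Q hQ => ?_
  simp (disch := omega) only [writeIndex, runs_seq, runs_store, runs_assign, eval_const_mod,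
    eval_mul_mod, eval_add_mod, eval_reg, setMem_reg, setReg_reg, reduceIte, Nat.reduceEqDiff,
    Nat.mod_eq_of_lt, hr3]
  refine (Runs.forUp_total (fun x s' => s'.mem 0 0 = N ∧ 4 * N + 8 ≤ s'.reg 6 ∧
      s'.reg 6 + N ≤ 4 * N + 8 + x * N ∧
      s'.reg 6 = 4 * N + 8 + ∑ a ∈ Finset.Ico 1 x, ∑ b ∈ Finset.Ico 1 (N + 1),
        (if mat (lab a * n + lab b) = 0 then 0 else 1) ∧
      s'.mem 0 (4 * x + 3) = s'.reg 6 ∧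
      ∀ a, 1 ≤ a → a < x → Row N par lab
        (fun a x => 1 ≤ x ∧ x ≤ N ∧ mat (lab a * n + lab x) ≠ 0) (s'.reg 6) (s'.mem 0) a)
    (by simp; omega) (by omega) rfl rfl (by decide) (by simp) ?_ ?_).use ?_
  · simp only [setReg_reg, setReg_mem, setMem_mem, setMem_reg, reduceIte, Nat.reduceEqDiff,
      Nat.reduceMul, Nat.reduceAdd, Function.update_self, Finset.Ico_self, Finset.sum_empty, Nat.one_mul]
    refine ⟨by simp, by omega, by omega, trivial, trivial, fun a h h' => by omega⟩
  · intro x s₁ hx0 hx1 ⟨hI0, hI1, hI2, hI3, hI4, hI5⟩ hx hf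
    have e1 : s₁.mem 1 = mat := by simpa [h1] using hf.mem 1 rfl
    have e3 : s₁.mem 3 = lab := by simpa [h3] using hf.mem 3 rfl
    have e4 : s₁.mem 4 = par := by simpa [h4] using hf.mem 4 rfl
    have r0 : s₁.reg 0 = n := by simpa [h0] using hf.reg 0 rfl
    have r3 : s₁.reg 3 = N := by simpa [hr3] using hf.reg 3 rfl
    have r10 : s₁.reg 10 = N + 1 := by simpa using hf.reg 10 rfl
    simp at hx0 hx1
    obtain ⟨q, hq'⟩ : ∃ q, s₁.reg 6 = q := ⟨_, rfl⟩
    rw [hq'] at hI1 hI2 hI3 hI4 hI5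
    have hxN : x * N ≤ N * N := Nat.mul_le_mul_right _ (by omega)
    have hqw : q + N + 1 < 2 ^ w := by
      rw [Nat.add_mul] at hq
      omega
    refine Runs.mono (runs_writeRow hw hN hn r0 r10 r3 e4 hx hq' e1 e3 rfl hlab hx0 (by omega)
      hqw hI1 hI4) ?_
    intro t s₂ ⟨hqN, hsum, hold, h7, hrow⟩
    simp only [setReg_reg, setReg_mem, Nat.reduceEqDiff, reduceIte]
    refine ⟨?_, by omega, ?_, ?_, h7, fun a ha hax => ?_⟩
    · rw [hold 0 (by omega) (by omega) (by omega) (by omega) (by omega), hI0]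
    · rw [Nat.add_mul]
      omega
    · rw [Finset.sum_Ico_succ_top hx0, hsum]
      omega
    · by_cases hax' : a = x
      · rw [hax']
        exact hrow
      · refine (hI5 a ha (by omega)).congr (by omega) ?_ ?_ ?_ ?_ ?_ fun j hj hjq => ?_
        all_goals exact hold _ (by omega) (by omega) (by omega) (by omega) (by omega)
  · rintro t s' ⟨⟨hI0, hI1, -, hI3, -, hI5⟩, -⟩ hf
    have r3 : s'.reg 3 = N := by simpa [hr3] using hf.reg 3 rfl
    simp at hI3 hI5
    have key : ∀ s₂ : State, s₂.mem 0 = s'.mem 0 →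
        s₂.reg 0 = (if N = 0 then 0 else s'.reg 6) → ∀ t, Q t s₂ := by
      intro s₂ hm hr t
      refine hQ _ _ ⟨by rw [hm, hI0], _, hr, hI1, hI3, fun a ha haN => ?_⟩
      rw [hm]
      have := hI5 a ha (by omega)
      simpa using this
    simp only [runs_cond, runs_assign, eval_reg, r3, eval_const_mod, Nat.zero_mod]
    refine ⟨fun h => key _ (by simp) ?_ _, fun h => key _ (by simp) ?_ _⟩
    · simp [h]
    · simp [h]

/-- The preprocessing program. -/
def preprocess : Program :=
  buildMatrix ;; number ;; writeIndex

theorem Row.rel {N : ℕ} {par lab : ℕ → ℕ} {r r' : ℕ → ℕ → Prop} {q : ℕ} {D : ℕ → ℕ} {a : ℕ}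
    (h : Row N par lab r q D a) (hr : ∀ x, r a x ↔ r' a x) : Row N par lab r' q D a :=
  { h with adj_iff := fun x => (h.adj_iff x).trans (hr x) }

namespace Numbered

variable {n N : ℕ} {adj : ℕ → ℕ → Prop} {num lab par : ℕ → ℕ}

theorem isIndex (h : Numbered n adj N num lab par) (hs : ∀ u v, adj u v → adj v u)
    (hi : ∀ u, ¬adj u u) {q : ℕ} {D : ℕ → ℕ}
    (hrow : ∀ a, 1 ≤ a → a ≤ N →
      Row N par lab (fun a x => 1 ≤ x ∧ x ≤ N ∧ adj (lab a) (lab x)) q D a) :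
    IsIndex N (fun a b => 1 ≤ a ∧ a ≤ N ∧ 1 ≤ b ∧ b ≤ N ∧ adj (lab a) (lab b)) D where
  symm := fun ⟨h1, h2, h3, h4, h5⟩ => ⟨h3, h4, h1, h2, hs _ _ h5⟩
  irrefl := fun h => hi _ h.2.2.2.2
  pos := fun h => h.1
  le := fun h => h.2.1
  par_lt := by
    intro b h1 h2
    rw [(hrow b h1 h2).par_eq]
    exact h.par_lt b h1 h2
  par_adj := by
    intro b h1 h2 h3
    rw [(hrow b h1 h2).par_eq] at h3 ⊢
    have := h.par_lt b h1 h2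
    exact ⟨h1, h2, by omega, by omega, h.par_adj b h1 h2 h3⟩
  desc_adj := by
    rintro a c ⟨h1, h2, h3, h4, h5⟩ hac b hab hbc
    rw [(hrow b (by omega) (by omega)).par_eq]
    -- When `b` was numbered, the neighbour `c` of `a` was not yet numbered, because `b ≤ c`.
    refine h.maximal a b (lab c) h1 hab (by omega) h5 (Or.inr ?_)
    rwa [(h.lab_mem c h3 h4).2]
  fin_iff := by
    intro v u h1 h2 h3
    rw [(hrow v h1 h2).fin_iff u h3]
    refine and_congr_right fun h4 => forall_congr' fun b => forall_congr' fun h5 =>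
      forall_congr' fun h6 => ?_
    rw [(hrow b (by omega) (by omega)).par_eq]
  off_le := fun h1 h2 => (hrow _ h1 h2).off_le
  adj_lt := fun h1 h2 => (hrow _ h1 h2).adj_lt _ _
  adj_iff := by
    intro u x h1 h2
    rw [(hrow u h1 h2).adj_iff x]
    tauto

/-- Each numbered vertex has a numbered neighbour, so `N` is at most the number of ordered adjacent
pairs, which `sum_le` bounds by `2 * m`. This keeps the space linear in `m`, whatever the number of
vertices. -/
theorem le_sum (h : Numbered n adj N num lab par) {mat : ℕ → ℕ}
    (hadj : ∀ u v, adj u v ↔ u < n ∧ v < n ∧ mat (u * n + v) ≠ 0)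
    (hall : ∀ u v, adj u v → num v ≠ 0) :
    N ≤ ∑ a ∈ Finset.Ico 1 (N + 1), ∑ b ∈ Finset.Ico 1 (N + 1),
      (if mat (lab a * n + lab b) = 0 then 0 else 1) := by
  have h1 : ∑ a ∈ Finset.Ico 1 (N + 1), 1 = N := by simp
  calc N = ∑ a ∈ Finset.Ico 1 (N + 1), 1 := h1.symm
    _ ≤ _ := by
      refine Finset.sum_le_sum fun a ha => ?_
      rw [Finset.mem_Ico] at ha
      obtain ⟨v, hv⟩ := h.nbr a ha.1 (by omega)
      obtain ⟨h2, h3, h4⟩ := (hadj _ _).1 hv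
      have h5 := hall _ _ hv
      obtain ⟨h6, h7⟩ := h.num_mem v h3 h5
      refine le_trans ?_ (Finset.single_le_sum (fun _ _ => Nat.zero_le _)
        (show num v ∈ Finset.Ico 1 (N + 1) by rw [Finset.mem_Ico]; omega))
      rw [h7, if_neg h4]

theorem sum_le (h : Numbered n adj N num lab par) {mat : ℕ → ℕ} {m : ℕ} {e₁ e₂ : ℕ → ℕ}
    (hadj : ∀ u v, adj u v ↔ u < n ∧ v < n ∧ mat (u * n + v) ≠ 0)
    (he : ∀ u v, adj u v → ∃ j < m, (e₁ j = u ∧ e₂ j = v) ∨ (e₁ j = v ∧ e₂ j = u)) :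
    ∑ a ∈ Finset.Ico 1 (N + 1), ∑ b ∈ Finset.Ico 1 (N + 1),
      (if mat (lab a * n + lab b) = 0 then 0 else 1) ≤ 2 * m := by
  rw [← Finset.sum_product' (Finset.Ico 1 (N + 1)) (Finset.Ico 1 (N + 1))
    (fun a b => if mat (lab a * n + lab b) = 0 then 0 else 1)]
  have h1 : ∀ p : ℕ × ℕ, (if mat (lab p.1 * n + lab p.2) = 0 then 0 else 1) =
      if mat (lab p.1 * n + lab p.2) ≠ 0 then 1 else 0 := fun p => by simp
  simp only [h1]
  rw [← Finset.card_filter]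
  have h2 : (Finset.filter (fun p : ℕ × ℕ => mat (lab p.1 * n + lab p.2) ≠ 0)
      (Finset.Ico 1 (N + 1) ×ˢ Finset.Ico 1 (N + 1))) ⊆
      (Finset.range m ×ˢ Finset.range 2).image fun q =>
        if q.2 = 0 then (num (e₁ q.1), num (e₂ q.1)) else (num (e₂ q.1), num (e₁ q.1)) := by
    rintro ⟨a, b⟩ hab
    simp only [Finset.mem_filter, Finset.mem_product, Finset.mem_Ico] at hab
    obtain ⟨⟨⟨a1, a2⟩, b1, b2⟩, hm⟩ := hab
    obtain ⟨a3, a4⟩ := h.lab_mem a a1 (by omega)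
    obtain ⟨b3, b4⟩ := h.lab_mem b b1 (by omega)
    simp only [Finset.mem_image, Finset.mem_product, Finset.mem_range, Prod.exists]
    obtain ⟨j, hj, ⟨h3, h4⟩ | ⟨h3, h4⟩⟩ := he _ _ ((hadj _ _).2 ⟨a3, b3, hm⟩)
    · exact ⟨j, 0, ⟨hj, by omega⟩, by rw [if_pos rfl, h3, h4, a4, b4]⟩
    · exact ⟨j, 1, ⟨hj, by omega⟩, by rw [if_neg (by omega), h3, h4, a4, b4]⟩
  refine (Finset.card_le_card h2).trans (Finset.card_image_le.trans ?_)
  rw [Finset.card_product, Finset.card_range, Finset.card_range, Nat.mul_comm]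

end Numbered

/-- `u` and `v` are the ends of one of the first `m` listed edges. -/
def ListedAdj (m : ℕ) (e₁ e₂ : ℕ → ℕ) (u v : ℕ) : Prop :=
  ∃ j < m, (e₁ j = u ∧ e₂ j = v) ∨ (e₁ j = v ∧ e₂ j = u)

theorem ListedAdj.symm {m : ℕ} {e₁ e₂ : ℕ → ℕ} {u v : ℕ} : ListedAdj m e₁ e₂ u v → ListedAdj m e₁ e₂ v u :=
  fun ⟨j, hj, h⟩ => ⟨j, hj, h.symm⟩

set_option maxHeartbeats 1000000 in
theorem runs_preprocess {w n m : ℕ} {e₁ e₂ : ℕ → ℕ} {s : State} (hw : 1024 ≤ 2 ^ w)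
    (hn8 : 8 * n + 8 < 2 ^ w) (hnn : 4 * n + 9 + (n + 2) * n < 2 ^ w) (hm : 2 * m + 2 < 2 ^ w)
    (h0 : s.reg 0 = n) (h1 : s.reg 1 = m)
    (he₁ : ∀ j < m, s.mem 0 (2 * j) = e₁ j ∧ e₁ j < n)
    (he₂ : ∀ j < m, s.mem 0 (2 * j + 1) = e₂ j ∧ e₂ j < n) (hne : ∀ j < m, e₁ j ≠ e₂ j)
    (hz : ∀ a, 1 ≤ a → s.mem a = fun _ => 0) :
    Runs w preprocess s fun _ s' => s'.reg 0 ≤ 18 * m ∧ ∀ D : ℕ → ℕ,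
      (∀ i, D i = if i < s'.reg 0 then s'.mem 0 i else 0) → ∃ (N : ℕ) (num : ℕ → ℕ), N ≤ n ∧ D 0 = N ∧
      (∀ i, 1 ≤ i → i ≤ N → D (4 * i) < n ∧ num (D (4 * i)) = i) ∧
      (∀ v, v < n → num v ≠ 0 → num v ≤ N ∧ D (4 * num v) = v) ∧
      (∀ u v, ListedAdj m e₁ e₂ u v → num v ≠ 0) ∧
      IsIndex N (fun a b => 1 ≤ a ∧ a ≤ N ∧ 1 ≤ b ∧ b ≤ N ∧
        ListedAdj m e₁ e₂ (D (4 * a)) (D (4 * b))) D ∧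
      ∀ u, 1 ≤ u → u ≤ N → D (4 * u + 7) ≤ 18 * m := by
  have hn : n * n + n < 2 ^ w := by
    rw [Nat.add_mul] at hnn
    omega
  refine Runs.hide fun Q hQ => ?_
  rw [preprocess, runs_seq]
  refine (runs_buildMatrix hw hn hm h0 h1 he₁ he₂ (hz 1 le_rfl)).use ?_
  intro t₁ s₁ hmat f₁
  rw [runs_seq]
  have hadj : ∀ u v, ListedAdj m e₁ e₂ u v ↔ u < n ∧ v < n ∧ s₁.mem 1 (u * n + v) ≠ 0 := by
    intro u v
    constructor
    · intro h
      have hb : u < n ∧ v < n := by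
        obtain ⟨j, hj, ⟨rfl, rfl⟩ | ⟨rfl, rfl⟩⟩ := h
        · exact ⟨(he₁ j hj).2, (he₂ j hj).2⟩
        · exact ⟨(he₂ j hj).2, (he₁ j hj).2⟩
      exact ⟨hb.1, hb.2, (hmat u v hb.1 hb.2).2 h⟩
    · rintro ⟨h1, h2, h3⟩
      exact (hmat u v h1 h2).1 h3
  refine (runs_number (adj := ListedAdj m e₁ e₂) hw hn ((f₁.reg 0 rfl).trans h0) rfl hadj
    (fun _ _ => ListedAdj.symm) ((f₁.mem 2 rfl).trans (hz 2 (by omega)))).use ?_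
  intro t₂ s₂ ⟨hNn, hnum, hall⟩ f₂
  obtain ⟨N, hN⟩ : ∃ N, s₂.reg 3 = N := ⟨_, rfl⟩
  rw [hN] at hNn hnum
  have hNq : (N + 2) * N ≤ (n + 2) * n := Nat.mul_le_mul (by omega) hNn
  refine Runs.mono (runs_writeIndex (mat := s₁.mem 1) hw (by omega) hn (by omega)
    ((f₂.reg 0 rfl).trans ((f₁.reg 0 rfl).trans h0)) hN rfl (f₂.mem 1 rfl) rfl
    (fun i h1 h2 => (hnum.lab_mem i h1 h2).1)) ?_
  intro t s' ⟨hD0, q, hr0, hq8, hq, hrow⟩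
  have hle := hnum.le_sum hadj hall
  have hge := hnum.sum_le hadj (fun _ _ h => h)
  -- If `N ≠ 0`, then `m ≥ 1` and `N ≤ 2 * m`, so the length is at most `4 * (2 * m) + 8 + 2 * m ≤
  -- 18 * m`.
  have hq18 : s'.reg 0 ≤ 18 * m := by
    rw [hr0]
    split_ifs with h
    · omega
    · omega
  refine hQ _ _ ⟨hq18, fun D hD => ⟨N, s₂.mem 2, hNn, ?_, ?_⟩⟩
  · rw [hD, hD0, hr0]
    split_ifs <;> omega
  have hrow' : ∀ a, 1 ≤ a → a ≤ N →
      Row N (s₂.mem 4) (s₂.mem 3)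
        (fun a x => 1 ≤ x ∧ x ≤ N ∧ ListedAdj m e₁ e₂ (s₂.mem 3 a) (s₂.mem 3 x)) q D a := by
    intro a ha1 haN
    rw [if_neg (by omega)] at hr0
    have hc : ∀ j, j < q → D j = s'.mem 0 j := fun j hj => by
      rw [hD, hr0, if_pos hj]
    refine ((hrow a ha1 haN).congr le_rfl (hc _ (by omega)) (hc _ (by omega)) (hc _ (by omega))
      (hc _ (by omega)) (hc _ (by omega)) fun j _ hj => hc j hj).rel fun x => ?_
    refine and_congr_right fun h1 => and_congr_right fun h2 => ?_
    rw [hadj]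
    have := (hnum.lab_mem a ha1 haN).1
    have := (hnum.lab_mem x h1 h2).1
    tauto
  have hidx := hnum.isIndex (fun _ _ => ListedAdj.symm) ?_ hrow'
  · have hl : ∀ i, 1 ≤ i → i ≤ N → D (4 * i) = s₂.mem 3 i := fun i h1 h2 => (hrow' i h1 h2).lab_eq
    refine ⟨fun i h1 h2 => ?_, fun v h1 h2 => ?_, hall, ?_, fun u h1 h2 => ?_⟩
    · rw [hl i h1 h2]
      exact hnum.lab_mem i h1 h2
    · have := hnum.num_mem v h1 h2
      rw [hl _ (by omega) this.1]
      exact this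
    · have hR : (fun a b => 1 ≤ a ∧ a ≤ N ∧ 1 ≤ b ∧ b ≤ N ∧
          ListedAdj m e₁ e₂ (D (4 * a)) (D (4 * b))) = fun a b => 1 ≤ a ∧ a ≤ N ∧ 1 ≤ b ∧ b ≤ N ∧
          ListedAdj m e₁ e₂ (s₂.mem 3 a) (s₂.mem 3 b) := by
        funext a b
        refine propext (and_congr_right fun h1 => and_congr_right fun h2 => and_congr_right fun h3 =>
          and_congr_right fun h4 => ?_)
        rw [hl a h1 h2, hl b h3 h4]
      rw [hR]
      exact hidx
    · have := (hrow' u h1 h2).off_end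
      rw [if_neg (by omega)] at hr0
      omega
  · rintro u ⟨j, hj, h | h⟩
    · exact hne j hj (h.1.trans h.2.symm)
    · exact hne j hj (h.1.trans h.2.symm)

/-! ### From numbers back to vertices -/

/-- Some vertices of `G`, including all that have neighbours, are numbered by `1, …, N`; `num` is `0`
at the other vertices. -/
structure VertexNumbering {n : ℕ} (G : SimpleGraph (Fin n)) (N : ℕ) (num : Fin n → ℕ)
    (lab : ℕ → ℕ) : Prop where
  lab_num : ∀ i, 1 ≤ i → i ≤ N → ∃ v : Fin n, lab i = v ∧ num v = i
  num_lab : ∀ v, num v ≠ 0 → num v ≤ N ∧ lab (num v) = v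
  adj : ∀ u v, G.Adj u v → num v ≠ 0

section Transfer

variable {n N : ℕ} {G : SimpleGraph (Fin n)} {F : Set (Fin n)} {num : Fin n → ℕ}
  {lab : ℕ → ℕ}

/-- The number of a surviving vertex; the root has number `0`. -/
def position (num : Fin n → ℕ) : Option ↥(Fᶜ) → ℕ
  | none => 0
  | some v => num v

open Classical in
/-- The surviving vertex with a given number. -/
noncomputable def vertexAt (F : Set (Fin n)) (lab : ℕ → ℕ) (i : ℕ) : Option ↥(Fᶜ) :=
  if h : i ≠ 0 ∧ ∃ v : Fin n, lab i = v ∧ v ∉ F then some ⟨h.2.choose, h.2.choose_spec.2⟩ else none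

theorem vertexAt_zero : vertexAt F lab 0 = none := dif_neg fun h => h.1 rfl

theorem vertexAt_eq {i : ℕ} (hi : i ≠ 0) (v : ↥(Fᶜ)) (h : lab i = (v : Fin n)) :
    vertexAt F lab i = some v := by
  have hex : i ≠ 0 ∧ ∃ v : Fin n, lab i = v ∧ v ∉ F := ⟨hi, v, h, v.2⟩
  rw [vertexAt, dif_pos hex]
  congr 1
  apply Subtype.ext
  apply Fin.ext
  exact hex.2.choose_spec.1.symm.trans h

theorem vertexAt_position (hG : VertexNumbering G N num lab)
    {o : Option ↥(Fᶜ)} (h : o = none ∨ position num o ≠ 0) :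
    vertexAt F lab (position num o) = o := by
  rcases o with _ | v
  · exact vertexAt_zero
  · have h0 : num v ≠ 0 := by simpa [position] using h
    exact vertexAt_eq h0 v (hG.num_lab v h0).2

theorem position_vertexAt (hG : VertexNumbering G N num lab)
    {dead : ℕ → Prop} (hdead : ∀ v, num v ≠ 0 → (dead (num v) ↔ v ∈ F))
    {i : ℕ} (hi : i ≤ N) (hd : ¬dead i) : position num (vertexAt F lab i) = i := by
  rcases Nat.eq_zero_or_pos i with rfl | h0
  · rw [vertexAt_zero, position]
  · obtain ⟨v, hv, rfl⟩ := hG.lab_num i h0 hi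
    rw [hdead v (by omega)] at hd
    rw [vertexAt_eq (by omega) ⟨v, hd⟩ hv, position]

theorem position_mem (hG : VertexNumbering G N num lab)
    {dead : ℕ → Prop} (hdead : ∀ v, num v ≠ 0 → (dead (num v) ↔ v ∈ F))
    (h0 : ¬dead 0) (o : Option ↥(Fᶜ)) : position num o ≤ N ∧ ¬dead (position num o) := by
  rcases o with _ | v
  · exact ⟨Nat.zero_le _, h0⟩
  · rw [position]
    by_cases hv : num v = 0
    · rw [hv]
      exact ⟨Nat.zero_le _, h0⟩
    · exact ⟨(hG.num_lab v hv).1, fun h => v.2 ((hdead v hv).1 h)⟩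

/-- The parent map on vertices is `par` transported by `position` and `vertexAt`, which are inverse
to each other on the root and the surviving numbered vertices. An unnumbered vertex shares position
`0` with the root and so becomes a child of the root; as it is isolated, no edge has to be checked
there. -/
theorem reportsDFSTree (hG : VertexNumbering G N num lab)
    {E : Set (Sym2 (Fin n))} {R Fl : ℕ → ℕ → Prop} {dead : ℕ → Prop}
    {par : ℕ → ℕ} {cur : ℕ} {out : ℕ → ℕ}
    (hR : ∀ u v, num u ≠ 0 → num v ≠ 0 → (R (num u) (num v) ↔ G.Adj u v))
    (hFl : ∀ u v, num u ≠ 0 → num v ≠ 0 → (Fl (num u) (num v) ↔ s(u, v) ∈ E))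
    (hdead : ∀ v, num v ≠ 0 → (dead (num v) ↔ v ∈ F))
    (hS : DFSState (LiveAdj N R Fl dead) (fun v => v ≤ N ∧ ¬dead v) par cur)
    (hout : ∀ i, 1 ≤ i → i ≤ N → ¬dead i → out (lab i) = if par i = 0 then n else lab (par i))
    (hiso : ∀ v : Fin n, num v = 0 → out v = n) :
    ReportsDFSTree G F E out := by
  have h0 := hS.root.2
  obtain ⟨par', hpar'⟩ : ∃ par' : Option ↥(Fᶜ) → Option ↥(Fᶜ), ∀ o,
    par' o = vertexAt F lab (par (position num o)) := ⟨_, fun _ => rfl⟩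
  have hmem := position_mem hG hdead h0
  have hpos : ∀ o, position num (par' o) = par (position num o) := fun o => by
    have := hS.par_mem (hmem o)
    rw [hpar', position_vertexAt hG hdead this.1 this.2]
  have hit : ∀ i o, position num (par'^[i] o) = par^[i] (position num o) := by
    intro i
    induction i with
    | zero => exact fun o => rfl
    | succ i ih =>
      intro o
      rw [Function.iterate_succ_apply, Function.iterate_succ_apply, ih, hpos]
  -- `vertexAt` undoes `position` only away from unnumbered vertices. All values of `par'` come from
  -- `vertexAt`, so this property persists along chains of ancestors.
  have hgood : ∀ i o, vertexAt F lab (position num o) = o →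
      vertexAt F lab (position num (par'^[i] o)) = par'^[i] o := by
    intro i o ho
    cases i with
    | zero => exact ho
    | succ i => rw [hit, Function.iterate_succ_apply', Function.iterate_succ_apply', ← hit, hpar']
  have hanc : ∀ a b, vertexAt F lab (position num a) = a → vertexAt F lab (position num b) = b →
      IsAncestor par (position num a) (position num b) → IsAncestor par' a b := by
    rintro a b ha hb ⟨i, hi⟩
    refine ⟨i, ?_⟩
    rw [← hgood i b hb, hit, hi, ha]
  have hnone : ∀ v : ↥(Fᶜ), num v = 0 → par' (some v) = none := by
    intro v hv
    rw [hpar', position, hv, hS.par_root, vertexAt_zero]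
  have hroot : ∀ o, IsAncestor par' none o := by
    rintro (_ | v)
    · exact ⟨0, rfl⟩
    · by_cases hv : num v = 0
      · exact ⟨1, hnone v hv⟩
      · exact hanc _ _ (vertexAt_position hG (Or.inl rfl)) (vertexAt_position hG (Or.inr hv))
          (hS.anc _ (hmem _))
  refine ⟨par', ⟨⟨?_, ?_, hroot⟩, ?_⟩, ?_⟩
  · rw [hpar', position, hS.par_root, vertexAt_zero]
  · rintro (_ | v) hv
    · exact absurd rfl hv
    · rcases hu : par' (some v) with _ | u
      · trivial
      · have hv0 : num v ≠ 0 := fun h => by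
          rw [hnone v h] at hu
          simp at hu
        have hp : num u = par (num v) := by
          have := hpos (some v)
          rwa [hu] at this
        have hu0 : num u ≠ 0 := by
          intro h
          have := hpar' (some v)
          rw [hu, position, ← hp, h, vertexAt_zero] at this
          simp at this
        obtain ⟨-, -, -, -, -, hadj⟩ := (hS.tree _ (hmem (some v)) hv0).1
        change num v = 0 ∨ par (num v) = 0 ∨ R (num v) (par (num v)) ∧ ¬Fl (num v) (par (num v)) at hadj
        rw [← hp, hR _ _ hv0 hu0, hFl _ _ hv0 hu0] at hadj
        have := (hadj.resolve_left hv0).resolve_left hu0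
        change ((G.deleteEdges E).induce Fᶜ).Adj v u
        rw [SimpleGraph.induce_adj, SimpleGraph.deleteEdges_adj]
        exact this
  · rintro (_ | u) (_ | v) huv
    · exact huv.elim
    · exact Or.inl (hroot _)
    · exact Or.inr (hroot _)
    · change ((G.deleteEdges E).induce Fᶜ).Adj u v at huv
      rw [SimpleGraph.induce_adj, SimpleGraph.deleteEdges_adj] at huv
      have hv0 := hG.adj _ _ huv.1
      have hu0 := hG.adj _ _ huv.1.symm
      have gu : vertexAt F lab (position num (some u)) = some u := vertexAt_position hG (Or.inr hu0)
      have gv : vertexAt F lab (position num (some v)) = some v := vertexAt_position hG (Or.inr hv0)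
      have hu := hmem (some u)
      have hv := hmem (some v)
      have hl : LiveAdj N R Fl dead (num u) (num v) := by
        refine ⟨hu.1, hv.1, fun h => ?_, hu.2, hv.2, Or.inr (Or.inr ⟨(hR _ _ hu0 hv0).2 huv.1,
          fun h => huv.2 ((hFl _ _ hu0 hv0).1 h)⟩)⟩
        have h1 := (hG.num_lab _ hu0).2
        rw [h, (hG.num_lab _ hv0).2] at h1
        exact huv.1.ne (Fin.ext h1.symm)
      exact (hS.comp _ _ hu hv hl).imp (hanc _ _ gu gv) (hanc _ _ gv gu)
  · intro v
    by_cases hv : num v = 0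
    · rw [hnone v hv]
      exact hiso v hv
    · obtain ⟨h1, h2⟩ := hG.num_lab v hv
      have h3 := hout (num v) (by omega) h1 (hmem (some v)).2
      rw [h2] at h3
      rw [h3, hpar', position]
      split_ifs with hp
      · rw [hp, vertexAt_zero]
        rfl
      · have := hS.par_mem (hmem (some v))
        rw [position] at this
        obtain ⟨u, hu, hu'⟩ := hG.lab_num _ (Nat.one_le_iff_ne_zero.2 hp) this.1
        have huF : u ∉ F := by
          have h4 := this.2
          rw [← hu', hdead u (by omega)] at h4
          exact h4
        rw [vertexAt_eq hp ⟨u, huF⟩ hu]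
        exact hu

end Transfer

/-! ### Lists as arrays -/

theorem pairWords_getD {n : ℕ} (l : List (Fin n × Fin n)) :
    ∀ j, (hj : j < l.length) → (pairWords l).getD (2 * j) 0 = (l[j].1 : ℕ) ∧
      (pairWords l).getD (2 * j + 1) 0 = (l[j].2 : ℕ) := by
  induction l with
  | nil => intro j hj; simp at hj
  | cons p l ih =>
    intro j hj
    cases j with
    | zero => simp [pairWords]
    | succ j =>
      have h1 : pairWords (p :: l) = (p.1 : ℕ) :: (p.2 : ℕ) :: pairWords l := rfl
      have := ih j (by simpa using hj)
      rw [h1, show 2 * (j + 1) = 2 * j + 1 + 1 by omega]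
      simpa using this

theorem listedAdj_iff {n : ℕ} (l : List (Fin n × Fin n)) (u v : Fin n) :
    ListedAdj l.length (fun j => (pairWords l).getD (2 * j) 0)
      (fun j => (pairWords l).getD (2 * j + 1) 0) u v ↔ s(u, v) ∈ l.map fun p => s(p.1, p.2) := by
  simp only [ListedAdj, List.mem_map, Sym2.eq_iff]
  constructor
  · rintro ⟨j, hj, h⟩
    obtain ⟨h1, h2⟩ := pairWords_getD l j hj
    refine ⟨l[j], List.getElem_mem hj, ?_⟩
    rw [h1, h2] at h
    simpa only [Fin.ext_iff] using h
  · rintro ⟨p, hp, h⟩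
    obtain ⟨j, hj, rfl⟩ := List.getElem_of_mem hp
    obtain ⟨h1, h2⟩ := pairWords_getD l j hj
    refine ⟨j, hj, ?_⟩
    rw [h1, h2]
    simpa only [Fin.ext_iff] using h

theorem prefixOf_getD (s : State) (a len i : ℕ) :
    (s.prefixOf a len).getD i 0 = if i < len then s.mem a i else 0 := by
  rw [State.prefixOf]
  split_ifs with h
  · rw [List.getD_eq_getElem _ _ (by simpa using h)]
    simp
  · rw [List.getD_eq_default _ _ (by simpa using h)]

theorem init_mem_of_le {regs : List ℕ} {arrays : List (List ℕ)} {a : ℕ} (h : arrays.length ≤ a) :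
    (State.init regs arrays).mem a = fun _ => 0 := by
  funext i
  change (arrays.getD a []).getD i 0 = 0
  rw [List.getD_eq_default _ _ h]
  rfl

theorem ListsEdges.length_eq {V : Type*} {l : List (V × V)} {S : Set (Sym2 V)}
    (h : ListsEdges l S) : l.length = S.ncard := by
  classical
  have h1 : S = ((l.map fun p => s(p.1, p.2)).toFinset : Set (Sym2 V)) := by
    ext e
    rw [← h.2 e]
    simp
  rw [h1, Set.ncard_coe_finset, List.toFinset_card_of_nodup h.1, List.length_map]

theorem ListsEdges.length_le {n : ℕ} {l : List (Fin n × Fin n)} {S : Set (Sym2 (Fin n))}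
    (h : ListsEdges l S) : l.length ≤ n * n := by
  have := (List.Nodup.of_map _ h.1).length_le_card
  simpa using this

/-! ### Numerical bounds -/

/-- For `n ≥ 2`, sixteen of the twenty factors `n` yield the constant `2 ^ 16`, and four are left
for quantities of order `n ^ 4`, such as the addresses in the lists. -/
theorem word_bound {n w : ℕ} (hn : 2 ≤ n) (h : n ^ 20 ≤ 2 ^ w) : 65536 * (n * n * (n * n)) ≤ 2 ^ w := by
  refine le_trans ?_ h
  calc 65536 * (n * n * (n * n)) = 2 ^ 16 * n ^ 4 := by ring
    _ ≤ n ^ 16 * n ^ 4 := Nat.mul_le_mul_right _ (Nat.pow_le_pow_left hn 16)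
    _ = n ^ 20 := by ring

theorem potential_bound {n N K L : ℕ} (hn : 2 ≤ n) (hN : N ≤ n) (hK : K ≤ 4 * n + 1) (hL : L ≤ n) :
    (N + 1) * (3 + K + 2 * K * L + 2 * L) * (N + 1) + N ≤ 1000 * (n * n * (n * n)) := by
  have h1 : N + 1 ≤ 2 * n := by omega
  have hnn : n ≤ n * n := Nat.le_mul_self n
  have h2 : K * L ≤ 5 * n * n := Nat.mul_le_mul (by omega) hL
  have h3 : 3 + K + 2 * K * L + 2 * L ≤ 20 * (n * n) := by
    rw [Nat.mul_assoc 2]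
    rw [Nat.mul_assoc 5] at h2
    omega
  have h4 : n * n ≤ n * n * (n * n) := Nat.le_mul_self _
  calc (N + 1) * (3 + K + 2 * K * L + 2 * L) * (N + 1) + N
      ≤ 2 * n * (20 * (n * n)) * (2 * n) + n :=
        Nat.add_le_add (Nat.mul_le_mul (Nat.mul_le_mul h1 h3) h1) hN
    _ = 80 * (n * n * (n * n)) + n := by ring
    _ ≤ 1000 * (n * n * (n * n)) := by omega

/-- The number of runs is at most `5 * k`, so the potential is of order `n * k * L`, and each unit
costs of order `L` steps. -/
theorem time_bound {n N k kv ke L t : ℕ} (hn : 2 ≤ n) (hN : N ≤ n) (hk : kv + ke = k) (hk1 : 1 ≤ k)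
    (hL : 1 ≤ L)
    (ht : t ≤ 1000 * (L + 1) * ((N + 1) * (3 + (2 * (kv + 2 * ke) + 1) +
        2 * (2 * (kv + 2 * ke) + 1) * L + 2 * L) + 1) + 20 * n + 400 * N + 30 * kv +
        ke * (60 * L + 160) + 400) :
    t ≤ 84000 * (n * k * (L * L)) := by
  have hkL : k ≤ k * L := Nat.le_mul_of_pos_right _ hL
  have hLk : L ≤ k * L := Nat.le_mul_of_pos_left _ hk1
  obtain ⟨K, hK⟩ : ∃ K, 2 * (kv + 2 * ke) + 1 = K := ⟨_, rfl⟩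
  have hK5 : K ≤ 5 * k := by omega
  rw [hK] at ht
  have h1 : K * L ≤ 5 * (k * L) := by
    rw [← Nat.mul_assoc]
    exact Nat.mul_le_mul_right _ hK5
  have h2 : 3 + K + 2 * K * L + 2 * L ≤ 20 * (k * L) := by
    rw [Nat.mul_assoc 2]
    omega
  have h3 : (N + 1) * (3 + K + 2 * K * L + 2 * L) ≤ 40 * (n * k * L) :=
    calc _ ≤ 2 * n * (20 * (k * L)) := Nat.mul_le_mul (by omega) h2
      _ = 40 * (n * k * L) := by ring
  have hnk : n ≤ n * k := Nat.le_mul_of_pos_right _ hk1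
  have hkn : k ≤ n * k := Nat.le_mul_of_pos_left _ (by omega)
  have hnkL : n * k ≤ n * k * L := Nat.le_mul_of_pos_right _ hL
  have hnkLL : n * k * L ≤ n * k * (L * L) := by
    rw [← Nat.mul_assoc]
    exact Nat.le_mul_of_pos_right _ hL
  have h4 : 1000 * (L + 1) * ((N + 1) * (3 + K + 2 * K * L + 2 * L) + 1) ≤
      82000 * (n * k * (L * L)) :=
    calc _ ≤ 1000 * (2 * L) * (41 * (n * k * L)) :=
          Nat.mul_le_mul (by omega) (by omega)
      _ = 82000 * (n * k * (L * L)) := by ring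
  have h5 : ke * (60 * L + 160) ≤ 220 * (n * k * L) :=
    calc _ ≤ n * k * (220 * L) := Nat.mul_le_mul (by omega) (by omega)
      _ = 220 * (n * k * L) := by ring
  omega

theorem one_le_log {n : ℕ} (hn : 2 ≤ n) : (1 : ℝ) ≤ 1.5 * Real.log n := by
  have h1 : Real.log 2 ≤ Real.log n :=
    Real.log_le_log (by norm_num) (by exact_mod_cast hn)
  have := Real.log_two_gt_d9
  linarith

theorem natLog_le_log {n : ℕ} (hn : 2 ≤ n) : ((Nat.log 2 n + 1 : ℕ) : ℝ) ≤ 3 * Real.log n := by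
  have h1 : (Nat.log 2 n : ℝ) * Real.log 2 ≤ Real.log n := by
    rw [← Real.log_pow]
    exact Real.log_le_log (by positivity) (by exact_mod_cast Nat.pow_log_le_self 2 (by omega))
  have h2 := one_le_log hn
  have h3 := Real.log_two_gt_d9
  have h4 : (Nat.log 2 n : ℝ) * 0.69 ≤ (Nat.log 2 n : ℝ) * Real.log 2 :=
    mul_le_mul_of_nonneg_left (by linarith) (Nat.cast_nonneg _)
  push_cast
  linarith

/-- The time is of order `n k log² n`. The two further logarithms come from `1 ≤ 1.5 log n`, applied
twice: `L ^ 2 ≤ 9 log² n ≤ 20.25 log⁴ n`, and `84000 * 20.25` is below `2000000`. -/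
theorem real_time_bound {n k t : ℕ} (hn : 2 ≤ n)
    (ht : t ≤ 84000 * (n * k * ((Nat.log 2 n + 1) * (Nat.log 2 n + 1)))) :
    (t : ℝ) ≤ (2000000 : ℕ) * (n * k * Real.log n ^ 4) := by
  have h1 := one_le_log hn
  have h2 := natLog_le_log hn
  generalize hL : Nat.log 2 n + 1 = L at ht h2
  have hx : 0 ≤ Real.log n := by linarith
  generalize Real.log n = x at h1 h2 hx
  have h3 : (L : ℝ) * L ≤ 3 * x * (3 * x) := mul_le_mul h2 h2 (Nat.cast_nonneg _) (by linarith)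
  have h4 : (1 : ℝ) ≤ 1.5 * x * (1.5 * x) := one_le_mul_of_one_le_of_one_le h1 h1
  have h5 : (L : ℝ) * L ≤ 20.25 * x ^ 4 := by
    have : 3 * x * (3 * x) * 1 ≤ 3 * x * (3 * x) * (1.5 * x * (1.5 * x)) :=
      mul_le_mul_of_nonneg_left h4 (by positivity)
    calc (L : ℝ) * L ≤ 3 * x * (3 * x) := h3
      _ = 3 * x * (3 * x) * 1 := by ring
      _ ≤ _ := this
      _ = 20.25 * x ^ 4 := by ring
  have h6 : (t : ℝ) ≤ 84000 * (n * k * (L * L)) := by exact_mod_cast ht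
  refine h6.trans ?_
  have h7 : (n * k : ℝ) * (L * L) ≤ n * k * (20.25 * x ^ 4) :=
    mul_le_mul_of_nonneg_left h5 (by positivity)
  have h8 : 0 ≤ (n * k : ℝ) * x ^ 4 := by positivity
  push_cast
  linarith

theorem real_space_bound {n m l : ℕ} (hn : 2 ≤ n) (hl : l ≤ 18 * m) :
    (l : ℝ) ≤ (2000000 : ℕ) * (m * Real.log n) := by
  have h1 := one_le_log hn
  have h2 : (l : ℝ) ≤ 18 * m := by exact_mod_cast hl
  have h3 : (m : ℝ) * 1 ≤ m * (1.5 * Real.log n) := mul_le_mul_of_nonneg_left h1 (Nat.cast_nonneg _)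
  have h4 : (0 : ℝ) ≤ m * Real.log n := mul_nonneg (Nat.cast_nonneg _) (by linarith)
  push_cast
  linarith

/-! ### The main theorem -/

theorem queryStart_mem_one {n : ℕ} (D : List ℕ) (vs : List (Fin n)) (es : List (Fin n × Fin n))
    (j : ℕ) : (queryStart D vs es).mem 1 j = (vs.map Fin.val).getD j 0 := by
  have h : ∀ l : List (Fin n), (l >>= fun a => pure (a : ℕ)) = l.map Fin.val := by
    intro l
    rw [List.bind_eq_flatMap]
    exact (List.map_eq_flatMap ..).symm
  change (List.map (fun v => v) (vs >>= fun a => pure (a : ℕ))).getD j 0 = _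
  rw [h, List.map_id']

set_option maxHeartbeats 1000000 in
theorem mainTheorem2 :
    ∃ (pre query : WordRAM.Program) (C c : ℕ),
      ∀ (n : ℕ), 2 ≤ n → ∀ (G : SimpleGraph (Fin n)) (edges : List (Fin n × Fin n)),
        ListsEdges edges G.edgeSet →
        -- words of at least `c * log₂ n` bits
        ∀ (w : ℕ), n ^ c ≤ 2 ^ w →
          ∃ D : List ℕ,
            Builds w pre n edges D ∧
            (D.length : ℝ) ≤ C * (G.edgeSet.ncard * Real.log n) ∧
            ∀ (F : Finset (Fin n)) (E : Finset (Sym2 (Fin n))) (k : ℕ),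
              (E : Set (Sym2 (Fin n))) ⊆ G.edgeSet →
              F.card + E.card = k → 1 ≤ k → k ≤ n →
              ∀ (vs : List (Fin n)) (es : List (Fin n × Fin n)),
                vs.Nodup → vs.toFinset = F → ListsEdges es (E : Set (Sym2 (Fin n))) →
                ∃ (t : ℕ) (s : WordRAM.State),
                  WordRAM.Exec w query (queryStart D vs es) t s ∧
                  (t : ℝ) ≤ C * (n * k * Real.log n ^ 4) ∧
                  ReportsDFSTree G (F : Set (Fin n)) (E : Set (Sym2 (Fin n))) (s.mem 3) := by
  -- The exponent `20` is the one of `word_bound`; `2000000` is dictated by `real_time_bound`, while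
  -- the space bound alone would need only `27`.
  refine ⟨preprocess, query, 2000000, 20, fun n hn G edges hedges w hw => ?_⟩
  have hB := word_bound hn hw
  obtain ⟨B, hB'⟩ : ∃ B, n * n * (n * n) = B := ⟨_, rfl⟩
  have hnn : n ≤ n * n := Nat.le_mul_self n
  have hnB : n * n ≤ B := hB' ▸ Nat.le_mul_self _
  rw [hB'] at hB
  have hm := hedges.length_le
  have hw1024 : 1024 ≤ 2 ^ w := by omega
  have hedge : ∀ u v : Fin n, ListedAdj edges.length (fun j => (pairWords edges).getD (2 * j) 0)
      (fun j => (pairWords edges).getD (2 * j + 1) 0) u v ↔ G.Adj u v := fun u v => by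
    rw [listedAdj_iff, hedges.2, SimpleGraph.mem_edgeSet]
  obtain ⟨t₀, s₀, hexec, hlen, hD⟩ := runs_preprocess (w := w) (n := n) (m := edges.length)
    (s := State.init [n, edges.length] [pairWords edges])
    (e₁ := fun j => (pairWords edges).getD (2 * j) 0)
    (e₂ := fun j => (pairWords edges).getD (2 * j + 1) 0) hw1024 (by omega)
    (by rw [Nat.add_mul]; omega) (by omega) rfl rfl
    (fun j hj => ⟨rfl, by rw [(pairWords_getD edges j hj).1]; exact Fin.is_lt _⟩)
    (fun j hj => ⟨rfl, by rw [(pairWords_getD edges j hj).2]; exact Fin.is_lt _⟩)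
    (fun j hj => by
      obtain ⟨h1, h2⟩ := pairWords_getD edges j hj
      have : G.Adj edges[j].1 edges[j].2 := (hedge _ _).1 ⟨j, hj, Or.inl ⟨h1, h2⟩⟩
      simp only [h1, h2]
      exact fun h => this.ne (Fin.ext h))
    (fun a ha => init_mem_of_le ha)
  refine ⟨s₀.prefixOf 0 (s₀.reg 0), ⟨t₀, s₀, hexec, rfl⟩, ?_, ?_⟩
  · rw [← hedges.length_eq]
    refine real_space_bound hn ?_
    simpa [State.prefixOf] using hlen
  intro F E k hE hk hk1 hkn vs es hvs hvF hes
  obtain ⟨N, num, hN, hD0, hlab, hnum, hall, hidx, hoff⟩ :=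
    hD (fun i => (s₀.prefixOf 0 (s₀.reg 0)).getD i 0) (fun i => prefixOf_getD ..)
  generalize s₀.prefixOf 0 (s₀.reg 0) = Dl at hD0 hlab hnum hidx hoff ⊢
  obtain ⟨D, hDl⟩ : ∃ D : ℕ → ℕ, D = fun i => Dl.getD i 0 := ⟨_, rfl⟩
  rw [← hDl] at hidx
  have hDi : ∀ i, Dl.getD i 0 = D i := fun i => by rw [hDl]
  simp only [hDi] at hD0 hlab hnum hoff
  have hG : VertexNumbering G N (fun v => num v) (fun i => D (4 * i)) := by
    refine ⟨fun i h1 h2 => ?_, fun v hv => hnum v v.2 hv, fun u v h => hall u v ((hedge u v).2 h)⟩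
    obtain ⟨h3, h4⟩ := hlab i h1 h2
    exact ⟨⟨_, h3⟩, rfl, h4⟩
  have hL : Nat.log 2 n + 1 ≤ n := Nat.log_lt_self 2 (by omega)
  have hfits : IndexFits w N (Nat.log 2 n + 1) _ D :=
    { hidx with
      word := hw1024
      off_word := fun {u} h1 h2 => by
        have := hoff u h1 h2
        omega
      size_word := by omega
      log := lt_of_le_of_lt hN (Nat.lt_pow_succ_log_self (by omega) n) }
  have hkv : vs.length = F.card := by rw [← hvF, List.toFinset_card_of_nodup hvs]
  have hke : es.length = E.card := by rw [hes.length_eq, Set.ncard_coe_finset]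
  have hEadj : ∀ u v : Fin n, ListedAdj es.length (fun j => (pairWords es).getD (2 * j) 0)
      (fun j => (pairWords es).getD (2 * j + 1) 0) u v ↔ s(u, v) ∈ (E : Set (Sym2 (Fin n))) :=
    fun u v => by rw [listedAdj_iff, hes.2]
  have hes' : ∀ j, (hj : j < es.length) → G.Adj es[j].1 es[j].2 := fun j hj => by
    obtain ⟨h1, h2⟩ := pairWords_getD es j hj
    exact hE ((hEadj _ _).1 ⟨j, hj, Or.inl ⟨h1, h2⟩⟩)
  have hpos : ∀ u v : Fin n, G.Adj u v → 1 ≤ num u ∧ num u ≤ N ∧ D (4 * num u) = u := by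
    intro u v h
    have h1 := hG.adj v u h.symm
    have h2 := hG.num_lab u h1
    exact ⟨Nat.one_le_iff_ne_zero.2 h1, h2⟩
  obtain ⟨t, s, hq, ht, dead, Fl, par, cur, hdead, hFl, hS, hout, hiso⟩ :=
    hfits.runs_query (n := n) (kv := vs.length) (ke := es.length)
      (e₁ := fun j => num ((pairWords es).getD (2 * j) 0))
      (e₂ := fun j => num ((pairWords es).getD (2 * j + 1) 0))
      (s := queryStart Dl vs es) (by omega)
      (by
        have : (N + 1) * (N + 1) ≤ (n + n) * (n + n) := Nat.mul_le_mul (by omega) (by omega)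
        have h2 : (n + n) * (n + n) = 4 * (n * n) := by ring
        omega)
      (by omega) (by omega)
      (fun K hK => by
        have := potential_bound (K := K) hn hN (by omega) hL
        omega)
      rfl rfl rfl hDl.symm (fun a ha => init_mem_of_le ha) hD0
      (fun i j h1 h2 h3 h => by
        have h4 := (hlab i h1 (by omega)).2
        rw [h, (hlab j (by omega) h3).2] at h4
        omega)
      (fun j hj => by
        obtain ⟨h1, h2⟩ := pairWords_getD es j hj
        obtain ⟨a1, a2, a3⟩ := hpos _ _ (hes' j hj)
        obtain ⟨b1, b2, b3⟩ := hpos _ _ (hes' j hj).symm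
        simp only [hDi, h1, h2, a3, b3]
        exact ⟨a1, a2, b1, b2, (hedge _ _).2 (hes' j hj)⟩)
      (fun j hj => by
        simp only [(pairWords_getD es j hj).1, (hpos _ _ (hes' j hj)).2.2]
        exact (pairWords_getD es j hj).1)
      (fun j hj => by
        simp only [(pairWords_getD es j hj).2, (hpos _ _ (hes' j hj).symm).2.2]
        exact (pairWords_getD es j hj).2)
  have hinj : ∀ u v : Fin n, num u ≠ 0 → num u = num v → u = v := by
    intro u v hu h
    have h1 := (hG.num_lab u hu).2
    have h2 := (hG.num_lab v (h ▸ hu)).2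
    simp only [h] at h1
    exact Fin.ext (h1.symm.trans h2)
  refine ⟨t, s, hq, real_time_bound hn (time_bound hn hN (by omega) hk1 (by omega) ht),
    reportsDFSTree hG ?_ ?_ ?_ hS (fun i h1 h2 h3 => hout i h1 h2 h3) ?_⟩
  · intro u v hu hv
    have hu' := hG.num_lab u hu
    have hv' := hG.num_lab v hv
    simp only [hDi, hu'.2, hv'.2, hedge]
    refine ⟨fun h => h.2.2.2.2, fun h => ⟨?_, hu'.1, ?_, hv'.1, h⟩⟩
    · exact Nat.one_le_iff_ne_zero.2 hu
    · exact Nat.one_le_iff_ne_zero.2 hv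
  · intro u v hu hv
    rw [hFl, ← hEadj]
    refine exists_congr fun j => and_congr_right fun hj => ?_
    obtain ⟨h1, h2⟩ := pairWords_getD es j hj
    simp only [h1, h2]
    have key : ∀ (x y : Fin n), num x ≠ 0 → (num x = num y ↔ (y : ℕ) = x) := fun x y hx =>
      ⟨fun h => congrArg Fin.val (hinj x y hx h).symm, fun h => by rw [h]⟩
    rw [key u _ hu, key v _ hv, key u _ hu, key v _ hv]
    tauto
  · intro v hv
    have hv' := hG.num_lab v hv
    rw [hdead, Finset.mem_coe, ← hvF, List.mem_toFinset, hv'.2]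
    have h1 : ∀ j, (hj : j < vs.length) → (queryStart Dl vs es).mem 1 j = (vs[j] : ℕ) := by
      intro j hj
      rw [queryStart_mem_one, List.getD_eq_getElem _ _ (by rwa [List.length_map])]
      exact List.getElem_map _
    constructor
    · rintro ⟨-, -, j, hj, h⟩
      rw [h1 j hj] at h
      rw [← Fin.ext h]
      exact List.getElem_mem hj
    · intro h
      obtain ⟨j, hj, rfl⟩ := List.getElem_of_mem h
      exact ⟨Nat.one_le_iff_ne_zero.2 hv, hv'.1, j, hj, h1 j hj⟩
  · intro v hv
    refine hiso v v.2 fun i h1 h2 h => ?_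
    have := (hlab i h1 h2).2
    rw [← h] at this
    omega
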